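/- Let $\Lambda\in\mathbb R^{2\times2}$ be invertible, $\Lambda^*:=2\pi(\Lambda^\top)^{-1}$, $W:=\{\Lambda z:-\tfrac12<z_1,z_2\le\tfrac12\}$ and $W^*:=\{\Lambda^* z:-\tfrac12<z_1,z_2\le\tfrac12\}$. For $\phi\in C_0^\infty(\mathbb R^2)$ the Bloch transform is \[ \mathcal J_{\mathbb R^2}\phi(\alpha,x)=\frac{|\det\Lambda|^{1/2}}{2\pi}\sum_{j\in\mathbb Z^2}\phi(x+\Lambda j)\,e^{-i\alpha\cdot\Lambda j},\qquad \alpha,x\in\mathbb R^2 . \] For $s,r\in\mathbb R$ let $H^s_r(\mathbb R^2)$ be the space of distributions $\phi$ with $(1+|x|^2)^{r/2}\phi\in H^s(\mathbb R^2)$. Let $\mathcal D'_\Lambda$ be the space of distributions $\psi$ on $\mathbb R^2\times\mathbb R^2$ with $\psi(\alpha+\Lambda^*\ell,x)=\psi(\alpha,x)$ and $\psi(\alpha,x+\Lambda j)=e^{i\alpha\cdot\Lambda j}\psi(\alpha,x)$ for all $\ell,j\in\mathbb Z^2$, and $C^\infty_\Lambda$ the space of smooth functions with these properties. Write $\hat\psi(\alpha,j)$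 for the Fourier coefficients in $\psi(\alpha,x)=|\det\Lambda|^{-1/2}\sum_{j\in\mathbb Z^2}\hat\psi(\alpha,j)e^{i(\Lambda^*j+\alpha)\cdot x}$. The spaces $H^r_0(W^*;H^s_\alpha(W))\subset\mathcal D'_\Lambda$ are defined as follows. For $r=\ell\in\mathbb N_0$ the squared norm is \[ \sum_{|\gamma|\le\ell}\ \sum_{j\in\mathbb Z^2}(1+|j|^2)^s\int_{W^*}|\partial_\alpha^\gamma\hat\psi(\alpha,j)|^2\,d\alpha ; \] for $r=\ell+\theta$ with $\ell\in\mathbb N_0$, $0<\theta<1$, it is the (Hilbert space) interpolation space of exponent $\theta$ between the spaces of orders $\ell$ and $\ell+1$; for $r<0$ it is the dual of $H^{-r}_0(W^*;H^{-s}_\alpha(W))$ with respect to the inner product of $L^2(W^*;L^2(W))$. Then for all $s,r\in\mathbb R$: the transform $\mathcal J_{\mathbb R^2}$ extends uniquely from $C_0^\infty(\mathbb R^2)$ to a linear isomorphism, bounded together with its inverse, $\mathcal J_{\mathbb R^2}:H^s_r(\mathbb R^2)\to H^r_0(W^*;H^s_\alpha(W))$. The inner product of $L^2(\mathbb R^2)$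 extends uniquely from $C_0^\infty(\mathbb R^2)$ to a bounded sesquilinear form on $H^s_r(\mathbb R^2)\times H^{-s}_{-r}(\mathbb R^2)$, and the inner product of $L^2(W^*;L^2(W))$ extends uniquely from $C^\infty_\Lambda$ to a bounded sesquilinear form on $H^r_0(W^*;H^s_\alpha(W))\times H^{-r}_0(W^*;H^{-s}_\alpha(W))$. With respect to these forms, the adjoint \[ \mathcal J_{\mathbb R^2}^*:H^{-r}_0(W^*;H^{-s}_\alpha(W))\to H^{-s}_{-r}(\mathbb R^2),\qquad \langle\mathcal J_{\mathbb R^2}\phi,\psi\rangle_{L^2(W^*;L^2(W))}=\langle\phi,\mathcal J_{\mathbb R^2}^*\psi\rangle_{L^2(\mathbb R^2)}\quad\text{for all }\phi\in H^s_r(\mathbb R^2),\ \psi\in H^{-r}_0(W^*;H^{-s}_\alpha(W)), \] exists, is unique, and equals the inverse $\mathcal J_{\mathbb R^2}^{-1}$ of the Bloch transform $\mathcal J_{\mathbb R^2}:H^{-s}_{-r}(\mathbb R^2)\to H^{-r}_0(W^*;H^{-s}_\alpha(W))$. -/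

import Mathlib

open scoped SchwartzMap ENNReal NNReal ContDiff Matrix

noncomputable section

namespace FloquetBloch

open MeasureTheory TemperedDistribution

/-- The plane `ℝ²` with its Euclidean norm and inner product. -/
abbrev Plane : Type := EuclideanSpace ℝ (Fin 2)

/-- The lattice point `Λ j`, `j ∈ ℤ²`. -/
def latVec (Λ : Matrix (Fin 2) (Fin 2) ℝ) (j : Fin 2 → ℤ) : Plane :=
  WithLp.toLp 2 (Λ *ᵥ fun i => (j i : ℝ))

/-- The dual periodicity matrix `Λ* = 2π (Λᵀ)⁻¹`. -/
def dualMat (Λ : Matrix (Fin 2) (Fin 2) ℝ) : Matrix (Fin 2) (Fin 2) ℝ :=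
  (2 * Real.pi) • (Λᵀ)⁻¹

/-- The fundamental cell `W = {Λ z : -1/2 < z₁, z₂ ≤ 1/2}`; the Brillouin zone `W*` is
`cell (dualMat Λ)`. -/
def cell (Λ : Matrix (Fin 2) (Fin 2) ℝ) : Set Plane :=
  {x | ∃ z : Fin 2 → ℝ, (∀ i, -(1 / 2) < z i ∧ z i ≤ 1 / 2) ∧ x = WithLp.toLp 2 (Λ *ᵥ z)}

/-- `e^{i a·b}`. -/
def phase (a b : Plane) : ℂ :=
  Complex.exp (Complex.I * ((inner ℝ a b : ℝ) : ℂ))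

/-- `1 + |j|²` for `j ∈ ℤ²`. -/
def latWeight (j : Fin 2 → ℤ) : ℝ :=
  1 + (j 0 : ℝ) ^ 2 + (j 1 : ℝ) ^ 2

/-- The tempered distribution `T` is the function `f`. -/
def Represents {V : Type*} [NormedAddCommGroup V] [NormedSpace ℝ V] [MeasureSpace V]
    (f : V → ℂ) (T : 𝓢'(V, ℂ)) : Prop :=
  ∀ Φ : 𝓢(V, ℂ), Integrable (fun p => f p * Φ p) ∧ T Φ = ∫ p, f p * Φ p

/-! ### Weighted Sobolev spaces on the plane -/

/-- Multiplication by `(1 + |x|²)^{r/2}`. -/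
def weightMul (r : ℝ) : 𝓢'(Plane, ℂ) →L[ℂ] 𝓢'(Plane, ℂ) :=
  smulLeftCLM ℂ (fun x : Plane => (((1 + ‖x‖ ^ 2) ^ (r / 2) : ℝ) : ℂ))

/-- The weighted space `H^s_r(ℝ²)` of all `u` with `(1 + |x|²)^{r/2} u ∈ H^s(ℝ²)`. -/
def WSob (s r : ℝ) : Submodule ℂ 𝓢'(Plane, ℂ) where
  carrier := {u | MemSobolev s 2 (weightMul r u)}
  zero_mem' := by
    simp
  add_mem' := by
    intro a b ha hb
    simpa using MemSobolev.add ha hb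
  smul_mem' := by
    intro c a ha
    simpa using MemSobolev.smul c ha

/-- The squared norm of `H^s_r(ℝ²)`. -/
def wSobSq (s r : ℝ) (u : 𝓢'(Plane, ℂ)) : ℝ≥0∞ :=
  ⨅ (g : Lp ℂ 2 (volume : Measure Plane))
    (_ : besselPotential Plane ℂ s (weightMul r u) = (g : 𝓢'(Plane, ℂ))), ‖g‖ₑ ^ 2

/-! ### Distributions and test functions in `(α, x)` -/

/-- `ψ(α, x)` is `Λ*`-periodic in `α` and `α`-quasiperiodic in `x`: it satisfies
`ψ(α + Λ* ℓ, x) = ψ(α, x)` and `ψ(α, x + Λ j) = e^{i α·Λ j} ψ(α, x)` in the sense of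
distributions. Distributions with these invariances are automatically tempered. -/
def IsBlochPeriodic (Λ : Matrix (Fin 2) (Fin 2) ℝ) (ψ : 𝓢'(Plane × Plane, ℂ)) : Prop :=
  (∀ (l : Fin 2 → ℤ) (Φ Φ' : 𝓢(Plane × Plane, ℂ)),
    (∀ α x, Φ' (α, x) = Φ (α - latVec (dualMat Λ) l, x)) → ψ Φ' = ψ Φ) ∧
  (∀ (j : Fin 2 → ℤ) (Φ Φ₁ Φ₂ : 𝓢(Plane × Plane, ℂ)),
    (∀ α x, Φ₁ (α, x) = Φ (α, x - latVec Λ j)) →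
    (∀ α x, Φ₂ (α, x) = phase α (latVec Λ j) * Φ (α, x)) → ψ Φ₁ = ψ Φ₂)

/-- The smooth functions of `(α, x)` that are `Λ*`-periodic in `α` and `α`-quasiperiodic
in `x`. -/
def IsBlochTest (Λ : Matrix (Fin 2) (Fin 2) ℝ) (f : Plane × Plane → ℂ) : Prop :=
  ContDiff ℝ ∞ f ∧
  (∀ (l : Fin 2 → ℤ) α x, f (α + latVec (dualMat Λ) l, x) = f (α, x)) ∧
  (∀ (j : Fin 2 → ℤ) α x, f (α, x + latVec Λ j) = phase α (latVec Λ j) * f (α, x))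

/-- `ρ` is smooth with compact support and its translates by the lattice generated by `Λ*` (in `α`)
and `Λ` (in `x`) sum up to `1`. -/
def IsCellPartition (Λ : Matrix (Fin 2) (Fin 2) ℝ) (ρ : Plane × Plane → ℂ) : Prop :=
  ContDiff ℝ ∞ ρ ∧ HasCompactSupport ρ ∧
  ∀ α x, ∑' lj : (Fin 2 → ℤ) × (Fin 2 → ℤ),
    ρ (α + latVec (dualMat Λ) lj.1, x + latVec Λ lj.2) = 1

/-! ### The spaces `H^r_0(W*; H^s_α(W))` -/

/-- The locally integrable functions `c j` of `α` are the Fourier coefficients of `ψ`: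
`ψ(α, x) = |det Λ|^{-1/2} ∑_j c_j(α) e^{i (Λ* j + α)·x}` in the sense of distributions. -/
def HasFourierCoeff (Λ : Matrix (Fin 2) (Fin 2) ℝ) (ψ : 𝓢'(Plane × Plane, ℂ))
    (c : (Fin 2 → ℤ) → Plane → ℂ) : Prop :=
  (∀ j, LocallyIntegrable (c j)) ∧
  (∀ j (Φ : 𝓢(Plane × Plane, ℂ)), Integrable (fun p : Plane × Plane => c j p.1 * Φ p)) ∧
  ∀ Φ : 𝓢(Plane × Plane, ℂ),
    HasSum (fun j => ∫ p : Plane × Plane,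
      c j p.1 * ((|Λ.det| ^ (-(1 / 2) : ℝ) : ℝ) : ℂ) *
        phase (latVec (dualMat Λ) j + p.1) p.2 * Φ p) (ψ Φ)

/-- `∑_j (1 + |j|²)^s ∫_{W*} |c_j(α)|² dα`. -/
def coeffSq (Λ : Matrix (Fin 2) (Fin 2) ℝ) (s : ℝ) (c : (Fin 2 → ℤ) → Plane → ℂ) : ℝ≥0∞ :=
  ∑' j, ENNReal.ofReal (latWeight j ^ s) * ∫⁻ α in cell (dualMat Λ), ‖c j α‖ₑ ^ 2

/-- The squared norm of `L²(W*; H^s_α(W))`, equal to `∞` off that space. (The Fourier coefficients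
are almost everywhere unique, so that the infimum is over at most one value.) -/
def l2Sq (Λ : Matrix (Fin 2) (Fin 2) ℝ) (s : ℝ) (ψ : 𝓢'(Plane × Plane, ℂ)) : ℝ≥0∞ :=
  ⨅ (c : (Fin 2 → ℤ) → Plane → ℂ) (_ : IsBlochPeriodic Λ ψ ∧ HasFourierCoeff Λ ψ c),
    coeffSq Λ s c

/-- The derivative in `α_k` of a family of `α`-quasiperiodic distributions: it acts on the Fourier
coefficients, i.e. it is `e^{i α·x} ∂_{α_k} (e^{-i α·x} ψ) = ∂_{α_k} ψ - i x_k ψ`. (The plain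
derivative `∂_{α_k} ψ` is not `α`-quasiperiodic any more.) -/
def alphaDeriv (k : Fin 2) : 𝓢'(Plane × Plane, ℂ) →L[ℂ] 𝓢'(Plane × Plane, ℂ) :=
  LineDeriv.lineDerivOpCLM ℂ 𝓢'(Plane × Plane, ℂ)
      ((EuclideanSpace.single k (1 : ℝ), 0) : Plane × Plane) -
    smulLeftCLM ℂ (fun p : Plane × Plane => Complex.I * ((p.2 k : ℝ) : ℂ))

/-- The squared norm of `W^{2,ℓ}_0(W*; H^s_α(W))`,
`∑_{|γ| ≤ ℓ} ∫_{W*} ‖∂_α^γ ψ(α, ·)‖²_{H^s_α(W)} dα`. -/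
def sobSq (Λ : Matrix (Fin 2) (Fin 2) ℝ) (l : ℕ) (s : ℝ) (ψ : 𝓢'(Plane × Plane, ℂ)) : ℝ≥0∞ :=
  ∑ γ ∈ (Finset.range (l + 1) ×ˢ Finset.range (l + 1)).filter (fun γ => γ.1 + γ.2 ≤ l),
    l2Sq Λ s ((alphaDeriv 0 ^ γ.1 * alphaDeriv 1 ^ γ.2) ψ)

/-- The squared (quadratic) `K`-functional of a couple of Hilbert spaces with squared norms `N₀`
and `N₁` (equal to `∞` off these spaces). -/
def kSq {V : Type*} [AddCommGroup V] (N₀ N₁ : V → ℝ≥0∞) (t : ℝ) (v : V) : ℝ≥0∞ :=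
  ⨅ w : V, (N₀ w + ENNReal.ofReal t ^ 2 * N₁ (v - w))

/-- The squared norm `∫_0^∞ (t^{-θ} K(t, v))² dt/t` of the interpolation space between two Hilbert
spaces. -/
def interpSq {V : Type*} [AddCommGroup V] (θ : ℝ) (N₀ N₁ : V → ℝ≥0∞) (v : V) : ℝ≥0∞ :=
  ∫⁻ t in Set.Ioi (0 : ℝ), ENNReal.ofReal (t ^ (-2 * θ - 1)) * kSq N₀ N₁ t v

open Classical in
/-- The squared norm of `H^r_0(W*; H^s_α(W))` for `r ≥ 0`: the one of `W^{2,r}_0` for integer `r`,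
interpolation between the neighbouring integers otherwise. -/
def posSq (Λ : Matrix (Fin 2) (Fin 2) ℝ) (r s : ℝ) : 𝓢'(Plane × Plane, ℂ) → ℝ≥0∞ :=
  if r = ⌊r⌋₊ then sobSq Λ ⌊r⌋₊ s
  else interpSq (r - ⌊r⌋₊) (sobSq Λ ⌊r⌋₊ s) (sobSq Λ (⌊r⌋₊ + 1) s)

/-- The squared dual norm `sup_f |⟨ψ, f⟩|² / N(f)` over all smooth `Λ*`-periodic,
`α`-quasiperiodic `f`. Here `⟨ψ, f⟩ = ∫_{W*} ∫_W ψ conj(f)` is the extension of the inner product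
of `L²(W*; L²(W))` to distributions `ψ`, namely `ψ (ρ conj(f))` for any cell partition `ρ`. -/
def dualSq (Λ : Matrix (Fin 2) (Fin 2) ℝ) (N : 𝓢'(Plane × Plane, ℂ) → ℝ≥0∞)
    (ψ : 𝓢'(Plane × Plane, ℂ)) : ℝ≥0∞ :=
  ⨅ _ : IsBlochPeriodic Λ ψ,
    ⨆ (f : Plane × Plane → ℂ) (F : 𝓢'(Plane × Plane, ℂ)) (ρ : Plane × Plane → ℂ)
      (Φ : 𝓢(Plane × Plane, ℂ))
      (_ : IsBlochTest Λ f ∧ Represents f F ∧ IsCellPartition Λ ρ ∧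
        ∀ p, Φ p = ρ p * (starRingEnd ℂ) (f p)),
      ‖ψ Φ‖ₑ ^ 2 / N F

open Classical in
/-- The squared norm of `H^r_0(W*; H^s_α(W))`, `r, s ∈ ℝ`. For `r < 0` this is the dual space of
`H^{-r}_0(W*; H^{-s}_α(W))` with respect to the inner product of `L²(W*; L²(W))`. -/
def blochSq (Λ : Matrix (Fin 2) (Fin 2) ℝ) (r s : ℝ) : 𝓢'(Plane × Plane, ℂ) → ℝ≥0∞ :=
  if 0 ≤ r then posSq Λ r s else dualSq Λ (posSq Λ (-r) (-s))

/-! ### The finite-norm elements form a vector space -/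

/-- The properties of a squared norm with values in `[0, ∞]` that are needed for the elements
of finite norm to form a vector space. -/
structure QuadLike {V : Type*} [AddCommGroup V] [Module ℂ V] (N : V → ℝ≥0∞) : Prop where
  zero : N 0 = 0
  add : ∀ a b, N (a + b) ≤ 2 * (N a + N b)
  smul : ∀ (c : ℂ) a, c ≠ 0 → N (c • a) ≤ ‖c‖ₑ ^ 2 * N a

theorem enorm_add_sq_le (a b : ℂ) : ‖a + b‖ₑ ^ 2 ≤ 2 * (‖a‖ₑ ^ 2 + ‖b‖ₑ ^ 2) := by
  have h : ‖a + b‖₊ ^ 2 ≤ 2 * (‖a‖₊ ^ 2 + ‖b‖₊ ^ 2) := by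
    rw [← NNReal.coe_le_coe]
    push_cast
    have := norm_add_le a b
    have h0 := norm_nonneg (a + b)
    nlinarith [sq_nonneg (‖a‖ - ‖b‖), norm_nonneg a, norm_nonneg b]
  simp only [enorm_eq_nnnorm]
  exact_mod_cast h

theorem IsBlochPeriodic.zero (Λ : Matrix (Fin 2) (Fin 2) ℝ) : IsBlochPeriodic Λ 0 := by
  constructor <;> intros <;> rfl

theorem IsBlochPeriodic.add {Λ : Matrix (Fin 2) (Fin 2) ℝ} {a b : 𝓢'(Plane × Plane, ℂ)}
    (ha : IsBlochPeriodic Λ a) (hb : IsBlochPeriodic Λ b) : IsBlochPeriodic Λ (a + b) := by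
  refine ⟨fun l Φ Φ' h => ?_, fun j Φ Φ₁ Φ₂ h₁ h₂ => ?_⟩
  · change a Φ' + b Φ' = a Φ + b Φ
    rw [ha.1 l Φ Φ' h, hb.1 l Φ Φ' h]
  · change a Φ₁ + b Φ₁ = a Φ₂ + b Φ₂
    rw [ha.2 j Φ Φ₁ Φ₂ h₁ h₂, hb.2 j Φ Φ₁ Φ₂ h₁ h₂]

theorem IsBlochPeriodic.smul {Λ : Matrix (Fin 2) (Fin 2) ℝ} {a : 𝓢'(Plane × Plane, ℂ)} (c : ℂ)
    (ha : IsBlochPeriodic Λ a) : IsBlochPeriodic Λ (c • a) := by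
  refine ⟨fun l Φ Φ' h => ?_, fun j Φ Φ₁ Φ₂ h₁ h₂ => ?_⟩
  · change c • a Φ' = c • a Φ
    rw [ha.1 l Φ Φ' h]
  · change c • a Φ₁ = c • a Φ₂
    rw [ha.2 j Φ Φ₁ Φ₂ h₁ h₂]

theorem phase_norm (a b : Plane) : ‖phase a b‖ = 1 := by
  unfold phase
  rw [mul_comm]
  exact Complex.norm_exp_ofReal_mul_I _

theorem continuous_phase_pair (v : Plane) :
    Continuous (fun p : Plane × Plane => phase (v + p.1) p.2) := by
  unfold phase
  fun_prop

/-- The integrands of the Fourier series are integrable. -/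
theorem integrable_series_term {c : Plane → ℂ} (Φ : 𝓢(Plane × Plane, ℂ)) (k : ℂ) (v : Plane)
    (h : Integrable (fun p : Plane × Plane => c p.1 * Φ p)) :
    Integrable (fun p : Plane × Plane => c p.1 * k * phase (v + p.1) p.2 * Φ p) := by
  have h1 : Integrable (fun p : Plane × Plane => phase (v + p.1) p.2 * (c p.1 * Φ p)) :=
    h.bdd_mul (c := 1) (continuous_phase_pair v).aestronglyMeasurable
      (Filter.Eventually.of_forall fun p => (phase_norm _ _).le)
  refine (h1.const_mul k).congr (Filter.Eventually.of_forall fun p => ?_)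
  simp only
  ring

theorem HasFourierCoeff.add {Λ : Matrix (Fin 2) (Fin 2) ℝ} {a b : 𝓢'(Plane × Plane, ℂ)}
    {c d : (Fin 2 → ℤ) → Plane → ℂ} (ha : HasFourierCoeff Λ a c) (hb : HasFourierCoeff Λ b d) :
    HasFourierCoeff Λ (a + b) (c + d) := by
  refine ⟨fun j => (ha.1 j).add (hb.1 j), fun j Φ => ?_, fun Φ => ?_⟩
  · refine ((ha.2.1 j Φ).add (hb.2.1 j Φ)).congr (Filter.Eventually.of_forall fun p => ?_)
    simp only [Pi.add_apply]
    ring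
  · change HasSum _ (a Φ + b Φ)
    refine ((ha.2.2 Φ).add (hb.2.2 Φ)).congr_fun ?_
    intro j
    rw [← integral_add (integrable_series_term Φ _ _ (ha.2.1 j Φ))
      (integrable_series_term Φ _ _ (hb.2.1 j Φ))]
    refine integral_congr_ae (Filter.Eventually.of_forall fun p => ?_)
    simp only [Pi.add_apply]
    ring

theorem HasFourierCoeff.smul {Λ : Matrix (Fin 2) (Fin 2) ℝ} {a : 𝓢'(Plane × Plane, ℂ)}
    {c : (Fin 2 → ℤ) → Plane → ℂ} (k : ℂ) (ha : HasFourierCoeff Λ a c) :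
    HasFourierCoeff Λ (k • a) (k • c) := by
  refine ⟨fun j => (ha.1 j).smul k, fun j Φ => ?_, fun Φ => ?_⟩
  · refine ((ha.2.1 j Φ).const_mul k).congr (Filter.Eventually.of_forall fun p => ?_)
    simp only [Pi.smul_apply, smul_eq_mul]
    ring
  · change HasSum _ (k * a Φ)
    refine ((ha.2.2 Φ).mul_left k).congr_fun ?_
    intro j
    rw [← integral_const_mul]
    refine integral_congr_ae (Filter.Eventually.of_forall fun p => ?_)
    simp only [Pi.smul_apply, smul_eq_mul]
    ring

theorem HasFourierCoeff.zero (Λ : Matrix (Fin 2) (Fin 2) ℝ) : HasFourierCoeff Λ 0 0 := by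
  refine ⟨fun j => locallyIntegrable_zero, fun j Φ => by simp, fun Φ => ?_⟩
  change HasSum _ (0 : ℂ)
  simp

theorem coeffSq_add {Λ : Matrix (Fin 2) (Fin 2) ℝ} (s : ℝ) {c d : (Fin 2 → ℤ) → Plane → ℂ}
    (hc : ∀ j, LocallyIntegrable (c j)) :
    coeffSq Λ s (c + d) ≤ 2 * (coeffSq Λ s c + coeffSq Λ s d) := by
  unfold coeffSq
  rw [← ENNReal.tsum_add, ← ENNReal.tsum_mul_left]
  refine ENNReal.tsum_le_tsum fun j => ?_
  rw [← mul_add, mul_left_comm]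
  gcongr
  have hm : AEMeasurable (fun α => ‖c j α‖ₑ ^ 2) (volume.restrict (cell (dualMat Λ))) :=
    ((hc j).aestronglyMeasurable.enorm.pow_const 2).restrict
  rw [← lintegral_add_left' hm, ← lintegral_const_mul' _ _ (by simp)]
  exact lintegral_mono fun α => enorm_add_sq_le _ _

theorem coeffSq_smul {Λ : Matrix (Fin 2) (Fin 2) ℝ} (s : ℝ) (k : ℂ)
    (c : (Fin 2 → ℤ) → Plane → ℂ) :
    coeffSq Λ s (k • c) = ‖k‖ₑ ^ 2 * coeffSq Λ s c := by
  unfold coeffSq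
  rw [← ENNReal.tsum_mul_left]
  refine tsum_congr fun j => ?_
  rw [mul_left_comm, ← lintegral_const_mul' (‖k‖ₑ ^ 2) _ (by simp)]
  simp [enorm_mul, mul_pow]

theorem le_two_mul_iInf_add {ι κ : Sort*} {x : ℝ≥0∞} {f : ι → ℝ≥0∞} {g : κ → ℝ≥0∞}
    (h : ∀ i j, x ≤ 2 * (f i + g j)) : x ≤ 2 * ((⨅ i, f i) + ⨅ j, g j) := by
  rw [ENNReal.iInf_add, ENNReal.mul_iInf_of_ne (by simp) (by simp)]
  refine le_iInf fun i => ?_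
  rw [ENNReal.add_iInf, ENNReal.mul_iInf_of_ne (by simp) (by simp)]
  exact le_iInf fun j => h i j

theorem le_enorm_sq_mul_iInf {ι : Sort*} {x : ℝ≥0∞} {f : ι → ℝ≥0∞} {c : ℂ} (hc : c ≠ 0)
    (h : ∀ i, x ≤ ‖c‖ₑ ^ 2 * f i) : x ≤ ‖c‖ₑ ^ 2 * ⨅ i, f i := by
  rw [ENNReal.mul_iInf_of_ne (by simpa using hc) (by simp)]
  exact le_iInf h

theorem l2Sq_quadLike (Λ : Matrix (Fin 2) (Fin 2) ℝ) (s : ℝ) : QuadLike (l2Sq Λ s) where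
  zero := by
    refine le_antisymm ?_ zero_le
    refine (iInf₂_le 0 ⟨IsBlochPeriodic.zero Λ, HasFourierCoeff.zero Λ⟩).trans ?_
    simp [coeffSq]
  add := by
    intro a b
    refine le_two_mul_iInf_add fun c d => ?_
    refine le_two_mul_iInf_add fun hc hd => ?_
    exact (iInf₂_le (c + d) ⟨hc.1.add hd.1, hc.2.add hd.2⟩).trans (coeffSq_add s hc.2.1)
  smul := by
    intro k a hk
    refine le_enorm_sq_mul_iInf hk fun c => ?_
    refine le_enorm_sq_mul_iInf hk fun hc => ?_
    exact (iInf₂_le (k • c) ⟨hc.1.smul k, hc.2.smul k⟩).trans (coeffSq_smul s k c).le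

theorem QuadLike.comp {V : Type*} [AddCommGroup V] [Module ℂ V] {N : V → ℝ≥0∞} (h : QuadLike N)
    (L : V →ₗ[ℂ] V) : QuadLike (fun v => N (L v)) where
  zero := by simpa using h.zero
  add a b := by simpa using h.add (L a) (L b)
  smul c a hc := by simpa using h.smul c (L a) hc

theorem QuadLike.sum {V ι : Type*} [AddCommGroup V] [Module ℂ V] {N : ι → V → ℝ≥0∞}
    (h : ∀ i, QuadLike (N i)) (S : Finset ι) : QuadLike (fun v => ∑ i ∈ S, N i v) where
  zero := by simp [fun i => (h i).zero]
  add a b := by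
    rw [← Finset.sum_add_distrib, Finset.mul_sum]
    exact Finset.sum_le_sum fun i _ => (h i).add a b
  smul c a hc := by
    rw [Finset.mul_sum]
    exact Finset.sum_le_sum fun i _ => (h i).smul c a hc

theorem sobSq_quadLike (Λ : Matrix (Fin 2) (Fin 2) ℝ) (l : ℕ) (s : ℝ) :
    QuadLike (sobSq Λ l s) := by
  have h : ∀ L : 𝓢'(Plane × Plane, ℂ) →L[ℂ] 𝓢'(Plane × Plane, ℂ),
      QuadLike (fun ψ => l2Sq Λ s (L ψ)) := fun L => (l2Sq_quadLike Λ s).comp L.toLinearMap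
  unfold sobSq
  exact QuadLike.sum (fun γ : ℕ × ℕ => h (alphaDeriv 0 ^ γ.1 * alphaDeriv 1 ^ γ.2)) _

theorem kSq_quadLike {V : Type*} [AddCommGroup V] [Module ℂ V] {N₀ N₁ : V → ℝ≥0∞}
    (h₀ : QuadLike N₀) (h₁ : QuadLike N₁) (t : ℝ) : QuadLike (kSq N₀ N₁ t) where
  zero := by
    refine le_antisymm ((iInf_le _ 0).trans ?_) zero_le
    simp [h₀.zero, h₁.zero]
  add a b := by
    refine le_two_mul_iInf_add fun w w' => ?_
    refine (iInf_le _ (w + w')).trans ?_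
    rw [add_sub_add_comm]
    calc N₀ (w + w') + ENNReal.ofReal t ^ 2 * N₁ (a - w + (b - w'))
        ≤ 2 * (N₀ w + N₀ w') + ENNReal.ofReal t ^ 2 * (2 * (N₁ (a - w) + N₁ (b - w'))) := by
          gcongr
          · exact h₀.add _ _
          · exact h₁.add _ _
      _ = _ := by ring
  smul c a hc := by
    refine le_enorm_sq_mul_iInf hc fun w => ?_
    refine (iInf_le _ (c • w)).trans ?_
    rw [← smul_sub]
    calc N₀ (c • w) + ENNReal.ofReal t ^ 2 * N₁ (c • (a - w))
        ≤ ‖c‖ₑ ^ 2 * N₀ w + ENNReal.ofReal t ^ 2 * (‖c‖ₑ ^ 2 * N₁ (a - w)) := by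
          gcongr
          · exact h₀.smul _ _ hc
          · exact h₁.smul _ _ hc
      _ = _ := by ring

theorem measurable_kSq {V : Type*} [AddCommGroup V] (N₀ N₁ : V → ℝ≥0∞) (v : V) :
    Measurable (fun t => kSq N₀ N₁ t v) := by
  refine Monotone.measurable fun t t' h => ?_
  unfold kSq
  gcongr

theorem interpSq_quadLike {V : Type*} [AddCommGroup V] [Module ℂ V] {N₀ N₁ : V → ℝ≥0∞}
    (h₀ : QuadLike N₀) (h₁ : QuadLike N₁) (θ : ℝ) : QuadLike (interpSq θ N₀ N₁) where
  zero := by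
    unfold interpSq
    simp [fun t => (kSq_quadLike h₀ h₁ t).zero]
  add a b := by
    unfold interpSq
    have hm : Measurable fun t : ℝ => ENNReal.ofReal (t ^ (-2 * θ - 1)) * kSq N₀ N₁ t a :=
      (by fun_prop : Measurable fun t : ℝ => ENNReal.ofReal (t ^ (-2 * θ - 1))).mul
        (measurable_kSq N₀ N₁ a)
    rw [← lintegral_add_left hm, ← lintegral_const_mul' _ _ (by simp)]
    refine lintegral_mono fun t => ?_
    calc ENNReal.ofReal (t ^ (-2 * θ - 1)) * kSq N₀ N₁ t (a + b)
        ≤ ENNReal.ofReal (t ^ (-2 * θ - 1)) * (2 * (kSq N₀ N₁ t a + kSq N₀ N₁ t b)) := by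
          gcongr
          exact (kSq_quadLike h₀ h₁ t).add a b
      _ = _ := by ring
  smul c a hc := by
    unfold interpSq
    rw [← lintegral_const_mul' _ _ (by simp)]
    refine lintegral_mono fun t => ?_
    calc ENNReal.ofReal (t ^ (-2 * θ - 1)) * kSq N₀ N₁ t (c • a)
        ≤ ENNReal.ofReal (t ^ (-2 * θ - 1)) * (‖c‖ₑ ^ 2 * kSq N₀ N₁ t a) := by
          gcongr
          exact (kSq_quadLike h₀ h₁ t).smul c a hc
      _ = _ := by ring

theorem posSq_quadLike (Λ : Matrix (Fin 2) (Fin 2) ℝ) (r s : ℝ) : QuadLike (posSq Λ r s) := by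
  unfold posSq
  split_ifs
  · exact sobSq_quadLike Λ _ s
  · exact interpSq_quadLike (sobSq_quadLike Λ _ s) (sobSq_quadLike Λ _ s) _

theorem dualSq_quadLike (Λ : Matrix (Fin 2) (Fin 2) ℝ) (N : 𝓢'(Plane × Plane, ℂ) → ℝ≥0∞) :
    QuadLike (dualSq Λ N) where
  zero := by
    refine le_antisymm ((iInf_le _ (IsBlochPeriodic.zero Λ)).trans ?_) zero_le
    refine iSup_le fun f => iSup_le fun F => iSup_le fun ρ => iSup_le fun Φ => iSup_le fun _ => ?_
    change ‖(0 : ℂ)‖ₑ ^ 2 / N F ≤ 0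
    simp
  add a b := by
    refine le_two_mul_iInf_add fun ha hb => ?_
    refine (iInf_le _ (ha.add hb)).trans ?_
    refine iSup_le fun f => iSup_le fun F => iSup_le fun ρ => iSup_le fun Φ => iSup_le fun h => ?_
    calc ‖a Φ + b Φ‖ₑ ^ 2 / N F ≤ 2 * (‖a Φ‖ₑ ^ 2 + ‖b Φ‖ₑ ^ 2) / N F := by
          gcongr
          exact enorm_add_sq_le _ _
      _ = 2 * (‖a Φ‖ₑ ^ 2 / N F + ‖b Φ‖ₑ ^ 2 / N F) := by
          rw [mul_div_assoc, ENNReal.add_div]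
      _ ≤ _ := by
          gcongr
          · exact le_iSup_of_le f (le_iSup_of_le F (le_iSup_of_le ρ (le_iSup_of_le Φ
              (le_iSup_of_le h le_rfl))))
          · exact le_iSup_of_le f (le_iSup_of_le F (le_iSup_of_le ρ (le_iSup_of_le Φ
              (le_iSup_of_le h le_rfl))))
  smul c a hc := by
    refine le_enorm_sq_mul_iInf hc fun ha => ?_
    refine (iInf_le _ (ha.smul c)).trans ?_
    refine iSup_le fun f => iSup_le fun F => iSup_le fun ρ => iSup_le fun Φ => iSup_le fun h => ?_
    calc ‖c * a Φ‖ₑ ^ 2 / N F = ‖c‖ₑ ^ 2 * (‖a Φ‖ₑ ^ 2 / N F) := by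
          rw [enorm_mul, mul_pow, mul_div_assoc]
      _ ≤ _ := by
          gcongr
          exact le_iSup_of_le f (le_iSup_of_le F (le_iSup_of_le ρ (le_iSup_of_le Φ
              (le_iSup_of_le h le_rfl))))

theorem blochSq_quadLike (Λ : Matrix (Fin 2) (Fin 2) ℝ) (r s : ℝ) :
    QuadLike (blochSq Λ r s) := by
  unfold blochSq
  split_ifs
  · exact posSq_quadLike Λ r s
  · exact dualSq_quadLike Λ _

/-- The space `H^r_0(W*; H^s_α(W))`. -/
def BlochSob (Λ : Matrix (Fin 2) (Fin 2) ℝ) (r s : ℝ) : Submodule ℂ 𝓢'(Plane × Plane, ℂ) where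
  carrier := {ψ | blochSq Λ r s ψ < ⊤}
  zero_mem' := by
    simp [(blochSq_quadLike Λ r s).zero]
  add_mem' := by
    intro a b ha hb
    refine ((blochSq_quadLike Λ r s).add a b).trans_lt ?_
    exact ENNReal.mul_lt_top (by simp) (ENNReal.add_lt_top.2 ⟨ha, hb⟩)
  smul_mem' := by
    intro c a ha
    by_cases hc : c = 0
    · simp [hc, (blochSq_quadLike Λ r s).zero]
    · exact ((blochSq_quadLike Λ r s).smul c a hc).trans_lt (ENNReal.mul_lt_top (by simp) ha)

/-! ### The Bloch transform, the pairings and adjoints -/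

/-- The Bloch transform `|det Λ|^{1/2} / (2π) ∑_j φ(x + Λ j) e^{-i α·Λ j}` of a function `φ` with
compact support, as a function of `(α, x)`. -/
def blochFun (Λ : Matrix (Fin 2) (Fin 2) ℝ) (φ : Plane → ℂ) (p : Plane × Plane) : ℂ :=
  ((Real.sqrt |Λ.det| / (2 * Real.pi) : ℝ) : ℂ) *
    ∑' j : Fin 2 → ℤ, φ (p.2 + latVec Λ j) * phase (-p.1) (latVec Λ j)

/-- `J` is the Bloch transform `H^s_r(ℝ²) → H^r_0(W*; H^s_α(W))`: the linear isomorphism, bounded in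
both directions, that extends the Bloch transform on `C^∞_0(ℝ²)`. -/
structure IsBlochTransform (Λ : Matrix (Fin 2) (Fin 2) ℝ) (s r : ℝ)
    (J : WSob s r ≃ₗ[ℂ] BlochSob Λ r s) : Prop where
  bounded : ∃ C : ℝ≥0, ∀ u : WSob s r, blochSq Λ r s (J u) ≤ C * wSobSq s r u
  bounded_symm : ∃ C : ℝ≥0, ∀ ψ : BlochSob Λ r s, wSobSq s r (J.symm ψ) ≤ C * blochSq Λ r s ψ
  extends_test : ∀ (φ : Plane → ℂ) (u : WSob s r), ContDiff ℝ ∞ φ → HasCompactSupport φ →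
    Represents φ (u : 𝓢'(Plane, ℂ)) →
    Represents (blochFun Λ φ) (J u : 𝓢'(Plane × Plane, ℂ))

/-- `b` is the bounded sesquilinear form on `H^s_r(ℝ²) × H^{-s}_{-r}(ℝ²)` that extends the inner
product of `L²(ℝ²)` from `C^∞_0(ℝ²)`. -/
structure IsPlanePairing (s r : ℝ) (b : WSob s r →ₗ[ℂ] WSob (-s) (-r) →ₗ⋆[ℂ] ℂ) : Prop where
  bounded : ∃ C : ℝ≥0, ∀ u v, ‖b u v‖ₑ ^ 2 ≤ C * wSobSq s r u * wSobSq (-s) (-r) v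
  extends_test : ∀ (φ χ : Plane → ℂ) (u : WSob s r) (v : WSob (-s) (-r)),
    ContDiff ℝ ∞ φ → HasCompactSupport φ → ContDiff ℝ ∞ χ → HasCompactSupport χ →
    Represents φ (u : 𝓢'(Plane, ℂ)) → Represents χ (v : 𝓢'(Plane, ℂ)) →
    b u v = ∫ x, φ x * (starRingEnd ℂ) (χ x)

/-- `B` is the bounded sesquilinear form on `H^r_0(W*; H^s_α(W)) × H^{-r}_0(W*; H^{-s}_α(W))` that
extends the inner product of `L²(W*; L²(W))` from the smooth `Λ*`-periodic, `α`-quasiperiodic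
functions. -/
structure IsCellPairing (Λ : Matrix (Fin 2) (Fin 2) ℝ) (s r : ℝ)
    (B : BlochSob Λ r s →ₗ[ℂ] BlochSob Λ (-r) (-s) →ₗ⋆[ℂ] ℂ) : Prop where
  bounded : ∃ C : ℝ≥0, ∀ u v, ‖B u v‖ₑ ^ 2 ≤ C * blochSq Λ r s u * blochSq Λ (-r) (-s) v
  extends_test : ∀ (f g : Plane × Plane → ℂ) (u : BlochSob Λ r s) (v : BlochSob Λ (-r) (-s)),
    IsBlochTest Λ f → IsBlochTest Λ g →
    Represents f (u : 𝓢'(Plane × Plane, ℂ)) → Represents g (v : 𝓢'(Plane × Plane, ℂ)) →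
    B u v = ∫ α in cell (dualMat Λ), ∫ x in cell Λ, f (α, x) * (starRingEnd ℂ) (g (α, x))

/-- `A` is an adjoint of `J` with respect to the pairings `B` (on the target of `J`) and `b`
(on its domain): `B(J φ, ψ) = b(φ, A ψ)` for all `φ` and `ψ`. -/
def IsAdjoint {X Y X' Y' : Type*} (B : Y → Y' → ℂ) (b : X → X' → ℂ) (J : X → Y)
    (A : Y' → X') : Prop :=
  ∀ φ ψ, B (J φ) ψ = b φ (A ψ)

end FloquetBloch

end

open scoped SchwartzMap ENNReal NNReal ContDiff Matrix

noncomputable section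

namespace FloquetBloch

open MeasureTheory TemperedDistribution
open scoped FourierTransform LineDeriv

/-! ### A subordination bound for fractional powers -/

/-! The transform is studied through its transpose. For a Schwartz function Φ of (α, x), the sum
over j of ∫ e^{-iα·Λj} Φ(α, y - Λj) dα is a Schwartz function `kern Φ` of y. Hence `u ↦ blochC Λ * u
(kern Φ)` defines one Bloch transform `Jt` on all tempered distributions, and on Schwartz functions
it is the defining series (`represents_blochFun`). Tensoring with a partition of unity in α inverts
`kern` on one side (`kern_tens`). Poisson summation and the two invariances show that a
Bloch-periodic distribution is determined by these tensors (`eq_zero_of_isBlochPeriodic`). So `Jt`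
is a bijection onto all Bloch-periodic distributions with explicit inverse `Jinv`, and the
isomorphism claim becomes an equivalence of norms.

For r = 0, Poisson summation on the frequency side shows that the j-th Fourier coefficient of `Jt u`
at α is (2π)⁻¹ û((α + Λ*j)/2π). The frequency plane is thus cut into translates of the Brillouin
zone, and unfolding this tiling compares the two norms (`exists_l2Sq_comparable`). For r = ℓ a
natural number, the derivative in α_k corresponds to multiplying u by -i x_k (`alphaDeriv_Jt`), so
the norm is a sum of H^s norms of monomials times u, which is the norm of H^s_ℓ because suitable
symbols act boundedly between the weighted spaces (`IsSymb.dominated`, `exists_wSobSq_nat_le`). For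
fractional r > 0, the Bessel potential carries the couple (H^s_ℓ, H^s_{ℓ+1}) to weighted L² spaces,
where the K-functional is explicit up to a factor 2. For r < 0, smooth Bloch functions are exactly
of the form needed to be transforms of Schwartz functions, so the dual norm of `Jt u` is a dual norm
of u, and density of test functions finishes (`dominated_dualSq_Jt`, `dominated_wSobSq_dualSq`).

The analytic core is that weights and Bessel potentials can be interchanged up to equivalent norms
(`exists_nrm_bes_wt_le`) and that order-zero symbols are multipliers of H^s. Both rest on one
commutator estimate. For 0 < σ < 1 the symbol (1+|ξ|²)^{σ/2} is a superposition of 1 -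
e^{-t(1+|ξ|²)}, whose second term is convolution with a Gaussian. Therefore a commutator with the
Bessel potential of order σ is bounded as soon as the commutators with translations by z are O(|z|)
with polynomial growth (`norm_pr_bes_sub_le`). Arbitrary s is reached by writing |s| = nσ and
inducting on n, negative s by duality.

The pairing on the plane is the L² inner product after applying weight and potential, and the
pairing on the cell is its transport by the Bloch transform. On smooth Bloch functions the latter is
the integral over the cells, by unfolding a partition of unity; this is Parseval's identity. The
adjoint identity for the inverse is then immediate, and its uniqueness is nondegeneracy of the plane
pairing. All other uniqueness claims follow from boundedness and density. -/

theorem one_add_pow_le_factorial_mul_exp (N : ℕ) {a : ℝ} (ha : 0 ≤ a) :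
    (1 + a) ^ N ≤ N.factorial * Real.exp (1 + a) := by
  have h := Real.pow_div_factorial_le_exp (x := 1 + a) (by positivity) N
  rw [div_le_iff₀ (by positivity)] at h
  linarith

theorem one_sub_exp_neg_nonneg {a : ℝ} (ha : 0 ≤ a) : 0 ≤ 1 - Real.exp (-a) := by
  have := Real.exp_le_one_iff.2 (neg_nonpos.2 ha)
  linarith

/-- The integrand of `∫_0^∞ t^{-σ/2-1} (1 - e^{-t}) dt`. -/
theorem integrableOn_subordinator {σ : ℝ} (h0 : 0 < σ) (h2 : σ < 2) :
    IntegrableOn (fun t : ℝ => t ^ (-σ / 2 - 1) * (1 - Real.exp (-t))) (Set.Ioi 0) := by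
  have hmeas : ∀ S : Set ℝ, AEStronglyMeasurable
      (fun t : ℝ => t ^ (-σ / 2 - 1) * (1 - Real.exp (-t))) (volume.restrict S) := by
    intro S
    apply Measurable.aestronglyMeasurable
    fun_prop
  rw [← Set.Ioc_union_Ioi_eq_Ioi zero_le_one]
  refine IntegrableOn.union ?_ ?_
  · have h : IntegrableOn (fun t : ℝ => t ^ (-σ / 2)) (Set.Ioc 0 1) := by
      rw [← intervalIntegrable_iff_integrableOn_Ioc_of_le zero_le_one]
      exact intervalIntegral.intervalIntegrable_rpow' (by linarith)
    refine Integrable.mono' h (hmeas _) ?_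
    filter_upwards [ae_restrict_mem measurableSet_Ioc] with t ht
    have h1 := Real.add_one_le_exp (-t)
    have h3 := one_sub_exp_neg_nonneg ht.1.le
    rw [Real.norm_of_nonneg (mul_nonneg (Real.rpow_nonneg ht.1.le _) h3)]
    calc t ^ (-σ / 2 - 1) * (1 - Real.exp (-t)) ≤ t ^ (-σ / 2 - 1) * t := by
          gcongr
          · exact Real.rpow_nonneg ht.1.le _
          · linarith
      _ = t ^ (-σ / 2) := by
          rw [← Real.rpow_add_one ht.1.ne']
          congr 1
          ring
  · have h : IntegrableOn (fun t : ℝ => t ^ (-σ / 2 - 1)) (Set.Ioi 1) :=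
      integrableOn_Ioi_rpow_of_lt (by linarith) one_pos
    refine Integrable.mono' h (hmeas _) ?_
    filter_upwards [ae_restrict_mem measurableSet_Ioi] with t ht
    have h0 : (0 : ℝ) < t := one_pos.trans ht
    have h3 := one_sub_exp_neg_nonneg h0.le
    rw [Real.norm_of_nonneg (mul_nonneg (Real.rpow_nonneg h0.le _) h3)]
    have := Real.exp_pos (-t)
    exact mul_le_of_le_one_right (Real.rpow_nonneg h0.le _) (by linarith)

theorem subordinator_pos {σ : ℝ} (h0 : 0 < σ) (h2 : σ < 2) :
    0 < ∫ t in Set.Ioi (0 : ℝ), t ^ (-σ / 2 - 1) * (1 - Real.exp (-t)) := by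
  rw [setIntegral_pos_iff_support_of_nonneg_ae]
  · have : Set.Ioi (0 : ℝ) ⊆ (Function.support fun t : ℝ => t ^ (-σ / 2 - 1) *
        (1 - Real.exp (-t))) ∩ Set.Ioi 0 := by
      intro t ht
      refine ⟨?_, ht⟩
      have ht' : (0 : ℝ) < t := ht
      have h1 : Real.exp (-t) < 1 := by simpa using ht'
      exact (mul_pos (Real.rpow_pos_of_pos ht' _) (by linarith)).ne'
    refine lt_of_lt_of_le ?_ (measure_mono this)
    simp
  · filter_upwards [ae_restrict_mem measurableSet_Ioi] with t ht
    exact mul_nonneg (Real.rpow_nonneg (le_of_lt ht) _) (one_sub_exp_neg_nonneg (le_of_lt ht))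
  · exact integrableOn_subordinator h0 h2

/-- The substitution `t ↦ t * a` does everything. The identity presents `a ^ (σ / 2)` as a positive
superposition of the functions 1 - e^{-ta}; it will be used with a = 1 + |ξ|². -/
theorem integral_subordinator {σ : ℝ} {a : ℝ} (ha : 0 < a) :
    ∫ t in Set.Ioi (0 : ℝ), t ^ (-σ / 2 - 1) * (1 - Real.exp (-(t * a))) =
      a ^ (σ / 2) * ∫ t in Set.Ioi (0 : ℝ), t ^ (-σ / 2 - 1) * (1 - Real.exp (-t)) := by
  have h := integral_comp_mul_left_Ioi
    (fun t : ℝ => t ^ (-σ / 2 - 1) * (1 - Real.exp (-t))) 0 ha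
  rw [mul_zero, smul_eq_mul] at h
  have h' : ∫ t in Set.Ioi (0 : ℝ), (a * t) ^ (-σ / 2 - 1) * (1 - Real.exp (-(a * t))) =
      a ^ (-σ / 2 - 1) *
        ∫ t in Set.Ioi (0 : ℝ), t ^ (-σ / 2 - 1) * (1 - Real.exp (-(t * a))) := by
    rw [← integral_const_mul]
    refine setIntegral_congr_fun measurableSet_Ioi fun t ht => ?_
    rw [Real.mul_rpow ha.le (le_of_lt ht), mul_comm a t]
    ring
  rw [h'] at h
  have hne : a ^ (-σ / 2 - 1) ≠ 0 := (Real.rpow_pos_of_pos ha _).ne'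
  rw [← mul_right_inj' hne, h, ← mul_assoc, ← Real.rpow_add ha,
    show -σ / 2 - 1 + σ / 2 = -1 by ring, Real.rpow_neg_one]

/-- This licenses Fubini for the subordination formula. The inner integral in t is computed exactly
by scaling, and what remains is a constant times the modulus of the Schwartz function (1+|ξ|²)^{σ/2}
P. -/
theorem integrable_subordinator_mul {σ : ℝ} (h0 : 0 < σ) (h2 : σ < 2) (P : 𝓢(Plane, ℂ)) :
    Integrable (fun q : ℝ × Plane => ((q.1 ^ (-σ / 2 - 1) *
      (1 - Real.exp (-(q.1 * (1 + ‖q.2‖ ^ 2)))) : ℝ) : ℂ) * P q.2)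
      ((volume.restrict (Set.Ioi 0)).prod volume) := by
  rw [integrable_prod_iff']
  · constructor
    · refine Filter.Eventually.of_forall fun ξ => ?_
      suffices hh : IntegrableOn (fun t : ℝ => t ^ (-σ / 2 - 1) *
          (1 - Real.exp (-(t * (1 + ‖ξ‖ ^ 2))))) (Set.Ioi 0) from
        (Integrable.ofReal (𝕜 := ℂ) hh).mul_const (P ξ)
      have ha : 0 < 1 + ‖ξ‖ ^ 2 := by positivity
      have := (integrableOn_Ioi_comp_mul_left_iff
        (fun t : ℝ => t ^ (-σ / 2 - 1) * (1 - Real.exp (-t))) 0 ha).2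
          (by simpa using integrableOn_subordinator h0 h2)
      refine (this.const_mul ((1 + ‖ξ‖ ^ 2) ^ (-σ / 2 - 1))⁻¹).congr ?_
      filter_upwards [ae_restrict_mem measurableSet_Ioi] with t ht
      have hne : (1 + ‖ξ‖ ^ 2) ^ (-σ / 2 - 1) ≠ 0 := (Real.rpow_pos_of_pos ha _).ne'
      rw [Real.mul_rpow ha.le (le_of_lt ht), mul_comm t]
      field_simp
    · have h : ∀ ξ : Plane, ∫ t in Set.Ioi (0 : ℝ), ‖((t ^ (-σ / 2 - 1) *
          (1 - Real.exp (-(t * (1 + ‖ξ‖ ^ 2)))) : ℝ) : ℂ) * P ξ‖ =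
          (∫ t in Set.Ioi (0 : ℝ), t ^ (-σ / 2 - 1) * (1 - Real.exp (-t))) *
            ‖(SchwartzMap.smulLeftCLM ℂ (fun x : Plane => (1 + ‖x‖ ^ 2) ^ (σ / 2)) P) ξ‖ := by
        intro ξ
        have ha : 0 < 1 + ‖ξ‖ ^ 2 := by positivity
        rw [SchwartzMap.smulLeftCLM_apply_apply (by fun_prop), norm_smul,
          Real.norm_of_nonneg (Real.rpow_nonneg ha.le _), ← mul_assoc, mul_comm (∫ _ in _, _),
          ← integral_subordinator ha, ← integral_mul_const]
        refine setIntegral_congr_fun measurableSet_Ioi fun t ht => ?_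
        rw [norm_mul, Complex.norm_real, Real.norm_of_nonneg]
        exact mul_nonneg (Real.rpow_nonneg (le_of_lt ht) _)
          (one_sub_exp_neg_nonneg (mul_nonneg (le_of_lt ht) ha.le))
      simp_rw [h]
      exact ((SchwartzMap.integrable _).norm).const_mul _
  · refine AEStronglyMeasurable.mul ?_ ?_
    · apply Measurable.aestronglyMeasurable
      fun_prop
    · exact (P.continuous.comp continuous_snd).aestronglyMeasurable

/-- The heat kernel of `e^{-t(1+|ξ|²)}`. -/
def heatKernel (t : ℝ) (z : Plane) : ℝ :=
  Real.exp (-t) * (Real.pi / t) * Real.exp (-(Real.pi ^ 2 / t) * ‖z‖ ^ 2)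

theorem integrable_gaussian {b : ℝ} (hb : 0 < b) :
    Integrable (fun z : Plane => Real.exp (-b * ‖z‖ ^ 2)) := by
  have := (GaussianFourier.integrable_cexp_neg_mul_sq_norm_add (V := Plane) (b := (b : ℂ))
    (by simpa using hb) 0 0).norm
  refine this.congr (Filter.Eventually.of_forall fun z => ?_)
  simp only [zero_mul, add_zero]
  rw [← Complex.ofReal_pow, ← Complex.ofReal_neg, ← Complex.ofReal_mul, Complex.norm_exp,
    Complex.ofReal_re]

/-- The multiplication formula ∫ (𝓕G) P = ∫ G (𝓕P) for a Gaussian G. It moves the estimate to 𝓕 P,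
whose behaviour at the origin is what will be assumed. -/
theorem integral_heatKernel_mul_fourier {t : ℝ} (ht : 0 < t) (P : 𝓢(Plane, ℂ)) :
    ∫ z, (heatKernel t z : ℂ) * 𝓕 P z = ∫ ξ, (Real.exp (-(t * (1 + ‖ξ‖ ^ 2))) : ℂ) * P ξ := by
  have hb : 0 < Real.pi ^ 2 / t := by positivity
  have hg : Integrable (fun z : Plane => (heatKernel t z : ℂ)) :=
    ((integrable_gaussian hb).const_mul _).ofReal
  have h := VectorFourier.integral_fourierIntegral_smul_eq_flip (L := innerₗ Plane)
    (μ := volume) (ν := volume) Real.continuous_fourierChar continuous_inner hg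
    P.integrable (F := ℂ)
  rw [flip_innerₗ] at h
  have hF : 𝓕 (fun z : Plane => (heatKernel t z : ℂ)) =
      fun ξ => (Real.exp (-(t * (1 + ‖ξ‖ ^ 2))) : ℂ) := by
    ext ξ
    have h1 : (fun z : Plane => (heatKernel t z : ℂ)) =
        fun z => ((Real.exp (-t) * (Real.pi / t) : ℝ) : ℂ) •
          Complex.exp (-((Real.pi ^ 2 / t : ℝ) : ℂ) * ‖z‖ ^ 2) := by
      ext z
      simp only [heatKernel, smul_eq_mul]
      push_cast
      ring
    rw [h1]
    have h2 := fourier_gaussian_innerProductSpace (V := Plane)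
      (b := ((Real.pi ^ 2 / t : ℝ) : ℂ)) (by rwa [Complex.ofReal_re]) ξ
    rw [Real.fourier_eq] at h2 ⊢
    simp_rw [smul_comm _ (((Real.exp (-t) * (Real.pi / t) : ℝ) : ℂ))]
    rw [integral_smul, h2]
    have hpi : (Real.pi : ℂ) ≠ 0 := by exact_mod_cast Real.pi_ne_zero
    have ht' : (t : ℂ) ≠ 0 := by exact_mod_cast ht.ne'
    simp only [smul_eq_mul, finrank_euclideanSpace, Fintype.card_fin]
    push_cast
    rw [show ((2 : ℂ) / 2) = 1 by norm_num, Complex.cpow_one]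
    have : Complex.exp (-(t * (1 + (‖ξ‖ : ℂ) ^ 2))) = Complex.exp (-t) *
        Complex.exp (-(Real.pi : ℂ) ^ 2 * (‖ξ‖ : ℂ) ^ 2 / (Real.pi ^ 2 / t)) := by
      rw [← Complex.exp_add]
      congr 1
      field_simp
      ring
    rw [this]
    field_simp
  change ∫ ξ, (𝓕 (fun z : Plane => (heatKernel t z : ℂ))) ξ • P ξ =
    ∫ z, (heatKernel t z : ℂ) • 𝓕 (P : Plane → ℂ) z at h
  rw [hF] at h
  simpa [SchwartzMap.fourier_coe] using h.symm

/-- In the scaled variable a = |z|/√t the polynomial is at most a constant times e^{1+a}, and (1 +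
a) - π²a² ≤ 2 - a². A Gaussian is left over for the integration, and the factor |z| has produced a
factor √t. -/
theorem heatKernel_mul_le {t : ℝ} (ht : 0 < t) (M : ℕ) (z : Plane) :
    heatKernel t z * (‖z‖ * (1 + ‖z‖) ^ M) ≤
      Real.exp (-t) * (Real.pi / t) * (√t * (1 + √t) ^ M * ((M + 1).factorial * Real.exp 2)) *
        Real.exp (-t⁻¹ * ‖z‖ ^ 2) := by
  set a := ‖z‖ / √t with ha
  have hs : 0 < √t := Real.sqrt_pos.2 ht
  have ha0 : 0 ≤ a := by positivity
  have hz : ‖z‖ = √t * a := by rw [ha]; field_simp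
  have hz2 : ‖z‖ ^ 2 = t * a ^ 2 := by rw [hz, mul_pow, Real.sq_sqrt ht.le]
  have h1 : ‖z‖ * (1 + ‖z‖) ^ M ≤ √t * (1 + √t) ^ M * (1 + a) ^ (M + 1) := by
    rw [hz]
    calc √t * a * (1 + √t * a) ^ M ≤ √t * (1 + a) * ((1 + √t) * (1 + a)) ^ M := by
          gcongr
          · linarith
          · nlinarith
      _ = _ := by rw [mul_pow, pow_succ]; ring
  have h2 := one_add_pow_le_factorial_mul_exp (M + 1) ha0
  have h3 : Real.exp (1 + a) * Real.exp (-(Real.pi ^ 2 / t) * ‖z‖ ^ 2) ≤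
      Real.exp 2 * Real.exp (-t⁻¹ * ‖z‖ ^ 2) := by
    rw [← Real.exp_add, ← Real.exp_add, hz2]
    apply Real.exp_le_exp.2
    have hpi : 9 ≤ Real.pi ^ 2 := by nlinarith [Real.pi_gt_three]
    have e1 : -(Real.pi ^ 2 / t) * (t * a ^ 2) = -Real.pi ^ 2 * a ^ 2 := by field_simp
    have e2 : -t⁻¹ * (t * a ^ 2) = - a ^ 2 := by field_simp
    rw [e1, e2]
    nlinarith [sq_nonneg (a - 1), sq_nonneg a]
  unfold heatKernel
  calc Real.exp (-t) * (Real.pi / t) * Real.exp (-(Real.pi ^ 2 / t) * ‖z‖ ^ 2) *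
        (‖z‖ * (1 + ‖z‖) ^ M)
      ≤ Real.exp (-t) * (Real.pi / t) * Real.exp (-(Real.pi ^ 2 / t) * ‖z‖ ^ 2) *
        (√t * (1 + √t) ^ M * ((M + 1).factorial * Real.exp (1 + a))) := by
        refine mul_le_mul_of_nonneg_left (h1.trans ?_) (by positivity)
        gcongr
    _ = Real.exp (-t) * (Real.pi / t) * (√t * (1 + √t) ^ M * (M + 1).factorial) *
        (Real.exp (1 + a) * Real.exp (-(Real.pi ^ 2 / t) * ‖z‖ ^ 2)) := by ring
    _ ≤ Real.exp (-t) * (Real.pi / t) * (√t * (1 + √t) ^ M * (M + 1).factorial) *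
        (Real.exp 2 * Real.exp (-t⁻¹ * ‖z‖ ^ 2)) := by gcongr
    _ = _ := by ring

/-- Integrating the leftover Gaussian gives πt, which cancels the π/t of the kernel. The power of 1
+ √t is absorbed by half of e^{-t}. -/
theorem norm_integral_heatKernel_mul_le (M : ℕ) : ∃ C : ℝ, 0 ≤ C ∧ ∀ t : ℝ, 0 < t →
    ∀ (Q : Plane → ℂ) (B : ℝ), 0 ≤ B → (∀ z, ‖Q z‖ ≤ B * (‖z‖ * (1 + ‖z‖) ^ M)) →
    ‖∫ z, (heatKernel t z : ℂ) * Q z‖ ≤ C * B * (√t * Real.exp (-(t / 2))) := by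
  refine ⟨Real.pi ^ 2 * (M.factorial * Real.exp 2) * ((M + 1).factorial * Real.exp 2),
    by positivity, fun t ht Q B hB hQ => ?_⟩
  have hint := GaussianFourier.integral_rexp_neg_mul_sq_norm (V := Plane) (inv_pos.2 ht)
  simp only [finrank_euclideanSpace, Fintype.card_fin, Nat.cast_ofNat, div_self, ne_eq,
    OfNat.ofNat_ne_zero, not_false_eq_true, Real.rpow_one] at hint
  set A := Real.exp (-t) * (Real.pi / t) *
    (√t * (1 + √t) ^ M * ((M + 1).factorial * Real.exp 2)) with hA
  have hb : ‖∫ z, (heatKernel t z : ℂ) * Q z‖ ≤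
      ∫ z : Plane, (B * A) * Real.exp (-t⁻¹ * ‖z‖ ^ 2) := by
    refine norm_integral_le_of_norm_le ((integrable_gaussian (inv_pos.2 ht)).const_mul _)
      (Filter.Eventually.of_forall fun z => ?_)
    have hk : 0 ≤ heatKernel t z := by unfold heatKernel; positivity
    rw [norm_mul, Complex.norm_real, Real.norm_of_nonneg hk]
    calc heatKernel t z * ‖Q z‖ ≤ heatKernel t z * (B * (‖z‖ * (1 + ‖z‖) ^ M)) := by
          gcongr
          exact hQ z
      _ = B * (heatKernel t z * (‖z‖ * (1 + ‖z‖) ^ M)) := by ring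
      _ ≤ B * (A * Real.exp (-t⁻¹ * ‖z‖ ^ 2)) := by
          exact mul_le_mul_of_nonneg_left (heatKernel_mul_le ht M z) hB
      _ = _ := by ring
  refine hb.trans ?_
  rw [integral_const_mul, hint, hA]
  have h1 : (1 + √t) ^ M ≤ M.factorial * (Real.exp 2 * Real.exp (t / 2)) := by
    refine (one_add_pow_le_factorial_mul_exp M (Real.sqrt_nonneg t)).trans ?_
    gcongr
    rw [← Real.exp_add]
    apply Real.exp_le_exp.2
    nlinarith [sq_nonneg (√t - 1), Real.sq_sqrt ht.le]
  have h2 : Real.exp (-t) = Real.exp (-(t / 2)) * Real.exp (-(t / 2)) := by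
    rw [← Real.exp_add]; congr 1; ring
  have h3 : Real.exp (-(t / 2)) * Real.exp (t / 2) = 1 := by
    rw [← Real.exp_add]; simp
  have hpt : Real.pi / t * (Real.pi / t⁻¹) = Real.pi ^ 2 := by field_simp
  calc B * (Real.exp (-t) * (Real.pi / t) *
        (√t * (1 + √t) ^ M * ((M + 1).factorial * Real.exp 2))) * (Real.pi / t⁻¹)
      = Real.pi ^ 2 * B * Real.exp (-t) * √t * ((M + 1).factorial * Real.exp 2) *
        (1 + √t) ^ M := by rw [← hpt]; ring
    _ ≤ Real.pi ^ 2 * B * Real.exp (-t) * √t * ((M + 1).factorial * Real.exp 2) *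
        (M.factorial * (Real.exp 2 * Real.exp (t / 2))) := by gcongr
    _ = Real.pi ^ 2 * (M.factorial * Real.exp 2) * ((M + 1).factorial * Real.exp 2) * B *
        (√t * Real.exp (-(t / 2))) * (Real.exp (-(t / 2)) * Real.exp (t / 2)) := by
        rw [h2]; ring
    _ = _ := by rw [h3, mul_one]

/-- If `𝓕 P` vanishes to first order at the origin and grows at most polynomially, then
`∫ (1 + |ξ|²)^{σ/2} P` is bounded by the corresponding constant, for `0 < σ < 1`. -/
theorem norm_integral_rpow_mul_le {σ : ℝ} (h0 : 0 < σ) (h1 : σ < 1) (M : ℕ) :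
    ∃ C : ℝ, 0 ≤ C ∧ ∀ (P : 𝓢(Plane, ℂ)) (B : ℝ), 0 ≤ B →
      (∀ z, ‖𝓕 P z‖ ≤ B * (‖z‖ * (1 + ‖z‖) ^ M)) →
      ‖∫ ξ, (((1 + ‖ξ‖ ^ 2) ^ (σ / 2) : ℝ) : ℂ) * P ξ‖ ≤ C * B := by
  have h2 : σ < 2 := by linarith
  obtain ⟨D, hD, hDb⟩ := norm_integral_heatKernel_mul_le M
  set c := ∫ t in Set.Ioi (0 : ℝ), t ^ (-σ / 2 - 1) * (1 - Real.exp (-t)) with hc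
  have hcpos : 0 < c := subordinator_pos h0 h2
  -- The power exceeds -1 exactly because σ < 1. The gain of √t from the first order vanishing of 𝓕
  -- P is what makes the singularity at t = 0 integrable.
  have hint : IntegrableOn (fun t : ℝ => t ^ (-σ / 2 - 1 / 2) * Real.exp (-(1 / 2) * t))
      (Set.Ioi 0) := by
    have := integrableOn_rpow_mul_exp_neg_mul_rpow (p := 1) (s := -σ / 2 - 1 / 2) (b := 1 / 2)
      (by linarith) one_pos (by norm_num)
    simpa using this
  set I := ∫ t in Set.Ioi (0 : ℝ), t ^ (-σ / 2 - 1 / 2) * Real.exp (-(1 / 2) * t) with hI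
  have hI0 : 0 ≤ I := setIntegral_nonneg measurableSet_Ioi fun t ht =>
    mul_nonneg (Real.rpow_nonneg (le_of_lt ht) _) (Real.exp_nonneg _)
  refine ⟨c⁻¹ * (D * I), by positivity, fun P B hB hP => ?_⟩
  -- Since 𝓕 P vanishes at 0, the constant in 1 - e^{-t(1+|ξ|²)} contributes nothing and only the
  -- heat kernel term survives.
  have hP0 : ∫ ξ, P ξ = 0 := by
    have := hP 0
    simp only [norm_zero, zero_mul, mul_zero, norm_le_zero_iff] at this
    rw [SchwartzMap.fourier_coe, Real.fourier_eq] at this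
    simpa using this
  have key : (c : ℂ) * ∫ ξ, (((1 + ‖ξ‖ ^ 2) ^ (σ / 2) : ℝ) : ℂ) * P ξ =
      ∫ t in Set.Ioi (0 : ℝ), -((t ^ (-σ / 2 - 1) : ℝ) : ℂ) *
        ∫ z, (heatKernel t z : ℂ) * 𝓕 P z := by
    have hF := integrable_subordinator_mul h0 h2 P
    calc (c : ℂ) * ∫ ξ, (((1 + ‖ξ‖ ^ 2) ^ (σ / 2) : ℝ) : ℂ) * P ξ
        = ∫ ξ, ∫ t in Set.Ioi (0 : ℝ), ((t ^ (-σ / 2 - 1) *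
          (1 - Real.exp (-(t * (1 + ‖ξ‖ ^ 2)))) : ℝ) : ℂ) * P ξ := by
          rw [← integral_const_mul]
          congr 1
          ext ξ
          rw [integral_mul_const, integral_complex_ofReal,
            integral_subordinator (by positivity : 0 < 1 + ‖ξ‖ ^ 2), ← hc]
          push_cast
          ring
      _ = ∫ t in Set.Ioi (0 : ℝ), ∫ ξ, ((t ^ (-σ / 2 - 1) *
          (1 - Real.exp (-(t * (1 + ‖ξ‖ ^ 2)))) : ℝ) : ℂ) * P ξ :=
          (integral_integral_swap hF).symm
      _ = _ := by
          refine setIntegral_congr_fun measurableSet_Ioi fun t ht => ?_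
          rw [integral_heatKernel_mul_fourier ht, ← integral_const_mul]
          have e : ∀ ξ : Plane, ((t ^ (-σ / 2 - 1) *
              (1 - Real.exp (-(t * (1 + ‖ξ‖ ^ 2)))) : ℝ) : ℂ) * P ξ =
              ((t ^ (-σ / 2 - 1) : ℝ) : ℂ) * P ξ + -((t ^ (-σ / 2 - 1) : ℝ) : ℂ) *
                ((Real.exp (-(t * (1 + ‖ξ‖ ^ 2))) : ℂ) * P ξ) := by
            intro ξ
            push_cast
            ring
          simp_rw [e]
          have hi : Integrable (fun ξ : Plane =>
              (Real.exp (-(t * (1 + ‖ξ‖ ^ 2))) : ℂ) * P ξ) := by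
            refine P.integrable.bdd_mul (c := 1) ?_ (Filter.Eventually.of_forall fun ξ => ?_)
            · apply Continuous.aestronglyMeasurable
              fun_prop
            · rw [Complex.norm_real, Real.norm_of_nonneg (Real.exp_nonneg _)]
              apply Real.exp_le_one_iff.2
              have : (0 : ℝ) < t := ht
              have : 0 ≤ t * (1 + ‖ξ‖ ^ 2) := by positivity
              linarith
          rw [integral_add (P.integrable.const_mul _) (hi.const_mul _), integral_const_mul, hP0]
          simp
  have hle : ‖(c : ℂ) * ∫ ξ, (((1 + ‖ξ‖ ^ 2) ^ (σ / 2) : ℝ) : ℂ) * P ξ‖ ≤ D * B * I := by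
    rw [key, hI, ← integral_const_mul]
    refine norm_integral_le_of_norm_le (hint.const_mul _) ?_
    filter_upwards [ae_restrict_mem measurableSet_Ioi] with t ht
    have ht' : (0 : ℝ) < t := ht
    rw [norm_mul, norm_neg, Complex.norm_real,
      Real.norm_of_nonneg (Real.rpow_nonneg ht'.le _)]
    calc t ^ (-σ / 2 - 1) * ‖∫ z, (heatKernel t z : ℂ) * 𝓕 P z‖
        ≤ t ^ (-σ / 2 - 1) * (D * B * (√t * Real.exp (-(t / 2)))) := by
          gcongr
          exact hDb t ht' _ B hB hP
      _ = D * B * (t ^ (-σ / 2 - 1) * √t * Real.exp (-(t / 2))) := by ring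
      _ = _ := by
          rw [Real.sqrt_eq_rpow, ← Real.rpow_add ht']
          congr 3
          · ring
          · ring_nf
  rw [norm_mul, Complex.norm_real, Real.norm_of_nonneg hcpos.le] at hle
  rw [mul_assoc, le_inv_mul_iff₀ hcpos]
  linarith

/-! ### Weights and Bessel potentials on Schwartz functions -/

/-- `(1 + |x|²)^{s/2}` as a complex-valued function. -/
def jap (s : ℝ) (x : Plane) : ℂ := (((1 + ‖x‖ ^ 2) ^ (s / 2) : ℝ) : ℂ)

theorem jap_hasTemperateGrowth (s : ℝ) : (jap s).HasTemperateGrowth := by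
  unfold jap
  fun_prop

theorem jap_mul_jap (s t : ℝ) : jap s * jap t = jap (s + t) := by
  ext x
  simp only [jap, Pi.mul_apply]
  rw [← Complex.ofReal_mul, ← Real.rpow_add (by positivity), add_div]

theorem jap_zero : jap 0 = fun _ => 1 := by
  ext x
  simp [jap]

theorem jap_neg_apply (s : ℝ) (x : Plane) : jap s (-x) = jap s x := by
  simp [jap]

theorem norm_jap (s : ℝ) (x : Plane) : ‖jap s x‖ = (1 + ‖x‖ ^ 2) ^ (s / 2) := by
  rw [jap, Complex.norm_real, Real.norm_of_nonneg (by positivity)]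

/-- Multiplication of a Schwartz function by a function of temperate growth. -/
abbrev smulS (m : Plane → ℂ) : 𝓢(Plane, ℂ) →L[ℂ] 𝓢(Plane, ℂ) := SchwartzMap.smulLeftCLM ℂ m

/-- Multiplication by `(1 + |x|²)^{r/2}` on Schwartz functions. -/
def wt (r : ℝ) : 𝓢(Plane, ℂ) →L[ℂ] 𝓢(Plane, ℂ) := smulS (jap r)

/-- The Bessel potential on Schwartz functions. -/
def bes (s : ℝ) : 𝓢(Plane, ℂ) →L[ℂ] 𝓢(Plane, ℂ) := SchwartzMap.fourierMultiplierCLM ℂ (jap s)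

theorem smulS_apply {m : Plane → ℂ} (hm : m.HasTemperateGrowth) (f : 𝓢(Plane, ℂ)) (x : Plane) :
    smulS m f x = m x * f x := SchwartzMap.smulLeftCLM_apply_apply hm f x

theorem wt_apply (r : ℝ) (f : 𝓢(Plane, ℂ)) (x : Plane) : wt r f x = jap r x * f x :=
  smulS_apply (jap_hasTemperateGrowth r) f x

theorem wt_wt (r t : ℝ) (f : 𝓢(Plane, ℂ)) : wt r (wt t f) = wt (r + t) f := by
  rw [wt, wt, SchwartzMap.smulLeftCLM_smulLeftCLM_apply (jap_hasTemperateGrowth r)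
    (jap_hasTemperateGrowth t), jap_mul_jap]
  rfl

theorem wt_zero (f : 𝓢(Plane, ℂ)) : wt 0 f = f := by
  ext x
  simp [wt_apply, jap_zero]

theorem bes_bes (s t : ℝ) (f : 𝓢(Plane, ℂ)) : bes s (bes t f) = bes (s + t) f := by
  rw [bes, bes, SchwartzMap.fourierMultiplierCLM_fourierMultiplierCLM_apply
    (jap_hasTemperateGrowth s) (jap_hasTemperateGrowth t), jap_mul_jap]
  rfl

theorem bes_zero (f : 𝓢(Plane, ℂ)) : bes 0 f = f := by
  rw [bes, jap_zero, SchwartzMap.fourierMultiplierCLM_const]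
  simp

theorem fourier_bes (s : ℝ) (f : 𝓢(Plane, ℂ)) : 𝓕 (bes s f) = wt s (𝓕 f) := by
  rw [bes, SchwartzMap.fourierMultiplierCLM_apply, FourierTransform.fourier_fourierInv_eq]
  rfl

theorem fourierInv_apply_neg (f : 𝓢(Plane, ℂ)) (x : Plane) : 𝓕⁻ f x = 𝓕 f (-x) := by
  rw [SchwartzMap.fourierInv_apply_eq]
  simp

theorem fourierInv_wt (s : ℝ) (f : 𝓢(Plane, ℂ)) : 𝓕⁻ (wt s f) = bes s (𝓕⁻ f) := by
  rw [bes, SchwartzMap.fourierMultiplierCLM_apply, FourierTransform.fourier_fourierInv_eq]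
  rfl

theorem fourierInv_bes (s : ℝ) (f : 𝓢(Plane, ℂ)) : 𝓕⁻ (bes s f) = wt s (𝓕⁻ f) := by
  ext x
  rw [fourierInv_apply_neg, fourier_bes, wt_apply, wt_apply, fourierInv_apply_neg, jap_neg_apply]

/-- The bilinear pairing `∫ f g`. -/
def pr (f g : 𝓢(Plane, ℂ)) : ℂ := ∫ x, f x * g x

theorem integrable_mul (f g : 𝓢(Plane, ℂ)) : Integrable (fun x => f x * g x) := by
  refine (smulS f g).integrable.congr (Filter.Eventually.of_forall fun x => ?_)
  rw [smulS_apply f.hasTemperateGrowth]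

theorem pr_sub_left (f f' g : 𝓢(Plane, ℂ)) : pr (f - f') g = pr f g - pr f' g := by
  simp only [pr, sub_apply, sub_mul]
  exact integral_sub (integrable_mul _ _) (integrable_mul _ _)

theorem pr_smulS {m : Plane → ℂ} (hm : m.HasTemperateGrowth) (f g : 𝓢(Plane, ℂ)) :
    pr (smulS m f) g = pr f (smulS m g) := by
  simp only [pr]
  congr 1
  ext x
  rw [smulS_apply hm, smulS_apply hm]
  ring

theorem pr_wt (r : ℝ) (f g : 𝓢(Plane, ℂ)) : pr (wt r f) g = pr f (wt r g) :=
  pr_smulS (jap_hasTemperateGrowth r) f g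

theorem pr_fourierInv (f g : 𝓢(Plane, ℂ)) : pr (𝓕⁻ f) g = pr f (𝓕⁻ g) :=
  SchwartzMap.integral_fourierInv_mul_eq f g

theorem pr_fourier (f g : 𝓢(Plane, ℂ)) : pr (𝓕 f) g = pr f (𝓕 g) :=
  SchwartzMap.integral_fourier_mul_eq f g

theorem pr_bes_left (s : ℝ) (f g : 𝓢(Plane, ℂ)) : pr (bes s f) g = pr (wt s (𝓕 f)) (𝓕⁻ g) := by
  rw [← pr_fourierInv, ← fourier_bes, FourierTransform.fourierInv_fourier_eq]

theorem pr_bes (s : ℝ) (f g : 𝓢(Plane, ℂ)) : pr (bes s f) g = pr f (bes s g) := by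
  rw [pr_bes_left, pr_wt, ← fourierInv_bes, pr_fourier, FourierTransform.fourier_fourierInv_eq]

/-- The `L²` norm of a Schwartz function. -/
def nrm (f : 𝓢(Plane, ℂ)) : ℝ := ‖f.toLp 2 (volume : Measure Plane)‖

theorem nrm_nonneg (f : 𝓢(Plane, ℂ)) : 0 ≤ nrm f := norm_nonneg _

theorem nrm_eq (f : 𝓢(Plane, ℂ)) : nrm f = (∫ x, ‖f x‖ ^ 2) ^ (1 / 2 : ℝ) := by
  rw [nrm, SchwartzMap.norm_toLp' (by simp) (by simp)]
  simp

theorem nrm_sq (f : 𝓢(Plane, ℂ)) : nrm f ^ 2 = ∫ x, ‖f x‖ ^ 2 := by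
  rw [nrm_eq, ← Real.rpow_mul_natCast (integral_nonneg fun x => by positivity)]
  simp

theorem nrm_add_le (f g : 𝓢(Plane, ℂ)) : nrm (f + g) ≤ nrm f + nrm g :=
  norm_add_le (f.toLp 2 volume) (g.toLp 2 volume)

theorem integrable_norm_sq (f : 𝓢(Plane, ℂ)) : Integrable (fun x => ‖f x‖ ^ 2) :=
  (f.memLp 2).integrable_norm_pow (by simp)

theorem nrm_le_mul_of_norm_le {f g : 𝓢(Plane, ℂ)} {C : ℝ} (hC : 0 ≤ C)
    (h : ∀ x, ‖f x‖ ≤ C * ‖g x‖) : nrm f ≤ C * nrm g := by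
  refine (sq_le_sq₀ (nrm_nonneg f) (mul_nonneg hC (nrm_nonneg g))).1 ?_
  rw [mul_pow, nrm_sq, nrm_sq, ← integral_const_mul]
  refine integral_mono (integrable_norm_sq f) ((integrable_norm_sq g).const_mul _) fun x => ?_
  rw [← mul_pow]
  exact pow_le_pow_left₀ (norm_nonneg _) (h x) 2

theorem nrm_smulS_le {m : Plane → ℂ} (hm : m.HasTemperateGrowth) {C : ℝ}
    (h : ∀ x, ‖m x‖ ≤ C) (f : 𝓢(Plane, ℂ)) : nrm (smulS m f) ≤ C * nrm f := by
  refine nrm_le_mul_of_norm_le ((norm_nonneg _).trans (h 0)) fun x => ?_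
  rw [smulS_apply hm, norm_mul]
  gcongr
  exact h x

theorem nrm_fourier (f : 𝓢(Plane, ℂ)) : nrm (𝓕 f) = nrm f := SchwartzMap.norm_fourier_toL2_eq f

theorem nrm_fourierInv (f : 𝓢(Plane, ℂ)) : nrm (𝓕⁻ f) = nrm f := by
  rw [← nrm_fourier, FourierTransform.fourier_fourierInv_eq]

theorem norm_jap_le_one {s : ℝ} (hs : s ≤ 0) (x : Plane) : ‖jap s x‖ ≤ 1 := by
  rw [norm_jap]
  exact Real.rpow_le_one_of_one_le_of_nonpos (by simp) (by linarith)

theorem nrm_bes_le {s : ℝ} (hs : s ≤ 0) (f : 𝓢(Plane, ℂ)) : nrm (bes s f) ≤ nrm f := by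
  rw [← nrm_fourier, fourier_bes, ← nrm_fourier f]
  have := nrm_smulS_le (jap_hasTemperateGrowth s) (norm_jap_le_one hs) (𝓕 f)
  rwa [one_mul] at this

/-- Complex conjugation of Schwartz functions. -/
def conjS {V : Type*} [NormedAddCommGroup V] [NormedSpace ℝ V] : 𝓢(V, ℂ) →L[ℝ] 𝓢(V, ℂ) :=
  SchwartzMap.postcompCLM (Complex.conjCLE : ℂ →L[ℝ] ℂ)

@[simp]
theorem conjS_apply {V : Type*} [NormedAddCommGroup V] [NormedSpace ℝ V] (f : 𝓢(V, ℂ)) (x : V) :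
    conjS f x = (starRingEnd ℂ) (f x) := rfl

@[simp]
theorem conjS_conjS {V : Type*} [NormedAddCommGroup V] [NormedSpace ℝ V] (f : 𝓢(V, ℂ)) :
    conjS (conjS f) = f := by
  ext x
  simp

theorem nrm_conjS (f : 𝓢(Plane, ℂ)) : nrm (conjS f) = nrm f := by
  rw [nrm_eq, nrm_eq]
  simp

theorem norm_pr_le (f g : 𝓢(Plane, ℂ)) : ‖pr f g‖ ≤ nrm f * nrm g := by
  have h := norm_inner_le_norm (𝕜 := ℂ) ((conjS f).toLp 2 (volume : Measure Plane)) (g.toLp 2 volume)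
  rw [SchwartzMap.inner_toL2_toL2_eq (conjS f) g volume] at h
  change _ ≤ nrm (conjS f) * nrm g at h
  rw [nrm_conjS] at h
  convert! h using 2
  simp [pr, mul_comm]

theorem nrm_le_of_norm_pr_le {f : 𝓢(Plane, ℂ)} {C : ℝ} (hC : 0 ≤ C)
    (h : ∀ g, ‖pr f g‖ ≤ C * nrm g) : nrm f ≤ C := by
  have h1 := h (conjS f)
  have h2 : pr f (conjS f) = ((nrm f ^ 2 : ℝ) : ℂ) := by
    rw [nrm_sq, ← integral_complex_ofReal, pr]
    congr 1
    ext x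
    rw [conjS_apply, Complex.mul_conj, Complex.normSq_eq_norm_sq]
  rw [h2, nrm_conjS, Complex.norm_real, Real.norm_of_nonneg (by positivity)] at h1
  by_contra hlt
  push Not at hlt
  nlinarith [nrm_nonneg f]

/-- Translation of Schwartz functions. -/
abbrev tr (z : Plane) : 𝓢(Plane, ℂ) →L[ℂ] 𝓢(Plane, ℂ) := SchwartzMap.compSubConstCLM ℂ z

theorem nrm_tr (z : Plane) (f : 𝓢(Plane, ℂ)) : nrm (tr z f) = nrm f := by
  rw [nrm_eq, nrm_eq]
  simp only [SchwartzMap.compSubConstCLM_apply]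
  rw [integral_sub_right_eq_self (fun x => ‖f x‖ ^ 2)]

theorem fourier_tr (z : Plane) (f : 𝓢(Plane, ℂ)) (ξ : Plane) :
    𝓕 (tr z f) ξ = Real.fourierChar (-(inner ℝ z ξ)) • 𝓕 f ξ := by
  have h := congrFun (VectorFourier.fourierIntegral_comp_add_right Real.fourierChar
    (volume : Measure Plane) (innerₗ Plane) f (-z)) ξ
  have h' : (f : Plane → ℂ) ∘ (fun v => v + -z) = tr z f := by
    ext x
    simp [sub_eq_add_neg]
  rw [h', map_neg, LinearMap.neg_apply, innerₗ_apply_apply] at h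
  exact h

theorem bes_tr (s : ℝ) (z : Plane) (f : 𝓢(Plane, ℂ)) : bes s (tr z f) = tr z (bes s f) := by
  apply (FourierTransform.fourierCLE ℂ 𝓢(Plane, ℂ)).injective
  change 𝓕 (bes s (tr z f)) = 𝓕 (tr z (bes s f))
  ext ξ
  rw [fourier_bes, wt_apply, fourier_tr, fourier_tr, fourier_bes, wt_apply, Circle.smul_def,
    Circle.smul_def]
  simp only [smul_eq_mul]
  ring

/-! ### Commutators with Bessel potentials from commutators with translations -/

/-- The product of `𝓕 f` and `𝓕⁻ g`. -/
def fprod (f g : 𝓢(Plane, ℂ)) : 𝓢(Plane, ℂ) := smulS (𝓕⁻ g : 𝓢(Plane, ℂ)) (𝓕 f)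

theorem fprod_apply (f g : 𝓢(Plane, ℂ)) (x : Plane) : fprod f g x = 𝓕⁻ g x * 𝓕 f x :=
  smulS_apply (SchwartzMap.hasTemperateGrowth _) _ _

/-- Translation by z is the phase e^{-2πi z·ξ} on the frequency side. So vanishing of a Fourier
transform at the origin can be read as smallness of pairings with translates. -/
theorem fourier_mul_fourierInv (f g : 𝓢(Plane, ℂ)) (z : Plane) :
    𝓕 (fprod f g) z = pr (tr z f) g := by
  have h : pr (tr z f) g = pr (𝓕 (tr z f)) (𝓕⁻ g) := by
    rw [pr_fourier, FourierTransform.fourier_fourierInv_eq]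
  rw [h, SchwartzMap.fourier_coe, Real.fourier_eq, pr]
  congr 1
  ext ξ
  rw [fourier_tr, fprod_apply, Circle.smul_def, Circle.smul_def,
    real_inner_comm]
  simp only [smul_eq_mul]
  ring

theorem pr_bes_eq_integral (σ : ℝ) (f g : 𝓢(Plane, ℂ)) :
    pr (bes σ f) g = ∫ ξ, jap σ ξ * fprod f g ξ := by
  rw [pr_bes_left, pr]
  congr 1
  ext ξ
  rw [wt_apply, fprod_apply]
  ring

/-- A bound for commutators of `bes σ`, `0 < σ < 1`, in terms of commutators of translations. -/
theorem norm_pr_bes_sub_le {σ : ℝ} (h0 : 0 < σ) (h1 : σ < 1) (M : ℕ) :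
    ∃ C : ℝ, 0 ≤ C ∧ ∀ (f₁ g₁ f₂ g₂ : 𝓢(Plane, ℂ)) (B : ℝ), 0 ≤ B →
      (∀ z, ‖pr (tr z f₁) g₁ - pr (tr z f₂) g₂‖ ≤ B * (‖z‖ * (1 + ‖z‖) ^ M)) →
      ‖pr (bes σ f₁) g₁ - pr (bes σ f₂) g₂‖ ≤ C * B := by
  obtain ⟨C, hC, h⟩ := norm_integral_rpow_mul_le h0 h1 M
  refine ⟨C, hC, fun f₁ g₁ f₂ g₂ B hB hb => ?_⟩
  have := h (fprod f₁ g₁ - fprod f₂ g₂) B hB fun z => by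
    rw [show 𝓕 (fprod f₁ g₁ - fprod f₂ g₂) = 𝓕 (fprod f₁ g₁) - 𝓕 (fprod f₂ g₂) from
      map_sub (FourierTransform.fourierCLM ℂ 𝓢(Plane, ℂ)) _ _, sub_apply, fourier_mul_fourierInv, fourier_mul_fourierInv]
    exact hb z
  refine le_trans (le_of_eq ?_) this
  rw [pr_bes_eq_integral, pr_bes_eq_integral, ← integral_sub]
  · congr 2
    ext ξ
    rw [sub_apply, mul_sub]
    rfl
  · refine (wt σ (fprod f₁ g₁)).integrable.congr (Filter.Eventually.of_forall fun x => ?_)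
    rw [wt_apply]
  · refine (wt σ (fprod f₂ g₂)).integrable.congr (Filter.Eventually.of_forall fun x => ?_)
    rw [wt_apply]

/-! ### Multipliers on Sobolev spaces -/

theorem norm_iteratedFDeriv_translate_sub_le {m : Plane → ℂ} (hm : ContDiff ℝ ∞ m) {A : ℝ} {i : ℕ}
    (h : ∀ x, ‖iteratedFDeriv ℝ (i + 1) m x‖ ≤ A) (z x : Plane) :
    ‖iteratedFDeriv ℝ i (fun x => m (x - z) - m x) x‖ ≤ A * ‖z‖ := by
  have hi : ∀ y, ContDiffAt ℝ i m y := fun y => (hm.of_le (by exact_mod_cast le_top)).contDiffAt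
  have e : iteratedFDeriv ℝ i (fun x => m (x - z) - m x) x =
      iteratedFDeriv ℝ i m (x - z) - iteratedFDeriv ℝ i m x := by
    rw [← iteratedFDeriv_comp_sub i z x]
    refine iteratedFDeriv_sub_apply ?_ (hi x)
    exact ((hm.comp (contDiff_id.sub contDiff_const)).of_le (by exact_mod_cast le_top)).contDiffAt
  rw [e]
  have := Convex.norm_image_sub_le_of_norm_fderiv_le (𝕜 := ℝ) (f := iteratedFDeriv ℝ i m)
    (C := A) (s := Set.univ) (x := x) (y := x - z)
    (fun y _ => (hm.differentiable_iteratedFDeriv (by exact_mod_cast ENat.natCast_lt_top i)) y)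
    (fun y _ => by rw [norm_fderiv_iteratedFDeriv]; exact h y) convex_univ trivial trivial
  simpa using this

theorem hasTemperateGrowth_translate {m : Plane → ℂ} (hm : m.HasTemperateGrowth) (z : Plane) :
    (fun x => m (x - z)).HasTemperateGrowth :=
  hm.comp (Function.HasTemperateGrowth.id'.sub (Function.HasTemperateGrowth.const z))

/-- Induction on n with s = nσ. Conjugating m by the potential of order s + σ gives the conjugate by
order s plus a term containing the commutator [bes σ, m]. By the translation criterion this
commutator is controlled by multiplication by m(· - z) - m, whose first n derivatives are at most
A|z| when the first n + 1 derivatives of m are at most A. The induction hypothesis applies to that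
difference. -/
theorem exists_nrm_bes_smulS_bes_le_nat {σ : ℝ} (h0 : 0 < σ) (h1 : σ < 1) (n : ℕ) :
    ∃ C : ℝ, 0 ≤ C ∧ ∀ m : Plane → ℂ, m.HasTemperateGrowth → ∀ A : ℝ, 0 ≤ A →
      (∀ i ≤ n, ∀ x, ‖iteratedFDeriv ℝ i m x‖ ≤ A) →
      ∀ f, nrm (bes (n * σ) (smulS m (bes (-(n * σ)) f))) ≤ C * A * nrm f := by
  induction n with
  | zero =>
    refine ⟨1, zero_le_one, fun m hm A hA h f => ?_⟩
    simp only [Nat.cast_zero, zero_mul, neg_zero, bes_zero, one_mul]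
    exact nrm_smulS_le hm (fun x => by simpa using h 0 le_rfl x) f
  | succ n ih =>
    obtain ⟨C₀, hC₀, H⟩ := ih
    obtain ⟨C₁, hC₁, H₁⟩ := norm_pr_bes_sub_le h0 h1 0
    refine ⟨C₀ + C₁ * C₀, by positivity, fun m hm A hA h f => ?_⟩
    refine nrm_le_of_norm_pr_le (by have := nrm_nonneg f; positivity) fun g => ?_
    set s : ℝ := n * σ with hs
    have hs' : ((n + 1 : ℕ) : ℝ) * σ = s + σ := by rw [hs]; push_cast; ring
    rw [hs']
    set f₂ := bes (-σ) f with hf₂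
    have hf₂n : nrm f₂ ≤ nrm f := nrm_bes_le (by linarith) f
    have e1 : bes (-(s + σ)) f = bes (-s) f₂ := by rw [hf₂, bes_bes]; congr 2; ring
    have e2 : pr (bes (s + σ) (smulS m (bes (-(s + σ)) f))) g =
        pr (bes σ (smulS m (bes (-s) f₂))) (bes s g) := by
      rw [e1, ← bes_bes, pr_bes]
    have e3 : pr (bes σ (bes (-s) f₂)) (smulS m (bes s g)) =
        pr (bes s (smulS m (bes (-s) f))) g := by
      rw [hf₂, bes_bes, bes_bes, ← pr_smulS hm, ← pr_bes]
      rw [show σ + -s + -σ = -s by ring]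
    have hdiff := H₁ (smulS m (bes (-s) f₂)) (bes s g) (bes (-s) f₂) (smulS m (bes s g))
      (C₀ * A * nrm f * nrm g)
      (by have := nrm_nonneg f; have := nrm_nonneg g; positivity) fun z => by
        have hmz : (fun x => m (x - z) - m x).HasTemperateGrowth := (hasTemperateGrowth_translate hm z).sub hm
        have e4 : pr (tr z (smulS m (bes (-s) f₂))) (bes s g) -
            pr (tr z (bes (-s) f₂)) (smulS m (bes s g)) =
            pr (bes s (smulS (fun x => m (x - z) - m x) (bes (-s) (tr z f₂)))) g := by
          rw [← pr_smulS hm, ← pr_sub_left, pr_bes]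
          congr 1
          ext x
          rw [sub_apply, smulS_apply hm, smulS_apply hmz, bes_tr]
          simp only [SchwartzMap.compSubConstCLM_apply]
          rw [smulS_apply hm]
          ring
        rw [e4]
        refine (norm_pr_le _ _).trans ?_
        have := H _ hmz (A * ‖z‖) (by positivity)
          (fun i hi x => norm_iteratedFDeriv_translate_sub_le hm.1
            (fun y => h (i + 1) (by omega) y) z x) (tr z f₂)
        rw [nrm_tr] at this
        calc _ ≤ C₀ * (A * ‖z‖) * nrm f₂ * nrm g :=
              mul_le_mul_of_nonneg_right this (nrm_nonneg g)
          _ ≤ C₀ * (A * ‖z‖) * nrm f * nrm g := by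
              gcongr
              exact nrm_nonneg g
          _ = _ := by ring
    have hmain := H m hm A hA (fun i hi x => h i (by omega) x) f
    rw [e2]
    calc ‖pr (bes σ (smulS m (bes (-s) f₂))) (bes s g)‖
        = ‖pr (bes s (smulS m (bes (-s) f))) g + (pr (bes σ (smulS m (bes (-s) f₂))) (bes s g) -
          pr (bes σ (bes (-s) f₂)) (smulS m (bes s g)))‖ := by rw [e3]; congr 1; ring
      _ ≤ C₀ * A * nrm f * nrm g + C₁ * (C₀ * A * nrm f * nrm g) := by
          refine (norm_add_le _ _).trans (add_le_add ?_ hdiff)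
          exact (norm_pr_le _ _).trans (mul_le_mul_of_nonneg_right hmain (nrm_nonneg g))
      _ = _ := by ring

/-- Every nonnegative real is `n σ` for some `n` and `0 < σ < 1`. -/
theorem exists_nat_mul_eq {s : ℝ} (hs : 0 ≤ s) :
    ∃ (n : ℕ) (σ : ℝ), 0 < σ ∧ σ < 1 ∧ (n : ℝ) * σ = s := by
  rcases hs.eq_or_lt with rfl | hs
  · exact ⟨0, 1 / 2, by norm_num, by norm_num, by simp⟩
  · have h := Nat.lt_floor_add_one s
    have hn : (0 : ℝ) < (⌊s⌋₊ + 1 : ℕ) := by positivity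
    refine ⟨⌊s⌋₊ + 1, s / (⌊s⌋₊ + 1 : ℕ), by positivity, ?_, by field_simp⟩
    rw [div_lt_one hn]
    exact_mod_cast h

/-- Smooth functions with bounded derivatives are multipliers of the Sobolev spaces, with a
norm controlled by finitely many derivatives. -/
theorem exists_nrm_bes_smulS_bes_le (s : ℝ) :
    ∃ (n : ℕ) (C : ℝ), 0 ≤ C ∧ ∀ m : Plane → ℂ, m.HasTemperateGrowth → ∀ A : ℝ, 0 ≤ A →
      (∀ i ≤ n, ∀ x, ‖iteratedFDeriv ℝ i m x‖ ≤ A) →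
      ∀ f, nrm (bes s (smulS m (bes (-s) f))) ≤ C * A * nrm f := by
  obtain ⟨n, σ, h0, h1, hn⟩ := exists_nat_mul_eq (abs_nonneg s)
  obtain ⟨C, hC, H⟩ := exists_nrm_bes_smulS_bes_le_nat h0 h1 n
  rw [hn] at H
  refine ⟨n, C, hC, fun m hm A hA h f => ?_⟩
  rcases abs_cases s with ⟨hs, -⟩ | ⟨hs, -⟩
  · rw [hs] at H
    exact H m hm A hA h f
  · rw [hs] at H
    refine nrm_le_of_norm_pr_le (by have := nrm_nonneg f; positivity) fun g => ?_
    -- For negative s the operator is the transpose of the one for -s, so the bound passes over by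
    -- duality.
    have e : pr (bes s (smulS m (bes (-s) f))) g =
        pr f (bes (-s) (smulS m (bes (- -s) g))) := by
      rw [pr_bes, pr_smulS hm, pr_bes, neg_neg]
    rw [e]
    refine (norm_pr_le _ _).trans ?_
    have := H m hm A hA h g
    calc _ ≤ nrm f * (C * A * nrm g) := mul_le_mul_of_nonneg_left this (nrm_nonneg f)
      _ = _ := by ring

/-! ### Symbol estimates for the weights -/

/-- `m` is smooth and all its derivatives are bounded by multiples of `(1 + |x|²)^{r/2}`. -/
def IsSymb (r : ℝ) (m : Plane → ℂ) : Prop :=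
  ContDiff ℝ ∞ m ∧ ∀ i : ℕ, ∃ C : ℝ, 0 ≤ C ∧
    ∀ x, ‖iteratedFDeriv ℝ i m x‖ ≤ C * (1 + ‖x‖ ^ 2) ^ (r / 2)

theorem IsSymb.mono {r r' : ℝ} {m : Plane → ℂ} (h : IsSymb r m) (hr : r ≤ r') : IsSymb r' m := by
  refine ⟨h.1, fun i => ?_⟩
  obtain ⟨C, hC, H⟩ := h.2 i
  refine ⟨C, hC, fun x => (H x).trans ?_⟩
  gcongr
  nlinarith [sq_nonneg ‖x‖]

theorem IsSymb.mul {r r' : ℝ} {m m' : Plane → ℂ} (h : IsSymb r m) (h' : IsSymb r' m') :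
    IsSymb (r + r') (fun x => m x * m' x) := by
  refine ⟨h.1.mul h'.1, fun i => ?_⟩
  choose C hC H using h.2
  choose C' hC' H' using h'.2
  refine ⟨∑ k ∈ Finset.range (i + 1), (i.choose k) * C k * C' (i - k),
    Finset.sum_nonneg fun k _ => mul_nonneg (mul_nonneg (by positivity) (hC k)) (hC' _),
    fun x => ?_⟩
  refine (norm_iteratedFDeriv_mul_le h.1 h'.1 x (by exact_mod_cast le_top)).trans ?_
  rw [Finset.sum_mul]
  refine Finset.sum_le_sum fun k _ => ?_
  rw [add_div, Real.rpow_add (by positivity)]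
  calc (i.choose k : ℝ) * ‖iteratedFDeriv ℝ k m x‖ * ‖iteratedFDeriv ℝ (i - k) m' x‖
      ≤ (i.choose k : ℝ) * (C k * (1 + ‖x‖ ^ 2) ^ (r / 2)) *
        (C' (i - k) * (1 + ‖x‖ ^ 2) ^ (r' / 2)) := by
        gcongr
        · have := hC k; positivity
        · exact H k x
        · exact H' _ x
    _ = _ := by ring

theorem norm_iteratedFDeriv_clm_le {F G : Type*} [NormedAddCommGroup F] [NormedSpace ℝ F]
    [NormedAddCommGroup G] [NormedSpace ℝ G] (L : F →L[ℝ] G) (i : ℕ) (x : F) :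
    ‖iteratedFDeriv ℝ i (fun y => L y) x‖ ≤ ‖L‖ * (1 + ‖x‖) := by
  match i with
  | 0 =>
    rw [norm_iteratedFDeriv_zero]
    exact (L.le_opNorm x).trans (by gcongr; linarith)
  | 1 =>
    have : fderiv ℝ (fun y => L y) = fun _ => L := by
      ext1 y
      exact L.fderiv
    rw [← norm_iteratedFDeriv_fderiv, this, norm_iteratedFDeriv_zero]
    exact le_mul_of_one_le_right (norm_nonneg L) (by linarith [norm_nonneg x])
  | k + 2 =>
    have : fderiv ℝ (fun y => L y) = fun _ => L := by
      ext1 y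
      exact L.fderiv
    rw [← norm_iteratedFDeriv_fderiv, this, iteratedFDeriv_succ_const]
    simp only [Pi.zero_apply, norm_zero]
    positivity

theorem one_add_norm_le_rpow (x : Plane) : 1 + ‖x‖ ≤ 2 * (1 + ‖x‖ ^ 2) ^ ((1 : ℝ) / 2) := by
  rw [← Real.sqrt_eq_rpow]
  have : ‖x‖ ≤ √(1 + ‖x‖ ^ 2) := Real.le_sqrt_of_sq_le (by linarith)
  have : 1 ≤ √(1 + ‖x‖ ^ 2) := Real.one_le_sqrt.2 (by nlinarith [sq_nonneg ‖x‖])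
  linarith

theorem isSymb_clm (L : Plane →L[ℝ] ℂ) : IsSymb 1 (fun x => L x) := by
  refine ⟨L.contDiff, fun i => ⟨‖L‖ * 2, by positivity, fun x => ?_⟩⟩
  refine (norm_iteratedFDeriv_clm_le L i x).trans ?_
  rw [mul_assoc]
  gcongr
  exact one_add_norm_le_rpow x

theorem hasFDerivAt_rpow_weight (r : ℝ) (x : Plane) :
    HasFDerivAt (fun x : Plane => (1 + ‖x‖ ^ 2) ^ (r / 2))
      ((1 + ‖x‖ ^ 2) ^ ((r - 2) / 2) • (r • innerSL ℝ x)) x := by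
  have h1 : HasFDerivAt (fun x : Plane => 1 + ‖x‖ ^ 2) (2 • innerSL ℝ x) x :=
    (hasStrictFDerivAt_norm_sq x).hasFDerivAt.const_add 1
  have h2 := h1.rpow_const (p := r / 2) (Or.inl (by positivity))
  refine h2.congr_fderiv ?_
  ext y
  simp only [smul_apply, nsmul_eq_mul, smul_eq_mul]
  rw [show (r - 2) / 2 = r / 2 - 1 by ring]
  simp
  ring

theorem contDiff_rpow_weight (r : ℝ) :
    ContDiff ℝ ∞ (fun x : Plane => (1 + ‖x‖ ^ 2) ^ (r / 2)) :=
  (Function.hasTemperateGrowth_one_add_norm_sq_rpow Plane (r / 2)).1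

/-- The gradient is a multiple of (1+|x|²)^{(r-2)/2} x, so Leibniz' rule reduces to the exponent r -
2; hence the induction is over all r simultaneously. The linear factor costs one order, and the
result of order r - 1 is then weakened to r. -/
theorem exists_norm_iteratedFDeriv_rpow_weight_le (i : ℕ) (r : ℝ) : ∃ C : ℝ, 0 ≤ C ∧ ∀ x : Plane,
    ‖iteratedFDeriv ℝ i (fun x : Plane => (1 + ‖x‖ ^ 2) ^ (r / 2)) x‖ ≤
      C * (1 + ‖x‖ ^ 2) ^ (r / 2) := by
  induction i using Nat.strong_induction_on generalizing r with
  | h i ih =>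
    match i with
    | 0 =>
      refine ⟨1, zero_le_one, fun x => ?_⟩
      rw [norm_iteratedFDeriv_zero, Real.norm_of_nonneg (by positivity), one_mul]
    | i + 1 =>
      have hf : fderiv ℝ (fun x : Plane => (1 + ‖x‖ ^ 2) ^ (r / 2)) =
          fun x => (1 + ‖x‖ ^ 2) ^ ((r - 2) / 2) • (r • innerSL ℝ) x := by
        ext1 x
        exact (hasFDerivAt_rpow_weight r x).fderiv
      have hex : ∀ k, ∃ C : ℝ, 0 ≤ C ∧ (k ≤ i → ∀ x : Plane,
          ‖iteratedFDeriv ℝ k (fun x : Plane => (1 + ‖x‖ ^ 2) ^ ((r - 2) / 2)) x‖ ≤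
            C * (1 + ‖x‖ ^ 2) ^ ((r - 2) / 2)) := by
        intro k
        by_cases hk : k ≤ i
        · obtain ⟨C, hC, H⟩ := ih k (by omega) (r - 2)
          exact ⟨C, hC, fun _ => H⟩
        · exact ⟨0, le_rfl, fun h => absurd h hk⟩
      choose C hC H using hex
      set N := ‖(r • innerSL ℝ : Plane →L[ℝ] Plane →L[ℝ] ℝ)‖
      refine ⟨∑ k ∈ Finset.range (i + 1), (i.choose k) * C k * (N * 2),
        Finset.sum_nonneg fun k _ => mul_nonneg (mul_nonneg (by positivity) (hC k))
          (by positivity), fun x => ?_⟩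
      rw [← norm_iteratedFDeriv_fderiv, hf]
      refine (norm_iteratedFDeriv_smul_le (contDiff_rpow_weight (r - 2))
        (r • innerSL ℝ : Plane →L[ℝ] Plane →L[ℝ] ℝ).contDiff x
        (by exact_mod_cast le_top)).trans ?_
      rw [Finset.sum_mul]
      refine Finset.sum_le_sum fun k hk => ?_
      have hk' : k ≤ i := by simpa [Nat.lt_succ_iff] using hk
      calc (i.choose k : ℝ) *
            ‖iteratedFDeriv ℝ k (fun x : Plane => (1 + ‖x‖ ^ 2) ^ ((r - 2) / 2)) x‖ *
            ‖iteratedFDeriv ℝ (i - k) (fun y => (r • innerSL ℝ : Plane →L[ℝ] Plane →L[ℝ] ℝ) y) x‖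
          ≤ (i.choose k : ℝ) * (C k * (1 + ‖x‖ ^ 2) ^ ((r - 2) / 2)) *
            (N * (2 * (1 + ‖x‖ ^ 2) ^ ((1 : ℝ) / 2))) := by
            gcongr
            · have := hC k; positivity
            · exact H k hk' x
            · refine (norm_iteratedFDeriv_clm_le _ _ x).trans ?_
              gcongr
              exact one_add_norm_le_rpow x
        _ = (i.choose k : ℝ) * C k * (N * 2) * (1 + ‖x‖ ^ 2) ^ ((r - 1) / 2) := by
            rw [show (r - 1) / 2 = (r - 2) / 2 + 1 / 2 by ring, Real.rpow_add (by positivity)]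
            ring
        _ ≤ _ := by
            gcongr
            · have := hC k; positivity
            · nlinarith [sq_nonneg ‖x‖]
            · linarith

theorem isSymb_jap (r : ℝ) : IsSymb r (jap r) := by
  refine ⟨(jap_hasTemperateGrowth r).1, fun i => ?_⟩
  obtain ⟨C, hC, H⟩ := exists_norm_iteratedFDeriv_rpow_weight_le i r
  refine ⟨C, hC, fun x => ?_⟩
  have := LinearIsometry.norm_iteratedFDeriv_comp_left (n := i) (i := i) Complex.ofRealLI
    ((contDiff_rpow_weight r).of_le (by exact_mod_cast le_top)).contDiffAt (x := x) le_rfl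
  exact (le_of_eq this).trans (H x)

theorem IsSymb.hasTemperateGrowth {r : ℝ} {m : Plane → ℂ} (h : IsSymb r m) :
    m.HasTemperateGrowth := by
  refine ⟨h.1, fun i => ?_⟩
  obtain ⟨C, hC, H⟩ := h.2 i
  refine ⟨2 * ⌈|r|⌉₊, C, fun x => (H x).trans ?_⟩
  gcongr
  calc (1 + ‖x‖ ^ 2) ^ (r / 2) ≤ (1 + ‖x‖ ^ 2) ^ ((⌈|r|⌉₊ : ℕ) : ℝ) := by
        gcongr
        · nlinarith [sq_nonneg ‖x‖]
        · have := Nat.le_ceil |r|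
          have := le_abs_self r
          have := abs_nonneg r
          linarith
    _ ≤ ((1 + ‖x‖) ^ 2) ^ ((⌈|r|⌉₊ : ℕ) : ℝ) := by
        gcongr
        nlinarith [norm_nonneg x]
    _ = _ := by
        rw [Real.rpow_natCast, ← pow_mul]

/-- Symbols of order zero are multipliers of all Sobolev spaces. -/
theorem IsSymb.exists_nrm_le {m : Plane → ℂ} (hm : IsSymb 0 m) (s : ℝ) :
    ∃ C : ℝ, 0 ≤ C ∧ ∀ f, nrm (bes s (smulS m (bes (-s) f))) ≤ C * nrm f := by
  obtain ⟨n, C, hC, H⟩ := exists_nrm_bes_smulS_bes_le s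
  choose D hD HD using hm.2
  have hA : 0 ≤ ∑ i ∈ Finset.range (n + 1), D i := Finset.sum_nonneg fun i _ => hD i
  refine ⟨C * ∑ i ∈ Finset.range (n + 1), D i, by positivity, fun f => ?_⟩
  refine H m hm.hasTemperateGrowth _ hA (fun i hi x => ?_) f
  have := HD i x
  simp only [zero_div, Real.rpow_zero, mul_one] at this
  exact this.trans (Finset.single_le_sum (fun j _ => hD j) (by simp; omega))

/-- Peetre's inequality. -/
theorem peetre (r : ℝ) (x y : Plane) : (1 + ‖x‖ ^ 2) ^ (r / 2) ≤
    (2 * (1 + ‖x - y‖) ^ 2) ^ ⌈|r|⌉₊ * (1 + ‖y‖ ^ 2) ^ (r / 2) := by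
  have key : ∀ a b : Plane, 1 + ‖a‖ ^ 2 ≤ 2 * (1 + ‖a - b‖) ^ 2 * (1 + ‖b‖ ^ 2) := by
    intro a b
    have h1 : ‖a‖ ≤ ‖a - b‖ + ‖b‖ := by simpa using norm_add_le (a - b) b
    have h2 : ‖a‖ ^ 2 ≤ (‖a - b‖ + ‖b‖) ^ 2 := by gcongr
    nlinarith [norm_nonneg a, norm_nonneg b, norm_nonneg (a - b),
      sq_nonneg (‖a - b‖ - ‖b‖), mul_nonneg (norm_nonneg (a - b)) (sq_nonneg ‖b‖),
      mul_nonneg (sq_nonneg ‖a - b‖) (sq_nonneg ‖b‖)]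
  have hbase : ∀ w : Plane, 1 ≤ 2 * (1 + ‖w‖) ^ 2 := fun w => by nlinarith [norm_nonneg w]
  have hpow : ∀ w : Plane, (2 * (1 + ‖w‖) ^ 2) ^ (|r| / 2) ≤ (2 * (1 + ‖w‖) ^ 2) ^ ⌈|r|⌉₊ := by
    intro w
    rw [← Real.rpow_natCast _ ⌈|r|⌉₊]
    have := Nat.le_ceil |r|
    have := abs_nonneg r
    exact Real.rpow_le_rpow_of_exponent_le (hbase w) (by linarith)
  refine le_trans ?_ (mul_le_mul_of_nonneg_right (hpow (x - y)) (by positivity))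
  -- For r ≥ 0 the basic inequality is raised to the power r/2; for r < 0 the same is done with x
  -- and y exchanged.
  rcases abs_cases r with ⟨h, h0⟩ | ⟨h, h0⟩
  · rw [h, ← Real.mul_rpow (by positivity) (by positivity)]
    gcongr
    exact key x y
  · rw [h, show r / 2 = -(-r / 2) by ring, Real.rpow_neg (by positivity),
      Real.rpow_neg (by positivity), ← div_eq_mul_inv, inv_le_iff_one_le_mul₀ (by positivity),
      div_mul_eq_mul_div, one_le_div₀ (by positivity),
      ← Real.mul_rpow (by positivity) (by positivity)]
    exact Real.rpow_le_rpow (by positivity) (by rw [norm_sub_rev]; exact key y x) (by linarith)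

/-- The ratio of two translates of a weight, minus one. -/
def ratioSub (r : ℝ) (z x : Plane) : ℂ := jap r x * jap (-r) (x - z) - 1

theorem ratioSub_eq (r : ℝ) (z : Plane) :
    ratioSub r z = fun x => (jap r x - jap r (x - z)) * jap (-r) (x - z) := by
  ext x
  have := congrFun (jap_mul_jap r (-r)) (x - z)
  simp only [Pi.mul_apply, add_neg_cancel, jap_zero] at this
  rw [ratioSub, sub_mul, this]

theorem hasTemperateGrowth_ratioSub (r : ℝ) (z : Plane) : (ratioSub r z).HasTemperateGrowth :=
  ((jap_hasTemperateGrowth r).mul (hasTemperateGrowth_translate (jap_hasTemperateGrowth (-r)) z)).sub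
    (Function.HasTemperateGrowth.const 1)

/-- The mean value inequality on the segment from x - z to x; Peetre's inequality compares the
weight at each point of the segment with its value at x - z. -/
theorem norm_iteratedFDeriv_jap_sub_le (r : ℝ) (i : ℕ) : ∃ C : ℝ, 0 ≤ C ∧ ∀ z x : Plane,
    ‖iteratedFDeriv ℝ i (fun x => jap r x - jap r (x - z)) x‖ ≤
      C * (‖z‖ * (2 * (1 + ‖z‖) ^ 2) ^ ⌈|r|⌉₊) * (1 + ‖x - z‖ ^ 2) ^ (r / 2) := by
  obtain ⟨C, hC, H⟩ := (isSymb_jap r).2 (i + 1)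
  refine ⟨C, hC, fun z x => ?_⟩
  have hm := (isSymb_jap r).1
  have hi : ∀ y, ContDiffAt ℝ i (jap r) y := fun y =>
    (hm.of_le (by exact_mod_cast le_top)).contDiffAt
  have e : iteratedFDeriv ℝ i (fun x => jap r x - jap r (x - z)) x =
      iteratedFDeriv ℝ i (jap r) x - iteratedFDeriv ℝ i (jap r) (x - z) := by
    rw [← iteratedFDeriv_comp_sub i z x]
    refine iteratedFDeriv_sub_apply (hi x) ?_
    exact ((hm.comp (contDiff_id.sub contDiff_const)).of_le (by exact_mod_cast le_top)).contDiffAt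
  rw [e]
  have := Convex.norm_image_sub_le_of_norm_fderiv_le (𝕜 := ℝ) (f := iteratedFDeriv ℝ i (jap r))
    (C := C * ((2 * (1 + ‖z‖) ^ 2) ^ ⌈|r|⌉₊ * (1 + ‖x - z‖ ^ 2) ^ (r / 2)))
    (s := segment ℝ (x - z) x) (x := x - z) (y := x)
    (fun y _ => (hm.differentiable_iteratedFDeriv (by exact_mod_cast ENat.natCast_lt_top i)) y)
    (fun y hy => by
      rw [norm_fderiv_iteratedFDeriv]
      refine (H y).trans ?_
      gcongr
      refine (peetre r y (x - z)).trans ?_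
      gcongr
      have h1 := norm_sub_le_of_mem_segment hy
      simpa using h1)
    (convex_segment _ _) (left_mem_segment _ _ _) (right_mem_segment _ _ _)
  refine this.trans (le_of_eq ?_)
  rw [sub_sub_cancel]
  ring

/-- In the product form of `ratioSub_eq` the powers of the weight at x - z cancel. What remains
vanishes to first order in z and grows polynomially, uniformly in x, as the commutator criterion
demands. -/
theorem norm_iteratedFDeriv_ratioSub_le (r : ℝ) (n : ℕ) : ∃ C : ℝ, 0 ≤ C ∧ ∀ i ≤ n, ∀ z x : Plane,
    ‖iteratedFDeriv ℝ i (ratioSub r z) x‖ ≤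
      C * (‖z‖ * (1 + ‖z‖) ^ (2 * ⌈|r|⌉₊)) := by
  suffices h : ∀ i, ∃ C : ℝ, 0 ≤ C ∧ ∀ z x : Plane,
      ‖iteratedFDeriv ℝ i (ratioSub r z) x‖ ≤ C * (‖z‖ * (1 + ‖z‖) ^ (2 * ⌈|r|⌉₊)) by
    choose C hC H using h
    refine ⟨∑ i ∈ Finset.range (n + 1), C i, Finset.sum_nonneg fun i _ => hC i,
      fun i hi z x => (H i z x).trans ?_⟩
    gcongr
    exact Finset.single_le_sum (fun j _ => hC j) (by simp; omega)
  intro i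
  choose C hC H using norm_iteratedFDeriv_jap_sub_le r
  choose D hD HD using (isSymb_jap (-r)).2
  refine ⟨(∑ k ∈ Finset.range (i + 1), (i.choose k) * C k * D (i - k)) * 2 ^ ⌈|r|⌉₊,
    mul_nonneg (Finset.sum_nonneg fun k _ => mul_nonneg (mul_nonneg (by positivity) (hC k)) (hD _))
      (by positivity), fun z x => ?_⟩
  have hs : ∀ q, ContDiff ℝ ∞ (fun x => jap q (x - z)) := fun q =>
    (isSymb_jap q).1.comp (contDiff_id.sub contDiff_const)
  rw [ratioSub_eq]
  refine (norm_iteratedFDeriv_mul_le ((isSymb_jap r).1.sub (hs r)) (hs (-r)) x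
    (by exact_mod_cast le_top)).trans ?_
  rw [mul_assoc, Finset.sum_mul]
  refine Finset.sum_le_sum fun k _ => ?_
  rw [iteratedFDeriv_comp_sub]
  have hone : (1 + ‖x - z‖ ^ 2) ^ (r / 2) * (1 + ‖x - z‖ ^ 2) ^ (-r / 2) = 1 := by
    rw [← Real.rpow_add (by positivity)]
    ring_nf
    simp
  calc (i.choose k : ℝ) * ‖iteratedFDeriv ℝ k (fun x => jap r x - jap r (x - z)) x‖ *
        ‖iteratedFDeriv ℝ (i - k) (jap (-r)) (x - z)‖
      ≤ (i.choose k : ℝ) * (C k * (‖z‖ * (2 * (1 + ‖z‖) ^ 2) ^ ⌈|r|⌉₊) *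
          (1 + ‖x - z‖ ^ 2) ^ (r / 2)) * (D (i - k) * (1 + ‖x - z‖ ^ 2) ^ (-r / 2)) := by
        gcongr
        · have := hC k; positivity
        · exact H k z x
        · exact HD _ _
    _ = (i.choose k : ℝ) * C k * D (i - k) * (‖z‖ * (2 * (1 + ‖z‖) ^ 2) ^ ⌈|r|⌉₊) *
        ((1 + ‖x - z‖ ^ 2) ^ (r / 2) * (1 + ‖x - z‖ ^ 2) ^ (-r / 2)) := by ring
    _ = _ := by
        rw [hone, mul_pow, ← pow_mul]
        ring

/-! ### Weights and Bessel potentials can be interchanged -/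

/-- The Bessel potential conjugated by a weight. -/
def besConj (r σ : ℝ) (f : 𝓢(Plane, ℂ)) : 𝓢(Plane, ℂ) := wt r (bes σ (wt (-r) f))

theorem besConj_besConj (r s t : ℝ) (f : 𝓢(Plane, ℂ)) :
    besConj r s (besConj r t f) = besConj r (s + t) f := by
  rw [besConj, besConj, besConj, wt_wt, neg_add_cancel, wt_zero, bes_bes]

/-- The inverse Fourier transform exchanges weights and potentials. The claim becomes that the
symbol of order -σ ≤ 0 is a multiplier of the Sobolev space of order r. -/
theorem exists_nrm_besConj_neg_le (r : ℝ) {σ : ℝ} (hσ : 0 ≤ σ) : ∃ C : ℝ, 0 ≤ C ∧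
    ∀ f, nrm (besConj r (-σ) f) ≤ C * nrm f := by
  obtain ⟨C, hC, H⟩ := ((isSymb_jap (-σ)).mono (neg_nonpos.2 hσ)).exists_nrm_le r
  refine ⟨C, hC, fun f => ?_⟩
  rw [besConj, ← nrm_fourierInv, fourierInv_wt, fourierInv_bes, fourierInv_wt,
    ← nrm_fourierInv f]
  exact H _

/-- Conjugating a translation by the weight multiplies it by a ratio of translated weights, so the
difference from the plain translation is multiplication by `ratioSub r z`. The commutator criterion
turns this into a bound for potentials: the conjugated and plain potentials of order σ differ by an
operator of order zero. -/
theorem exists_nrm_bes_sub_besConj_le (r s : ℝ) {σ : ℝ} (h0 : 0 < σ) (h1 : σ < 1) :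
    ∃ C : ℝ, 0 ≤ C ∧ ∀ f, nrm (bes s (bes σ (bes (-s) f) - besConj r σ (bes (-s) f))) ≤
      C * nrm f := by
  obtain ⟨n, C₁, hC₁, H₁⟩ := exists_nrm_bes_smulS_bes_le s
  obtain ⟨C₂, hC₂, H₂⟩ := norm_iteratedFDeriv_ratioSub_le r n
  obtain ⟨C₃, hC₃, H₃⟩ := norm_pr_bes_sub_le h0 h1 (2 * ⌈|r|⌉₊)
  refine ⟨C₃ * (C₁ * C₂), by positivity, fun f => ?_⟩
  refine nrm_le_of_norm_pr_le (by have := nrm_nonneg f; positivity) fun g => ?_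
  have e : pr (bes s (bes σ (bes (-s) f) - besConj r σ (bes (-s) f))) g =
      pr (bes σ (bes (-s) f)) (bes s g) -
        pr (bes σ (wt (-r) (bes (-s) f))) (wt r (bes s g)) := by
    rw [pr_bes, pr_sub_left, besConj, pr_wt]
  rw [e]
  have := H₃ (bes (-s) f) (bes s g) (wt (-r) (bes (-s) f)) (wt r (bes s g))
    (C₁ * C₂ * nrm f * nrm g) (by have := nrm_nonneg f; have := nrm_nonneg g; positivity)
    fun z => by
      have e4 : pr (tr z (wt (-r) (bes (-s) f))) (wt r (bes s g)) -
          pr (tr z (bes (-s) f)) (bes s g) =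
          pr (bes s (smulS (ratioSub r z) (bes (-s) (tr z f)))) g := by
        rw [← pr_wt, ← pr_sub_left, pr_bes]
        congr 1
        ext x
        rw [sub_apply, wt_apply, smulS_apply (hasTemperateGrowth_ratioSub r z), bes_tr]
        simp only [SchwartzMap.compSubConstCLM_apply]
        rw [wt_apply, ratioSub]
        ring
      rw [norm_sub_rev, e4]
      refine (norm_pr_le _ _).trans ?_
      have h := H₁ _ (hasTemperateGrowth_ratioSub r z)
        (C₂ * (‖z‖ * (1 + ‖z‖) ^ (2 * ⌈|r|⌉₊))) (by positivity)
        (fun i hi x => H₂ i hi z x) (tr z f)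
      rw [nrm_tr] at h
      calc _ ≤ C₁ * (C₂ * (‖z‖ * (1 + ‖z‖) ^ (2 * ⌈|r|⌉₊))) * nrm f * nrm g :=
            mul_le_mul_of_nonneg_right h (nrm_nonneg g)
        _ = _ := by ring
  refine this.trans (le_of_eq ?_)
  ring

/-- One step from s to s + σ splits off the conjugated potential of order σ, which lowers the
problem to s, plus the order-zero difference of the plain and conjugated potentials. -/
theorem exists_nrm_bes_besConj_le_nat (r : ℝ) {σ : ℝ} (h0 : 0 < σ) (h1 : σ < 1) (n : ℕ) :
    ∃ C : ℝ, 0 ≤ C ∧ ∀ f, nrm (bes (n * σ) (besConj r (-(n * σ)) f)) ≤ C * nrm f := by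
  induction n with
  | zero =>
    refine ⟨1, zero_le_one, fun f => ?_⟩
    simp [besConj, bes_zero, wt_wt, wt_zero]
  | succ n ih =>
    obtain ⟨C, hC, H⟩ := ih
    set s : ℝ := n * σ with hs
    have hs' : ((n + 1 : ℕ) : ℝ) * σ = s + σ := by rw [hs]; push_cast; ring
    obtain ⟨D, hD, HD⟩ := exists_nrm_bes_sub_besConj_le r s h0 h1
    obtain ⟨G, hG, HG⟩ := exists_nrm_besConj_neg_le r h0.le
    refine ⟨C + D * (C * G), by positivity, fun f => ?_⟩
    rw [hs']
    set k := besConj r (-(s + σ)) f with hk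
    have e1 : besConj r σ k = besConj r (-s) f := by
      rw [hk, besConj_besConj]; congr 1; ring
    -- This form bounds the argument of the difference term by the induction hypothesis, at the cost
    -- of the bounded operator `besConj r (-σ)`.
    have e2 : bes s k = bes s (besConj r (-s) (besConj r (-σ) f)) := by
      rw [hk, besConj_besConj]; congr 2; ring
    have e3 : bes (s + σ) k = bes s (besConj r (-s) f) +
        bes s (bes σ (bes (-s) (bes s k)) - besConj r σ (bes (-s) (bes s k))) := by
      rw [bes_bes (-s) s, neg_add_cancel, bes_zero, ← e1, ← map_add, ← bes_bes]
      congr 1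
      abel
    rw [e3]
    refine (nrm_add_le _ _).trans ?_
    have h3 := HD (bes s k)
    have h4 := H (besConj r (-σ) f)
    rw [← e2] at h4
    calc _ ≤ C * nrm f + D * (C * (G * nrm f)) := by
          refine add_le_add (H f) (h3.trans ?_)
          gcongr
          refine h4.trans ?_
          gcongr
          exact HG f
      _ = _ := by ring

/-- The same induction with plain and conjugated potentials exchanged; it supplies the case of
negative s through transposition. -/
theorem exists_nrm_besConj_bes_le_nat (r : ℝ) {σ : ℝ} (h0 : 0 < σ) (h1 : σ < 1) (n : ℕ) :
    ∃ C : ℝ, 0 ≤ C ∧ ∀ f, nrm (besConj r (n * σ) (bes (-(n * σ)) f)) ≤ C * nrm f := by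
  induction n with
  | zero =>
    refine ⟨1, zero_le_one, fun f => ?_⟩
    simp [besConj, bes_zero, wt_wt, wt_zero]
  | succ n ih =>
    obtain ⟨C, hC, H⟩ := ih
    set s : ℝ := n * σ with hs
    have hs' : ((n + 1 : ℕ) : ℝ) * σ = s + σ := by rw [hs]; push_cast; ring
    obtain ⟨D, hD, HD⟩ := exists_nrm_bes_sub_besConj_le r s h0 h1
    refine ⟨C + C * D, by positivity, fun f => ?_⟩
    rw [hs']
    set k := bes (-(s + σ)) f with hk
    have e1 : k = bes (-s) (bes (-σ) f) := by
      rw [hk, bes_bes]; congr 2; ring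
    have e2 : bes σ k = bes (-s) f := by
      rw [hk, bes_bes]; congr 2; ring
    set d := bes s (bes σ (bes (-s) (bes (-σ) f)) - besConj r σ (bes (-s) (bes (-σ) f))) with hd
    have e4 : bes (-s) d = bes (-s) f - besConj r σ k := by
      rw [hd, ← e1, e2, bes_bes, neg_add_cancel, bes_zero]
    have e3 : besConj r (s + σ) k = besConj r s (bes (-s) f) + besConj r s (bes (-s) (-d)) := by
      rw [map_neg, e4, ← besConj_besConj]
      simp only [besConj, map_sub, map_neg]
      abel
    rw [e3]
    refine (nrm_add_le _ _).trans ?_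
    have hneg : nrm (-d) = nrm d := by
      rw [nrm_eq, nrm_eq]
      simp
    calc _ ≤ C * nrm f + C * (D * nrm f) := by
          refine add_le_add (H f) ((H (-d)).trans ?_)
          rw [hneg]
          gcongr
          refine (HD (bes (-σ) f)).trans ?_
          gcongr
          exact nrm_bes_le (by linarith) f
      _ = _ := by ring

theorem pr_bes_besConj (r s t : ℝ) (f g : 𝓢(Plane, ℂ)) :
    pr (bes s (besConj r t f)) g = pr f (besConj (-r) t (bes s g)) := by
  rw [pr_bes, besConj, besConj, pr_wt, pr_bes, pr_wt, neg_neg]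

/-- Multiplication by weights and Bessel potentials can be interchanged. -/
theorem exists_nrm_bes_wt_le (s r : ℝ) :
    ∃ C : ℝ, 0 ≤ C ∧ ∀ f, nrm (bes s (wt r f)) ≤ C * nrm (wt r (bes s f)) := by
  obtain ⟨n, σ, h0, h1, hn⟩ := exists_nat_mul_eq (abs_nonneg s)
  suffices h : ∃ C : ℝ, 0 ≤ C ∧ ∀ f, nrm (bes s (besConj r (-s) f)) ≤ C * nrm f by
    obtain ⟨C, hC, H⟩ := h
    refine ⟨C, hC, fun f => ?_⟩
    have := H (wt r (bes s f))
    rwa [besConj, wt_wt, neg_add_cancel, wt_zero, bes_bes, neg_add_cancel, bes_zero] at this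
  rcases abs_cases s with ⟨hs, -⟩ | ⟨hs, -⟩
  · obtain ⟨C, hC, H⟩ := exists_nrm_bes_besConj_le_nat r h0 h1 n
    rw [hn, hs] at H
    exact ⟨C, hC, H⟩
  · obtain ⟨C, hC, H⟩ := exists_nrm_besConj_bes_le_nat (-r) h0 h1 n
    rw [hn, hs, neg_neg] at H
    refine ⟨C, hC, fun f => ?_⟩
    refine nrm_le_of_norm_pr_le (by have := nrm_nonneg f; positivity) fun g => ?_
    rw [pr_bes_besConj]
    refine (norm_pr_le _ _).trans ?_
    calc _ ≤ nrm f * (C * nrm g) := mul_le_mul_of_nonneg_left (H g) (nrm_nonneg f)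
      _ = _ := by ring

/-- Multiplication by weights and Bessel potentials can be interchanged. -/
theorem exists_nrm_wt_bes_le (s r : ℝ) :
    ∃ C : ℝ, 0 ≤ C ∧ ∀ f, nrm (wt r (bes s f)) ≤ C * nrm (bes s (wt r f)) := by
  -- The inverse Fourier transform interchanges the roles of s and r, so the converse inequality is
  -- the previous one with the parameters swapped.
  obtain ⟨C, hC, H⟩ := exists_nrm_bes_wt_le r s
  refine ⟨C, hC, fun f => ?_⟩
  have h := H (𝓕⁻ f)
  rwa [← fourierInv_bes, ← fourierInv_wt, nrm_fourierInv, ← fourierInv_wt, ← fourierInv_bes,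
    nrm_fourierInv] at h

/-! ### Square integrable distributions -/

/-- The squared `L²` norm of a tempered distribution, `∞` off `L²`. -/
def L2sq (T : 𝓢'(Plane, ℂ)) : ℝ≥0∞ :=
  ⨅ (g : Lp ℂ 2 (volume : Measure Plane)) (_ : T = (g : 𝓢'(Plane, ℂ))), ‖g‖ₑ ^ 2

theorem toTemperedDistribution_eq_inner (g : Lp ℂ 2 (volume : Measure Plane)) (φ : 𝓢(Plane, ℂ)) :
    (g : 𝓢'(Plane, ℂ)) φ = inner ℂ ((conjS φ).toLp 2 volume) g := by
  rw [Lp.toTemperedDistribution_apply, L2.inner_def]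
  refine integral_congr_ae ?_
  filter_upwards [(conjS φ).coeFn_toLp 2 volume] with x hx
  rw [hx]
  simp [mul_comm]

theorem norm_toTemperedDistribution_le (g : Lp ℂ 2 (volume : Measure Plane)) (φ : 𝓢(Plane, ℂ)) :
    ‖(g : 𝓢'(Plane, ℂ)) φ‖ ≤ ‖g‖ * nrm φ := by
  rw [toTemperedDistribution_eq_inner, mul_comm, ← nrm_conjS]
  exact norm_inner_le_norm _ _

theorem toTemperedDistribution_injective :
    Function.Injective (fun g : Lp ℂ 2 (volume : Measure Plane) => (g : 𝓢'(Plane, ℂ))) := by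
  have := Lp.ker_toTemperedDistributionCLM_eq_bot (F := ℂ) (μ := (volume : Measure Plane)) (p := 2)
  exact LinearMap.ker_eq_bot.1 this

theorem L2sq_coe (g : Lp ℂ 2 (volume : Measure Plane)) :
    L2sq (g : 𝓢'(Plane, ℂ)) = ‖g‖ₑ ^ 2 := by
  refine le_antisymm ((iInf_le _ g).trans (iInf_le _ rfl)) (le_iInf₂ fun g' h => ?_)
  rw [toTemperedDistribution_injective h]

theorem exists_eq_of_L2sq_lt_top {T : 𝓢'(Plane, ℂ)} (h : L2sq T < ⊤) :
    ∃ g : Lp ℂ 2 (volume : Measure Plane), T = g := by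
  by_contra! H
  simp [L2sq, H] at h

/-- Schwartz functions are dense in L², so the functional extends and Riesz' theorem represents it.
-/
theorem exists_eq_of_norm_apply_le {T : 𝓢'(Plane, ℂ)} {C : ℝ} (hC : 0 ≤ C)
    (h : ∀ φ, ‖T φ‖ ≤ C * nrm φ) :
    ∃ g : Lp ℂ 2 (volume : Measure Plane), T = g ∧ ‖g‖ ≤ C := by
  let e : 𝓢(Plane, ℂ) →ₗ[ℂ] Lp ℂ 2 (volume : Measure Plane) :=
    (SchwartzMap.toLpCLM ℂ ℂ 2 volume).toLinearMap
  let f : 𝓢(Plane, ℂ) →ₗ[ℂ] ℂ :=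
    { toFun := fun φ => T φ
      map_add' := fun a b => map_add T a b
      map_smul' := fun a b => map_smul T a b }
  have hd : DenseRange e := SchwartzMap.denseRange_toLpCLM (by simp)
  have hb : ∀ φ, ‖f φ‖ ≤ C * ‖e φ‖ := h
  let L : StrongDual ℂ (Lp ℂ 2 (volume : Measure Plane)) := f.extendOfNorm e
  have hL : ∀ φ, L (e φ) = T φ := fun φ => LinearMap.extendOfNorm_eq hd ⟨C, hb⟩ φ
  let y := (InnerProductSpace.toDual ℂ (Lp ℂ 2 (volume : Measure Plane))).symm L
  have hy : ‖y‖ ≤ C := by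
    rw [LinearIsometryEquiv.norm_map]
    exact LinearMap.opNorm_extendOfNorm_le hd hC hb
  -- Distributions pair bilinearly while the Riesz representation is sesquilinear, hence the
  -- conjugate.
  refine ⟨star y, ?_, ?_⟩
  · ext φ
    rw [← hL, ← InnerProductSpace.toDual_symm_apply, Lp.toTemperedDistribution_apply, L2.inner_def]
    refine integral_congr_ae ?_
    filter_upwards [φ.coeFn_toLp 2 volume, Lp.coeFn_star y] with x hx hs
    rw [hs, RCLike.inner_apply]
    change (φ.toLp 2 volume : Plane → ℂ) x * _ = _
    rw [hx]
    simp [y]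
  · refine le_trans (le_of_eq ?_) hy
    rw [Lp.norm_def, Lp.norm_def]
    congr 1
    refine eLpNorm_congr_norm_ae ?_
    filter_upwards [Lp.coeFn_star y] with x hs
    rw [hs]
    simp

/-- The dual description of the L² norm. With it every comparison of Sobolev norms of distributions
reduces to an estimate between norms of Schwartz functions. -/
theorem L2sq_le_iff {T : 𝓢'(Plane, ℂ)} {C : ℝ≥0} :
    L2sq T ≤ (C : ℝ≥0∞) ^ 2 ↔ ∀ φ, ‖T φ‖ ≤ C * nrm φ := by
  have key : ∀ g : Lp ℂ 2 (volume : Measure Plane), ‖g‖ₑ ^ 2 ≤ (C : ℝ≥0∞) ^ 2 ↔ ‖g‖ ≤ C := by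
    intro g
    rw [ENNReal.pow_le_pow_left_iff two_ne_zero, enorm_eq_nnnorm, ENNReal.coe_le_coe]
    rfl
  constructor
  · intro h φ
    obtain ⟨g, rfl⟩ := exists_eq_of_L2sq_lt_top (h.trans_lt (by simp))
    rw [L2sq_coe, key] at h
    exact (norm_toTemperedDistribution_le g φ).trans
      (mul_le_mul_of_nonneg_right h (nrm_nonneg φ))
  · intro h
    obtain ⟨g, rfl, hg⟩ := exists_eq_of_norm_apply_le C.2 h
    rw [L2sq_coe, key]
    exact hg

/-- Passes from implications between finite bounds to an inequality in `[0, ∞]`. The constant has to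
be nonzero so that the right side is infinite when `a` is. -/
theorem le_mul_of_forall_le_sq {a b : ℝ≥0∞} {K : ℝ≥0} (hK : K ≠ 0)
    (h : ∀ C : ℝ≥0, a ≤ (C : ℝ≥0∞) ^ 2 → b ≤ ((K * C : ℝ≥0) : ℝ≥0∞) ^ 2) :
    b ≤ ((K ^ 2 : ℝ≥0) : ℝ≥0∞) * a := by
  induction a with
  | top => rw [ENNReal.mul_top (by simpa using hK)]; exact le_top
  | coe a =>
    have e : (NNReal.sqrt a) ^ 2 = a := NNReal.sq_sqrt a
    refine (h (NNReal.sqrt a) ?_).trans (le_of_eq ?_)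
    · rw [← ENNReal.coe_pow, e]
    · rw [← ENNReal.coe_pow, mul_pow, e, ENNReal.coe_mul]

theorem weightMul_apply (r : ℝ) (u : 𝓢'(Plane, ℂ)) (φ : 𝓢(Plane, ℂ)) :
    weightMul r u φ = u (wt r φ) := rfl

theorem fourier_wt_fourierInv (s : ℝ) (φ : 𝓢(Plane, ℂ)) : 𝓕 (wt s (𝓕⁻ φ)) = bes s φ := by
  rw [← fourierInv_bes, FourierTransform.fourier_fourierInv_eq]

theorem besselPotential_apply (s : ℝ) (u : 𝓢'(Plane, ℂ)) (φ : 𝓢(Plane, ℂ)) :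
    besselPotential Plane ℂ s u φ = u (bes s φ) := by
  rw [← fourier_wt_fourierInv]
  exact fourierMultiplierCLM_apply_apply _ u φ

theorem wSobSq_eq (s r : ℝ) (u : 𝓢'(Plane, ℂ)) :
    wSobSq s r u = L2sq (besselPotential Plane ℂ s (weightMul r u)) := rfl

/-- Substituting for φ the image under the inverse weights and potentials moves them from u to the
test function. -/
theorem wSobSq_le_iff {s r : ℝ} {u : 𝓢'(Plane, ℂ)} {C : ℝ≥0} :
    wSobSq s r u ≤ (C : ℝ≥0∞) ^ 2 ↔ ∀ φ, ‖u φ‖ ≤ C * nrm (bes (-s) (wt (-r) φ)) := by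
  rw [wSobSq_eq, L2sq_le_iff]
  constructor
  · intro h φ
    have := h (bes (-s) (wt (-r) φ))
    rwa [besselPotential_apply, weightMul_apply, bes_bes, add_neg_cancel, bes_zero, wt_wt,
      add_neg_cancel, wt_zero] at this
  · intro h φ
    have := h (wt r (bes s φ))
    rwa [wt_wt, neg_add_cancel, wt_zero, bes_bes, neg_add_cancel, bes_zero, ← weightMul_apply,
      ← besselPotential_apply] at this

theorem mem_WSob_iff {s r : ℝ} {u : 𝓢'(Plane, ℂ)} : u ∈ WSob s r ↔ wSobSq s r u < ⊤ := by
  constructor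
  · rintro ⟨g, hg⟩
    rw [wSobSq_eq, hg, L2sq_coe]
    simp
  · intro h
    exact exists_eq_of_L2sq_lt_top h

theorem exists_nnreal_sq_ge {a : ℝ≥0∞} (h : a < ⊤) : ∃ C : ℝ≥0, a = (C : ℝ≥0∞) ^ 2 := by
  lift a to ℝ≥0 using h.ne
  exact ⟨NNReal.sqrt a, by rw [← ENNReal.coe_pow, NNReal.sq_sqrt]⟩

/-- The squared norm of `<x>^r (1 - Δ)^{s/2} u` in `L²`, equivalent to the one of `H^s_r`. -/
def sobWSq (s r : ℝ) (u : 𝓢'(Plane, ℂ)) : ℝ≥0∞ :=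
  L2sq (weightMul r (besselPotential Plane ℂ s u))

theorem sobWSq_le_iff {s r : ℝ} {u : 𝓢'(Plane, ℂ)} {C : ℝ≥0} :
    sobWSq s r u ≤ (C : ℝ≥0∞) ^ 2 ↔ ∀ φ, ‖u φ‖ ≤ C * nrm (wt (-r) (bes (-s) φ)) := by
  rw [sobWSq, L2sq_le_iff]
  constructor
  · intro h φ
    have := h (wt (-r) (bes (-s) φ))
    rwa [weightMul_apply, besselPotential_apply, wt_wt, add_neg_cancel, wt_zero, bes_bes,
      add_neg_cancel, bes_zero] at this
  · intro h φ
    have := h (bes s (wt r φ))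
    rwa [bes_bes, neg_add_cancel, bes_zero, wt_wt, neg_add_cancel, wt_zero,
      ← besselPotential_apply, ← weightMul_apply] at this

theorem exists_wSobSq_le_sobWSq (s r : ℝ) : ∃ C : ℝ≥0, ∀ u, wSobSq s r u ≤ C * sobWSq s r u := by
  obtain ⟨K, hK, H⟩ := exists_nrm_wt_bes_le (-s) (-r)
  lift K to ℝ≥0 using hK
  refine ⟨(K + 1) ^ 2, fun u => le_mul_of_forall_le_sq (by positivity) fun C h => ?_⟩
  rw [wSobSq_le_iff]
  rw [sobWSq_le_iff] at h
  intro φ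
  have h1 := H φ
  have h2 := nrm_nonneg (bes (-s) (wt (-r) φ))
  calc ‖u φ‖ ≤ C * nrm (wt (-r) (bes (-s) φ)) := h φ
    _ ≤ C * (K * nrm (bes (-s) (wt (-r) φ))) := by gcongr
    _ ≤ C * ((K + 1) * nrm (bes (-s) (wt (-r) φ))) := by gcongr; simp
    _ = _ := by push_cast; ring

theorem exists_sobWSq_le_wSobSq (s r : ℝ) : ∃ C : ℝ≥0, ∀ u, sobWSq s r u ≤ C * wSobSq s r u := by
  obtain ⟨K, hK, H⟩ := exists_nrm_bes_wt_le (-s) (-r)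
  lift K to ℝ≥0 using hK
  refine ⟨(K + 1) ^ 2, fun u => le_mul_of_forall_le_sq (by positivity) fun C h => ?_⟩
  rw [sobWSq_le_iff]
  rw [wSobSq_le_iff] at h
  intro φ
  have h1 := H φ
  have h2 := nrm_nonneg (wt (-r) (bes (-s) φ))
  calc ‖u φ‖ ≤ C * nrm (bes (-s) (wt (-r) φ)) := h φ
    _ ≤ C * (K * nrm (wt (-r) (bes (-s) φ))) := by gcongr
    _ ≤ C * ((K + 1) * nrm (wt (-r) (bes (-s) φ))) := by gcongr; simp
    _ = _ := by push_cast; ring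

/-- Multiplication by symbols of order zero is bounded on Sobolev spaces. -/
theorem IsSymb.exists_wSobSq_smulLeft_le {m : Plane → ℂ} (hm : IsSymb 0 m) (s : ℝ) :
    ∃ C : ℝ≥0, ∀ u, wSobSq s 0 (smulLeftCLM ℂ m u) ≤ C * wSobSq s 0 u := by
  obtain ⟨K, hK, H⟩ := hm.exists_nrm_le (-s)
  lift K to ℝ≥0 using hK
  refine ⟨(K + 1) ^ 2, fun u => le_mul_of_forall_le_sq (by positivity) fun C h => ?_⟩
  rw [wSobSq_le_iff] at h ⊢
  simp only [neg_zero, wt_zero] at h ⊢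
  intro φ
  have h1 := H (bes (-s) φ)
  rw [bes_bes, neg_add_cancel, bes_zero] at h1
  have h2 := nrm_nonneg (bes (-s) φ)
  calc ‖u (smulS m φ)‖ ≤ C * nrm (bes (-s) (smulS m φ)) := h _
    _ ≤ C * (K * nrm (bes (-s) φ)) := by gcongr
    _ ≤ C * ((K + 1) * nrm (bes (-s) φ)) := by gcongr; simp
    _ = _ := by push_cast; ring

theorem L2sq_quadLike : QuadLike L2sq where
  zero := by
    have := L2sq_le_iff (T := 0) (C := 0)
    simp only [ENNReal.coe_zero, ne_eq, OfNat.ofNat_ne_zero, not_false_eq_true, zero_pow,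
      nonpos_iff_eq_zero, NNReal.coe_zero, zero_mul] at this
    exact this.2 fun φ => by change ‖(0 : ℂ)‖ ≤ 0; simp
  add a b := by
    by_cases ha : L2sq a = ⊤
    · simp [ha]
    by_cases hb : L2sq b = ⊤
    · simp [hb]
    obtain ⟨A, hA⟩ := exists_nnreal_sq_ge (lt_top_iff_ne_top.2 ha)
    obtain ⟨B, hB⟩ := exists_nnreal_sq_ge (lt_top_iff_ne_top.2 hb)
    have h : L2sq (a + b) ≤ ((A + B : ℝ≥0) : ℝ≥0∞) ^ 2 := by
      rw [L2sq_le_iff]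
      intro φ
      have h1 := L2sq_le_iff.1 hA.le φ
      have h2 := L2sq_le_iff.1 hB.le φ
      calc ‖a φ + b φ‖ ≤ ‖a φ‖ + ‖b φ‖ := norm_add_le _ _
        _ ≤ A * nrm φ + B * nrm φ := add_le_add h1 h2
        _ = _ := by push_cast; ring
    refine h.trans ?_
    rw [hA, hB]
    norm_cast
    rw [← NNReal.coe_le_coe]
    push_cast
    nlinarith [sq_nonneg ((A : ℝ) - B)]
  smul c a hc := by
    have := le_mul_of_forall_le_sq (a := L2sq a) (b := L2sq (c • a)) (K := ‖c‖₊)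
      (by simpa using hc) (fun C h => by
        rw [L2sq_le_iff] at h ⊢
        intro φ
        calc ‖c * a φ‖ = ‖c‖ * ‖a φ‖ := norm_mul _ _
          _ ≤ ‖c‖ * (C * nrm φ) := by gcongr; exact h φ
          _ = _ := by push_cast; ring)
    simpa [enorm_eq_nnnorm] using this

theorem wSobSq_quadLike (s r : ℝ) : QuadLike (wSobSq s r) :=
  L2sq_quadLike.comp ((besselPotential Plane ℂ s).comp (weightMul r)).toLinearMap

theorem eq_zero_of_wSobSq_eq_zero {s r : ℝ} {u : 𝓢'(Plane, ℂ)} (h : wSobSq s r u = 0) :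
    u = 0 := by
  have := wSobSq_le_iff (s := s) (r := r) (u := u) (C := 0)
  simp only [h, ENNReal.coe_zero, zero_le, NNReal.coe_zero, zero_mul, true_iff] at this
  ext φ
  exact norm_le_zero_iff.1 (this φ)

/-! ### Distributions represented by functions -/

theorem Represents.locallyIntegrable {f : Plane → ℂ} {T : 𝓢'(Plane, ℂ)} (h : Represents f T) :
    LocallyIntegrable f := by
  intro x
  let b : ContDiffBump x := ⟨1, 2, by norm_num, by norm_num⟩
  have hc : HasCompactSupport (fun y => ((b y : ℝ) : ℂ)) :=
    b.hasCompactSupport.comp_left (g := fun t : ℝ => (t : ℂ)) (by simp)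
  have hd : ContDiff ℝ ∞ (fun y => ((b y : ℝ) : ℂ)) := Complex.ofRealCLM.contDiff.comp b.contDiff
  refine ⟨Metric.closedBall x 1, Metric.closedBall_mem_nhds x one_pos, ?_⟩
  refine IntegrableOn.congr_fun ((h (hc.toSchwartzMap hd)).1.integrableOn) (fun y hy => ?_)
    Metric.isClosed_closedBall.measurableSet
  change f y * ((b y : ℝ) : ℂ) = f y
  rw [b.one_of_mem_closedBall hy]
  simp

theorem Represents.ae_eq {f f' : Plane → ℂ} {T : 𝓢'(Plane, ℂ)} (h : Represents f T)
    (h' : Represents f' T) : f =ᵐ[volume] f' := by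
  have := ae_eq_zero_of_integral_contDiff_smul_eq_zero
    (h.locallyIntegrable.sub h'.locallyIntegrable) fun g hg hc => ?_
  · filter_upwards [this] with x hx
    exact sub_eq_zero.1 hx
  · have hc' : HasCompactSupport (fun y => ((g y : ℝ) : ℂ)) :=
      hc.comp_left (g := fun t : ℝ => (t : ℂ)) (by simp)
    have hd : ContDiff ℝ ∞ (fun y => ((g y : ℝ) : ℂ)) := Complex.ofRealCLM.contDiff.comp hg
    have e1 := h (hc'.toSchwartzMap hd)
    have e2 := h' (hc'.toSchwartzMap hd)
    have e3 := integral_sub e1.1 e2.1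
    rw [← e1.2, ← e2.2, sub_self] at e3
    rw [← e3]
    congr 1
    ext y
    change (g y : ℝ) • (f y - f' y) = f y * (g y : ℂ) - f' y * (g y : ℂ)
    rw [Complex.real_smul]
    ring

theorem represents_coe (g : Lp ℂ 2 (volume : Measure Plane)) :
    Represents (g : Plane → ℂ) (g : 𝓢'(Plane, ℂ)) := by
  refine fun φ => ⟨(Lp.memLp g).integrable_mul (φ.memLp 2), ?_⟩
  rw [Lp.toTemperedDistribution_apply]
  simp [mul_comm]

theorem Represents.smulLeft {V : Type*} [NormedAddCommGroup V] [NormedSpace ℝ V] [MeasureSpace V]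
    {f m : V → ℂ} {T : 𝓢'(V, ℂ)} (h : Represents f T)
    (hm : m.HasTemperateGrowth) : Represents (fun x => m x * f x) (smulLeftCLM ℂ m T) := by
  have e : ∀ (φ : 𝓢(V, ℂ)) (x : V), f x * SchwartzMap.smulLeftCLM ℂ m φ x = m x * f x * φ x := by
    intro φ x
    rw [SchwartzMap.smulLeftCLM_apply_apply hm, smul_eq_mul]
    ring
  intro φ
  have := h (SchwartzMap.smulLeftCLM ℂ m φ)
  simp only [e] at this
  exact this

theorem Represents.add {V : Type*} [NormedAddCommGroup V] [NormedSpace ℝ V] [MeasureSpace V]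
    {f g : V → ℂ} {T S : 𝓢'(V, ℂ)} (h : Represents f T) (h' : Represents g S) :
    Represents (fun x => f x + g x) (T + S) := by
  intro φ
  have e : (fun x => (f x + g x) * φ x) = fun x => f x * φ x + g x * φ x := by
    ext x; ring
  rw [e]
  refine ⟨(h φ).1.add (h' φ).1, ?_⟩
  rw [integral_add (h φ).1 (h' φ).1, ← (h φ).2, ← (h' φ).2]
  rfl

theorem Represents.sub {V : Type*} [NormedAddCommGroup V] [NormedSpace ℝ V] [MeasureSpace V]
    {f g : V → ℂ} {T S : 𝓢'(V, ℂ)} (h : Represents f T) (h' : Represents g S) :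
    Represents (fun x => f x - g x) (T - S) := by
  intro φ
  have e : (fun x => (f x - g x) * φ x) = fun x => f x * φ x - g x * φ x := by
    ext x; ring
  rw [e]
  refine ⟨(h φ).1.sub (h' φ).1, ?_⟩
  rw [integral_sub (h φ).1 (h' φ).1, ← (h φ).2, ← (h' φ).2]
  rfl

theorem enorm_sq_eq_lintegral (g : Lp ℂ 2 (volume : Measure Plane)) :
    ‖g‖ₑ ^ 2 = ∫⁻ x, ‖g x‖ₑ ^ 2 := by
  rw [Lp.enorm_def, eLpNorm_eq_lintegral_rpow_enorm_toReal (by simp) (by simp)]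
  simp only [ENNReal.toReal_ofNat, ENNReal.rpow_ofNat, one_div]
  rw [← ENNReal.rpow_natCast, ← ENNReal.rpow_mul]
  simp

/-- If T lies in L², its representative is almost everywhere unique; if f is square integrable, it
puts T in L². So the two sides are also infinite together. -/
theorem Represents.L2sq_eq {f : Plane → ℂ} {T : 𝓢'(Plane, ℂ)} (h : Represents f T) :
    L2sq T = ∫⁻ x, ‖f x‖ₑ ^ 2 := by
  by_cases hT : L2sq T < ⊤
  · obtain ⟨g, rfl⟩ := exists_eq_of_L2sq_lt_top hT
    rw [L2sq_coe, enorm_sq_eq_lintegral]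
    refine lintegral_congr_ae ?_
    filter_upwards [h.ae_eq (represents_coe g)] with x hx
    rw [hx]
  · by_contra hne
    have hf : ∫⁻ x, ‖f x‖ₑ ^ 2 < ⊤ := by
      refine lt_top_iff_ne_top.2 fun e => hne ?_
      rw [e]
      exact not_lt_top_iff.1 hT
    have hm : MemLp f 2 := by
      refine ⟨h.locallyIntegrable.aestronglyMeasurable, ?_⟩
      rw [eLpNorm_lt_top_iff_lintegral_rpow_enorm_lt_top (by simp) (by simp)]
      simpa using hf
    have e : T = (hm.toLp f : 𝓢'(Plane, ℂ)) := by
      ext φ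
      rw [(h φ).2, Lp.toTemperedDistribution_apply]
      refine integral_congr_ae ?_
      filter_upwards [hm.coeFn_toLp] with x hx
      rw [hx, smul_eq_mul, mul_comm]
    apply hT
    rw [e, L2sq_coe]
    exact ENNReal.pow_lt_top enorm_lt_top

theorem weightMul_weightMul (r t : ℝ) (u : 𝓢'(Plane, ℂ)) :
    weightMul r (weightMul t u) = weightMul (t + r) u := by
  ext φ
  rw [weightMul_apply, weightMul_apply, weightMul_apply, wt_wt]

theorem weightMul_zero (u : 𝓢'(Plane, ℂ)) : weightMul 0 u = u := by
  ext φ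
  rw [weightMul_apply, wt_zero]

theorem Represents.weightMul {f : Plane → ℂ} {T : 𝓢'(Plane, ℂ)} (h : Represents f T) (r : ℝ) :
    Represents (fun x => jap r x * f x) (weightMul r T) :=
  h.smulLeft (jap_hasTemperateGrowth r)

theorem exists_represents_of_L2sq_weightMul_lt_top {r : ℝ} {T : 𝓢'(Plane, ℂ)}
    (h : L2sq (weightMul r T) < ⊤) : ∃ f : Plane → ℂ, Represents f T := by
  obtain ⟨g, hg⟩ := exists_eq_of_L2sq_lt_top h
  have := (represents_coe g).weightMul (-r)
  rw [← hg, weightMul_weightMul, add_neg_cancel, weightMul_zero] at this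
  exact ⟨_, this⟩

theorem Represents.L2sq_weightMul_eq {f : Plane → ℂ} {T : 𝓢'(Plane, ℂ)} (h : Represents f T)
    (r : ℝ) : L2sq (FloquetBloch.weightMul r T) = ∫⁻ x, ENNReal.ofReal ((1 + ‖x‖ ^ 2) ^ r) * ‖f x‖ₑ ^ 2 := by
  rw [(h.weightMul r).L2sq_eq]
  congr 1
  ext x
  rw [enorm_mul, mul_pow]
  congr 1
  rw [← ofReal_norm, norm_jap, ← ENNReal.ofReal_pow (by positivity),
    ← Real.rpow_mul_natCast (by positivity)]
  congr 2
  push_cast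
  ring

theorem L2sq_fourier (T : 𝓢'(Plane, ℂ)) : L2sq (𝓕 T) = L2sq T := by
  have key : ∀ C : ℝ≥0, L2sq (𝓕 T) ≤ (C : ℝ≥0∞) ^ 2 ↔ L2sq T ≤ (C : ℝ≥0∞) ^ 2 := by
    intro C
    rw [L2sq_le_iff, L2sq_le_iff]
    constructor
    · intro h φ
      have := h (𝓕⁻ φ)
      rwa [TemperedDistribution.fourier_apply, FourierTransform.fourier_fourierInv_eq,
        nrm_fourierInv] at this
    · intro h φ
      have := h (𝓕 φ)
      rwa [nrm_fourier] at this
  refine le_antisymm ?_ ?_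
  · have := le_mul_of_forall_le_sq (K := 1) one_ne_zero
      (fun C h => by rw [one_mul]; exact (key C).2 h)
    simpa using this
  · have := le_mul_of_forall_le_sq (K := 1) one_ne_zero
      (fun C h => by rw [one_mul]; exact (key C).1 h)
    simpa using this

/-- Plancherel: the unweighted Sobolev norm is a weighted L² norm of the Fourier transform, which
has a representing function whenever it is finite. -/
theorem wSobSq_zero_eq (s : ℝ) (u : 𝓢'(Plane, ℂ)) :
    wSobSq s 0 u = L2sq (weightMul s (𝓕 u)) := by
  rw [wSobSq_eq, weightMul_zero, ← L2sq_fourier]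
  congr 1
  exact fourier_besselPotential_eq_smulLeftCLM_fourier_apply s u

/-! ### Density of the test functions -/

section Density

variable {V : Type*} [NormedAddCommGroup V] [NormedSpace ℝ V]

/-- Near the origin 1 - χ vanishes identically, and elsewhere ‖x‖ ≥ 1. After rescaling by 1/n, the
factor ‖x‖ becomes ‖x‖/n, which trades one power of decay for convergence. -/
theorem norm_iteratedFDeriv_one_sub_le {χ : V → ℂ} (hχ : ContDiff ℝ ∞ χ)
    (hc : HasCompactSupport χ) (h1 : ∀ x, ‖x‖ < 1 → χ x = 1) (i : ℕ) :
    ∃ C : ℝ, 0 ≤ C ∧ ∀ x, ‖iteratedFDeriv ℝ i (fun y => 1 - χ y) x‖ ≤ C * ‖x‖ := by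
  have hd : ContDiff ℝ ∞ (fun y => 1 - χ y) := contDiff_const.sub hχ
  obtain ⟨C, hC⟩ := ((hc.iteratedFDeriv (𝕜 := ℝ) i).isCompact_range
    (hχ.continuous_iteratedFDeriv (by exact_mod_cast le_top))).isBounded.exists_norm_le
  have hC' : ∀ x, ‖iteratedFDeriv ℝ i χ x‖ ≤ C := fun x => hC _ ⟨x, rfl⟩
  have hC0 : 0 ≤ C := (norm_nonneg _).trans (hC' 0)
  refine ⟨1 + C, by positivity, fun x => ?_⟩
  rcases lt_or_ge ‖x‖ 1 with hx | hx
  · have : (fun y => 1 - χ y) =ᶠ[nhds x] fun _ => 0 := by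
      filter_upwards [(isOpen_lt continuous_norm continuous_const).mem_nhds hx] with y hy
      rw [h1 y hy, sub_self]
    rw [(this.iteratedFDeriv ℝ i).eq_of_nhds]
    simp only [iteratedFDeriv_fun_zero, Pi.zero_apply, norm_zero]
    positivity
  · have e : iteratedFDeriv ℝ i (fun y => 1 - χ y) x =
        iteratedFDeriv ℝ i (fun _ => (1 : ℂ)) x - iteratedFDeriv ℝ i χ x :=
      iteratedFDeriv_sub_apply contDiff_const.contDiffAt
        (hχ.of_le (by exact_mod_cast le_top)).contDiffAt
    have hone : ‖iteratedFDeriv ℝ i (fun _ : V => (1 : ℂ)) x‖ ≤ 1 := by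
      cases i with
      | zero => simp
      | succ i => simp [iteratedFDeriv_succ_const]
    rw [e]
    refine (norm_sub_le _ _).trans ((add_le_add hone (hC' x)).trans ?_)
    exact le_mul_of_one_le_right (by positivity) hx

theorem exists_seminorm_sub_cutoff_le {χ : V → ℂ} (hχ : ContDiff ℝ ∞ χ)
    (hc : HasCompactSupport χ) (h1 : ∀ x, ‖x‖ < 1 → χ x = 1) (f : 𝓢(V, ℂ)) (k i : ℕ) :
    ∃ C : ℝ, ∀ n : ℕ, 0 < n → ∀ g : 𝓢(V, ℂ), (∀ x, g x = χ ((n : ℝ)⁻¹ • x) * f x) →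
      SchwartzMap.seminorm ℝ k i (g - f) ≤ C * (n : ℝ)⁻¹ := by
  choose D hD0 hD using norm_iteratedFDeriv_one_sub_le hχ hc h1
  refine ⟨∑ j ∈ Finset.range (i + 1), (i.choose j : ℝ) * D j *
    SchwartzMap.seminorm ℝ (k + 1) (i - j) f, fun n hn g hg => ?_⟩
  have hn' : (0 : ℝ) < (n : ℝ)⁻¹ := by positivity
  have hn1 : (n : ℝ)⁻¹ ≤ 1 := inv_le_one_of_one_le₀ (by exact_mod_cast hn)
  have hS : 0 ≤ ∑ j ∈ Finset.range (i + 1), (i.choose j : ℝ) * D j *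
      SchwartzMap.seminorm ℝ (k + 1) (i - j) f :=
    Finset.sum_nonneg fun j _ => mul_nonneg (mul_nonneg (by positivity) (hD0 j)) (apply_nonneg _ _)
  refine SchwartzMap.seminorm_le_bound ℝ k i _ (by positivity) fun x => ?_
  set m : V → ℂ := fun y => 1 - χ ((n : ℝ)⁻¹ • y) with hm
  have hd : ContDiff ℝ ∞ (fun y => 1 - χ y) := contDiff_const.sub hχ
  have hmd : ContDiff ℝ ∞ m := hd.comp (contDiff_const_smul ((n : ℝ)⁻¹))
  have hmb : ∀ j, ‖iteratedFDeriv ℝ j m x‖ ≤ D j * ((n : ℝ)⁻¹ * ‖x‖) := by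
    intro j
    have e := congrFun (iteratedFDeriv_comp_const_smul (i := j) ((n : ℝ)⁻¹)
      (hd.of_le (by exact_mod_cast le_top))) x
    change iteratedFDeriv ℝ j m x = _ at e
    rw [e, norm_smul, norm_pow, Real.norm_of_nonneg hn'.le]
    calc (n : ℝ)⁻¹ ^ j * ‖iteratedFDeriv ℝ j (fun y => 1 - χ y) ((n : ℝ)⁻¹ • x)‖
        ≤ 1 * (D j * ‖(n : ℝ)⁻¹ • x‖) := by
          gcongr
          · exact pow_le_one₀ hn'.le hn1
          · exact hD j _
      _ = _ := by rw [norm_smul, Real.norm_of_nonneg hn'.le, one_mul]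
  have e : (⇑(g - f) : V → ℂ) = -fun y => m y * f y := by
    ext y
    simp only [sub_apply, hg, hm, Pi.neg_apply]
    ring
  rw [e, iteratedFDeriv_neg_apply, norm_neg, Finset.sum_mul]
  refine (mul_le_mul_of_nonneg_left (norm_iteratedFDeriv_mul_le hmd (f.smooth ⊤) x
    (by exact_mod_cast le_top)) (by positivity)).trans ?_
  rw [Finset.mul_sum]
  refine Finset.sum_le_sum fun j _ => ?_
  have h2 := SchwartzMap.le_seminorm ℝ (k + 1) (i - j) f x
  calc ‖x‖ ^ k * ((i.choose j : ℝ) * ‖iteratedFDeriv ℝ j m x‖ * ‖iteratedFDeriv ℝ (i - j) f x‖)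
      ≤ ‖x‖ ^ k * ((i.choose j : ℝ) * (D j * ((n : ℝ)⁻¹ * ‖x‖)) *
        ‖iteratedFDeriv ℝ (i - j) f x‖) := by
        gcongr
        exact hmb j
    _ = (i.choose j : ℝ) * D j * (‖x‖ ^ (k + 1) * ‖iteratedFDeriv ℝ (i - j) f x‖) * (n : ℝ)⁻¹ := by
        ring
    _ ≤ _ := by
        have := hD0 j
        gcongr

/-- Schwartz functions are limits of test functions. -/
theorem exists_tendsto_hasCompactSupport [FiniteDimensional ℝ V] (f : 𝓢(V, ℂ)) :
    ∃ g : ℕ → 𝓢(V, ℂ), (∀ n, HasCompactSupport (g n)) ∧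
      Filter.Tendsto g Filter.atTop (nhds f) := by
  let b : ContDiffBump (0 : V) := ⟨1, 2, by norm_num, by norm_num⟩
  set χ : V → ℂ := fun y => ((b y : ℝ) : ℂ) with hχ'
  have hc : HasCompactSupport χ := b.hasCompactSupport.comp_left (g := fun t : ℝ => (t : ℂ)) (by simp)
  have hχ : ContDiff ℝ ∞ χ := Complex.ofRealCLM.contDiff.comp b.contDiff
  have h1 : ∀ x, ‖x‖ < 1 → χ x = 1 := by
    intro x hx
    simp only [hχ']
    rw [b.one_of_mem_closedBall (by simpa using hx.le)]
    simp
  have hcn : ∀ n : ℕ, HasCompactSupport (fun x => χ (((n : ℝ) + 1)⁻¹ • x) * f x) := by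
    intro n
    refine HasCompactSupport.mul_right ?_
    exact hc.comp_homeomorph (Homeomorph.smulOfNeZero ((n : ℝ) + 1)⁻¹ (by positivity))
  have hdn : ∀ n : ℕ, ContDiff ℝ ∞ (fun x => χ (((n : ℝ) + 1)⁻¹ • x) * f x) := fun n =>
    (hχ.comp (contDiff_const_smul _)).mul (f.smooth ⊤)
  refine ⟨fun n => (hcn n).toSchwartzMap (hdn n), fun n => hcn n, ?_⟩
  rw [(schwartz_withSeminorms ℝ V ℂ).tendsto_nhds]
  rintro ⟨k, i⟩ ε hε
  obtain ⟨C, hC⟩ := exists_seminorm_sub_cutoff_le hχ hc h1 f k i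
  have hlim : Filter.Tendsto (fun n : ℕ => C * ((n + 1 : ℕ) : ℝ)⁻¹) Filter.atTop (nhds 0) := by
    have := (tendsto_inv_atTop_nhds_zero_nat (𝕜 := ℝ)).comp (Filter.tendsto_add_atTop_nat 1)
    simpa using this.const_mul C
  filter_upwards [hlim.eventually_lt_const hε] with n hn
  refine (hC (n + 1) (by omega) _ fun x => ?_).trans_lt hn
  push_cast
  rfl

/-- Tempered distributions are determined by their values on test functions. -/
theorem eq_of_forall_hasCompactSupport [FiniteDimensional ℝ V] {T S : 𝓢'(V, ℂ)}
    (h : ∀ f : 𝓢(V, ℂ), HasCompactSupport f → T f = S f) : T = S := by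
  ext f
  obtain ⟨g, hg, hl⟩ := exists_tendsto_hasCompactSupport f
  have hT := (T.continuous.tendsto f).comp hl
  have hS := (S.continuous.tendsto f).comp hl
  refine tendsto_nhds_unique hT (hS.congr fun n => ?_)
  exact (h (g n) (hg n)).symm

end Density

/-! ### Schwartz functions as distributions and density in the weighted Sobolev spaces -/

/-- The tempered distribution given by a Schwartz function. -/
abbrev dist (φ : 𝓢(Plane, ℂ)) : 𝓢'(Plane, ℂ) := SchwartzMap.toTemperedDistributionCLM Plane ℂ volume φ

theorem dist_apply (φ χ : 𝓢(Plane, ℂ)) : dist φ χ = pr φ χ := by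
  refine (SchwartzMap.toTemperedDistributionCLM_apply_apply volume φ χ).trans ?_
  simp only [smul_eq_mul, pr, mul_comm]

theorem represents_dist (φ : 𝓢(Plane, ℂ)) : Represents φ (dist φ) :=
  fun χ => ⟨integrable_mul φ χ, dist_apply φ χ⟩

theorem Represents.eq_dist {φ : 𝓢(Plane, ℂ)} {u : 𝓢'(Plane, ℂ)} (h : Represents φ u) :
    u = dist φ := by
  ext χ
  rw [(h χ).2, dist_apply, pr]

theorem weightMul_dist (r : ℝ) (φ : 𝓢(Plane, ℂ)) : weightMul r (dist φ) = dist (wt r φ) := by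
  ext χ
  rw [weightMul_apply, dist_apply, dist_apply, pr_wt]

theorem besselPotential_dist (s : ℝ) (φ : 𝓢(Plane, ℂ)) :
    besselPotential Plane ℂ s (dist φ) = dist (bes s φ) := by
  ext χ
  rw [besselPotential_apply, dist_apply, dist_apply, pr_bes]

theorem dist_eq_toLp (φ : 𝓢(Plane, ℂ)) :
    dist φ = (φ.toLp 2 (volume : Measure Plane) : 𝓢'(Plane, ℂ)) := by
  ext χ
  rw [dist_apply, pr, Lp.toTemperedDistribution_apply]
  refine integral_congr_ae ?_
  filter_upwards [φ.coeFn_toLp 2 volume] with x hx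
  rw [hx, smul_eq_mul, mul_comm]

theorem wSobSq_dist (s r : ℝ) (φ : 𝓢(Plane, ℂ)) :
    wSobSq s r (dist φ) = ENNReal.ofReal (nrm (bes s (wt r φ))) ^ 2 := by
  rw [wSobSq_eq, weightMul_dist, besselPotential_dist, dist_eq_toLp, L2sq_coe, nrm, ofReal_norm]

theorem dist_mem_WSob (s r : ℝ) (φ : 𝓢(Plane, ℂ)) : dist φ ∈ WSob s r := by
  rw [mem_WSob_iff, wSobSq_dist]
  simp

/-- Test functions are dense in the weighted Sobolev spaces. -/
theorem exists_wSobSq_sub_dist_lt {s r : ℝ} {u : 𝓢'(Plane, ℂ)} (hu : u ∈ WSob s r) {ε : ℝ≥0∞}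
    (hε : 0 < ε) : ∃ φ : 𝓢(Plane, ℂ), HasCompactSupport φ ∧ wSobSq s r (u - dist φ) < ε := by
  obtain ⟨g, hg⟩ := hu
  let N : 𝓢(Plane, ℂ) → Lp ℂ 2 (volume : Measure Plane) :=
    fun φ => SchwartzMap.toLpCLM ℂ ℂ 2 volume (bes s (wt r φ))
  have hN : ∀ φ, wSobSq s r (u - dist φ) = ‖g - N φ‖ₑ ^ 2 := by
    intro φ
    rw [wSobSq_eq, map_sub, map_sub, hg, weightMul_dist, besselPotential_dist, dist_eq_toLp,
      ← L2sq_coe]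
    congr 1
    exact (map_sub (Lp.toTemperedDistributionCLM ℂ volume 2) g (N φ)).symm
  have hNc : Continuous N := by fun_prop
  -- Weights and potentials are invertible on Schwartz functions, so the range of `N` is that of the
  -- embedding into L².
  have hNd : DenseRange N := by
    have h := SchwartzMap.denseRange_toLpCLM (F := ℂ) (E := Plane) (p := 2)
      (μ := volume) (by simp)
    refine h.mono ?_
    rintro _ ⟨f, rfl⟩
    refine ⟨wt (-r) (bes (-s) f), ?_⟩
    simp only [N]
    rw [wt_wt, add_neg_cancel, wt_zero, bes_bes, add_neg_cancel, bes_zero]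
    rfl
  have hFc : Continuous fun y : Lp ℂ 2 (volume : Measure Plane) => ‖g - y‖ₑ ^ 2 := by fun_prop
  have hO : IsOpen {y : Lp ℂ 2 (volume : Measure Plane) | ‖g - y‖ₑ ^ 2 < ε} :=
    isOpen_lt hFc continuous_const
  obtain ⟨f, hf⟩ := hNd.exists_mem_open hO ⟨g, by simpa using hε⟩
  obtain ⟨φ, hφ, hl⟩ := exists_tendsto_hasCompactSupport f
  have := ((hNc.tendsto f).comp hl).eventually (hO.mem_nhds hf)
  obtain ⟨n, hn⟩ := this.exists
  exact ⟨φ n, hφ n, by rw [hN]; exact hn⟩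

/-! ### Conjugation and the sesquilinear pairing -/

theorem fourier_conjS (f : 𝓢(Plane, ℂ)) : 𝓕 (conjS f) = conjS (𝓕⁻ f) := by
  ext ξ
  rw [SchwartzMap.fourier_coe, conjS_apply, SchwartzMap.fourierInv_coe, Real.fourier_eq',
    Real.fourierInv_eq', ← integral_conj]
  congr 1
  ext x
  simp only [conjS_apply, smul_eq_mul, map_mul, ← Complex.exp_conj]
  congr 2
  simp [Complex.conj_ofNat]

theorem conjS_wt (r : ℝ) (f : 𝓢(Plane, ℂ)) : conjS (wt r f) = wt r (conjS f) := by
  ext x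
  simp only [conjS_apply, wt_apply, map_mul, jap, Complex.conj_ofReal]

theorem conjS_bes (s : ℝ) (f : 𝓢(Plane, ℂ)) : conjS (bes s f) = bes s (conjS f) := by
  apply (FourierTransform.fourierCLE ℂ 𝓢(Plane, ℂ)).injective
  change 𝓕 (conjS (bes s f)) = 𝓕 (bes s (conjS f))
  rw [fourier_conjS, fourierInv_bes, conjS_wt, fourier_bes, fourier_conjS]

/-- The `L²` function `(1 - Δ)^{s/2} (1 + |x|²)^{r/2} u`. -/
def toL2 (s r : ℝ) (u : WSob s r) : Lp ℂ 2 (volume : Measure Plane) := u.2.choose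

theorem toL2_spec (s r : ℝ) (u : WSob s r) :
    besselPotential Plane ℂ s (weightMul r u) = (toL2 s r u : 𝓢'(Plane, ℂ)) := u.2.choose_spec

theorem wSobSq_eq_toL2 (s r : ℝ) (u : WSob s r) : wSobSq s r u = ‖toL2 s r u‖ₑ ^ 2 := by
  rw [wSobSq_eq, toL2_spec, L2sq_coe]

theorem toL2_eq_of {s r : ℝ} {u : WSob s r} {g : Lp ℂ 2 (volume : Measure Plane)}
    (h : besselPotential Plane ℂ s (weightMul r u) = (g : 𝓢'(Plane, ℂ))) : toL2 s r u = g :=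
  toTemperedDistribution_injective ((toL2_spec s r u).symm.trans h)

theorem toL2_add (s r : ℝ) (u v : WSob s r) : toL2 s r (u + v) = toL2 s r u + toL2 s r v := by
  apply toL2_eq_of
  rw [Submodule.coe_add, map_add, map_add, toL2_spec, toL2_spec]
  exact (map_add (Lp.toTemperedDistributionCLM ℂ volume 2) _ _).symm

theorem toL2_smul (s r : ℝ) (c : ℂ) (u : WSob s r) : toL2 s r (c • u) = c • toL2 s r u := by
  apply toL2_eq_of
  rw [Submodule.coe_smul, map_smul, map_smul, toL2_spec]
  exact (map_smul (Lp.toTemperedDistributionCLM ℂ volume 2) c _).symm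

/-- The duality pairing between `H^s_r` and `H^{-s}_{-r}`. -/
def planePairing (s r : ℝ) : WSob s r →ₗ[ℂ] WSob (-s) (-r) →ₗ⋆[ℂ] ℂ :=
  LinearMap.mk₂'ₛₗ (RingHom.id ℂ) (starRingEnd ℂ)
    (fun u v => inner ℂ (toL2 (-s) (-r) v) (toL2 s r u))
    (fun u u' v => by rw [toL2_add, inner_add_right])
    (fun c u v => by rw [toL2_smul, inner_smul_right]; rfl)
    (fun u v v' => by rw [toL2_add, inner_add_left])
    (fun c u v => by rw [toL2_smul, inner_smul_left]; rfl)

theorem planePairing_apply (s r : ℝ) (u : WSob s r) (v : WSob (-s) (-r)) :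
    planePairing s r u v = inner ℂ (toL2 (-s) (-r) v) (toL2 s r u) := rfl

theorem enorm_planePairing_sq_le (s r : ℝ) (u : WSob s r) (v : WSob (-s) (-r)) :
    ‖planePairing s r u v‖ₑ ^ 2 ≤ wSobSq s r u * wSobSq (-s) (-r) v := by
  rw [planePairing_apply, wSobSq_eq_toL2, wSobSq_eq_toL2, ← mul_pow, mul_comm]
  gcongr
  simp only [enorm_eq_nnnorm]
  exact_mod_cast norm_inner_le_norm (𝕜 := ℂ) (toL2 (-s) (-r) v) (toL2 s r u)

/-- The opposite potentials and weights in the two slots cancel. Against a Schwartz function the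
pairing is therefore plain evaluation of the distribution, with a conjugate. -/
theorem planePairing_dist (s r : ℝ) (u : WSob s r) (v : WSob (-s) (-r)) (χ : 𝓢(Plane, ℂ))
    (hv : (v : 𝓢'(Plane, ℂ)) = dist χ) :
    planePairing s r u v = (u : 𝓢'(Plane, ℂ)) (conjS χ) := by
  have e : toL2 (-s) (-r) v = (bes (-s) (wt (-r) χ)).toLp 2 volume := by
    apply toL2_eq_of
    rw [hv, weightMul_dist, besselPotential_dist, dist_eq_toLp]
  have := toTemperedDistribution_eq_inner (toL2 s r u) (conjS (bes (-s) (wt (-r) χ)))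
  rw [conjS_conjS] at this
  rw [planePairing_apply, e, ← this, ← toL2_spec, besselPotential_apply, weightMul_apply,
    conjS_bes, conjS_wt, bes_bes, add_neg_cancel, bes_zero, wt_wt, add_neg_cancel, wt_zero]

theorem isPlanePairing_planePairing (s r : ℝ) : IsPlanePairing s r (planePairing s r) where
  bounded := ⟨1, fun u v => by simpa using enorm_planePairing_sq_le s r u v⟩
  extends_test := by
    intro φ χ u v _ _ hχ hχc hu hv
    have hv' : (v : 𝓢'(Plane, ℂ)) = dist (hχc.toSchwartzMap hχ) := by
      ext f
      rw [(hv f).2, dist_apply, pr]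
      rfl
    rw [planePairing_dist s r u v _ hv', (hu _).2]
    rfl

/-! ### Tilings and unfolding of integrals -/

section Tiling

variable {V ι : Type*} [AddGroup V]

/-- The translates of `C` by the vectors `v i` partition `V`. -/
def IsTiling [MeasurableSpace V] (C : Set V) (v : ι → V) : Prop :=
  MeasurableSet C ∧ ∀ x, ∃! i, x - v i ∈ C

theorem IsTiling.prod {V' ι' : Type*} [AddGroup V'] [MeasurableSpace V] [MeasurableSpace V']
    {C : Set V} {v : ι → V} {C' : Set V'} {v' : ι' → V'} (h : IsTiling C v)
    (h' : IsTiling C' v') : IsTiling (C ×ˢ C') (fun i : ι × ι' => (v i.1, v' i.2)) := by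
  refine ⟨h.1.prod h'.1, fun x => ?_⟩
  obtain ⟨i, hi, hi'⟩ := h.2 x.1
  obtain ⟨j, hj, hj'⟩ := h'.2 x.2
  exact ⟨(i, j), ⟨hi, hj⟩, fun k hk => Prod.ext (hi' _ hk.1) (hj' _ hk.2)⟩

variable [MeasureSpace V] {C : Set V} {v : ι → V}

theorem IsTiling.iUnion_eq (h : IsTiling C v) : ⋃ i, (fun x => x - v i) ⁻¹' C = Set.univ := by
  refine Set.eq_univ_of_forall fun x => Set.mem_iUnion.2 ?_
  obtain ⟨i, hi, -⟩ := h.2 x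
  exact ⟨i, hi⟩

theorem IsTiling.pairwise_disjoint (h : IsTiling C v) :
    Pairwise (Function.onFun Disjoint fun i => (fun x => x - v i) ⁻¹' C) := by
  intro i j hij
  refine Set.disjoint_left.2 fun x hi hj => hij ?_
  exact (h.2 x).unique hi hj

variable [MeasurableAdd V]

theorem measurableSet_preimage_sub (hC : MeasurableSet C) (a : V) :
    MeasurableSet ((fun x => x - a) ⁻¹' C) := by
  simp only [sub_eq_add_neg]
  exact hC.preimage (measurable_add_const _)

variable [(volume : Measure V).IsAddRightInvariant]

theorem setLIntegral_preimage_sub (f : V → ℝ≥0∞) (C : Set V) (a : V) :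
    ∫⁻ x in (fun x => x - a) ⁻¹' C, f x = ∫⁻ x in C, f (x + a) := by
  have := (measurePreserving_sub_right (volume : Measure V) a).setLIntegral_comp_preimage_emb
    (MeasurableEquiv.subRight a).measurableEmbedding (fun x => f (x + a)) C
  simpa using this

theorem setIntegral_preimage_sub {E : Type*} [NormedAddCommGroup E] [NormedSpace ℝ E] (f : V → E)
    (C : Set V) (a : V) :
    ∫ x in (fun x => x - a) ⁻¹' C, f x = ∫ x in C, f (x + a) := by
  have := (measurePreserving_sub_right (volume : Measure V) a).setIntegral_preimage_emb
    (MeasurableEquiv.subRight a).measurableEmbedding (fun x => f (x + a)) C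
  simpa using this

theorem IsTiling.lintegral_eq_tsum [Countable ι] (h : IsTiling C v) (f : V → ℝ≥0∞) :
    ∫⁻ x, f x = ∑' i, ∫⁻ x in C, f (x + v i) := by
  rw [← setLIntegral_univ, ← h.iUnion_eq,
    lintegral_iUnion (fun i => measurableSet_preimage_sub h.1 _) h.pairwise_disjoint]
  simp only [setLIntegral_preimage_sub]

theorem IsTiling.hasSum_integral [Countable ι] {E : Type*} [NormedAddCommGroup E]
    [NormedSpace ℝ E] (h : IsTiling C v) {f : V → E} (hf : Integrable f) :
    HasSum (fun i => ∫ x in C, f (x + v i)) (∫ x, f x) := by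
  have := hasSum_integral_iUnion (fun i => measurableSet_preimage_sub h.1 (v i))
    h.pairwise_disjoint (μ := volume) (f := f) hf.integrableOn
  rw [h.iUnion_eq, setIntegral_univ] at this
  simpa only [setIntegral_preimage_sub] using this

/-- Integration of a periodic function against a partition of unity. -/
theorem IsTiling.integral_mul_eq [Countable ι] (h : IsTiling C v) {ρ G : V → ℂ}
    (hi : Integrable (fun x => ρ x * G x)) (hG : ∀ i x, G (x + v i) = G x)
    (hρ : ∀ x, ∑' i, ρ (x + v i) = 1) : ∫ x, ρ x * G x = ∫ x in C, G x := by
  have h1 := h.hasSum_integral hi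
  have h2 := h.hasSum_integral hi.norm
  -- Summing over translates before integrating exposes the sum of the translates of ρ, which is 1,
  -- while G is unaffected by periodicity.
  have h3 := hasSum_integral_of_summable_integral_norm (μ := volume.restrict C)
    (F := fun i x => ρ (x + v i) * G (x + v i))
    (fun i => (hi.comp_add_right (v i)).integrableOn) h2.summable
  rw [h1.unique h3]
  congr 1
  ext x
  simp only [hG]
  rw [tsum_mul_right, hρ, one_mul]

end Tiling

/-! ### Lattices in the plane -/

/-- The coordinates with respect to the columns of an invertible matrix. -/
def latEquiv (A : Matrix (Fin 2) (Fin 2) ℝ) (hA : IsUnit A.det) : (Fin 2 → ℝ) ≃L[ℝ] Plane :=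
  letI := A.invertibleOfIsUnitDet hA
  ((Matrix.toLinearEquiv' A this).trans
    (WithLp.linearEquiv 2 ℝ (Fin 2 → ℝ)).symm).toContinuousLinearEquiv

section Lattice

variable {A : Matrix (Fin 2) (Fin 2) ℝ} (hA : IsUnit A.det)

theorem latEquiv_apply (z : Fin 2 → ℝ) : latEquiv A hA z = WithLp.toLp 2 (A *ᵥ z) := rfl

theorem latVec_eq (j : Fin 2 → ℤ) : latVec A j = latEquiv A hA fun i => (j i : ℝ) := rfl

theorem latVec_add (A : Matrix (Fin 2) (Fin 2) ℝ) (j l : Fin 2 → ℤ) :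
    latVec A (j + l) = latVec A j + latVec A l := by
  have : (fun i => (((j + l) i : ℤ) : ℝ)) = (fun i => (j i : ℝ)) + fun i => (l i : ℝ) := by
    ext i; simp
  rw [latVec, this, Matrix.mulVec_add]
  rfl

theorem latVec_neg (A : Matrix (Fin 2) (Fin 2) ℝ) (j : Fin 2 → ℤ) :
    latVec A (-j) = -latVec A j := by
  have : (fun i => (((-j) i : ℤ) : ℝ)) = -(fun i => (j i : ℝ)) := by
    ext i; simp
  rw [latVec, this, Matrix.mulVec_neg]
  rfl

theorem latVec_zero (A : Matrix (Fin 2) (Fin 2) ℝ) : latVec A 0 = 0 := by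
  have : (fun i => (((0 : Fin 2 → ℤ) i : ℤ) : ℝ)) = 0 := by
    ext i; simp
  rw [latVec, this, Matrix.mulVec_zero]
  rfl

theorem latVec_sub (A : Matrix (Fin 2) (Fin 2) ℝ) (j l : Fin 2 → ℤ) :
    latVec A (j - l) = latVec A j - latVec A l := by
  rw [sub_eq_add_neg, latVec_add, latVec_neg, ← sub_eq_add_neg]

theorem mem_cell_iff (x : Plane) :
    x ∈ cell A ↔ ∀ i, (latEquiv A hA).symm x i ∈ Set.Ioc (-(1 / 2) : ℝ) (1 / 2) := by
  constructor
  · rintro ⟨z, hz, rfl⟩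
    rw [← latEquiv_apply hA, ContinuousLinearEquiv.symm_apply_apply]
    exact hz
  · intro h
    exact ⟨(latEquiv A hA).symm x, h, ((latEquiv A hA).apply_symm_apply x).symm⟩

theorem cell_eq_preimage : cell A = (latEquiv A hA).symm ⁻¹'
    {z | ∀ i, z i ∈ Set.Ioc (-(1 / 2) : ℝ) (1 / 2)} := by
  ext x
  exact mem_cell_iff hA x

theorem measurableSet_cube :
    MeasurableSet {z : Fin 2 → ℝ | ∀ i, z i ∈ Set.Ioc (-(1 / 2) : ℝ) (1 / 2)} := by
  have : {z : Fin 2 → ℝ | ∀ i, z i ∈ Set.Ioc (-(1 / 2) : ℝ) (1 / 2)} =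
      Set.pi Set.univ fun _ => Set.Ioc (-(1 / 2) : ℝ) (1 / 2) := by
    ext z; simp [Set.mem_pi]
  rw [this]
  exact MeasurableSet.univ_pi fun _ => measurableSet_Ioc

theorem isTiling_cube : IsTiling {z : Fin 2 → ℝ | ∀ i, z i ∈ Set.Ioc (-(1 / 2) : ℝ) (1 / 2)}
    (fun (j : Fin 2 → ℤ) i => (j i : ℝ)) := by
  -- The cube is open on the left and closed on the right, which is why the ceiling of z - 1/2 is
  -- the index, and not a floor.
  refine ⟨measurableSet_cube, fun z => ⟨fun i => ⌈z i - 1 / 2⌉, fun i => ?_, fun j hj => ?_⟩⟩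
  · have h1 := Int.le_ceil (z i - 1 / 2)
    have h2 := Int.ceil_lt_add_one (z i - 1 / 2)
    simp only [Pi.sub_apply]
    constructor <;> linarith
  · ext i
    have := hj i
    simp only [Pi.sub_apply, Set.mem_Ioc] at this
    refine (Int.ceil_eq_iff.2 ⟨?_, ?_⟩).symm <;> linarith [this.1, this.2]

theorem isTiling_cell (hA : IsUnit A.det) : IsTiling (cell A) (latVec A) := by
  refine ⟨?_, fun x => ?_⟩
  · rw [cell_eq_preimage hA]
    exact measurableSet_cube.preimage (latEquiv A hA).symm.continuous.measurable
  · have := isTiling_cube.2 ((latEquiv A hA).symm x)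
    simp only [mem_cell_iff hA, map_sub, latVec_eq hA, ContinuousLinearEquiv.symm_apply_apply]
    exact this

theorem map_latEquiv : Measure.map (latEquiv A hA) volume =
    ENNReal.ofReal |A.det⁻¹| • (volume : Measure Plane) := by
  have h1 : (latEquiv A hA : (Fin 2 → ℝ) → Plane) = WithLp.toLp 2 ∘ Matrix.toLin' A := by
    ext z : 1
    rw [latEquiv_apply]
    rfl
  rw [h1, ← Measure.map_map (PiLp.volume_preserving_toLp (Fin 2)).measurable
    (LinearMap.continuous_of_finiteDimensional _).measurable,
    Real.map_matrix_volume_pi_eq_smul_volume_pi hA.ne_zero, Measure.map_smul,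
    (PiLp.volume_preserving_toLp (Fin 2)).map_eq]

theorem integral_comp_latEquiv {E : Type*} [NormedAddCommGroup E] [NormedSpace ℝ E]
    (f : Plane → E) : ∫ z, f (latEquiv A hA z) = |A.det|⁻¹ • ∫ x, f x := by
  have := (latEquiv A hA).toHomeomorph.measurableEmbedding.integral_map (μ := volume) f
  refine this.symm.trans ?_
  change ∫ x, f x ∂(Measure.map (latEquiv A hA) volume) = _
  rw [map_latEquiv, integral_smul_measure, ENNReal.toReal_ofReal (abs_nonneg _), abs_inv]

theorem setIntegral_cell {E : Type*} [NormedAddCommGroup E] [NormedSpace ℝ E]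
    (f : Plane → E) : ∫ x in cell A, f x =
      |A.det| • ∫ z in {z : Fin 2 → ℝ | ∀ i, z i ∈ Set.Ioc (-(1 / 2) : ℝ) (1 / 2)},
        f (latEquiv A hA z) := by
  rw [← integral_indicator measurableSet_cube, ← integral_indicator (isTiling_cell hA).1]
  have := integral_comp_latEquiv hA ((cell A).indicator f)
  rw [← inv_smul_eq_iff₀ (by simpa using hA.ne_zero), ← this]
  congr 1
  ext z
  simp only [Set.indicator, mem_cell_iff hA, ContinuousLinearEquiv.symm_apply_apply,
    Set.mem_ofPred_eq]

theorem setIntegral_cell_one (hA : IsUnit A.det) : ∫ _ in cell A, (1 : ℂ) = (|A.det| : ℝ) := by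
  rw [setIntegral_cell hA]
  have : {z : Fin 2 → ℝ | ∀ i, z i ∈ Set.Ioc (-(1 / 2) : ℝ) (1 / 2)} =
      Set.pi Set.univ fun _ => Set.Ioc (-(1 / 2) : ℝ) (1 / 2) := by
    ext z; simp [Set.mem_pi]
  rw [this, setIntegral_const, measureReal_def, Real.volume_pi_Ioc]
  norm_num

end Lattice

theorem isUnit_det_dualMat {Λ : Matrix (Fin 2) (Fin 2) ℝ} (hΛ : IsUnit Λ.det) :
    IsUnit (dualMat Λ).det := by
  rw [dualMat, Matrix.det_smul, Matrix.det_nonsing_inv, Matrix.det_transpose]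
  refine IsUnit.mul ?_ ?_
  · simp [Real.pi_ne_zero]
  · simpa using hΛ

theorem abs_det_dualMat {Λ : Matrix (Fin 2) (Fin 2) ℝ} :
    |(dualMat Λ).det| = (2 * Real.pi) ^ 2 * |Λ.det|⁻¹ := by
  rw [dualMat, Matrix.det_smul, Matrix.det_nonsing_inv, Matrix.det_transpose]
  simp [abs_mul, abs_of_pos Real.pi_pos]

theorem inner_latEquiv_dualMat {Λ : Matrix (Fin 2) (Fin 2) ℝ} (hΛ : IsUnit Λ.det)
    (a b : Fin 2 → ℝ) :
    inner ℝ (WithLp.toLp 2 (dualMat Λ *ᵥ a) : Plane) (WithLp.toLp 2 (Λ *ᵥ b)) =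
      2 * Real.pi * (a ⬝ᵥ b) := by
  rw [EuclideanSpace.inner_toLp_toLp, star_trivial, dotProduct_comm, dualMat, Matrix.smul_mulVec,
    smul_dotProduct, Matrix.dotProduct_mulVec, ← Matrix.mulVec_transpose, Matrix.mulVec_mulVec,
    Matrix.mul_nonsing_inv _ (by rwa [Matrix.det_transpose]), Matrix.one_mulVec, smul_eq_mul]

/-! ### Phases -/

theorem phase_comm (a b : Plane) : phase a b = phase b a := by
  rw [phase, phase, real_inner_comm]

theorem phase_add_left (a b c : Plane) : phase (a + b) c = phase a c * phase b c := by
  rw [phase, phase, phase, ← Complex.exp_add, inner_add_left]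
  push_cast
  ring_nf

theorem phase_add_right (a b c : Plane) : phase a (b + c) = phase a b * phase a c := by
  rw [phase_comm, phase_add_left, phase_comm b, phase_comm c]

theorem conj_phase (a b : Plane) : (starRingEnd ℂ) (phase a b) = phase (-a) b := by
  rw [phase, phase, ← Complex.exp_conj]
  simp

theorem phase_neg_right (a b : Plane) : phase a (-b) = phase (-a) b := by
  simp [phase]

theorem phase_zero_left (a : Plane) : phase 0 a = 1 := by simp [phase]

theorem phase_zero_right (a : Plane) : phase a 0 = 1 := by simp [phase]

theorem phase_mul_phase_neg (a b : Plane) : phase a b * phase (-a) b = 1 := by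
  rw [← phase_add_left, add_neg_cancel, phase_zero_left]

theorem continuous_phase : Continuous fun p : Plane × Plane => phase p.1 p.2 := by
  unfold phase
  fun_prop

theorem contDiff_phase {n : WithTop ℕ∞} : ContDiff ℝ n fun p : Plane × Plane => phase p.1 p.2 := by
  unfold phase
  refine Complex.contDiff_exp.comp (contDiff_const.mul ?_)
  exact Complex.ofRealCLM.contDiff.comp (contDiff_fst.inner ℝ contDiff_snd)

theorem phase_dual {Λ : Matrix (Fin 2) (Fin 2) ℝ} (hΛ : IsUnit Λ.det) (l j : Fin 2 → ℤ) :
    phase (latVec (dualMat Λ) l) (latVec Λ j) = 1 := by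
  rw [phase, latVec, latVec, inner_latEquiv_dualMat hΛ]
  refine Complex.exp_eq_one_iff.2 ⟨∑ i, l i * j i, ?_⟩
  simp only [dotProduct]
  push_cast
  ring

theorem fourier_eq_phase (g : 𝓢(Plane, ℂ)) (ξ : Plane) :
    𝓕 g ξ = ∫ x, phase (-x) ((2 * Real.pi) • ξ) * g x := by
  rw [SchwartzMap.fourier_coe, Real.fourier_eq']
  congr 1
  ext x
  rw [phase, smul_eq_mul]
  congr 2
  rw [inner_neg_left, inner_smul_right]
  push_cast
  ring

theorem fourierInv_eq_phase (g : 𝓢(Plane, ℂ)) (ξ : Plane) :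
    𝓕⁻ g ξ = ∫ x, phase x ((2 * Real.pi) • ξ) * g x := by
  rw [SchwartzMap.fourierInv_coe, Real.fourierInv_eq']
  congr 1
  ext x
  rw [phase, smul_eq_mul]
  congr 2
  rw [inner_smul_right]
  push_cast
  ring

/-! ### Decay and summability over lattices -/

theorem exists_norm_le_one_add_norm_pow {V : Type*} [NormedAddCommGroup V] [NormedSpace ℝ V]
    (f : 𝓢(V, ℂ)) (k : ℕ) : ∃ C : ℝ, 0 ≤ C ∧ ∀ x, ‖f x‖ ≤ C * ((1 + ‖x‖) ^ k)⁻¹ := by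
  refine ⟨2 ^ k * ((Finset.Iic (k, 0)).sup fun m => SchwartzMap.seminorm ℝ m.1 m.2) f,
    by positivity, fun x => ?_⟩
  have := SchwartzMap.one_add_le_sup_seminorm_apply (𝕜 := ℝ) (m := (k, 0)) (k := k) (n := 0)
    le_rfl le_rfl f x
  rw [norm_iteratedFDeriv_zero] at this
  rw [← div_eq_mul_inv, le_div_iff₀' (by positivity)]
  exact this

section

variable {A : Matrix (Fin 2) (Fin 2) ℝ} (hA : IsUnit A.det)

theorem exists_norm_le_latVec (hA : IsUnit A.det) :
    ∃ C : ℝ, 0 < C ∧ ∀ j, ‖j‖ ≤ C * ‖latVec A j‖ := by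
  refine ⟨‖((latEquiv A hA).symm : Plane →L[ℝ] Fin 2 → ℝ)‖ + 1, by positivity, fun j => ?_⟩
  have h := ((latEquiv A hA).symm : Plane →L[ℝ] Fin 2 → ℝ).le_opNorm (latVec A j)
  rw [latVec_eq hA] at h ⊢
  simp only [ContinuousLinearEquiv.coe_coe, ContinuousLinearEquiv.symm_apply_apply] at h
  have e : ‖fun i => (j i : ℝ)‖ = ‖j‖ := by
    simp only [Pi.norm_def]
    congr 2
  rw [e] at h
  refine h.trans ?_
  gcongr
  linarith

theorem summable_one_add_norm_latVec (hA : IsUnit A.det) :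
    Summable fun j => ((1 + ‖latVec A j‖) ^ 3)⁻¹ := by
  obtain ⟨C, hC, h⟩ := exists_norm_le_latVec hA
  have h1 := (EisensteinSeries.summable_one_div_norm_rpow (k := 3) (by norm_num)).mul_left (C ^ 3)
  refine Summable.of_norm_bounded_eventually h1 ?_
  refine (Set.finite_singleton (0 : Fin 2 → ℤ)).subset fun j hj => ?_
  by_contra h0
  apply hj
  have hj0 : 0 < ‖j‖ := norm_pos_iff.2 h0
  change ‖((1 + ‖latVec A j‖) ^ 3)⁻¹‖ ≤ C ^ 3 * ‖j‖ ^ (-3 : ℝ)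
  rw [Real.norm_of_nonneg (by positivity), Real.rpow_neg (by positivity)]
  norm_cast
  rw [← div_eq_mul_inv, ← one_div, div_le_div_iff₀ (by positivity) (by positivity), one_mul,
    ← mul_pow]
  refine pow_le_pow_left₀ (by positivity) ((h j).trans ?_) 3
  gcongr
  linarith

theorem finite_norm_latVec_le (hA : IsUnit A.det) (R : ℝ) : {j | ‖latVec A j‖ ≤ R}.Finite := by
  obtain ⟨C, hC, h⟩ := exists_norm_le_latVec hA
  refine (Metric.finite_isBounded_inter_isClosed DiscreteTopology.isDiscrete
    (Metric.isBounded_closedBall (x := (0 : Fin 2 → ℤ)) (r := C * R)) isClosed_univ).subset ?_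
  intro j hj
  refine ⟨?_, trivial⟩
  rw [mem_closedBall_zero_iff]
  exact (h j).trans (mul_le_mul_of_nonneg_left hj hC.le)

theorem one_add_norm_le_mul (V : Type*) [SeminormedAddCommGroup V] (x y : V) :
    1 + ‖y‖ ≤ (1 + ‖x‖) * (1 + ‖x + y‖) := by
  have : ‖y‖ ≤ ‖x + y‖ + ‖x‖ := by
    have := norm_sub_le (x + y) x
    simpa using this
  nlinarith [norm_nonneg x, norm_nonneg (x + y)]

theorem inv_one_add_norm_add_le {V : Type*} [SeminormedAddCommGroup V] (x y : V) (k : ℕ) :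
    ((1 + ‖x + y‖) ^ k)⁻¹ ≤ (1 + ‖x‖) ^ k * ((1 + ‖y‖) ^ k)⁻¹ := by
  rw [← div_eq_mul_inv, ← one_div, div_le_div_iff₀ (by positivity) (by positivity), one_mul,
    ← mul_pow]
  exact pow_le_pow_left₀ (by positivity) (one_add_norm_le_mul V x y) k

/-- Uniform summability over lattices of Schwartz functions. -/
theorem exists_norm_add_latVec_le (f : 𝓢(Plane, ℂ)) (A : Matrix (Fin 2) (Fin 2) ℝ) :
    ∃ C : ℝ, 0 ≤ C ∧ ∀ x j, ‖f (x + latVec A j)‖ ≤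
      C * (1 + ‖x‖) ^ 3 * ((1 + ‖latVec A j‖) ^ 3)⁻¹ := by
  obtain ⟨C, hC, h⟩ := exists_norm_le_one_add_norm_pow f 3
  refine ⟨C, hC, fun x j => (h _).trans ?_⟩
  rw [mul_assoc]
  gcongr
  exact inv_one_add_norm_add_le _ _ _

theorem summable_add_latVec (hA : IsUnit A.det) (f : 𝓢(Plane, ℂ)) (x : Plane) :
    Summable fun j => ‖f (x + latVec A j)‖ := by
  obtain ⟨C, hC, h⟩ := exists_norm_add_latVec_le f A
  exact Summable.of_nonneg_of_le (fun j => norm_nonneg _) (h x)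
    ((summable_one_add_norm_latVec hA).mul_left _)

theorem continuous_tsum_add_latVec (hA : IsUnit A.det) (f : 𝓢(Plane, ℂ)) :
    Continuous fun x => ∑' j, f (x + latVec A j) := by
  obtain ⟨C, hC, h⟩ := exists_norm_add_latVec_le f A
  rw [continuous_iff_continuousAt]
  intro x
  have : ContinuousOn (fun x => ∑' j, f (x + latVec A j)) (Metric.ball 0 (‖x‖ + 1)) := by
    refine continuousOn_tsum (u := fun j => C * (1 + (‖x‖ + 1)) ^ 3 * ((1 + ‖latVec A j‖) ^ 3)⁻¹)
      (fun j => (f.continuous.comp (continuous_add_const _)).continuousOn)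
      ((summable_one_add_norm_latVec hA).mul_left _) fun j y hy => (h y j).trans ?_
    rw [mem_ball_zero_iff] at hy
    gcongr
  exact this.continuousAt (Metric.isOpen_ball.mem_nhds (by simp))

/-! ### Partitions of unity -/

/-- A smooth function on the line whose integer translates sum up to one. -/
def linePart (t : ℝ) : ℝ := Real.smoothTransition (t + 1) - Real.smoothTransition t

theorem linePart_eq_zero {t : ℝ} (h : t ≤ -1 ∨ 1 ≤ t) : linePart t = 0 := by
  rcases h with h | h
  · rw [linePart, Real.smoothTransition.zero_of_nonpos (by linarith),
      Real.smoothTransition.zero_of_nonpos (by linarith), sub_self]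
  · rw [linePart, Real.smoothTransition.one_of_one_le (by linarith),
      Real.smoothTransition.one_of_one_le (by linarith), sub_self]

theorem linePart_eq_zero_of_notMem {t : ℝ} {n : ℤ} (h : n ∉ ({-⌊t⌋, -⌊t⌋ - 1} : Finset ℤ)) :
    linePart (t + n) = 0 := by
  simp only [Finset.mem_insert, Finset.mem_singleton, not_or] at h
  apply linePart_eq_zero
  have h1 := Int.floor_le t
  have h2 := Int.lt_floor_add_one t
  rcases lt_or_ge n (-⌊t⌋ - 1) with hn | hn
  · left
    have : (n : ℝ) + 1 ≤ -⌊t⌋ - 1 := by exact_mod_cast hn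
    linarith
  · right
    have : -⌊t⌋ + 1 ≤ n := by omega
    have : -(⌊t⌋ : ℝ) + 1 ≤ n := by exact_mod_cast this
    linarith

/-- A difference of consecutive translates of one transition function telescopes: at the right end
it equals 1, at the left end 0. Only the two listed integers can contribute. -/
theorem sum_linePart (t : ℝ) : ∑ n ∈ ({-⌊t⌋, -⌊t⌋ - 1} : Finset ℤ), linePart (t + n) = 1 := by
  have h1 := Int.floor_le t
  have h2 := Int.lt_floor_add_one t
  rw [Finset.sum_pair (by omega)]
  simp only [linePart]
  push_cast
  rw [Real.smoothTransition.one_of_one_le (show 1 ≤ t + -⌊t⌋ + 1 by linarith),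
    Real.smoothTransition.zero_of_nonpos (show t + (-⌊t⌋ - 1) ≤ 0 by linarith)]
  have : t + (-(⌊t⌋ : ℝ) - 1) + 1 = t + -⌊t⌋ := by ring
  rw [this]
  ring

theorem contDiff_linePart : ContDiff ℝ ∞ linePart :=
  (Real.smoothTransition.contDiff.comp (contDiff_id.add contDiff_const)).sub
    Real.smoothTransition.contDiff

/-- A smooth partition of unity for the lattice generated by `A`. -/
def latPart (A : Matrix (Fin 2) (Fin 2) ℝ) (hA : IsUnit A.det) (x : Plane) : ℂ :=
  ((∏ i, linePart ((latEquiv A hA).symm x i) : ℝ) : ℂ)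

theorem contDiff_latPart : ContDiff ℝ ∞ (latPart A hA) := by
  have h : ContDiff ℝ ∞ fun x => ∏ i, linePart ((latEquiv A hA).symm x i) :=
    contDiff_prod fun i _ => contDiff_linePart.comp
      ((contDiff_apply ℝ ℝ i).comp (latEquiv A hA).symm.contDiff)
  exact Complex.ofRealCLM.contDiff.comp h

theorem hasCompactSupport_latPart : HasCompactSupport (latPart A hA) := by
  refine HasCompactSupport.intro (K := latEquiv A hA '' Metric.closedBall 0 1)
    ((isCompact_closedBall 0 1).image (latEquiv A hA).continuous) fun x hx => ?_
  have : ∃ i, 1 < ‖(latEquiv A hA).symm x i‖ := by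
    by_contra! h
    refine hx ⟨(latEquiv A hA).symm x, ?_, (latEquiv A hA).apply_symm_apply x⟩
    rw [mem_closedBall_zero_iff]
    exact (pi_norm_le_iff_of_nonneg zero_le_one).2 h
  obtain ⟨i, hi⟩ := this
  rw [latPart, Finset.prod_eq_zero (Finset.mem_univ i), Complex.ofReal_zero]
  apply linePart_eq_zero
  rw [Real.norm_eq_abs, lt_abs] at hi
  rcases hi with hi | hi
  · right; linarith
  · left; linarith

theorem hasSum_latPart (x : Plane) : HasSum (fun j => latPart A hA (x + latVec A j)) 1 := by
  set z := (latEquiv A hA).symm x with hz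
  have e : ∀ j : Fin 2 → ℤ, latPart A hA (x + latVec A j) =
      ((∏ i, linePart (z i + j i) : ℝ) : ℂ) := by
    intro j
    rw [latPart, map_add, latVec_eq hA, ContinuousLinearEquiv.symm_apply_apply]
    rfl
  simp only [e]
  have h := hasSum_sum_of_ne_finset_zero (L := .unconditional _)
    (f := fun j : Fin 2 → ℤ => ∏ i, linePart (z i + j i))
    (s := Fintype.piFinset fun i => ({-⌊z i⌋, -⌊z i⌋ - 1} : Finset ℤ)) (fun j hj => by
      rw [Fintype.mem_piFinset, not_forall] at hj
      obtain ⟨i, hi⟩ := hj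
      exact Finset.prod_eq_zero (Finset.mem_univ i) (linePart_eq_zero_of_notMem hi))
  rw [← Finset.prod_univ_sum (fun i => ({-⌊z i⌋, -⌊z i⌋ - 1} : Finset ℤ))
    (fun i n => linePart (z i + (n : ℤ)))] at h
  simp only [sum_linePart, Finset.prod_const_one] at h
  have h' := Complex.hasSum_ofReal.2 h
  rwa [Complex.ofReal_one] at h'

/-- The partition of unity as a Schwartz function. -/
def latPartS (A : Matrix (Fin 2) (Fin 2) ℝ) (hA : IsUnit A.det) : 𝓢(Plane, ℂ) :=
  (hasCompactSupport_latPart hA).toSchwartzMap (contDiff_latPart hA)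

theorem latPartS_apply (x : Plane) : latPartS A hA x = latPart A hA x := rfl

/-- The translates of the shifted partition still sum to one, so the integral does not depend on the
shift `a`. This freedom is what proves orthogonality of the characters. -/
theorem integral_latPart_mul {G : Plane → ℂ} (hG : Continuous G)
    (hp : ∀ j x, G (x + latVec A j) = G x) (a : Plane) :
    ∫ x, latPart A hA (x + a) * G x = ∫ x in cell A, G x := by
  have hc : HasCompactSupport (fun x => latPart A hA (x + a)) :=
    (hasCompactSupport_latPart hA).comp_homeomorph (Homeomorph.addRight a)
  refine (isTiling_cell hA).integral_mul_eq ?_ hp fun x => ?_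
  · refine Continuous.integrable_of_hasCompactSupport ?_ hc.mul_right
    exact ((contDiff_latPart hA).continuous.comp (continuous_add_const a)).mul hG
  · simp only [add_right_comm x _ a]
    exact (hasSum_latPart hA (x + a)).tsum_eq

/-- Orthogonality of the characters of a lattice. -/
theorem integral_latPart_phase {b : Plane} (hb : ∀ j, phase (latVec A j) b = 1) [Decidable (b = 0)] :
    ∫ x, latPart A hA x * phase x b = if b = 0 then ((|A.det| : ℝ) : ℂ) else 0 := by
  have hc : Continuous fun x => phase x b := by
    unfold phase
    fun_prop
  have hp : ∀ (j : Fin 2 → ℤ) x, phase (x + latVec A j) b = phase x b := by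
    intro j x
    rw [phase_add_left, hb, mul_one]
  have h0 := integral_latPart_mul hA hc hp 0
  simp only [add_zero] at h0
  split_ifs with h
  · rw [h0, h]
    simp only [phase_zero_right]
    exact setIntegral_cell_one hA
  -- The shift is chosen so that a·b = π. Translating by it changes the sign of the character but
  -- not the integral, so the integral vanishes.
  · set a : Plane := (Real.pi / ‖b‖ ^ 2) • b with ha
    have hab : phase a b = -1 := by
      rw [phase, ha, inner_smul_left, real_inner_self_eq_norm_sq]
      have : ‖b‖ ≠ 0 := norm_ne_zero_iff.2 h
      simp only [conj_trivial]
      rw [div_mul_cancel₀ _ (by positivity), mul_comm]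
      exact Complex.exp_pi_mul_I
    have h1 := integral_latPart_mul hA hc hp a
    have h2 : ∫ x, latPart A hA x * phase x b = -∫ x, latPart A hA x * phase x b := by
      calc ∫ x, latPart A hA x * phase x b
          = ∫ x, latPart A hA (x + a) * phase (x + a) b :=
            (integral_add_right_eq_self (fun x => latPart A hA x * phase x b) a).symm
        _ = ∫ x, -(latPart A hA (x + a) * phase x b) := by
            congr 1
            ext x
            rw [phase_add_left, hab]
            ring
        _ = _ := by rw [integral_neg, h1, h0]
    have h3 : (2 : ℂ) * ∫ x, latPart A hA x * phase x b = 0 := by linear_combination h2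
    simpa using h3

end

theorem smul_latVec (c : ℝ) (A : Matrix (Fin 2) (Fin 2) ℝ) (j : Fin 2 → ℤ) :
    c • latVec A j = latVec (c • A) j := by
  rw [latVec, latVec, Matrix.smul_mulVec]
  rfl

theorem isUnit_det_smul {c : ℝ} (hc : c ≠ 0) {A : Matrix (Fin 2) (Fin 2) ℝ} (hA : IsUnit A.det) :
    IsUnit (c • A).det := by
  rw [Matrix.det_smul]
  exact (IsUnit.mk0 _ (pow_ne_zero _ hc)).mul hA

/-! ### Poisson summation -/

theorem phase_latEquiv_dual {Λ : Matrix (Fin 2) (Fin 2) ℝ} (hΛ : IsUnit Λ.det) (z : Fin 2 → ℝ)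
    (n : Fin 2 → ℤ) : phase (latEquiv (dualMat Λ) (isUnit_det_dualMat hΛ) z) (latVec Λ n) =
      UnitAddTorus.mFourier n fun i => (z i : UnitAddCircle) := by
  rw [latEquiv_apply, phase, latVec, inner_latEquiv_dualMat hΛ, UnitAddTorus.mFourier]
  simp only [ContinuousMap.coe_mk, fourier_coe_apply, ← Complex.exp_sum, dotProduct]
  congr 1
  push_cast
  rw [Finset.mul_sum, Finset.mul_sum]
  refine Finset.sum_congr rfl fun i _ => ?_
  simp only [div_one]
  ring

/-- The sum of g over β plus the dual lattice descends to a continuous function on the torus.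
Unfolding the cell gives its Fourier coefficients as samples of 𝓕 g on (2π)⁻¹Λℤ², up to the phase in
β. They are summable, so the Fourier series may be evaluated at the origin. -/
theorem hasSum_poisson {Λ : Matrix (Fin 2) (Fin 2) ℝ} (hΛ : IsUnit Λ.det) (g : 𝓢(Plane, ℂ))
    (β : Plane) :
    HasSum (fun j => phase β (latVec Λ j) * 𝓕 g ((2 * Real.pi)⁻¹ • latVec Λ j))
      (((|(dualMat Λ).det| : ℝ) : ℂ) * ∑' l, g (β + latVec (dualMat Λ) l)) := by
  set B := dualMat Λ with hB
  have hBu : IsUnit B.det := isUnit_det_dualMat hΛ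
  set L := latEquiv B hBu with hL
  set f : 𝓢(Plane, ℂ) := tr (-β) g with hf
  have hfa : ∀ x, f x = g (β + x) := by
    intro x
    rw [hf, SchwartzMap.compSubConstCLM_apply, sub_neg_eq_add, add_comm]
  let q : C(Fin 2 → ℝ, UnitAddTorus (Fin 2)) :=
    ⟨fun z i => (z i : UnitAddCircle), by fun_prop⟩
  have hq : Topology.IsQuotientMap q :=
    (IsOpenQuotientMap.piMap fun _ : Fin 2 =>
      QuotientAddGroup.isOpenQuotientMap_mk (G := ℝ) (N := AddSubgroup.zmultiples (1 : ℝ))).isQuotientMap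
  let P : C(Fin 2 → ℝ, ℂ) :=
    ⟨fun z => ∑' l, f (L z + latVec B l), (continuous_tsum_add_latVec hBu f).comp L.continuous⟩
  have hPq : Function.FactorsThrough P q := by
    intro z w hzw
    have : ∀ i, ∃ k : ℤ, w i = z i + k := by
      intro i
      have h := congrFun hzw i
      obtain ⟨k, hk⟩ := AddSubgroup.mem_zmultiples_iff.1 (QuotientAddGroup.eq.1 h)
      refine ⟨k, ?_⟩
      simp only [zsmul_eq_mul, mul_one] at hk
      linarith
    choose k hk using this
    have hw : w = z + fun i => (k i : ℝ) := funext hk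
    have hLw : L w = L z + latVec B k := by rw [hw, map_add, latVec_eq hBu]
    simp only [P, ContinuousMap.coe_mk, hLw]
    rw [← (Equiv.addLeft k).tsum_eq]
    refine tsum_congr fun l => ?_
    simp only [Equiv.coe_addLeft]
    rw [latVec_add, add_assoc]
  let F : C(UnitAddTorus (Fin 2), ℂ) := hq.lift P hPq
  have hF : ∀ z : Fin 2 → ℝ, F (fun i => (z i : UnitAddCircle)) = P z := by
    intro z
    exact congrArg (fun h : C(Fin 2 → ℝ, ℂ) => h z) (hq.lift_comp P hPq)
  have hcoef : ∀ n, UnitAddTorus.mFourierCoeff F n = ((|B.det|⁻¹ : ℝ) : ℂ) *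
      𝓕 f ((2 * Real.pi)⁻¹ • latVec Λ n) := by
    intro n
    have hphase : ∀ x, phase (-x) ((2 * Real.pi) • (2 * Real.pi)⁻¹ • latVec Λ n) * f x =
        phase x (latVec Λ (-n)) * f x := by
      intro x
      rw [smul_inv_smul₀ (by positivity), latVec_neg, phase_neg_right]
    have hint : Integrable fun x => phase x (latVec Λ (-n)) * f x := by
      refine f.integrable.bdd_mul (c := 1) ?_ (Filter.Eventually.of_forall fun x => (phase_norm _ _).le)
      exact (continuous_phase.comp (Continuous.prodMk_left _)).aestronglyMeasurable
    have hcube : {x : Fin 2 → ℝ | ∀ i, x i ∈ Set.Ioc (-(1 / 2) : ℝ) (-(1 / 2) + 1)} =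
        {x : Fin 2 → ℝ | ∀ i, x i ∈ Set.Ioc (-(1 / 2) : ℝ) (1 / 2)} := by
      norm_num
    -- The base point -1/2 makes the fundamental domain of the torus coincide with the cube that
    -- defines `cell`.
    rw [UnitAddTorus.mFourierCoeff_eq_integral F n (fun _ => -(1 / 2)), hcube, fourier_eq_phase]
    simp only [hphase, hF]
    have h1 := (isTiling_cell hBu).hasSum_integral hint
    have h2 := (isTiling_cell hBu).hasSum_integral hint.norm
    have h3 := hasSum_integral_of_summable_integral_norm (μ := volume.restrict (cell B))
      (F := fun l x => phase (x + latVec B l) (latVec Λ (-n)) * f (x + latVec B l))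
      (fun l => (hint.comp_add_right (latVec B l)).integrableOn) h2.summable
    rw [h1.unique h3, setIntegral_cell hBu, Complex.real_smul, ← mul_assoc, ← Complex.ofReal_mul,
      inv_mul_cancel₀ (by simpa using hBu.ne_zero), Complex.ofReal_one, one_mul]
    congr 1
    ext z
    rw [← phase_latEquiv_dual hΛ, smul_eq_mul]
    simp only [P, ContinuousMap.coe_mk, phase_add_left, phase_dual hΛ, mul_one, tsum_mul_left, hB]
    rfl
  have hsum : Summable (UnitAddTorus.mFourierCoeff F) := by
    have : (UnitAddTorus.mFourierCoeff F) = fun n => ((|B.det|⁻¹ : ℝ) : ℂ) *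
      𝓕 f ((2 * Real.pi)⁻¹ • latVec Λ n) := funext hcoef
    rw [this]
    refine Summable.mul_left _ (Summable.of_norm ?_)
    have h := summable_add_latVec (isUnit_det_smul (c := (2 * Real.pi)⁻¹) (by positivity) hΛ)
      (𝓕 f : 𝓢(Plane, ℂ)) 0
    simpa only [smul_latVec, zero_add] using h
  have hfin := UnitAddTorus.hasSum_mFourier_series_apply_of_summable hsum
    (fun i => ((0 : ℝ) : UnitAddCircle))
  have h0 := hF 0
  simp only [Pi.zero_apply] at h0
  rw [h0] at hfin
  have hP0 : P 0 = ∑' l, g (β + latVec B l) := by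
    simp only [P, ContinuousMap.coe_mk, map_zero, zero_add, hfa]
  have hone : ∀ n, UnitAddTorus.mFourier n (fun _ : Fin 2 => ((0 : ℝ) : UnitAddCircle)) = 1 := by
    intro n
    have := phase_latEquiv_dual hΛ 0 n
    rw [map_zero, phase_zero_left] at this
    exact this.symm
  have hdet : ((|B.det| : ℝ) : ℂ) ≠ 0 := by simpa using hBu.ne_zero
  have := hfin.mul_left ((|B.det| : ℝ) : ℂ)
  rw [hP0] at this
  refine this.congr_fun fun j => ?_
  rw [hone, hcoef, smul_eq_mul, mul_one, ← mul_assoc, Complex.ofReal_inv, mul_inv_cancel₀ hdet,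
    one_mul, hf, fourier_tr, Circle.smul_def, smul_eq_mul, Real.fourierChar_apply, phase]
  congr 2
  rw [inner_neg_left, neg_neg, inner_smul_right]
  push_cast
  have : (Real.pi : ℂ) ≠ 0 := by simp [Real.pi_ne_zero]
  field_simp

/-! ### Schwartz functions of two variables -/

instance : (volume : Measure (Plane × Plane)).IsAddHaarMeasure :=
  inferInstanceAs ((volume : Measure Plane).prod (volume : Measure Plane)).IsAddHaarMeasure

theorem contDiff_exp_mul_I : ContDiff ℝ ∞ fun t : ℝ => Complex.exp (Complex.I * (t : ℂ)) :=
  Complex.contDiff_exp.comp (contDiff_const.mul Complex.ofRealCLM.contDiff)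

theorem norm_iteratedFDeriv_exp_mul_I (n : ℕ) (t : ℝ) :
    ‖iteratedFDeriv ℝ n (fun t : ℝ => Complex.exp (Complex.I * (t : ℂ))) t‖ = 1 := by
  have hder : ∀ t : ℝ, HasDerivAt (fun t : ℝ => Complex.exp (Complex.I * (t : ℂ)))
      (Complex.I * Complex.exp (Complex.I * (t : ℂ))) t := by
    intro t
    have := ((Complex.ofRealCLM.hasDerivAt (x := t)).const_mul Complex.I).cexp
    simpa [mul_comm] using this
  have hit : iteratedDeriv n (fun t : ℝ => Complex.exp (Complex.I * (t : ℂ))) =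
      fun t : ℝ => Complex.I ^ n * Complex.exp (Complex.I * (t : ℂ)) := by
    induction n with
    | zero => simp
    | succ n ih =>
      rw [iteratedDeriv_succ, ih]
      ext t
      rw [((hder t).const_mul (Complex.I ^ n)).deriv]
      ring
  rw [norm_iteratedFDeriv_eq_norm_iteratedDeriv, hit]
  simp [Complex.norm_exp]

theorem hasTemperateGrowth_exp_mul_I :
    (fun t : ℝ => Complex.exp (Complex.I * (t : ℂ))).HasTemperateGrowth :=
  ⟨contDiff_exp_mul_I, fun n => ⟨0, 1, fun t => by simp [norm_iteratedFDeriv_exp_mul_I]⟩⟩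

theorem hasTemperateGrowth_phase {V : Type*} [NormedAddCommGroup V] [NormedSpace ℝ V]
    {a b : V → Plane} (ha : a.HasTemperateGrowth) (hb : b.HasTemperateGrowth) :
    (fun p => phase (a p) (b p)).HasTemperateGrowth :=
  hasTemperateGrowth_exp_mul_I.comp
    ((innerSL ℝ (E := Plane)).bilinear_hasTemperateGrowth ha hb)

theorem hasTemperateGrowth_fst : (fun p : Plane × Plane => p.1).HasTemperateGrowth :=
  (ContinuousLinearMap.fst ℝ Plane Plane).hasTemperateGrowth

theorem hasTemperateGrowth_snd : (fun p : Plane × Plane => p.2).HasTemperateGrowth :=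
  (ContinuousLinearMap.snd ℝ Plane Plane).hasTemperateGrowth

theorem hasTemperateGrowth_mk_left (x : Plane) :
    (fun α : Plane => (α, x)).HasTemperateGrowth := by
  have : (fun α : Plane => (α, x)) =
      fun α => ContinuousLinearMap.inl ℝ Plane Plane α + ((0, x) : Plane × Plane) := by
    ext1 α; simp
  rw [this]
  exact (ContinuousLinearMap.inl ℝ Plane Plane).hasTemperateGrowth.add
    (Function.HasTemperateGrowth.const _)

theorem hasTemperateGrowth_mk_right (α : Plane) :
    (fun x : Plane => (α, x)).HasTemperateGrowth := by
  have : (fun x : Plane => (α, x)) =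
      fun x => ContinuousLinearMap.inr ℝ Plane Plane x + ((α, 0) : Plane × Plane) := by
    ext1 x; simp
  rw [this]
  exact (ContinuousLinearMap.inr ℝ Plane Plane).hasTemperateGrowth.add
    (Function.HasTemperateGrowth.const _)

/-- The restriction of a Schwartz function of `(α, x)` to fixed `x`. -/
def sl1 (x : Plane) : 𝓢(Plane × Plane, ℂ) →L[ℂ] 𝓢(Plane, ℂ) :=
  SchwartzMap.compCLMOfAntilipschitz ℂ (K := 1) (hasTemperateGrowth_mk_left x)
    (AntilipschitzWith.of_le_mul_dist fun a b => by simp [Prod.dist_eq])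

/-- The restriction of a Schwartz function of `(α, x)` to fixed `α`. -/
def sl2 (α : Plane) : 𝓢(Plane × Plane, ℂ) →L[ℂ] 𝓢(Plane, ℂ) :=
  SchwartzMap.compCLMOfAntilipschitz ℂ (K := 1) (hasTemperateGrowth_mk_right α)
    (AntilipschitzWith.of_le_mul_dist fun a b => by simp [Prod.dist_eq])

theorem sl1_apply (x α : Plane) (Φ : 𝓢(Plane × Plane, ℂ)) : sl1 x Φ α = Φ (α, x) := rfl

theorem sl2_apply (x α : Plane) (Φ : 𝓢(Plane × Plane, ℂ)) : sl2 α Φ x = Φ (α, x) := rfl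

/-- Exchange of the variables. -/
def swapS : 𝓢(Plane × Plane, ℂ) →L[ℂ] 𝓢(Plane × Plane, ℂ) :=
  SchwartzMap.compCLMOfContinuousLinearEquiv ℂ (ContinuousLinearEquiv.prodComm ℝ Plane Plane)

theorem swapS_apply (Φ : 𝓢(Plane × Plane, ℂ)) (p : Plane × Plane) : swapS Φ p = Φ (p.2, p.1) := rfl

theorem sl1_swapS (x : Plane) (Φ : 𝓢(Plane × Plane, ℂ)) : sl1 x (swapS Φ) = sl2 x Φ := rfl

theorem sl2_swapS (x : Plane) (Φ : 𝓢(Plane × Plane, ℂ)) : sl2 x (swapS Φ) = sl1 x Φ := rfl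

/-- The Fourier transform in both variables. -/
def F12 : 𝓢(Plane × Plane, ℂ) →L[ℂ] 𝓢(Plane × Plane, ℂ) :=
  -- The product `Plane × Plane` carries the maximum norm and no inner product, so the Fourier
  -- transform is taken on the ℓ² product and carried back.
  (SchwartzMap.compCLMOfContinuousLinearEquiv ℂ
      (WithLp.prodContinuousLinearEquiv 2 ℝ Plane Plane).symm).comp
    ((FourierTransform.fourierCLM ℂ 𝓢(WithLp 2 (Plane × Plane), ℂ)).comp
      (SchwartzMap.compCLMOfContinuousLinearEquiv ℂ
        (WithLp.prodContinuousLinearEquiv 2 ℝ Plane Plane)))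

theorem F12_apply (Φ : 𝓢(Plane × Plane, ℂ)) (ζ η : Plane) :
    F12 Φ (ζ, η) = ∫ p : Plane × Plane,
      phase (-p.1) ((2 * Real.pi) • ζ) * phase (-p.2) ((2 * Real.pi) • η) * Φ p := by
  have h : F12 Φ (ζ, η) = 𝓕 (SchwartzMap.compCLMOfContinuousLinearEquiv ℂ
      (WithLp.prodContinuousLinearEquiv 2 ℝ Plane Plane) Φ) (WithLp.toLp 2 (ζ, η)) := rfl
  rw [h, SchwartzMap.fourier_coe, Real.fourier_eq',
    ← (WithLp.volume_preserving_symm_measurableEquiv_toLp_prod Plane Plane).symm.integral_comp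
    (MeasurableEquiv.toLp 2 (Plane × Plane)).measurableEmbedding]
  congr 1
  ext p
  rw [smul_eq_mul, phase, phase, ← Complex.exp_add]
  congr 1
  congr 1
  have : inner ℝ ((MeasurableEquiv.toLp 2 (Plane × Plane)).symm.symm p) (WithLp.toLp 2 (ζ, η)) =
    inner ℝ p.1 ζ + inner ℝ p.2 η := rfl
  rw [this, inner_neg_left, inner_neg_left, inner_smul_right, inner_smul_right]
  push_cast
  ring

theorem integrable_phase_mul (Φ : 𝓢(Plane × Plane, ℂ)) (ζ η : Plane) :
    Integrable fun p : Plane × Plane =>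
      phase (-p.1) ((2 * Real.pi) • ζ) * phase (-p.2) ((2 * Real.pi) • η) * Φ p := by
  refine Φ.integrable.bdd_mul (c := 1) ?_ (Filter.Eventually.of_forall fun p => ?_)
  · refine Continuous.aestronglyMeasurable ?_
    unfold phase
    fun_prop
  · rw [norm_mul, phase_norm, phase_norm, one_mul]

theorem exists_norm_le_one_add_norm_pow_mul (Φ : 𝓢(Plane × Plane, ℂ)) (k l : ℕ) :
    ∃ C : ℝ, 0 ≤ C ∧ ∀ α x, ‖Φ (α, x)‖ ≤ C * (((1 + ‖α‖) ^ k)⁻¹ * ((1 + ‖x‖) ^ l)⁻¹) := by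
  obtain ⟨C, hC, h⟩ := exists_norm_le_one_add_norm_pow Φ (k + l)
  refine ⟨C, hC, fun α x => (h _).trans ?_⟩
  rw [← mul_inv, pow_add]
  have h1 : ‖α‖ ≤ ‖(α, x)‖ := norm_fst_le (α, x)
  have h2 : ‖x‖ ≤ ‖(α, x)‖ := norm_snd_le (α, x)
  gcongr

theorem integrable_inv_one_add_norm_pow {k : ℕ} (hk : 3 ≤ k) :
    Integrable fun x : Plane => ((1 + ‖x‖) ^ k)⁻¹ := by
  have := integrable_one_add_norm (E := Plane) (μ := volume) (r := k) (by
    simp only [finrank_euclideanSpace, Fintype.card_fin]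
    exact_mod_cast hk)
  refine this.congr (Filter.Eventually.of_forall fun x => ?_)
  simp only
  rw [Real.rpow_neg (by positivity), Real.rpow_natCast]

theorem continuous_fourier_sl1 (Φ : 𝓢(Plane × Plane, ℂ)) (ζ : Plane) :
    Continuous fun x => 𝓕 (sl1 x Φ) ζ := by
  obtain ⟨C, hC, h⟩ := exists_norm_le_one_add_norm_pow_mul Φ 3 0
  simp only [fourier_eq_phase]
  refine continuous_of_dominated (bound := fun α => C * ((1 + ‖α‖) ^ 3)⁻¹) (fun x => ?_)
    (fun x => Filter.Eventually.of_forall fun α => ?_)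
    ((integrable_inv_one_add_norm_pow le_rfl).const_mul C)
    (Filter.Eventually.of_forall fun α => ?_)
  · refine Continuous.aestronglyMeasurable (Continuous.mul ?_ (sl1 x Φ).continuous)
    unfold phase
    fun_prop
  · rw [norm_mul, phase_norm, one_mul, sl1_apply]
    simpa using h α x
  · refine continuous_const.mul ?_
    exact Φ.continuous.comp (Continuous.prodMk_right α)

/-- Partial Fourier inversion. -/
theorem fourierInv_sl2_F12 (Φ : 𝓢(Plane × Plane, ℂ)) (ζ x : Plane) :
    𝓕⁻ (sl2 ζ (F12 Φ)) x = 𝓕 (sl1 x Φ) ζ := by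
  have hint : Integrable fun p : Plane × Plane => phase (-p.1) ((2 * Real.pi) • ζ) * Φ p := by
    have := integrable_phase_mul Φ ζ 0
    simpa [phase_zero_right] using this
  have e : (fun x => 𝓕 (sl1 x Φ) ζ) =
      fun x => ∫ α, phase (-α) ((2 * Real.pi) • ζ) * Φ (α, x) := by
    ext x
    rw [fourier_eq_phase]
    rfl
  have hi : Integrable fun x => 𝓕 (sl1 x Φ) ζ := by
    rw [e]
    exact hint.integral_prod_right
  have hF : 𝓕 (fun x => 𝓕 (sl1 x Φ) ζ) = (sl2 ζ (F12 Φ) : Plane → ℂ) := by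
    ext η
    rw [sl2_apply, F12_apply, Measure.volume_eq_prod,
      integral_prod_symm _ (integrable_phase_mul Φ ζ η), e, Real.fourier_eq']
    congr 1
    ext x
    rw [smul_eq_mul, ← integral_const_mul]
    congr 1
    ext α
    have : Complex.exp (((-2 * Real.pi * inner ℝ x η : ℝ) : ℂ) * Complex.I) =
        phase (-x) ((2 * Real.pi) • η) := by
      rw [phase, inner_neg_left, inner_smul_right]
      push_cast
      ring_nf
    rw [this]
    ring
  have := (continuous_fourier_sl1 Φ ζ).fourierInv_fourier_eq hi (by
    rw [hF]
    exact (sl2 ζ (F12 Φ)).integrable)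
  rw [hF] at this
  rw [SchwartzMap.fourierInv_coe, this]

theorem F12_swapS (Φ : 𝓢(Plane × Plane, ℂ)) : F12 (swapS Φ) = swapS (F12 Φ) := by
  ext ⟨ζ, η⟩
  rw [swapS_apply, F12_apply, F12_apply, Measure.volume_eq_prod,
    ← (Measure.measurePreserving_swap (μ := (volume : Measure Plane))
      (ν := (volume : Measure Plane))).integral_comp
      MeasurableEquiv.prodComm.measurableEmbedding]
  congr 1
  ext p
  simp only [swapS_apply, Prod.fst_swap, Prod.snd_swap]
  ring

theorem fourierInv_sl1_F12 (Φ : 𝓢(Plane × Plane, ℂ)) (η α : Plane) :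
    𝓕⁻ (sl1 η (F12 Φ)) α = 𝓕 (sl2 α Φ) η := by
  have := fourierInv_sl2_F12 (swapS Φ) η α
  rwa [F12_swapS, sl2_swapS, sl1_swapS] at this

theorem norm_iteratedFDeriv_comp_clm_add_le {V W : Type*} [NormedAddCommGroup V] [NormedSpace ℝ V]
    [NormedAddCommGroup W] [NormedSpace ℝ W] {f : W → ℂ} (hf : ContDiff ℝ ∞ f) (L : V →L[ℝ] W)
    (hL : ‖L‖ ≤ 1) (w : W) (n : ℕ) (x : V) :
    ‖iteratedFDeriv ℝ n (fun y => f (L y + w)) x‖ ≤ ‖iteratedFDeriv ℝ n f (L x + w)‖ := by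
  have h1 : ContDiff ℝ ∞ fun z => f (z + w) := hf.comp (contDiff_id.add contDiff_const)
  have h2 := L.iteratedFDeriv_comp_right h1 x (i := n) (by exact_mod_cast le_top)
  change iteratedFDeriv ℝ n (fun y => f (L y + w)) x = _ at h2
  rw [h2, iteratedFDeriv_comp_add_right]
  refine (ContinuousMultilinearMap.norm_compContinuousLinearMap_le _ _).trans ?_
  refine mul_le_of_le_one_right (norm_nonneg _) ?_
  exact Finset.prod_le_one (fun _ _ => norm_nonneg _) fun _ _ => hL

theorem norm_iteratedFDeriv_sl2_le (α : Plane) (Ψ : 𝓢(Plane × Plane, ℂ)) (n : ℕ) (x : Plane) :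
    ‖iteratedFDeriv ℝ n (sl2 α Ψ) x‖ ≤ ‖iteratedFDeriv ℝ n Ψ (α, x)‖ := by
  have h := norm_iteratedFDeriv_comp_clm_add_le (Ψ.smooth ⊤) (ContinuousLinearMap.inr ℝ Plane Plane)
    (ContinuousLinearMap.norm_inr_le_one ℝ Plane Plane) (α, 0) n x
  have e : (sl2 α Ψ : Plane → ℂ) =
      fun y => Ψ (ContinuousLinearMap.inr ℝ Plane Plane y + (α, 0)) := by
    ext y
    simp [sl2_apply]
  rw [e]
  simpa using h

/-- A bound for the terms of lattice sums that is uniform in all seminorms. -/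
theorem norm_pow_mul_iteratedFDeriv_sl2_le (Ψ : 𝓢(Plane × Plane, ℂ)) (α x : Plane) (k n N : ℕ) :
    ‖x‖ ^ k * ‖iteratedFDeriv ℝ n (sl2 α Ψ) x‖ ≤ ((1 + ‖α‖) ^ N)⁻¹ *
      (2 ^ (k + N) * ((Finset.Iic (k + N, n)).sup fun m => SchwartzMap.seminorm ℂ m.1 m.2) Ψ) := by
  have h := SchwartzMap.one_add_le_sup_seminorm_apply (𝕜 := ℂ) (m := (k + N, n)) (k := k + N)
    (n := n) le_rfl le_rfl Ψ (α, x)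
  rw [← div_eq_inv_mul, le_div_iff₀ (by positivity)]
  refine le_trans ?_ h
  have h1 : ‖α‖ ≤ ‖(α, x)‖ := norm_fst_le (α, x)
  have h2 : ‖x‖ ≤ 1 + ‖(α, x)‖ := (norm_snd_le (α, x)).trans (by linarith)
  calc ‖x‖ ^ k * ‖iteratedFDeriv ℝ n (sl2 α Ψ) x‖ * (1 + ‖α‖) ^ N
      ≤ (1 + ‖(α, x)‖) ^ k * ‖iteratedFDeriv ℝ n Ψ (α, x)‖ * (1 + ‖(α, x)‖) ^ N := by
        gcongr
        exact norm_iteratedFDeriv_sl2_le α Ψ n x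
    _ = _ := by ring

/-! ### Lattice sums and tensor products of Schwartz functions -/

/-- The sum `∑_j Ψ(B j, ·)` over a lattice. -/
def latSum (B : Matrix (Fin 2) (Fin 2) ℝ) (hB : IsUnit B.det) :
    𝓢(Plane × Plane, ℂ) →L[ℂ] 𝓢(Plane, ℂ) := by
  have hsum := summable_one_add_norm_latVec hB
  have hv : ∀ (Ψ : 𝓢(Plane × Plane, ℂ)) (n : ℕ) (j : Fin 2 → ℤ) (x : Plane),
      ‖iteratedFDeriv ℝ n (sl2 (latVec B j) Ψ) x‖ ≤ ((1 + ‖latVec B j‖) ^ 3)⁻¹ *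
      (2 ^ (0 + 3) * ((Finset.Iic (0 + 3, n)).sup fun m => SchwartzMap.seminorm ℂ m.1 m.2) Ψ) := by
    intro Ψ n j x
    simpa using norm_pow_mul_iteratedFDeriv_sl2_le Ψ (latVec B j) x 0 n 3
  have hs : ∀ (Ψ : 𝓢(Plane × Plane, ℂ)) x, Summable fun j => sl2 (latVec B j) Ψ x := by
    intro Ψ x
    have := fun j => hv Ψ 0 j x
    simp only [norm_iteratedFDeriv_zero] at this
    exact Summable.of_norm_bounded (hsum.mul_right _) this
  refine SchwartzMap.mkCLM (fun Ψ η => ∑' j, sl2 (latVec B j) Ψ η) (fun f g x => ?_)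
    (fun a f x => ?_) (fun f => ?_) (fun m => ?_)
  · simp only [map_add, add_apply]
    exact (hs f x).tsum_add (hs g x)
  · simp only [map_smul, smul_apply, RingHom.id_apply]
    exact (hs f x).tsum_const_smul a
  · exact contDiff_tsum (fun j => (sl2 (latVec B j) f).smooth _) (fun k _ => hsum.mul_right _)
      fun k j x _ => hv f k j x
  · refine ⟨Finset.Iic (m.1 + 3, m.2), (∑' j, ((1 + ‖latVec B j‖) ^ 3)⁻¹) * 2 ^ (m.1 + 3),
      mul_nonneg (tsum_nonneg fun j => by positivity) (by positivity), fun f x => ?_⟩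
    have e := congrFun (iteratedFDeriv_tsum (N := ⊤) (f := fun j => (sl2 (latVec B j) f : Plane → ℂ))
      (fun j => (sl2 (latVec B j) f).smooth _) (fun k _ => hsum.mul_right _)
      (fun k j x _ => hv f k j x) (k := m.2) le_top) x
    rw [e]
    have hb : ∀ j, ‖‖x‖ ^ m.1 • iteratedFDeriv ℝ m.2 (sl2 (latVec B j) f) x‖ ≤
        ((1 + ‖latVec B j‖) ^ 3)⁻¹ * (2 ^ (m.1 + 3) *
          ((Finset.Iic (m.1 + 3, m.2)).sup fun m => SchwartzMap.seminorm ℂ m.1 m.2) f) := by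
      intro j
      rw [norm_smul, norm_pow, norm_norm]
      exact norm_pow_mul_iteratedFDeriv_sl2_le f _ x m.1 m.2 3
    have h1 : ‖x‖ ^ m.1 * ‖∑' j, iteratedFDeriv ℝ m.2 (sl2 (latVec B j) f) x‖ =
        ‖∑' j, ‖x‖ ^ m.1 • iteratedFDeriv ℝ m.2 (sl2 (latVec B j) f) x‖ := by
      rw [tsum_const_smul'', norm_smul, norm_pow, norm_norm]
    refine h1.trans_le ((tsum_of_norm_bounded (hsum.mul_right _).hasSum hb).trans (le_of_eq ?_))
    rw [tsum_mul_right, mul_assoc]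
    rfl

theorem latSum_apply (B : Matrix (Fin 2) (Fin 2) ℝ) (hB : IsUnit B.det)
    (Ψ : 𝓢(Plane × Plane, ℂ)) (η : Plane) :
    latSum B hB Ψ η = ∑' j, Ψ (latVec B j, η) := rfl

theorem norm_pow_mul_iteratedFDeriv_tens_le (h f : 𝓢(Plane, ℂ)) (m : ℕ × ℕ) (p : Plane × Plane) :
    ‖p‖ ^ m.1 * ‖iteratedFDeriv ℝ m.2 (fun p : Plane × Plane => h p.1 * f p.2) p‖ ≤
      (∑ i ∈ Finset.range (m.2 + 1), (m.2.choose i : ℝ) *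
      (2 ^ m.1 * ((Finset.Iic m).sup fun m => SchwartzMap.seminorm ℂ m.1 m.2) h) * 2 ^ m.1) *
      ((Finset.Iic m).sup fun m => SchwartzMap.seminorm ℂ m.1 m.2) f := by
  have h1 : ContDiff ℝ ∞ fun p : Plane × Plane => h p.1 := (h.smooth _).comp contDiff_fst
  have h2 : ContDiff ℝ ∞ fun p : Plane × Plane => f p.2 := (f.smooth _).comp contDiff_snd
  refine (mul_le_mul_of_nonneg_left (norm_iteratedFDeriv_mul_le h1 h2 p
    (n := m.2) (by exact_mod_cast le_top)) (by positivity)).trans ?_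
  rw [Finset.mul_sum, Finset.sum_mul]
  refine Finset.sum_le_sum fun i hi => ?_
  have hi' : i ≤ m.2 := by simpa [Nat.lt_succ_iff] using hi
  have e1 : ‖iteratedFDeriv ℝ i (fun p : Plane × Plane => h p.1) p‖ ≤
      ‖iteratedFDeriv ℝ i h p.1‖ := by
    simpa using norm_iteratedFDeriv_comp_clm_add_le (h.smooth ⊤)
      (ContinuousLinearMap.fst ℝ Plane Plane) (ContinuousLinearMap.norm_fst_le ..) 0 i p
  have e2 : ‖iteratedFDeriv ℝ (m.2 - i) (fun p : Plane × Plane => f p.2) p‖ ≤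
      ‖iteratedFDeriv ℝ (m.2 - i) f p.2‖ := by
    simpa using norm_iteratedFDeriv_comp_clm_add_le (f.smooth ⊤)
      (ContinuousLinearMap.snd ℝ Plane Plane) (ContinuousLinearMap.norm_snd_le ..) 0 (m.2 - i) p
  have e3 := SchwartzMap.one_add_le_sup_seminorm_apply (𝕜 := ℂ) (m := m) (k := m.1)
    (n := i) le_rfl hi' h p.1
  have e4 := SchwartzMap.one_add_le_sup_seminorm_apply (𝕜 := ℂ) (m := m) (k := m.1)
    (n := m.2 - i) le_rfl (Nat.sub_le _ _) f p.2
  have e5 : ‖p‖ ≤ (1 + ‖p.1‖) * (1 + ‖p.2‖) := by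
    have h1 := norm_nonneg p.1
    have h2 := norm_nonneg p.2
    rw [Prod.norm_def]
    refine max_le ?_ ?_ <;> nlinarith
  calc ‖p‖ ^ m.1 * ((m.2.choose i : ℝ) *
        ‖iteratedFDeriv ℝ i (fun p : Plane × Plane => h p.1) p‖ *
        ‖iteratedFDeriv ℝ (m.2 - i) (fun p : Plane × Plane => f p.2) p‖)
      ≤ ((1 + ‖p.1‖) * (1 + ‖p.2‖)) ^ m.1 * ((m.2.choose i : ℝ) *
        ‖iteratedFDeriv ℝ i h p.1‖ * ‖iteratedFDeriv ℝ (m.2 - i) f p.2‖) := by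
        gcongr
    _ = (m.2.choose i : ℝ) * ((1 + ‖p.1‖) ^ m.1 * ‖iteratedFDeriv ℝ i h p.1‖) *
        ((1 + ‖p.2‖) ^ m.1 * ‖iteratedFDeriv ℝ (m.2 - i) f p.2‖) := by
        rw [mul_pow]; ring
    _ ≤ (m.2.choose i : ℝ) *
        (2 ^ m.1 * ((Finset.Iic m).sup fun m => SchwartzMap.seminorm ℂ m.1 m.2) h) *
        (2 ^ m.1 * ((Finset.Iic m).sup fun m => SchwartzMap.seminorm ℂ m.1 m.2) f) := by
        gcongr
    _ = _ := by
        rw [mul_assoc _ (2 ^ m.1) _]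

/-- The tensor product with a fixed Schwartz function. -/
def tens (h : 𝓢(Plane, ℂ)) : 𝓢(Plane, ℂ) →L[ℂ] 𝓢(Plane × Plane, ℂ) := by
  refine SchwartzMap.mkCLM (fun φ p => h p.1 * φ p.2) (fun f g x => ?_) (fun a f x => ?_)
    (fun f => ?_) (fun m => ?_)
  · simp [mul_add]
  · simp [mul_left_comm]
  · exact ((h.smooth _).comp contDiff_fst).mul ((f.smooth _).comp contDiff_snd)
  · refine ⟨Finset.Iic m, ∑ i ∈ Finset.range (m.2 + 1), (m.2.choose i : ℝ) *
      (2 ^ m.1 * ((Finset.Iic m).sup fun m => SchwartzMap.seminorm ℂ m.1 m.2) h) * 2 ^ m.1,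
      Finset.sum_nonneg fun i _ => by positivity,
      fun f p => norm_pow_mul_iteratedFDeriv_tens_le h f m p⟩

theorem tens_apply (h φ : 𝓢(Plane, ℂ)) (p : Plane × Plane) : tens h φ p = h p.1 * φ p.2 := rfl

/-! ### The transpose of the Bloch transform -/

section Kernel

variable {Λ : Matrix (Fin 2) (Fin 2) ℝ} (hΛ : IsUnit Λ.det)

theorem inv_two_pi_ne_zero : (2 * Real.pi)⁻¹ ≠ 0 := by positivity

/-- Multiplication by `e^{-4 π² i ζ·η}`. -/
def chirp (p : Plane × Plane) : ℂ := phase (-((2 * Real.pi) • p.1)) ((2 * Real.pi) • p.2)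

theorem hasTemperateGrowth_chirp : chirp.HasTemperateGrowth := by
  refine hasTemperateGrowth_phase ?_ ?_
  · exact (-((2 * Real.pi) • ContinuousLinearMap.fst ℝ Plane Plane)).hasTemperateGrowth
  · exact ((2 * Real.pi) • ContinuousLinearMap.snd ℝ Plane Plane).hasTemperateGrowth

/-- The Schwartz function `y ↦ ∑_j ∫ e^{-i α·Λ j} Φ(α, y - Λ j) dα`. -/
def kern (Λ : Matrix (Fin 2) (Fin 2) ℝ) (hΛ : IsUnit Λ.det) :
    𝓢(Plane × Plane, ℂ) →L[ℂ] 𝓢(Plane, ℂ) :=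
  -- On the frequency side the integral in α samples `F12 Φ` at (2π)⁻¹Λj, and the translation by Λj
  -- becomes the chirp. In this form it is evident that the result is Schwartz and depends
  -- continuously on Φ; the direct formula is `hasSum_kern`.
  (FourierTransform.fourierInvCLM ℂ 𝓢(Plane, ℂ)).comp
    ((latSum ((2 * Real.pi)⁻¹ • Λ) (isUnit_det_smul inv_two_pi_ne_zero hΛ)).comp
      ((SchwartzMap.smulLeftCLM ℂ chirp).comp F12))

theorem chirp_smul (v η : Plane) : chirp ((2 * Real.pi)⁻¹ • v, η) = phase (-v) ((2 * Real.pi) • η) := by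
  rw [chirp]
  simp only
  rw [smul_inv_smul₀ (by positivity)]

theorem fourier_kern (Φ : 𝓢(Plane × Plane, ℂ)) (η : Plane) :
    𝓕 (kern Λ hΛ Φ) η = ∑' j, phase (-latVec Λ j) ((2 * Real.pi) • η) *
      F12 Φ ((2 * Real.pi)⁻¹ • latVec Λ j, η) := by
  have : kern Λ hΛ Φ = 𝓕⁻ (latSum ((2 * Real.pi)⁻¹ • Λ) (isUnit_det_smul inv_two_pi_ne_zero hΛ)
      (SchwartzMap.smulLeftCLM ℂ chirp (F12 Φ))) := rfl
  rw [this, FourierTransform.fourier_fourierInv_eq, latSum_apply]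
  refine tsum_congr fun j => ?_
  rw [SchwartzMap.smulLeftCLM_apply_apply hasTemperateGrowth_chirp, ← smul_latVec, chirp_smul,
    smul_eq_mul]

/-- The frequency side formula for the kernel map. -/
theorem fourierInv_kern (Φ : 𝓢(Plane × Plane, ℂ)) (ξ : Plane) :
    𝓕⁻ (kern Λ hΛ Φ) ξ = ((|(dualMat Λ).det| : ℝ) : ℂ) *
      ∑' l, 𝓕⁻ (sl2 ((2 * Real.pi) • ξ + latVec (dualMat Λ) l) Φ) ξ := by
  -- For fixed frequency, the samples over j are those of a Fourier transform in the first variable;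
  -- Poisson summation turns them into a sum over the dual lattice.
  have h := hasSum_poisson hΛ (𝓕⁻ (sl1 (-ξ) (F12 Φ)) : 𝓢(Plane, ℂ)) ((2 * Real.pi) • ξ)
  rw [FourierTransform.fourier_fourierInv_eq] at h
  simp only [fourierInv_sl1_F12, sl1_apply] at h
  rw [fourierInv_apply_neg, fourier_kern]
  simp only [fourierInv_apply_neg]
  rw [← h.tsum_eq]
  refine tsum_congr fun j => ?_
  rw [smul_neg, phase_neg_right, neg_neg, phase_comm]

/-- The direct formula for the kernel map. -/
theorem hasSum_kern (Φ : 𝓢(Plane × Plane, ℂ)) (y : Plane) :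
    HasSum (fun j => 𝓕 (sl1 (y - latVec Λ j) Φ) ((2 * Real.pi)⁻¹ • latVec Λ j))
      (kern Λ hΛ Φ y) := by
  set B := (2 * Real.pi)⁻¹ • Λ with hB
  have hBu : IsUnit B.det := isUnit_det_smul inv_two_pi_ne_zero hΛ
  obtain ⟨C, hC, hb⟩ := exists_norm_le_one_add_norm_pow_mul (F12 Φ) 3 3
  have hi3 := integrable_inv_one_add_norm_pow (le_refl 3)
  let T : (Fin 2 → ℤ) → Plane → ℂ := fun j η =>
    phase η ((2 * Real.pi) • (y - latVec Λ j)) * sl2 (latVec B j) (F12 Φ) η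
  have hTn : ∀ j η, ‖T j η‖ ≤ C * ((1 + ‖latVec B j‖) ^ 3)⁻¹ * ((1 + ‖η‖) ^ 3)⁻¹ := by
    intro j η
    simp only [T]
    rw [norm_mul, phase_norm, one_mul, sl2_apply, mul_assoc]
    exact hb _ _
  have hTi : ∀ j, Integrable (T j) := by
    intro j
    refine (sl2 (latVec B j) (F12 Φ)).integrable.bdd_mul (c := 1) ?_
      (Filter.Eventually.of_forall fun η => (phase_norm _ _).le)
    exact (continuous_phase.comp (Continuous.prodMk_left _)).aestronglyMeasurable
  have hTs : Summable fun j => ∫ η, ‖T j η‖ := by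
    refine Summable.of_nonneg_of_le (fun j => integral_nonneg fun η => norm_nonneg _) (fun j => ?_)
      (((summable_one_add_norm_latVec hBu).mul_left C).mul_right (∫ η : Plane, ((1 + ‖η‖) ^ 3)⁻¹))
    rw [← integral_const_mul]
    exact integral_mono (hTi j).norm (hi3.const_mul _) fun η => hTn j η
  have h := hasSum_integral_of_summable_integral_norm hTi hTs
  have e1 : ∀ j, ∫ η, T j η = 𝓕 (sl1 (y - latVec Λ j) Φ) ((2 * Real.pi)⁻¹ • latVec Λ j) := by
    intro j
    rw [← fourierInv_sl2_F12, fourierInv_eq_phase, smul_latVec]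
  have e2 : ∫ η, ∑' j, T j η = kern Λ hΛ Φ y := by
    have : kern Λ hΛ Φ = 𝓕⁻ (𝓕 (kern Λ hΛ Φ)) := (FourierTransform.fourierInv_fourier_eq _).symm
    rw [this, fourierInv_eq_phase]
    congr 1
    ext η
    rw [fourier_kern, ← tsum_mul_left]
    refine tsum_congr fun j => ?_
    simp only [T]
    rw [sl2_apply, smul_latVec, ← mul_assoc, smul_sub, sub_eq_add_neg, phase_add_right,
      phase_neg_right]
    congr 2
    rw [← phase_neg_right, ← smul_neg, phase, phase, inner_smul_right, inner_smul_right,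
      real_inner_comm]
  simp only [e1] at h
  rwa [e2] at h

end Kernel

/-! ### The Bloch transform of tempered distributions -/

/-- The normalizing factor of the Bloch transform. -/
def blochC (Λ : Matrix (Fin 2) (Fin 2) ℝ) : ℂ := ((Real.sqrt |Λ.det| / (2 * Real.pi) : ℝ) : ℂ)

/-- The Bloch transform of tempered distributions. -/
def Jt (Λ : Matrix (Fin 2) (Fin 2) ℝ) (hΛ : IsUnit Λ.det) :
    𝓢'(Plane, ℂ) →L[ℂ] 𝓢'(Plane × Plane, ℂ) :=
  blochC Λ • PointwiseConvergenceCLM.precomp ℂ (kern Λ hΛ)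

section Transform

variable {Λ : Matrix (Fin 2) (Fin 2) ℝ} (hΛ : IsUnit Λ.det)

theorem Jt_apply (u : 𝓢'(Plane, ℂ)) (Φ : 𝓢(Plane × Plane, ℂ)) :
    Jt Λ hΛ u Φ = blochC Λ * u (kern Λ hΛ Φ) := rfl

/-- Here |det Λ*| = (2π)²/|det Λ|. This normalization is the reason why the inverse, and not a
multiple of it, is the adjoint. -/
theorem blochC_sq_mul {Λ : Matrix (Fin 2) (Fin 2) ℝ} (hΛ : IsUnit Λ.det) :
    blochC Λ * blochC Λ * ((|(dualMat Λ).det| : ℝ) : ℂ) = 1 := by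
  have h := abs_pos.2 hΛ.ne_zero
  rw [blochC, abs_det_dualMat, ← Complex.ofReal_mul, ← Complex.ofReal_mul, ← Complex.ofReal_one]
  congr 1
  have h2 := Real.mul_self_sqrt h.le
  have := Real.pi_pos
  field_simp
  nlinarith

theorem conj_blochC : (starRingEnd ℂ) (blochC Λ) = blochC Λ := Complex.conj_ofReal _

theorem fourier_inv_two_pi_smul (g : 𝓢(Plane, ℂ)) (v : Plane) :
    𝓕 g ((2 * Real.pi)⁻¹ • v) = ∫ x, phase (-x) v * g x := by
  rw [fourier_eq_phase, smul_inv_smul₀ (by positivity)]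

/-- Translating the variable of integration α by a dual lattice vector leaves each phase e^{-iα·Λj}
unchanged. -/
theorem kern_eq_of_dual_translate (l : Fin 2 → ℤ) {Φ Φ' : 𝓢(Plane × Plane, ℂ)}
    (h : ∀ α x, Φ' (α, x) = Φ (α - latVec (dualMat Λ) l, x)) : kern Λ hΛ Φ' = kern Λ hΛ Φ := by
  ext y
  refine (hasSum_kern hΛ Φ' y).unique ((hasSum_kern hΛ Φ y).congr_fun fun j => ?_)
  rw [fourier_inv_two_pi_smul, fourier_inv_two_pi_smul,
    ← integral_add_right_eq_self _ (latVec (dualMat Λ) l)]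
  congr 1
  ext α
  rw [sl1_apply, sl1_apply, h, add_sub_cancel_right, neg_add, phase_add_left, ← latVec_neg,
    phase_dual hΛ, mul_one]

/-- Translation by Λm in x is a shift j ↦ j + m of the summation index, and the extra phase
compensates the change in e^{-iα·Λj}. -/
theorem kern_eq_of_translate (m : Fin 2 → ℤ) {Φ Φ₁ Φ₂ : 𝓢(Plane × Plane, ℂ)}
    (h₁ : ∀ α x, Φ₁ (α, x) = Φ (α, x - latVec Λ m))
    (h₂ : ∀ α x, Φ₂ (α, x) = phase α (latVec Λ m) * Φ (α, x)) :
    kern Λ hΛ Φ₁ = kern Λ hΛ Φ₂ := by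
  ext y
  have h := (Equiv.addRight m).hasSum_iff.2 (hasSum_kern hΛ Φ₂ y)
  refine (hasSum_kern hΛ Φ₁ y).unique (h.congr_fun fun j => ?_)
  simp only [Function.comp_apply, Equiv.coe_addRight]
  rw [fourier_inv_two_pi_smul, fourier_inv_two_pi_smul]
  congr 1
  ext α
  rw [sl1_apply, sl1_apply, h₁, h₂, latVec_add, phase_add_right, sub_sub]
  have := phase_mul_phase_neg α (latVec Λ m)
  linear_combination (-(phase (-α) (latVec Λ j)) * Φ (α, y - (latVec Λ j + latVec Λ m))) * this

theorem isBlochPeriodic_Jt (u : 𝓢'(Plane, ℂ)) : IsBlochPeriodic Λ (Jt Λ hΛ u) := by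
  refine ⟨fun l Φ Φ' h => ?_, fun j Φ Φ₁ Φ₂ h₁ h₂ => ?_⟩
  · rw [Jt_apply, Jt_apply, kern_eq_of_dual_translate hΛ l h]
  · rw [Jt_apply, Jt_apply, kern_eq_of_translate hΛ j h₁ h₂]

/-! ### Derivatives in the quasi-momentum -/

/-- The function `-i x_k`. -/
def negIMul (k : Fin 2) (x : Plane) : ℂ := -(Complex.I * ((x k : ℝ) : ℂ))

theorem hasTemperateGrowth_negIMul (k : Fin 2) : (negIMul k).HasTemperateGrowth := by
  have : (fun x : Plane => ((x k : ℝ) : ℂ)).HasTemperateGrowth :=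
    (Complex.ofRealCLM.comp (EuclideanSpace.proj k : Plane →L[ℝ] ℝ)).hasTemperateGrowth
  exact ((Function.HasTemperateGrowth.const Complex.I).mul this).neg

theorem hasTemperateGrowth_I_mul_snd (k : Fin 2) :
    (fun p : Plane × Plane => Complex.I * ((p.2 k : ℝ) : ℂ)).HasTemperateGrowth := by
  have : (fun p : Plane × Plane => ((p.2 k : ℝ) : ℂ)).HasTemperateGrowth :=
    (Complex.ofRealCLM.comp ((EuclideanSpace.proj k : Plane →L[ℝ] ℝ).comp
      (ContinuousLinearMap.snd ℝ Plane Plane))).hasTemperateGrowth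
  exact (Function.HasTemperateGrowth.const Complex.I).mul this

theorem sl1_lineDerivOp (x m : Plane) (Φ : 𝓢(Plane × Plane, ℂ)) :
    sl1 x (∂_{((m, 0) : Plane × Plane)} Φ) = ∂_{m} (sl1 x Φ) := by
  ext α
  rw [sl1_apply, SchwartzMap.lineDerivOp_apply, SchwartzMap.lineDerivOp_apply, lineDeriv, lineDeriv]
  congr 1
  ext t
  rw [sl1_apply]
  simp

/-- Integration by parts against e^{-iα·Λj} gives -i(Λj)_k, and the multiplication contributes -i(y
- Λj)_k. The sum -i y_k is independent of j, which explains the correction term in `alphaDeriv`. -/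
theorem kern_alphaDeriv (k : Fin 2) (Φ : 𝓢(Plane × Plane, ℂ)) :
    kern Λ hΛ (-∂_{((EuclideanSpace.single k (1 : ℝ), 0) : Plane × Plane)} Φ -
      SchwartzMap.smulLeftCLM ℂ (fun p : Plane × Plane => Complex.I * ((p.2 k : ℝ) : ℂ)) Φ) =
      smulS (negIMul k) (kern Λ hΛ Φ) := by
  ext y
  rw [smulS_apply (hasTemperateGrowth_negIMul k)]
  refine (hasSum_kern hΛ _ y).unique (((hasSum_kern hΛ Φ y).mul_left (negIMul k y)).congr_fun
    fun j => ?_)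
  set v := latVec Λ j with hv
  have h1 : sl1 (y - v) (SchwartzMap.smulLeftCLM ℂ
      (fun p : Plane × Plane => Complex.I * ((p.2 k : ℝ) : ℂ)) Φ) =
      (Complex.I * (((y - v) k : ℝ) : ℂ)) • sl1 (y - v) Φ := by
    ext α
    rw [sl1_apply, SchwartzMap.smulLeftCLM_apply_apply (hasTemperateGrowth_I_mul_snd k), smul_apply,
      sl1_apply]
  have h2 : (inner ℝ · (EuclideanSpace.single k (1 : ℝ)) : Plane → ℝ).HasTemperateGrowth := by
    fun_prop
  have e : sl1 (y - v) (-∂_{((EuclideanSpace.single k (1 : ℝ), 0) : Plane × Plane)} Φ -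
      SchwartzMap.smulLeftCLM ℂ (fun p : Plane × Plane => Complex.I * ((p.2 k : ℝ) : ℂ)) Φ) =
      -∂_{(EuclideanSpace.single k (1 : ℝ) : Plane)} (sl1 (y - v) Φ) -
        (Complex.I * (((y - v) k : ℝ) : ℂ)) • sl1 (y - v) Φ := by
    rw [map_sub, map_neg, sl1_lineDerivOp, h1]
  have e2 : 𝓕 (-∂_{(EuclideanSpace.single k (1 : ℝ) : Plane)} (sl1 (y - v) Φ) -
        (Complex.I * (((y - v) k : ℝ) : ℂ)) • sl1 (y - v) Φ) =
      -𝓕 (∂_{(EuclideanSpace.single k (1 : ℝ) : Plane)} (sl1 (y - v) Φ)) -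
        (Complex.I * (((y - v) k : ℝ) : ℂ)) • 𝓕 (sl1 (y - v) Φ) := by
    change FourierTransform.fourierCLM ℂ 𝓢(Plane, ℂ) _ = _
    rw [map_sub, map_neg, map_smul]
    rfl
  rw [e, e2, SchwartzMap.fourier_lineDerivOp_eq, sub_apply, neg_apply, smul_apply, smul_apply,
    SchwartzMap.smulLeftCLM_apply_apply h2, negIMul]
  simp only [inner_smul_left, EuclideanSpace.inner_single_right, smul_eq_mul, Complex.real_smul,
    PiLp.sub_apply]
  have hpi : (Real.pi : ℂ) ≠ 0 := by simp [Real.pi_ne_zero]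
  push_cast
  simp
  field_simp
  ring

theorem alphaDeriv_Jt (k : Fin 2) (u : 𝓢'(Plane, ℂ)) :
    alphaDeriv k (Jt Λ hΛ u) = Jt Λ hΛ (smulLeftCLM ℂ (negIMul k) u) := by
  ext Φ
  have e : alphaDeriv k (Jt Λ hΛ u) Φ = Jt Λ hΛ u
      (-∂_{((EuclideanSpace.single k (1 : ℝ), 0) : Plane × Plane)} Φ -
      SchwartzMap.smulLeftCLM ℂ (fun p : Plane × Plane => Complex.I * ((p.2 k : ℝ) : ℂ)) Φ) := by
    rw [map_sub]
    rfl
  rw [e, Jt_apply, kern_alphaDeriv, Jt_apply]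
  rfl

theorem alphaDeriv_pow_Jt (k : Fin 2) (n : ℕ) (u : 𝓢'(Plane, ℂ)) :
    (alphaDeriv k ^ n) (Jt Λ hΛ u) = Jt Λ hΛ ((smulLeftCLM ℂ (negIMul k) ^ n) u) := by
  induction n with
  | zero => rfl
  | succ n ih =>
    rw [pow_succ', pow_succ']
    change alphaDeriv k ((alphaDeriv k ^ n) (Jt Λ hΛ u)) = _
    rw [ih, alphaDeriv_Jt]
    rfl

theorem alphaDeriv_pow_mul_Jt (a b : ℕ) (u : 𝓢'(Plane, ℂ)) :
    (alphaDeriv 0 ^ a * alphaDeriv 1 ^ b) (Jt Λ hΛ u) =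
      Jt Λ hΛ ((smulLeftCLM ℂ (negIMul 0) ^ a * smulLeftCLM ℂ (negIMul 1) ^ b) u) := by
  change (alphaDeriv 0 ^ a) ((alphaDeriv 1 ^ b) (Jt Λ hΛ u)) = _
  rw [alphaDeriv_pow_Jt, alphaDeriv_pow_Jt]
  rfl

end Transform

/-! ### The Bloch transform of Schwartz functions -/

theorem integrable_tsum_of_summable {X ι : Type*} [MeasurableSpace X] [Countable ι] {μ : Measure X}
    {F : ι → X → ℂ} (hF : ∀ i, Integrable (F i) μ) (hs : Summable fun i => ∫ a, ‖F i a‖ ∂μ)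
    (hp : ∀ a, Summable fun i => F i a) : Integrable (fun a => ∑' i, F i a) μ := by
  refine ⟨?_, ?_⟩
  · refine aestronglyMeasurable_of_tendsto_ae (u := (Filter.atTop : Filter (Finset ι)))
      (f := fun s a => ∑ i ∈ s, F i a) (fun s => ?_) (Filter.Eventually.of_forall fun a => ?_)
    · exact (integrable_finsetSum s fun i _ => hF i).aestronglyMeasurable
    · exact (hp a).hasSum
  · rw [HasFiniteIntegral]
    refine (lintegral_mono fun a => enorm_tsum_le_tsum_enorm).trans_lt ?_
    rw [lintegral_tsum fun i => (hF i).aestronglyMeasurable.enorm]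
    have : ∀ i, ∫⁻ a, ‖F i a‖ₑ ∂μ = ENNReal.ofReal (∫ a, ‖F i a‖ ∂μ) := fun i =>
      (ofReal_integral_norm_eq_lintegral_enorm (hF i)).symm
    simp only [this]
    rw [← ENNReal.ofReal_tsum_of_nonneg (fun i => integral_nonneg fun a => norm_nonneg _) hs]
    exact ENNReal.ofReal_lt_top

theorem exists_norm_fourier_sl1_le_snd (Φ : 𝓢(Plane × Plane, ℂ)) (k : ℕ) :
    ∃ C : ℝ, 0 ≤ C ∧ ∀ x ζ, ‖𝓕 (sl1 x Φ) ζ‖ ≤ C * ((1 + ‖x‖) ^ k)⁻¹ := by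
  obtain ⟨C, hC, h⟩ := exists_norm_le_one_add_norm_pow_mul Φ 3 k
  have hi := (integrable_inv_one_add_norm_pow (le_refl 3))
  refine ⟨C * ∫ α : Plane, ((1 + ‖α‖) ^ 3)⁻¹, mul_nonneg hC (integral_nonneg fun _ => by positivity),
    fun x ζ => ?_⟩
  rw [fourier_eq_phase]
  refine (norm_integral_le_of_norm_le (hi.const_mul (C * ((1 + ‖x‖) ^ k)⁻¹))
    (Filter.Eventually.of_forall fun α => ?_)).trans_eq ?_
  · rw [norm_mul, phase_norm, one_mul, sl1_apply]
    exact (h α x).trans_eq (by ring)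
  · rw [integral_const_mul]
    ring

theorem exists_norm_fourierInv_sl2_le (Φ : 𝓢(Plane × Plane, ℂ)) (k : ℕ) :
    ∃ C : ℝ, 0 ≤ C ∧ ∀ α ξ, ‖𝓕⁻ (sl2 α Φ) ξ‖ ≤ C * ((1 + ‖α‖) ^ k)⁻¹ := by
  obtain ⟨C, hC, h⟩ := exists_norm_fourier_sl1_le_snd (swapS Φ) k
  refine ⟨C, hC, fun α ξ => ?_⟩
  have := h α (-ξ)
  rwa [sl1_swapS, ← fourierInv_apply_neg] at this

/-- Decay of order 2k in x and of order 2l in ζ are known separately, the latter from the rapid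
decay of `F12 Φ`. Multiplying the two bounds and taking the square root yields joint decay. -/
theorem exists_norm_fourier_sl1_le (Φ : 𝓢(Plane × Plane, ℂ)) (k l : ℕ) :
    ∃ C : ℝ, 0 ≤ C ∧ ∀ x ζ, ‖𝓕 (sl1 x Φ) ζ‖ ≤ C * (((1 + ‖x‖) ^ k)⁻¹ * ((1 + ‖ζ‖) ^ l)⁻¹) := by
  obtain ⟨C₁, hC₁, h₁⟩ := exists_norm_fourier_sl1_le_snd Φ (2 * k)
  obtain ⟨C₂, hC₂, h₂⟩ := exists_norm_fourierInv_sl2_le (F12 Φ) (2 * l)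
  refine ⟨C₁ + C₂, by positivity, fun x ζ => abs_le_of_sq_le_sq' ?_ (by positivity) |>.2⟩
  have e₁ := h₁ x ζ
  have e₂ := h₂ ζ x
  rw [fourierInv_sl2_F12] at e₂
  have e₁' := e₁.trans (mul_le_mul_of_nonneg_right (le_add_of_nonneg_right hC₂ : C₁ ≤ C₁ + C₂)
    (by positivity))
  have e₂' := e₂.trans (mul_le_mul_of_nonneg_right (le_add_of_nonneg_left hC₁ : C₂ ≤ C₁ + C₂)
    (by positivity))
  rw [sq]
  refine (mul_le_mul e₁' e₂' (norm_nonneg _) (by positivity)).trans_eq ?_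
  rw [mul_pow, mul_pow, pow_mul', pow_mul', inv_pow, inv_pow]
  ring

section

variable {Λ : Matrix (Fin 2) (Fin 2) ℝ} (hΛ : IsUnit Λ.det)

theorem summable_blochFun (hΛ : IsUnit Λ.det) (φ : 𝓢(Plane, ℂ)) (p : Plane × Plane) :
    Summable fun j => φ (p.2 + latVec Λ j) * phase (-p.1) (latVec Λ j) := by
  refine Summable.of_norm ?_
  simp only [norm_mul, phase_norm, mul_one]
  exact summable_add_latVec hΛ φ p.2

/-- Fubini, with the substitution y = x + Λj in the j-th term. All exchanges are dominated by a
summable lattice factor times (1 + |x|)³ |Ψ|. -/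
theorem represents_blochFun (φ : 𝓢(Plane, ℂ)) : Represents (blochFun Λ φ) (Jt Λ hΛ (dist φ)) := by
  intro Ψ
  obtain ⟨C, hC, h⟩ := exists_norm_add_latVec_le φ Λ
  set G : (Fin 2 → ℤ) → Plane × Plane → ℂ :=
    fun j p => φ (p.2 + latVec Λ j) * phase (-p.1) (latVec Λ j) * Ψ p with hG
  have hpc : ∀ v : Plane, Continuous fun p : Plane × Plane => phase (-p.1) v := fun v => by
    unfold phase; fun_prop
  have hGc : ∀ j, Continuous (G j) := fun j =>
    ((φ.continuous.comp (continuous_snd.add continuous_const)).mul (hpc _)).mul Ψ.continuous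
  have hdom : Integrable fun p : Plane × Plane => (1 + ‖p.2‖) ^ 3 * ‖Ψ p‖ := by
    obtain ⟨D, hD, h'⟩ := exists_norm_le_one_add_norm_pow_mul Ψ 3 6
    have hi := integrable_inv_one_add_norm_pow (le_refl 3)
    refine ((hi.mul_prod hi).const_mul D).mono' ?_ (Filter.Eventually.of_forall fun p => ?_)
    · exact Continuous.aestronglyMeasurable (by fun_prop)
    · rw [Real.norm_of_nonneg (by positivity)]
      refine (mul_le_mul_of_nonneg_left (h' p.1 p.2) (by positivity)).trans_eq ?_
      rw [show 6 = 3 + 3 from rfl, pow_add]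
      field_simp
  have hb : ∀ j p, ‖G j p‖ ≤ C * ((1 + ‖latVec Λ j‖) ^ 3)⁻¹ * ((1 + ‖p.2‖) ^ 3 * ‖Ψ p‖) := by
    intro j p
    rw [norm_mul, norm_mul, phase_norm, mul_one]
    refine (mul_le_mul_of_nonneg_right (h p.2 j) (norm_nonneg _)).trans_eq (by ring)
  have hGi : ∀ j, Integrable (G j) := fun j =>
    (hdom.const_mul _).mono' (hGc j).aestronglyMeasurable (Filter.Eventually.of_forall (hb j))
  have hGs : Summable fun j => ∫ p, ‖G j p‖ := by
    refine Summable.of_nonneg_of_le (fun j => integral_nonneg fun p => norm_nonneg _) (fun j => ?_)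
      (((summable_one_add_norm_latVec hΛ).mul_left C).mul_right
        (∫ p : Plane × Plane, (1 + ‖p.2‖) ^ 3 * ‖Ψ p‖))
    rw [← integral_const_mul]
    exact integral_mono (hGi j).norm (hdom.const_mul _) (hb j)
  have hGp : ∀ p, Summable fun j => G j p := fun p => (summable_blochFun hΛ φ p).mul_right _
  have e1 : (fun p => blochFun Λ φ p * Ψ p) = fun p => blochC Λ * ∑' j, G j p := by
    ext p
    rw [hG, blochFun, tsum_mul_right, mul_assoc]
    rfl
  have hsum := hasSum_integral_of_summable_integral_norm hGi hGs
  refine ⟨?_, ?_⟩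
  · rw [e1]
    exact (integrable_tsum_of_summable hGi hGs hGp).const_mul _
  rw [Jt_apply, e1, integral_const_mul, dist_apply, pr]
  congr 1
  -- Shifting the j-th term by Λj makes the value of φ independent of j; the remaining sum over j is
  -- the direct formula for `kern Ψ`.
  set K : (Fin 2 → ℤ) → Plane × Plane → ℂ := fun j p => G j (p - (0, latVec Λ j)) with hK
  have hKi : ∀ j, Integrable (K j) := fun j => (hGi j).comp_sub_right _
  have hKp : ∀ j, ∫ p, K j p = ∫ p, G j p := fun j => integral_sub_right_eq_self (G j) _
  have hKn : ∀ j, ∫ p, ‖K j p‖ = ∫ p, ‖G j p‖ := fun j =>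
    integral_sub_right_eq_self (fun p => ‖G j p‖) _
  have hH : ∀ j y, ∫ α, K j (α, y) =
      φ y * 𝓕 (sl1 (y - latVec Λ j) Ψ) ((2 * Real.pi)⁻¹ • latVec Λ j) := by
    intro j y
    rw [fourier_inv_two_pi_smul, ← integral_const_mul]
    congr 1
    ext α
    simp only [hK, hG, Prod.mk_sub_mk, sub_zero, sub_add_cancel, sl1_apply]
    ring
  have h1 : ∀ j, ∫ y, ∫ α, K j (α, y) = ∫ p, G j p := by
    intro j
    rw [← hKp, Measure.volume_eq_prod]
    exact (integral_prod_symm _ (hKi j)).symm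
  have h2 : HasSum (fun j => ∫ y, ∫ α, K j (α, y)) (∫ y, ∑' j, ∫ α, K j (α, y)) := by
    refine hasSum_integral_of_summable_integral_norm (fun j => (hKi j).integral_prod_right) ?_
    refine Summable.of_nonneg_of_le (fun j => integral_nonneg fun p => norm_nonneg _) (fun j => ?_)
      hGs
    rw [← hKn, Measure.volume_eq_prod]
    refine le_of_le_of_eq ?_ (integral_prod_symm _ (hKi j).norm).symm
    exact integral_mono (hKi j).integral_prod_right.norm (hKi j).norm.integral_prod_right
      fun y => norm_integral_le_integral_norm _
  simp only [h1] at h2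
  rw [hsum.unique h2]
  congr 1
  ext y
  simp only [hH]
  rw [tsum_mul_left, (hasSum_kern hΛ Ψ y).tsum_eq]

/-- The Bloch transform of `kern Φ` periodizes `Φ`. -/
theorem hasSum_phase_mul_kern (Φ : 𝓢(Plane × Plane, ℂ)) (α x : Plane) :
    HasSum (fun m => phase α (latVec Λ m) * kern Λ hΛ Φ (x + latVec Λ m))
      (((|(dualMat Λ).det| : ℝ) : ℂ) *
        ∑' n, phase α (latVec Λ n) * ∑' l, Φ (α + latVec (dualMat Λ) l, x + latVec Λ n)) := by
  set T : (Fin 2 → ℤ) × (Fin 2 → ℤ) → ℂ := fun nj => phase α (latVec Λ nj.1) *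
    (phase α (latVec Λ nj.2) *
      𝓕 (sl1 (x + latVec Λ nj.1) Φ) ((2 * Real.pi)⁻¹ • latVec Λ nj.2)) with hT
  obtain ⟨C, hC, h⟩ := exists_norm_fourier_sl1_le Φ 3 3
  have hTs : Summable T := by
    have hB := isUnit_det_smul inv_two_pi_ne_zero hΛ
    have hs := (((summable_one_add_norm_latVec hΛ).mul_left (C * (1 + ‖x‖) ^ 3)).mul_of_nonneg
      (summable_one_add_norm_latVec hB) (fun _ => by positivity) (fun _ => by positivity))
    refine Summable.of_norm_bounded hs fun nj => ?_
    rw [norm_mul, norm_mul, phase_norm, phase_norm, one_mul, one_mul, ← smul_latVec]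
    refine (h _ _).trans ?_
    rw [← mul_assoc, mul_assoc C ((1 + ‖x‖) ^ 3)]
    refine mul_le_mul_of_nonneg_right (mul_le_mul_of_nonneg_left ?_ hC) (by positivity)
    exact inv_one_add_norm_add_le x (latVec Λ nj.1) 3
  have h1 := hTs.hasSum.prod_fiberwise
    (fun n => (hasSum_poisson hΛ (sl1 (x + latVec Λ n) Φ) α).mul_left (phase α (latVec Λ n)))
  -- With m = n + j the two phases combine to e^{iα·Λm}, and for fixed m the sum over j is `kern` at
  -- x + Λm. Absolute summability allows both orders of summation.
  let e : (Fin 2 → ℤ) × (Fin 2 → ℤ) ≃ (Fin 2 → ℤ) × (Fin 2 → ℤ) :=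
    { toFun := fun mj => (mj.1 - mj.2, mj.2)
      invFun := fun nj => (nj.1 + nj.2, nj.2)
      left_inv := fun mj => by simp
      right_inv := fun nj => by simp }
  have h2 : HasSum (T ∘ e) (∑' nj, T nj) := e.hasSum_iff.2 hTs.hasSum
  have h3 := h2.prod_fiberwise (g := fun m => phase α (latVec Λ m) * kern Λ hΛ Φ (x + latVec Λ m))
    fun m => by
      refine ((hasSum_kern hΛ Φ (x + latVec Λ m)).mul_left (phase α (latVec Λ m))).congr_fun
        fun j => ?_
      change phase α (latVec Λ (m - j)) * (phase α (latVec Λ j) *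
        𝓕 (sl1 (x + latVec Λ (m - j)) Φ) ((2 * Real.pi)⁻¹ • latVec Λ j)) = _
      rw [← mul_assoc, ← phase_add_right, latVec_sub, sub_add_cancel, add_sub_assoc]
  convert h3 using 1
  rw [← h1.tsum_eq, ← tsum_mul_left]
  refine tsum_congr fun n => ?_
  simp only [sl1_apply]
  ring

/-- Bloch-periodic functions with Schwartz cut-offs are Bloch transforms of Schwartz functions. -/
theorem blochFun_conjS_kern {f ρ : Plane × Plane → ℂ} {Φ : 𝓢(Plane × Plane, ℂ)}
    (hf : IsBlochTest Λ f) (hρ : IsCellPartition Λ ρ)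
    (hΦ : ∀ p, Φ p = ρ p * (starRingEnd ℂ) (f p)) :
    blochFun Λ (blochC Λ • conjS (kern Λ hΛ Φ) : 𝓢(Plane, ℂ)) = f := by
  ext ⟨α, x⟩
  have hs : HasSum (fun nl : (Fin 2 → ℤ) × (Fin 2 → ℤ) =>
      ρ (α + latVec (dualMat Λ) nl.2, x + latVec Λ nl.1)) 1 := by
    have h := hρ.2.2 α x
    have hsum : Summable fun lj : (Fin 2 → ℤ) × (Fin 2 → ℤ) =>
        ρ (α + latVec (dualMat Λ) lj.1, x + latVec Λ lj.2) := by
      by_contra hn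
      rw [tsum_eq_zero_of_not_summable hn] at h
      exact zero_ne_one h
    have h' := hsum.hasSum
    rw [h] at h'
    exact (Equiv.prodComm _ _).hasSum_iff.2 h'
  have h1 : ∀ n l, phase α (latVec Λ n) * Φ (α + latVec (dualMat Λ) l, x + latVec Λ n) =
      (starRingEnd ℂ) (f (α, x)) * ρ (α + latVec (dualMat Λ) l, x + latVec Λ n) := by
    intro n l
    rw [hΦ, hf.2.1, hf.2.2, map_mul, conj_phase]
    linear_combination ρ (α + latVec (dualMat Λ) l, x + latVec Λ n) * (starRingEnd ℂ) (f (α, x)) *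
      phase_mul_phase_neg α (latVec Λ n)
  have h2 : ∑' n, phase α (latVec Λ n) * ∑' l, Φ (α + latVec (dualMat Λ) l, x + latVec Λ n) =
      (starRingEnd ℂ) (f (α, x)) := by
    simp only [← tsum_mul_left, h1]
    have := (hs.mul_left ((starRingEnd ℂ) (f (α, x))))
    rw [mul_one] at this
    rw [← this.summable.tsum_prod, this.tsum_eq]
  have h3 := hasSum_phase_mul_kern hΛ Φ α x
  rw [h2] at h3
  rw [blochFun]
  change blochC Λ * ∑' j, (blochC Λ * (starRingEnd ℂ) (kern Λ hΛ Φ (x + latVec Λ j))) *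
    phase (-α) (latVec Λ j) = _
  have h4 : ∑' j, (blochC Λ * (starRingEnd ℂ) (kern Λ hΛ Φ (x + latVec Λ j))) *
    phase (-α) (latVec Λ j) = blochC Λ * (((|(dualMat Λ).det| : ℝ) : ℂ) * f (α, x)) := by
    have h5 := (Complex.hasSum_conj'.2 h3 : HasSum (fun m =>
      (starRingEnd ℂ) (phase α (latVec Λ m) * kern Λ hΛ Φ (x + latVec Λ m)))
      (starRingEnd ℂ (((|(dualMat Λ).det| : ℝ) : ℂ) * (starRingEnd ℂ) (f (α, x)))))
    rw [map_mul, Complex.conj_conj, Complex.conj_ofReal] at h5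
    rw [← (h5.mul_left (blochC Λ)).tsum_eq]
    refine tsum_congr fun j => ?_
    rw [map_mul, conj_phase]
    ring
  rw [h4]
  linear_combination f (α, x) * blochC_sq_mul hΛ

theorem Represents.eq_of {V : Type*} [NormedAddCommGroup V] [NormedSpace ℝ V] [MeasureSpace V]
    {f : V → ℂ} {T S : 𝓢'(V, ℂ)} (hT : Represents f T) (hS : Represents f S) : T = S := by
  ext Φ
  rw [(hT Φ).2, (hS Φ).2]

/-- Smooth Bloch functions are transforms of Schwartz functions. The test functions in the dual norm
can thereby be replaced by functions on the plane. -/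
theorem eq_Jt_dist_of_represents {f ρ : Plane × Plane → ℂ} {Φ : 𝓢(Plane × Plane, ℂ)}
    {F : 𝓢'(Plane × Plane, ℂ)} (hf : IsBlochTest Λ f) (hρ : IsCellPartition Λ ρ)
    (hΦ : ∀ p, Φ p = ρ p * (starRingEnd ℂ) (f p)) (hF : Represents f F) :
    F = Jt Λ hΛ (dist (blochC Λ • conjS (kern Λ hΛ Φ))) := by
  have := represents_blochFun hΛ (blochC Λ • conjS (kern Λ hΛ Φ))
  rw [blochFun_conjS_kern hΛ hf hρ hΦ] at this
  exact hF.eq_of this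

/-- Testing with a cut-off conjugated Bloch function is testing u with the conjugate of its
preimage: Parseval's identity at the level of distributions. -/
theorem Jt_apply_eq_conjS (u : 𝓢'(Plane, ℂ)) (Φ : 𝓢(Plane × Plane, ℂ)) :
    Jt Λ hΛ u Φ = u (conjS (blochC Λ • conjS (kern Λ hΛ Φ))) := by
  have : conjS (blochC Λ • conjS (kern Λ hΛ Φ)) = blochC Λ • kern Λ hΛ Φ := by
    ext x
    simp only [conjS_apply, smul_apply, smul_eq_mul, map_mul, conj_blochC, Complex.conj_conj]
  rw [this, map_smul, Jt_apply, smul_eq_mul]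

end

/-! ### Convergence in the Schwartz space -/

/-- Derivatives may be taken term by term, so each seminorm of a tail is at most the tail of the
corresponding series of seminorms. -/
theorem hasSum_schwartz {V ι : Type*} [NormedAddCommGroup V] [NormedSpace ℝ V] {f : ι → 𝓢(V, ℂ)}
    {g : 𝓢(V, ℂ)} (hs : ∀ k n, Summable fun i => SchwartzMap.seminorm ℂ k n (f i))
    (hp : ∀ x, HasSum (fun i => f i x) (g x)) : HasSum f g := by
  rw [HasSum, SummationFilter.unconditional_filter,
    (schwartz_withSeminorms ℂ V ℂ).tendsto_nhds]
  rintro ⟨k, n⟩ ε hε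
  have ht := tendsto_tsum_compl_atTop_zero fun i => SchwartzMap.seminorm ℂ k n (f i)
  filter_upwards [ht.eventually (gt_mem_nhds hε)] with S hS
  refine lt_of_le_of_lt ?_ hS
  have hg : (g : V → ℂ) = fun x => ∑' i, f i x := by
    ext x
    exact (hp x).tsum_eq.symm
  have hd : ∀ x, iteratedFDeriv ℝ n g x = ∑' i, iteratedFDeriv ℝ n (f i) x := by
    intro x
    rw [hg]
    exact iteratedFDeriv_tsum_apply (N := ⊤) (f := fun i => (f i : V → ℂ))
      (fun i => (f i).smooth _) (fun m _ => hs 0 m)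
      (fun m i x _ => SchwartzMap.norm_iteratedFDeriv_le_seminorm ℂ (f i) m x) le_top x
  have hsum : ∀ x, Summable fun i => iteratedFDeriv ℝ n (f i) x := fun x =>
    Summable.of_norm_bounded (hs 0 n)
      fun i => SchwartzMap.norm_iteratedFDeriv_le_seminorm ℂ (f i) n x
  refine SchwartzMap.seminorm_le_bound ℂ k n _ (tsum_nonneg fun i => apply_nonneg _ _) fun x => ?_
  have e1 : iteratedFDeriv ℝ n (∑ i ∈ S, f i - g : 𝓢(V, ℂ)) x =
      -∑' i : ↥(S : Set ι)ᶜ, iteratedFDeriv ℝ n (f i) x := by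
    have e2 : ((∑ i ∈ S, f i - g : 𝓢(V, ℂ)) : V → ℂ) = (fun y => ∑ i ∈ S, f i y) - g := by
      ext y
      simp [sum_apply]
    have hS' : ContDiff ℝ n fun y => ∑ i ∈ S, f i y := ContDiff.sum fun i _ => (f i).smooth n
    rw [e2, iteratedFDeriv_sub hS' (g.smooth n), Pi.sub_apply,
      iteratedFDeriv_fun_sum_apply fun i _ => ((f i).smooth n).contDiffAt, hd, ← (hsum x).sum_add_tsum_compl (s := S)]
    abel
  rw [e1, norm_neg]
  have e3 : ‖x‖ ^ k * ‖∑' i : ↥(S : Set ι)ᶜ, iteratedFDeriv ℝ n (f i) x‖ =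
      ‖∑' i : ↥(S : Set ι)ᶜ, ‖x‖ ^ k • iteratedFDeriv ℝ n (f i) x‖ := by
    rw [tsum_const_smul'', norm_smul, norm_pow, norm_norm]
  rw [e3]
  refine tsum_of_norm_bounded ((hs k n).subtype _).hasSum fun i => ?_
  rw [norm_smul, norm_pow, norm_norm]
  exact SchwartzMap.le_seminorm ℂ k n (f i) x

theorem exists_seminorm_sl2_le (q : Seminorm ℂ 𝓢(Plane, ℂ)) (hq : Continuous q)
    (Ψ : 𝓢(Plane × Plane, ℂ)) (N : ℕ) :
    ∃ C : ℝ, 0 ≤ C ∧ ∀ ζ, q (sl2 ζ Ψ) ≤ C * ((1 + ‖ζ‖) ^ N)⁻¹ := by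
  obtain ⟨S, C, -, h⟩ := Seminorm.bound_of_continuous (schwartz_withSeminorms ℂ Plane ℂ) q hq
  refine ⟨C * ∑ m ∈ S, 2 ^ (m.1 + N) *
    ((Finset.Iic (m.1 + N, m.2)).sup fun m => SchwartzMap.seminorm ℂ m.1 m.2) Ψ,
    by positivity, fun ζ => ?_⟩
  refine (h _).trans ?_
  change (C : ℝ) * _ ≤ _
  rw [mul_assoc, Finset.sum_mul]
  gcongr
  refine Seminorm.finset_sup_apply_le (Finset.sum_nonneg fun m _ => by positivity) fun m hm => ?_
  refine le_trans ?_ (Finset.single_le_sum (f := fun m : ℕ × ℕ => 2 ^ (m.1 + N) *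
    ((Finset.Iic (m.1 + N, m.2)).sup fun m => SchwartzMap.seminorm ℂ m.1 m.2) Ψ *
    ((1 + ‖ζ‖) ^ N)⁻¹) (fun i _ => by positivity) hm)
  refine SchwartzMap.seminorm_le_bound ℂ m.1 m.2 _ (by positivity) fun x => ?_
  exact (norm_pow_mul_iteratedFDeriv_sl2_le Ψ ζ x m.1 m.2 N).trans_eq (mul_comm _ _)

theorem hasTemperateGrowth_phase_right (v : Plane) :
    (fun α : Plane => phase α v).HasTemperateGrowth :=
  hasTemperateGrowth_phase (ContinuousLinearMap.id ℝ Plane).hasTemperateGrowth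
    (Function.HasTemperateGrowth.const v)

theorem norm_iteratedFDeriv_phase_le (v : Plane) (n : ℕ) (α : Plane) :
    ‖iteratedFDeriv ℝ n (fun α : Plane => phase α v) α‖ ≤ ‖v‖ ^ n := by
  have h := (innerSL ℝ v).iteratedFDeriv_comp_right contDiff_exp_mul_I α (i := n)
    (by exact_mod_cast le_top)
  have e : (fun α : Plane => phase α v) =
      (fun t : ℝ => Complex.exp (Complex.I * (t : ℂ))) ∘ innerSL ℝ v := by
    ext α
    rw [phase, real_inner_comm]
    rfl
  rw [e, h]
  refine (ContinuousMultilinearMap.norm_compContinuousLinearMap_le _ _).trans ?_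
  rw [norm_iteratedFDeriv_exp_mul_I]
  simp

/-- Each derivative of the phase costs at most one power of ‖v‖. The loss is polynomial in the
lattice vector and is beaten by rapidly decaying coefficients. -/
theorem exists_seminorm_phase_mul_le (h : 𝓢(Plane, ℂ)) (m : ℕ × ℕ) :
    ∃ C : ℝ, 0 ≤ C ∧ ∀ v, ((Finset.Iic m).sup fun m => SchwartzMap.seminorm ℂ m.1 m.2)
      (smulS (fun α => phase α v) h) ≤ C * (1 + ‖v‖) ^ m.2 := by
  refine ⟨∑ a ∈ Finset.Iic m, ∑ i ∈ Finset.range (a.2 + 1),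
    (a.2.choose i : ℝ) * SchwartzMap.seminorm ℂ a.1 (a.2 - i) h,
    Finset.sum_nonneg fun a _ => Finset.sum_nonneg fun i _ => by positivity, fun v => ?_⟩
  refine Seminorm.finset_sup_apply_le (mul_nonneg (Finset.sum_nonneg fun a _ =>
    Finset.sum_nonneg fun i _ => by positivity) (by positivity)) fun a ha => ?_
  have ham : a.2 ≤ m.2 := (Finset.mem_Iic.1 ha).2
  refine le_trans ?_ (mul_le_mul_of_nonneg_right (Finset.single_le_sum
    (f := fun a : ℕ × ℕ => ∑ i ∈ Finset.range (a.2 + 1),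
      (a.2.choose i : ℝ) * SchwartzMap.seminorm ℂ a.1 (a.2 - i) h)
    (fun a _ => Finset.sum_nonneg fun i _ => by positivity) ha) (by positivity))
  refine SchwartzMap.seminorm_le_bound ℂ a.1 a.2 _ (mul_nonneg
    (Finset.sum_nonneg fun i _ => by positivity) (by positivity)) fun x => ?_
  have e : (smulS (fun α => phase α v) h : Plane → ℂ) = fun α => phase α v * h α := by
    ext α
    rw [smulS_apply (hasTemperateGrowth_phase_right v)]
  rw [e]
  refine (mul_le_mul_of_nonneg_left (norm_iteratedFDeriv_mul_le
    ((hasTemperateGrowth_phase_right v).1) (h.smooth ⊤) x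
    (n := a.2) (by exact_mod_cast le_top)) (by positivity)).trans ?_
  rw [Finset.mul_sum, Finset.sum_mul]
  refine Finset.sum_le_sum fun i hi => ?_
  have hi' : i ≤ m.2 := (Nat.lt_succ_iff.1 (Finset.mem_range.1 hi)).trans ham
  have h1 : ‖iteratedFDeriv ℝ i (fun α : Plane => phase α v) x‖ ≤ (1 + ‖v‖) ^ m.2 := by
    refine (norm_iteratedFDeriv_phase_le v i x).trans ?_
    refine (pow_le_pow_left₀ (norm_nonneg v) (by linarith : ‖v‖ ≤ 1 + ‖v‖) i).trans ?_
    exact pow_le_pow_right₀ (by linarith [norm_nonneg v]) hi'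
  have h2 := SchwartzMap.le_seminorm ℂ a.1 (a.2 - i) h x
  calc ‖x‖ ^ a.1 * ((a.2.choose i : ℝ) * ‖iteratedFDeriv ℝ i (fun α : Plane => phase α v) x‖ *
        ‖iteratedFDeriv ℝ (a.2 - i) h x‖)
      = (a.2.choose i : ℝ) * (‖x‖ ^ a.1 * ‖iteratedFDeriv ℝ (a.2 - i) h x‖) *
        ‖iteratedFDeriv ℝ i (fun α : Plane => phase α v) x‖ := by ring
    _ ≤ _ := by gcongr

/-! ### Bloch-periodic distributions are Bloch transforms -/

section

variable {Λ : Matrix (Fin 2) (Fin 2) ℝ} (hΛ : IsUnit Λ.det)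

theorem latVec_eq_zero_iff {A : Matrix (Fin 2) (Fin 2) ℝ} (hA : IsUnit A.det) (j : Fin 2 → ℤ) :
    latVec A j = 0 ↔ j = 0 := by
  rw [latVec_eq hA, map_eq_zero_iff _ (latEquiv A hA).injective]
  constructor
  · intro h
    ext i
    have := congrFun h i
    simpa using this
  · rintro rfl
    ext i
    simp

/-- The integral of the partition of unity against e^{-iα·Λj} vanishes unless j = 0, by
orthogonality of characters. Hence tensoring is a right inverse of `kern` up to a constant. -/
theorem kern_tens (φ : 𝓢(Plane, ℂ)) :
    kern Λ hΛ (tens (latPartS (dualMat Λ) (isUnit_det_dualMat hΛ)) φ) =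
      ((|(dualMat Λ).det| : ℝ) : ℂ) • φ := by
  classical
  ext y
  refine (hasSum_kern hΛ _ y).unique ?_
  have h : ∀ j, 𝓕 (sl1 (y - latVec Λ j) (tens (latPartS (dualMat Λ) (isUnit_det_dualMat hΛ)) φ))
      ((2 * Real.pi)⁻¹ • latVec Λ j) =
      if j = 0 then ((|(dualMat Λ).det| : ℝ) : ℂ) * φ y else 0 := by
    intro j
    rw [fourier_inv_two_pi_smul]
    have hb : ∀ l, phase (latVec (dualMat Λ) l) (-latVec Λ j) = 1 := by
      intro l
      rw [← latVec_neg, phase_dual hΛ]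
    have e : (fun x => phase (-x) (latVec Λ j) *
        sl1 (y - latVec Λ j) (tens (latPartS (dualMat Λ) (isUnit_det_dualMat hΛ)) φ) x) =
        fun x => (latPart (dualMat Λ) (isUnit_det_dualMat hΛ) x * phase x (-latVec Λ j)) *
          φ (y - latVec Λ j) := by
      ext x
      rw [sl1_apply, tens_apply, latPartS_apply, phase_neg_right]
      ring
    rw [e, integral_mul_const, integral_latPart_phase _ hb]
    simp only [neg_eq_zero, latVec_eq_zero_iff hΛ]
    split_ifs with h0
    · rw [h0, latVec_zero, sub_zero]
    · rw [zero_mul]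
  simp only [h]
  exact hasSum_ite_eq 0 _

/-- Periodicity in α allows Φ to be replaced by h(α) times its periodization over the dual lattice.
Poisson summation expands the periodization as ∑ e^{iα·Λj} b_j(x) up to a constant. By
quasiperiodicity D cannot distinguish h e^{iα·Λj} ⊗ b_j from h tensored with a translate of b_j, and
there D vanishes. -/
theorem eq_zero_of_isBlochPeriodic {D : 𝓢'(Plane × Plane, ℂ)} (hD : IsBlochPeriodic Λ D)
    (h0 : ∀ φ, D (tens (latPartS (dualMat Λ) (isUnit_det_dualMat hΛ)) φ) = 0) : D = 0 := by
  set h := latPartS (dualMat Λ) (isUnit_det_dualMat hΛ) with hh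
  refine eq_of_forall_hasCompactSupport fun Φ hΦ => ?_
  change D Φ = 0
  have hgr : (fun p : Plane × Plane => h p.1).HasTemperateGrowth :=
    h.hasTemperateGrowth.comp hasTemperateGrowth_fst
  set Θ : (Fin 2 → ℤ) → 𝓢(Plane × Plane, ℂ) := fun l =>
    SchwartzMap.smulLeftCLM ℂ (fun p : Plane × Plane => h p.1)
      (SchwartzMap.compSubConstCLM ℂ ((-latVec (dualMat Λ) l, 0) : Plane × Plane) Φ) with hΘ
  have hΘa : ∀ l α x, Θ l (α, x) = h α * Φ (α + latVec (dualMat Λ) l, x) := by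
    intro l α x
    rw [hΘ]
    simp only
    rw [SchwartzMap.smulLeftCLM_apply_apply hgr, SchwartzMap.compSubConstCLM_apply, smul_eq_mul]
    simp
  -- Compact supports of Φ and h leave only finitely many dual lattice translates.
  obtain ⟨R₁, hR₁⟩ := hΦ.isBounded.exists_norm_le
  obtain ⟨R₂, hR₂⟩ := (hasCompactSupport_latPart (isUnit_det_dualMat hΛ)).isBounded.exists_norm_le
  set S := (finite_norm_latVec_le (isUnit_det_dualMat hΛ) (R₁ + R₂)).toFinset with hS
  have hz : ∀ l ∉ S, ∀ α x, h α * Φ (α + latVec (dualMat Λ) l, x) = 0 := by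
    intro l hl α x
    by_contra hne
    apply hl
    rw [hS, Set.Finite.mem_toFinset]
    have n1 := hR₁ _ (subset_tsupport _ (Function.mem_support.2 (right_ne_zero_of_mul hne)))
    have n2 := hR₂ _ (subset_tsupport _ (Function.mem_support.2 (left_ne_zero_of_mul hne)))
    have n3 : ‖α + latVec (dualMat Λ) l‖ ≤ ‖(α + latVec (dualMat Λ) l, x)‖ :=
      norm_fst_le (α + latVec (dualMat Λ) l, x)
    have n4 := norm_sub_le (α + latVec (dualMat Λ) l) α
    rw [add_sub_cancel_left] at n4
    change ‖latVec (dualMat Λ) l‖ ≤ R₁ + R₂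
    linarith
  have e1 : Φ = ∑ l ∈ S, SchwartzMap.compSubConstCLM ℂ
      ((latVec (dualMat Λ) l, 0) : Plane × Plane) (Θ l) := by
    ext ⟨α, x⟩
    have hs := (hasSum_latPart (isUnit_det_dualMat hΛ) α).mul_right (Φ (α, x))
    have hs' := (Equiv.neg (Fin 2 → ℤ)).hasSum_iff.2 hs
    rw [one_mul] at hs'
    have e : ∀ l, ((fun i => latPart (dualMat Λ) (isUnit_det_dualMat hΛ)
        (α + latVec (dualMat Λ) i) * Φ (α, x)) ∘ (Equiv.neg (Fin 2 → ℤ))) l =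
        h (α - latVec (dualMat Λ) l) * Φ (α - latVec (dualMat Λ) l + latVec (dualMat Λ) l, x) := by
      intro l
      rw [sub_add_cancel, hh, latPartS_apply, sub_eq_add_neg, ← latVec_neg]
      rfl
    rw [← hs'.tsum_eq, tsum_congr e, tsum_eq_sum (s := S) fun l hl => hz l hl _ _, sum_apply]
    refine Finset.sum_congr rfl fun l _ => ?_
    rw [SchwartzMap.compSubConstCLM_apply]
    simp only [Prod.mk_sub_mk, sub_zero, hΘa]
  have e2 : D Φ = D (∑ l ∈ S, Θ l) := by
    conv_lhs => rw [e1]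
    rw [map_sum, map_sum]
    refine Finset.sum_congr rfl fun l _ => ?_
    refine hD.1 l (Θ l) _ fun α x => ?_
    rw [SchwartzMap.compSubConstCLM_apply]
    simp
  rw [e2]
  set b : (Fin 2 → ℤ) → 𝓢(Plane, ℂ) :=
    fun j => 𝓕⁻ (sl2 ((2 * Real.pi)⁻¹ • latVec Λ j) (F12 Φ)) with hb
  set T : (Fin 2 → ℤ) → 𝓢(Plane × Plane, ℂ) :=
    fun j => tens (smulS (fun α => phase α (latVec Λ j)) h) (b j) with hT
  have hDT : ∀ j, D (T j) = 0 := by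
    intro j
    rw [← h0 (SchwartzMap.compSubConstCLM ℂ (latVec Λ j) (b j))]
    refine (hD.2 j (tens h (b j)) _ _ (fun α x => rfl) fun α x => ?_).symm
    rw [hT]
    simp only [tens_apply]
    rw [smulS_apply (hasTemperateGrowth_phase_right _)]
    ring
  have hsum : HasSum T (((|(dualMat Λ).det| : ℝ) : ℂ) • ∑ l ∈ S, Θ l) := by
    refine hasSum_schwartz (fun k n => ?_) fun p => ?_
    · obtain ⟨C₁, hC₁, h1⟩ := exists_seminorm_phase_mul_le h (k, n)
      let P : Seminorm ℂ 𝓢(Plane, ℂ) :=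
        (Finset.Iic (k, n)).sup fun m => SchwartzMap.seminorm ℂ m.1 m.2
      have hP : Continuous P := Seminorm.continuous_finsetSup fun m _ =>
        (schwartz_withSeminorms ℂ Plane ℂ).continuous_seminorm m
      obtain ⟨C₂, hC₂, h2⟩ := exists_seminorm_sl2_le
        -- Of the order n + 3 of decay, n pays for the derivatives of the phase, and 3 suffices for
        -- summability over a planar lattice.
        (P.comp (FourierTransform.fourierInvCLM ℂ 𝓢(Plane, ℂ)).toLinearMap)
        (hP.comp (FourierTransform.fourierInvCLM ℂ 𝓢(Plane, ℂ)).continuous) (F12 Φ) (n + 3)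
      have hB := isUnit_det_smul inv_two_pi_ne_zero hΛ
      set c : ℝ := ∑ i ∈ Finset.range (n + 1), (n.choose i : ℝ) * 2 ^ k * 2 ^ k with hc
      have hc0 : 0 ≤ c := Finset.sum_nonneg fun i _ => by positivity
      refine Summable.of_nonneg_of_le (fun j => apply_nonneg _ _) (fun j => ?_)
        ((summable_one_add_norm_latVec hB).mul_left (c * C₁ * C₂ * (2 * Real.pi) ^ n))
      have hP1 : P (smulS (fun α => phase α (latVec Λ j)) h) ≤ C₁ * (1 + ‖latVec Λ j‖) ^ n := h1 _
      have hP2 : P (b j) ≤ C₂ * ((1 + ‖(2 * Real.pi)⁻¹ • latVec Λ j‖) ^ (n + 3))⁻¹ := h2 _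
      have hP0 : 0 ≤ P (smulS (fun α => phase α (latVec Λ j)) h) := apply_nonneg _ _
      have hle : 1 + ‖latVec Λ j‖ ≤ (2 * Real.pi) * (1 + ‖(2 * Real.pi)⁻¹ • latVec Λ j‖) := by
        have := Real.pi_gt_three
        rw [norm_smul, Real.norm_of_nonneg (by positivity), mul_add, mul_one,
          mul_inv_cancel_left₀ (by positivity)]
        linarith
      have hpi := Real.pi_pos
      rw [← smul_latVec]
      calc SchwartzMap.seminorm ℂ k n (T j)
          ≤ c * P (smulS (fun α => phase α (latVec Λ j)) h) * P (b j) := by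
            refine SchwartzMap.seminorm_le_bound ℂ k n _
              (mul_nonneg (mul_nonneg hc0 hP0) (apply_nonneg _ _)) fun p => ?_
            refine (norm_pow_mul_iteratedFDeriv_tens_le _ (b j) (k, n) p).trans_eq ?_
            rw [hc]
            congr 1
            rw [Finset.sum_mul]
            refine Finset.sum_congr rfl fun i _ => ?_
            change _ * (_ * P _) * _ = _
            ring
        _ ≤ c * (C₁ * (1 + ‖latVec Λ j‖) ^ n) *
            (C₂ * ((1 + ‖(2 * Real.pi)⁻¹ • latVec Λ j‖) ^ (n + 3))⁻¹) := by
            gcongr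
        _ ≤ c * (C₁ * ((2 * Real.pi) * (1 + ‖(2 * Real.pi)⁻¹ • latVec Λ j‖)) ^ n) *
            (C₂ * ((1 + ‖(2 * Real.pi)⁻¹ • latVec Λ j‖) ^ (n + 3))⁻¹) := by
            gcongr
        _ = c * C₁ * C₂ * (2 * Real.pi) ^ n *
            ((1 + ‖(2 * Real.pi)⁻¹ • latVec Λ j‖) ^ 3)⁻¹ := by
            rw [mul_pow, pow_add]
            field_simp
    · obtain ⟨α, x⟩ := p
      have hps := (hasSum_poisson hΛ (sl1 x Φ) α).mul_left (h α)
      have e3 : h α * (((|(dualMat Λ).det| : ℝ) : ℂ) * ∑' l, sl1 x Φ (α + latVec (dualMat Λ) l)) =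
          (((|(dualMat Λ).det| : ℝ) : ℂ) • ∑ l ∈ S, Θ l) (α, x) := by
        rw [smul_apply, sum_apply, smul_eq_mul, mul_left_comm, ← tsum_mul_left]
        simp only [sl1_apply]
        rw [tsum_eq_sum (s := S) fun l hl => hz l hl α x]
        simp only [hΘa]
      rw [← e3]
      refine hps.congr_fun fun j => ?_
      simp only [hT, hb, tens_apply]
      rw [smulS_apply (hasTemperateGrowth_phase_right _), fourierInv_sl2_F12]
      ring
  have hlim : HasSum (fun j => D (T j)) (D (((|(dualMat Λ).det| : ℝ) : ℂ) • ∑ l ∈ S, Θ l)) :=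
    hsum.map D D.continuous
  simp only [hDT] at hlim
  have := hlim.unique hasSum_zero
  rw [map_smul, smul_eq_mul] at this
  refine (mul_eq_zero.1 this).resolve_left ?_
  have := (isUnit_det_dualMat hΛ).ne_zero
  simpa using this

/-- The inverse of the Bloch transform on Bloch-periodic distributions. -/
def Jinv (Λ : Matrix (Fin 2) (Fin 2) ℝ) (hΛ : IsUnit Λ.det) :
    𝓢'(Plane × Plane, ℂ) →L[ℂ] 𝓢'(Plane, ℂ) :=
  blochC Λ • PointwiseConvergenceCLM.precomp ℂ
    (tens (latPartS (dualMat Λ) (isUnit_det_dualMat hΛ)))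

theorem Jinv_apply (ψ : 𝓢'(Plane × Plane, ℂ)) (φ : 𝓢(Plane, ℂ)) : Jinv Λ hΛ ψ φ =
    blochC Λ * ψ (tens (latPartS (dualMat Λ) (isUnit_det_dualMat hΛ)) φ) := rfl

theorem Jinv_Jt (u : 𝓢'(Plane, ℂ)) : Jinv Λ hΛ (Jt Λ hΛ u) = u := by
  ext φ
  rw [Jinv_apply, Jt_apply, kern_tens, map_smul, smul_eq_mul]
  linear_combination u φ * blochC_sq_mul hΛ

/-- The difference of the two sides is Bloch-periodic, so it is enough to test it on tensors with
the partition of unity. -/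
theorem Jt_Jinv {ψ : 𝓢'(Plane × Plane, ℂ)} (hψ : IsBlochPeriodic Λ ψ) :
    Jt Λ hΛ (Jinv Λ hΛ ψ) = ψ := by
  have h : IsBlochPeriodic Λ (Jt Λ hΛ (Jinv Λ hΛ ψ) + (-1 : ℂ) • ψ) :=
    (isBlochPeriodic_Jt hΛ _).add (hψ.smul _)
  have h1 := eq_zero_of_isBlochPeriodic hΛ h fun φ => by
    change Jt Λ hΛ (Jinv Λ hΛ ψ) _ + (-1 : ℂ) * ψ _ = 0
    rw [Jt_apply, kern_tens, map_smul, smul_eq_mul, Jinv_apply]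
    linear_combination ψ (tens (latPartS (dualMat Λ) (isUnit_det_dualMat hΛ)) φ) * blochC_sq_mul hΛ
  refine sub_eq_zero.1 (Eq.trans ?_ h1)
  rw [sub_eq_add_neg, ← neg_one_smul ℂ ψ]

end

/-! ### The substitution `α = 2π ξ - v` -/

/-- The affine map `ξ ↦ 2π ξ - v`. -/
def affE (v : Plane) : Plane ≃ₜ Plane :=
  (Homeomorph.smulOfNeZero (2 * Real.pi) (by positivity)).trans (Homeomorph.subRight v)

theorem affE_apply (v ξ : Plane) : affE v ξ = (2 * Real.pi) • ξ - v := rfl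

theorem affE_symm_apply (v α : Plane) : (affE v).symm α = (2 * Real.pi)⁻¹ • (α + v) := by
  rw [Homeomorph.symm_apply_eq, affE_apply, smul_inv_smul₀ (by positivity), add_sub_cancel_right]

theorem map_affE (v : Plane) : Measure.map (affE v) volume =
    ENNReal.ofReal ((2 * Real.pi) ^ 2)⁻¹ • (volume : Measure Plane) := by
  have h : (affE v : Plane → Plane) = (fun x => x - v) ∘ ((2 * Real.pi) • ·) := rfl
  rw [h, ← Measure.map_map (measurable_sub_const v) (measurable_const_smul _),
    Measure.map_addHaar_smul _ (by positivity), Measure.map_smul,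
    (measurePreserving_sub_right volume v).map_eq]
  simp only [finrank_euclideanSpace, Fintype.card_fin]
  rw [abs_of_pos (by positivity)]

theorem integral_affE (v : Plane) (f : Plane → ℂ) :
    ∫ ξ, f (affE v ξ) = (((2 * Real.pi) ^ 2)⁻¹ : ℝ) • ∫ α, f α := by
  rw [← (affE v).measurableEmbedding.integral_map (μ := volume) f, map_affE, integral_smul_measure,
    ENNReal.toReal_ofReal (by positivity)]

theorem lintegral_affE (v : Plane) (f : Plane → ℝ≥0∞) :
    ∫⁻ ξ, f (affE v ξ) = ENNReal.ofReal ((2 * Real.pi) ^ 2)⁻¹ * ∫⁻ α, f α := by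
  rw [← (affE v).measurableEmbedding.lintegral_map (μ := volume) f, map_affE,
    lintegral_smul_measure, smul_eq_mul]

theorem ofReal_inv_two_pi_sq_ne_zero : ENNReal.ofReal ((2 * Real.pi) ^ 2)⁻¹ ≠ 0 := by
  exact (ENNReal.ofReal_pos.2 (by positivity)).ne'

theorem integrable_affE_iff {E : Type*} [NormedAddCommGroup E] (v : Plane) (f : Plane → E) :
    Integrable (fun ξ => f (affE v ξ)) ↔ Integrable f := by
  have := (affE v).measurableEmbedding.integrable_map_iff (μ := volume) (g := f)
  rw [map_affE, integrable_smul_measure ofReal_inv_two_pi_sq_ne_zero ENNReal.ofReal_ne_top] at this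
  exact this.symm

theorem ae_affE_symm {v : Plane} {p : Plane → Prop} (h : ∀ᵐ ξ, p ξ) :
    ∀ᵐ α, p ((affE v).symm α) := by
  have h1 : ∀ᵐ ξ, p ((affE v).symm (affE v ξ)) := by simpa using h
  have h2 := (affE v).measurableEmbedding.ae_map_iff (p := fun α => p ((affE v).symm α)) |>.2 h1
  rwa [map_affE, Measure.ae_ennreal_smul_measure_iff ofReal_inv_two_pi_sq_ne_zero] at h2

/-! ### Partial Fourier transforms -/

theorem exists_norm_fourierInv_sl2_le_mul (Φ : 𝓢(Plane × Plane, ℂ)) (k l : ℕ) :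
    ∃ C : ℝ, 0 ≤ C ∧ ∀ α ξ,
      ‖𝓕⁻ (sl2 α Φ) ξ‖ ≤ C * (((1 + ‖α‖) ^ k)⁻¹ * ((1 + ‖ξ‖) ^ l)⁻¹) := by
  obtain ⟨C, hC, h⟩ := exists_norm_fourier_sl1_le (swapS Φ) k l
  refine ⟨C, hC, fun α ξ => ?_⟩
  have := h α (-ξ)
  rwa [sl1_swapS, ← fourierInv_apply_neg, norm_neg] at this

theorem continuous_fourierInv_sl2 (Φ : 𝓢(Plane × Plane, ℂ)) :
    Continuous fun p : Plane × Plane => 𝓕⁻ (sl2 p.1 Φ) p.2 := by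
  obtain ⟨C, hC, h⟩ := exists_norm_le_one_add_norm_pow_mul Φ 0 3
  simp only [fourierInv_eq_phase]
  refine continuous_of_dominated (bound := fun x => C * ((1 + ‖x‖) ^ 3)⁻¹) (fun p => ?_)
    (fun p => Filter.Eventually.of_forall fun x => ?_)
    ((integrable_inv_one_add_norm_pow le_rfl).const_mul C)
    (Filter.Eventually.of_forall fun x => ?_)
  · refine Continuous.aestronglyMeasurable (Continuous.mul ?_ (sl2 p.1 Φ).continuous)
    unfold phase
    fun_prop
  · rw [norm_mul, phase_norm, one_mul, sl2_apply]
    simpa using h p.1 x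
  · refine Continuous.mul ?_ (Φ.continuous.comp (by fun_prop))
    unfold phase
    fun_prop

/-! ### Fourier coefficients of Bloch transforms -/

/-- Young's inequality against the weight. In the exponent n + 2, n absorbs the order s, and the
square of the other factor is (1 + |ξ|)⁻⁴, which is integrable on the plane. -/
theorem exists_integrable_inv_pow_mul_norm {w : Plane → ℂ} {s : ℝ} (hw : LocallyIntegrable w)
    (hfin : ∫⁻ ξ, ENNReal.ofReal ((1 + ‖ξ‖ ^ 2) ^ s) * ‖w ξ‖ₑ ^ 2 < ⊤) :
    ∃ k : ℕ, Integrable fun ξ => ((1 + ‖ξ‖) ^ k)⁻¹ * ‖w ξ‖ := by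
  set n := ⌈|s|⌉₊
  have hn : -s ≤ n := (neg_le_abs s).trans (Nat.le_ceil _)
  have hcw : Continuous fun ξ : Plane => (1 + ‖ξ‖ ^ 2) ^ s :=
    (by fun_prop : Continuous fun ξ : Plane => 1 + ‖ξ‖ ^ 2).rpow_const
      fun ξ => Or.inl (by positivity)
  have hi1 : Integrable fun ξ => (1 + ‖ξ‖ ^ 2) ^ s * ‖w ξ‖ ^ 2 := by
    refine ⟨hcw.aestronglyMeasurable.mul (hw.aestronglyMeasurable.norm.pow 2), ?_⟩
    rw [HasFiniteIntegral]
    refine lt_of_eq_of_lt ?_ hfin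
    congr 1
    ext ξ
    rw [enorm_mul, enorm_pow, enorm_norm, Real.enorm_of_nonneg (by positivity)]
  have hi2 := integrable_inv_one_add_norm_pow (k := 4) (by norm_num)
  refine ⟨n + 2, (hi1.add hi2).mono' ?_ (Filter.Eventually.of_forall fun ξ => ?_)⟩
  · refine AEStronglyMeasurable.mul (Continuous.aestronglyMeasurable ?_)
      hw.aestronglyMeasurable.norm
    exact Continuous.inv₀ (by fun_prop) fun ξ => by positivity
  · rw [Real.norm_of_nonneg (by positivity)]
    have h1 : (1 + ‖ξ‖ ^ 2) ^ (-s) ≤ (1 + ‖ξ‖) ^ (2 * n) := by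
      calc (1 + ‖ξ‖ ^ 2) ^ (-s) ≤ (1 + ‖ξ‖ ^ 2) ^ (n : ℝ) :=
            Real.rpow_le_rpow_of_exponent_le (by nlinarith [norm_nonneg ξ]) hn
        _ = (1 + ‖ξ‖ ^ 2) ^ n := Real.rpow_natCast _ _
        _ ≤ ((1 + ‖ξ‖) ^ 2) ^ n := by
            gcongr
            nlinarith [norm_nonneg ξ]
        _ = _ := by rw [← pow_mul]
    set a := (1 + ‖ξ‖ ^ 2) ^ s
    have ha : 0 < a := by positivity
    rw [Real.rpow_neg (by positivity)] at h1
    set b := (1 + ‖ξ‖) ^ n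
    have hb : 0 < b := by positivity
    have hb2 : (1 + ‖ξ‖) ^ (2 * n) = b ^ 2 := by rw [mul_comm, pow_mul]
    set d := (1 + ‖ξ‖) ^ 2
    have hd : 0 < d := by positivity
    have hd2 : (1 + ‖ξ‖) ^ 4 = d ^ 2 := by rw [← pow_mul]
    rw [Pi.add_apply, hd2, pow_add]
    rw [hb2, inv_le_iff_one_le_mul₀ ha] at h1
    have h2 : (b * d)⁻¹ * ‖w ξ‖ ≤ a * ‖w ξ‖ ^ 2 + a⁻¹ * ((b * d)⁻¹) ^ 2 := by
      have h3 : (b * d)⁻¹ * ‖w ξ‖ * a ≤ (a * ‖w ξ‖) ^ 2 + ((b * d)⁻¹) ^ 2 := by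
        have := norm_nonneg (w ξ)
        have h5 : 0 < (b * d)⁻¹ := by positivity
        nlinarith [sq_nonneg (a * ‖w ξ‖ - (b * d)⁻¹), mul_pos ha h5]
      rw [← le_div_iff₀ ha] at h3
      refine h3.trans_eq ?_
      field_simp
    refine h2.trans (add_le_add le_rfl ?_)
    rw [inv_mul_le_iff₀ ha, mul_inv, mul_pow, inv_pow, inv_pow]
    refine mul_le_mul_of_nonneg_right ?_ (by positivity)
    rwa [inv_le_iff_one_le_mul₀ (by positivity), mul_comm]

section

variable {Λ : Matrix (Fin 2) (Fin 2) ℝ} (hΛ : IsUnit Λ.det)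

/-- The Fourier coefficients of the Bloch transform of the distribution with Fourier
transform `w`. -/
def blochCoeff (Λ : Matrix (Fin 2) (Fin 2) ℝ) (w : Plane → ℂ) (j : Fin 2 → ℤ) (α : Plane) : ℂ :=
  ((2 * Real.pi)⁻¹ : ℝ) * w ((affE (latVec (dualMat Λ) j)).symm α)

theorem blochCoeff_affE (w : Plane → ℂ) (j : Fin 2 → ℤ) (ξ : Plane) :
    blochCoeff Λ w j (affE (latVec (dualMat Λ) j) ξ) = ((2 * Real.pi)⁻¹ : ℝ) * w ξ := by
  rw [blochCoeff, Homeomorph.symm_apply_apply]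

theorem norm_latVec_le_affE (v ξ : Plane) (k : ℕ) :
    ((1 + ‖affE v ξ‖) ^ k)⁻¹ ≤ (2 * Real.pi) ^ k * (1 + ‖ξ‖) ^ k * ((1 + ‖v‖) ^ k)⁻¹ := by
  have h := inv_one_add_norm_add_le ((2 * Real.pi) • ξ) (-v) k
  rw [← sub_eq_add_neg, norm_neg] at h
  refine h.trans ?_
  rw [← mul_pow]
  have hp := Real.pi_gt_three
  gcongr
  rw [norm_smul, Real.norm_of_nonneg (by positivity), mul_add]
  linarith

theorem blochC_mul_abs_det (hΛ : IsUnit Λ.det) :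
    blochC Λ * ((|(dualMat Λ).det| : ℝ) : ℂ) =
      ((2 * Real.pi : ℝ) : ℂ) * ((|Λ.det| ^ (-(1 / 2) : ℝ) : ℝ) : ℂ) := by
  have h := abs_pos.2 hΛ.ne_zero
  rw [blochC, abs_det_dualMat, ← Complex.ofReal_mul, ← Complex.ofReal_mul]
  congr 1
  rw [Real.rpow_neg h.le, ← Real.sqrt_eq_rpow]
  have h1 := Real.sqrt_pos.2 h
  have h2 := Real.mul_self_sqrt h.le
  have := Real.pi_pos
  field_simp
  nlinarith

/-- Testing û against the frequency formula for `kern Φ` splits it into a sum over the dual lattice.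
The substitution α = 2πξ - Λ*j turns the j-th term into the j-th term of the Fourier series. The
weighted L² bound serves for integrability and for the absolute convergence of the series. -/
theorem hasFourierCoeff_Jt {u : 𝓢'(Plane, ℂ)} {w : Plane → ℂ} (hw : Represents w (𝓕 u)) {s : ℝ}
    (hfin : ∫⁻ ξ, ENNReal.ofReal ((1 + ‖ξ‖ ^ 2) ^ s) * ‖w ξ‖ₑ ^ 2 < ⊤) :
    HasFourierCoeff Λ (Jt Λ hΛ u) (blochCoeff Λ w) := by
  obtain ⟨k, hk⟩ := exists_integrable_inv_pow_mul_norm hw.locallyIntegrable hfin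
  have hwm := hw.locallyIntegrable.aestronglyMeasurable
  have hcm : ∀ j, AEStronglyMeasurable (blochCoeff Λ w j) := by
    intro j
    refine AEStronglyMeasurable.const_mul ?_ _
    obtain ⟨w', hw', he⟩ := hwm
    exact ⟨fun α => w' ((affE (latVec (dualMat Λ) j)).symm α),
      hw'.comp_measurable (affE _).symm.continuous.measurable, ae_affE_symm he⟩
  have hci : ∀ j, Integrable fun α => ((1 + ‖α‖) ^ k)⁻¹ * ‖blochCoeff Λ w j α‖ := by
    intro j
    rw [← integrable_affE_iff (latVec (dualMat Λ) j)]
    refine (hk.const_mul (((1 + ‖-latVec (dualMat Λ) j‖) ^ k * (2 * Real.pi)⁻¹))).mono' ?_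
      (Filter.Eventually.of_forall fun ξ => ?_)
    · simp only [blochCoeff_affE]
      refine AEStronglyMeasurable.mul (Continuous.aestronglyMeasurable ?_)
        (hwm.const_mul _).norm
      exact Continuous.inv₀ (by fun_prop) fun ξ => by positivity
    · rw [Real.norm_of_nonneg (by positivity), blochCoeff_affE, norm_mul, Complex.norm_real,
        Real.norm_of_nonneg (by positivity : 0 ≤ (2 * Real.pi)⁻¹)]
      have h1 := inv_one_add_norm_add_le (-latVec (dualMat Λ) j) ((2 * Real.pi) • ξ) k
      have h2 : ((1 + ‖(2 * Real.pi) • ξ‖) ^ k)⁻¹ ≤ ((1 + ‖ξ‖) ^ k)⁻¹ := by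
        have hp := Real.pi_gt_three
        rw [norm_smul, Real.norm_of_nonneg (by positivity)]
        gcongr
        nlinarith [norm_nonneg ξ]
      rw [neg_add_eq_sub] at h1
      rw [affE_apply]
      calc _ ≤ ((1 + ‖-latVec (dualMat Λ) j‖) ^ k * ((1 + ‖ξ‖) ^ k)⁻¹) *
            ((2 * Real.pi)⁻¹ * ‖w ξ‖) := by
            gcongr
            exact h1.trans (by gcongr)
        _ = _ := by ring
  have hint : ∀ j (Φ : 𝓢(Plane × Plane, ℂ)),
      Integrable fun p : Plane × Plane => blochCoeff Λ w j p.1 * Φ p := by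
    intro j Φ
    obtain ⟨C, hC, h⟩ := exists_norm_le_one_add_norm_pow_mul Φ k 3
    refine (((hci j).mul_prod (integrable_inv_one_add_norm_pow (le_refl 3))).const_mul C).mono' ?_
      (Filter.Eventually.of_forall fun p => ?_)
    · exact (hcm j).comp_fst.mul Φ.continuous.aestronglyMeasurable
    · rw [norm_mul]
      refine (mul_le_mul_of_nonneg_left (h p.1 p.2) (norm_nonneg _)).trans_eq ?_
      ring
  refine ⟨fun j => ?_, hint, fun Φ => ?_⟩
  · have hc : Continuous fun α : Plane => (1 + ‖α‖) ^ k := by fun_prop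
    have := ((hci j).locallyIntegrable.continuous_smul hc).congr
      (g := fun α => ‖blochCoeff Λ w j α‖) (Filter.Eventually.of_forall fun α => ?_)
    · exact this.mono (hcm j) (Filter.Eventually.of_forall fun α => by simp)
    · simp only [smul_eq_mul]
      rw [mul_inv_cancel_left₀ (by positivity)]
  set g : (Fin 2 → ℤ) → Plane → ℂ :=
    fun j ξ => w ξ * 𝓕⁻ (sl2 (affE (latVec (dualMat Λ) j) ξ) Φ) ξ with hg
  have hterm : ∀ j, ∫ p : Plane × Plane,
      blochCoeff Λ w j p.1 * ((|Λ.det| ^ (-(1 / 2) : ℝ) : ℝ) : ℂ) *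
        phase (latVec (dualMat Λ) j + p.1) p.2 * Φ p =
      blochC Λ * ((|(dualMat Λ).det| : ℝ) : ℂ) * ∫ ξ, g j ξ := by
    intro j
    have hi := integrable_series_term Φ ((|Λ.det| ^ (-(1 / 2) : ℝ) : ℝ) : ℂ)
      (latVec (dualMat Λ) j) (hint j Φ)
    have e1 : ∀ ξ, ∫ x, blochCoeff Λ w j (affE (latVec (dualMat Λ) j) ξ) *
        ((|Λ.det| ^ (-(1 / 2) : ℝ) : ℝ) : ℂ) *
        phase (latVec (dualMat Λ) j + affE (latVec (dualMat Λ) j) ξ) x *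
          Φ (affE (latVec (dualMat Λ) j) ξ, x) =
        (((2 * Real.pi)⁻¹ : ℝ) : ℂ) * ((|Λ.det| ^ (-(1 / 2) : ℝ) : ℝ) : ℂ) * g j ξ := by
      intro ξ
      simp only [blochCoeff_affE, hg]
      rw [fourierInv_eq_phase, ← mul_assoc, ← integral_const_mul]
      congr 1
      ext x
      rw [affE_apply, add_sub_cancel, sl2_apply, phase_comm x]
      ring
    have e2 := integral_affE (latVec (dualMat Λ) j) fun α => ∫ x, blochCoeff Λ w j α *
        ((|Λ.det| ^ (-(1 / 2) : ℝ) : ℝ) : ℂ) *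
        phase (latVec (dualMat Λ) j + α) x * Φ (α, x)
    simp only [e1] at e2
    rw [Measure.volume_eq_prod, integral_prod _ hi, blochC_mul_abs_det hΛ]
    rw [integral_const_mul, eq_comm, inv_smul_eq_iff₀ (by positivity)] at e2
    refine e2.trans ?_
    rw [Complex.real_smul]
    have := Real.pi_ne_zero
    push_cast
    field_simp
  simp only [hterm]
  have hJ : Jt Λ hΛ u Φ = blochC Λ * ∫ ξ, w ξ * 𝓕⁻ (kern Λ hΛ Φ) ξ := by
    rw [Jt_apply, ← (hw _).2, TemperedDistribution.fourier_apply,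
      FourierTransform.fourier_fourierInv_eq]
  have hk2 : ∀ ξ, w ξ * 𝓕⁻ (kern Λ hΛ Φ) ξ = ((|(dualMat Λ).det| : ℝ) : ℂ) * ∑' j, g j ξ := by
    intro ξ
    rw [fourierInv_kern, hg]
    simp only
    rw [tsum_mul_left, ← (Equiv.neg (Fin 2 → ℤ)).tsum_eq
      (fun l => 𝓕⁻ (sl2 ((2 * Real.pi) • ξ + latVec (dualMat Λ) l) Φ) ξ), mul_left_comm]
    simp only [Equiv.neg_apply, latVec_neg, affE_apply, sub_eq_add_neg]
  rw [hJ]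
  simp only [hk2]
  rw [integral_const_mul, ← mul_assoc]
  refine HasSum.mul_left _ ?_
  obtain ⟨C, hC, hb⟩ := exists_norm_fourierInv_sl2_le_mul Φ 3 (k + 3)
  have hgb : ∀ j ξ, ‖g j ξ‖ ≤ C * (2 * Real.pi) ^ 3 * ((1 + ‖latVec (dualMat Λ) j‖) ^ 3)⁻¹ *
      (((1 + ‖ξ‖) ^ k)⁻¹ * ‖w ξ‖) := by
    intro j ξ
    rw [hg, norm_mul]
    have := norm_latVec_le_affE (latVec (dualMat Λ) j) ξ 3
    calc ‖w ξ‖ * ‖𝓕⁻ (sl2 (affE (latVec (dualMat Λ) j) ξ) Φ) ξ‖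
        ≤ ‖w ξ‖ * (C * (((1 + ‖affE (latVec (dualMat Λ) j) ξ‖) ^ 3)⁻¹ *
          ((1 + ‖ξ‖) ^ (k + 3))⁻¹)) := by
          gcongr
          exact hb _ _
      _ ≤ ‖w ξ‖ * (C * (((2 * Real.pi) ^ 3 * (1 + ‖ξ‖) ^ 3 *
          ((1 + ‖latVec (dualMat Λ) j‖) ^ 3)⁻¹) * ((1 + ‖ξ‖) ^ (k + 3))⁻¹)) := by
          gcongr
      _ = _ := by
          rw [pow_add]
          field_simp
  have hgi : ∀ j, Integrable (g j) := fun j => (hk.const_mul _).mono'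
    (hwm.mul (((continuous_fourierInv_sl2 Φ).comp
      ((affE _).continuous.prodMk continuous_id)).aestronglyMeasurable))
    (Filter.Eventually.of_forall (hgb j))
  refine hasSum_integral_of_summable_integral_norm hgi ?_
  refine Summable.of_nonneg_of_le (fun j => integral_nonneg fun ξ => norm_nonneg _) (fun j => ?_)
    (((summable_one_add_norm_latVec (isUnit_det_dualMat hΛ)).mul_left
      (C * (2 * Real.pi) ^ 3)).mul_right (∫ ξ, ((1 + ‖ξ‖) ^ k)⁻¹ * ‖w ξ‖))
  rw [← integral_const_mul]
  exact integral_mono (hgi j).norm (hk.const_mul _) (hgb j)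

/-! ### Recovering the Fourier transform from the coefficients -/

/-- A test function that singles out one Fourier coefficient. -/
def coeffTest (Λ : Matrix (Fin 2) (Fin 2) ℝ) (hΛ : IsUnit Λ.det) (k : Fin 2 → ℤ)
    (h : 𝓢(Plane, ℂ)) : 𝓢(Plane × Plane, ℂ) :=
  SchwartzMap.smulLeftCLM ℂ
    (fun p : Plane × Plane => phase (-(latVec (dualMat Λ) k + p.1)) p.2) (tens h (latPartS Λ hΛ))

theorem coeffTest_apply (k : Fin 2 → ℤ) (h : 𝓢(Plane, ℂ)) (α x : Plane) :
    coeffTest Λ hΛ k h (α, x) =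
      phase (-(latVec (dualMat Λ) k + α)) x * (h α * latPart Λ hΛ x) := by
  have hg : (fun p : Plane × Plane => phase (-(latVec (dualMat Λ) k + p.1)) p.2).HasTemperateGrowth :=
    hasTemperateGrowth_phase
      ((Function.HasTemperateGrowth.const _).add hasTemperateGrowth_fst).neg hasTemperateGrowth_snd
  rw [coeffTest, SchwartzMap.smulLeftCLM_apply_apply hg, tens_apply, latPartS_apply, smul_eq_mul]

theorem integral_latPart_phase_dual [DecidableEq (Fin 2 → ℤ)] (j : Fin 2 → ℤ) :
    ∫ x, latPart Λ hΛ x * phase x (latVec (dualMat Λ) j) =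
      if j = 0 then ((|Λ.det| : ℝ) : ℂ) else 0 := by
  classical
  rw [integral_latPart_phase hΛ fun l => by rw [phase_comm, phase_dual hΛ]]
  simp only [latVec_eq_zero_iff (isUnit_det_dualMat hΛ)]

/-- In the sum over the dual lattice, integration in x against the partition of unity kills all
terms with l ≠ k by orthogonality. -/
theorem fourierInv_kern_coeffTest (k : Fin 2 → ℤ) (h : 𝓢(Plane, ℂ)) (ξ : Plane) :
    𝓕⁻ (kern Λ hΛ (coeffTest Λ hΛ k h)) ξ =
      ((|(dualMat Λ).det| : ℝ) : ℂ) * (((|Λ.det| : ℝ) : ℂ) * h (affE (latVec (dualMat Λ) k) ξ)) := by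
  classical
  rw [fourierInv_kern, ← (Equiv.neg (Fin 2 → ℤ)).tsum_eq, tsum_eq_single k]
  · rw [Equiv.neg_apply, latVec_neg, ← sub_eq_add_neg, ← affE_apply, fourierInv_eq_phase]
    have e : (fun x => phase x ((2 * Real.pi) • ξ) *
        sl2 (affE (latVec (dualMat Λ) k) ξ) (coeffTest Λ hΛ k h) x) =
        fun x => (latPart Λ hΛ x * phase x (latVec (dualMat Λ) 0)) *
          h (affE (latVec (dualMat Λ) k) ξ) := by
      ext x
      rw [sl2_apply, coeffTest_apply, affE_apply, add_sub_cancel, latVec_zero, phase_zero_right,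
        phase_comm x]
      linear_combination h ((2 * Real.pi) • ξ - latVec (dualMat Λ) k) * latPart Λ hΛ x *
        phase_mul_phase_neg ((2 * Real.pi) • ξ) x
    rw [e, integral_mul_const, integral_latPart_phase_dual, if_pos rfl]
  · intro l hl
    rw [Equiv.neg_apply, latVec_neg, ← sub_eq_add_neg, fourierInv_eq_phase]
    have e : (fun x => phase x ((2 * Real.pi) • ξ) *
        sl2 ((2 * Real.pi) • ξ - latVec (dualMat Λ) l) (coeffTest Λ hΛ k h) x) =
        fun x => (latPart Λ hΛ x * phase x (latVec (dualMat Λ) (l - k))) *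
          h ((2 * Real.pi) • ξ - latVec (dualMat Λ) l) := by
      ext x
      have e1 : phase (-(latVec (dualMat Λ) k + ((2 * Real.pi) • ξ - latVec (dualMat Λ) l))) x =
          phase (-((2 * Real.pi) • ξ)) x * phase x (latVec (dualMat Λ) (l - k)) := by
        rw [phase_comm x, ← phase_add_left, latVec_sub]
        congr 1
        abel
      rw [sl2_apply, coeffTest_apply, e1, phase_comm x ((2 * Real.pi) • ξ)]
      linear_combination phase x (latVec (dualMat Λ) (l - k)) *
        h ((2 * Real.pi) • ξ - latVec (dualMat Λ) l) * latPart Λ hΛ x *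
        phase_mul_phase_neg ((2 * Real.pi) • ξ) x
    rw [e, integral_mul_const, integral_latPart_phase_dual, if_neg (sub_ne_zero.2 hl), zero_mul]

/-- The Fourier coefficients of a Bloch transform determine the Fourier transform. -/
theorem HasFourierCoeff.represents {u : 𝓢'(Plane, ℂ)} {c : (Fin 2 → ℤ) → Plane → ℂ}
    (hc : HasFourierCoeff Λ (Jt Λ hΛ u) c) (k : Fin 2 → ℤ) :
    Represents (fun ξ => ((2 * Real.pi : ℝ) : ℂ) * c k (affE (latVec (dualMat Λ) k) ξ)) (𝓕 u) := by
  classical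
  have hdet : (((|Λ.det| : ℝ) : ℝ) : ℂ) ≠ 0 := by
    have := hΛ.ne_zero
    simpa using this
  have hint : ∀ h : 𝓢(Plane, ℂ), Integrable fun α => c k α * h α := by
    intro h
    have h1 := (hc.2.1 k (tens h (latPartS Λ hΛ))).integral_prod_left
    have e : (fun α => ∫ x, c k α * tens h (latPartS Λ hΛ) (α, x)) =
        fun α => (c k α * h α) * ((|Λ.det| : ℝ) : ℂ) := by
      ext α
      have h2 := integral_latPart_phase_dual hΛ 0
      rw [latVec_zero, if_pos rfl] at h2
      simp only [phase_zero_right, mul_one] at h2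
      rw [← h2, ← integral_const_mul]
      congr 1
      ext x
      rw [tens_apply, latPartS_apply]
      ring
    simp only [e] at h1
    refine (h1.mul_const (((|Λ.det| : ℝ) : ℂ)⁻¹)).congr (Filter.Eventually.of_forall fun α => ?_)
    simp only
    rw [mul_inv_cancel_right₀ hdet]
  have hval : ∀ h : 𝓢(Plane, ℂ), Jt Λ hΛ u (coeffTest Λ hΛ k h) =
      ((|Λ.det| ^ (-(1 / 2) : ℝ) : ℝ) : ℂ) * ((|Λ.det| : ℝ) : ℂ) * ∫ α, c k α * h α := by
    intro h
    refine (hc.2.2 (coeffTest Λ hΛ k h)).unique ?_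
    have e : ∀ j, ∫ p : Plane × Plane, c j p.1 * ((|Λ.det| ^ (-(1 / 2) : ℝ) : ℝ) : ℂ) *
        phase (latVec (dualMat Λ) j + p.1) p.2 * coeffTest Λ hΛ k h p =
        if j = k then ((|Λ.det| ^ (-(1 / 2) : ℝ) : ℝ) : ℂ) * ((|Λ.det| : ℝ) : ℂ) *
          ∫ α, c k α * h α else 0 := by
      intro j
      have e1 : (fun p : Plane × Plane => c j p.1 * ((|Λ.det| ^ (-(1 / 2) : ℝ) : ℝ) : ℂ) *
          phase (latVec (dualMat Λ) j + p.1) p.2 * coeffTest Λ hΛ k h p) =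
          fun p : Plane × Plane => (c j p.1 * h p.1 * ((|Λ.det| ^ (-(1 / 2) : ℝ) : ℝ) : ℂ)) *
            (latPart Λ hΛ p.2 * phase p.2 (latVec (dualMat Λ) (j - k))) := by
        ext ⟨α, x⟩
        have e2 : phase (latVec (dualMat Λ) j + α) x * phase (-(latVec (dualMat Λ) k + α)) x =
            phase x (latVec (dualMat Λ) (j - k)) := by
          rw [phase_comm x, ← phase_add_left, latVec_sub]
          congr 1
          abel
        simp only [coeffTest_apply]
        rw [← e2]
        ring
      rw [e1, Measure.volume_eq_prod, integral_prod_mul (fun α => c j α * h α *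
        ((|Λ.det| ^ (-(1 / 2) : ℝ) : ℝ) : ℂ)) (fun x => latPart Λ hΛ x *
          phase x (latVec (dualMat Λ) (j - k))), integral_latPart_phase_dual, integral_mul_const]
      simp only [sub_eq_zero]
      split_ifs with hj
      · rw [hj]
        ring
      · rw [mul_zero]
    simp only [e]
    exact hasSum_ite_eq k _
  intro g
  set h : 𝓢(Plane, ℂ) := SchwartzMap.compSubConstCLM ℂ (-latVec (dualMat Λ) k)
    (SchwartzMap.compCLMOfContinuousLinearEquiv ℂ
      (ContinuousLinearEquiv.smulLeft (Units.mk0 ((2 * Real.pi)⁻¹ : ℝ) (by positivity))) g) with hh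
  have hha : ∀ ξ, h (affE (latVec (dualMat Λ) k) ξ) = g ξ := by
    intro ξ
    change g ((2 * Real.pi)⁻¹ • (affE (latVec (dualMat Λ) k) ξ - -latVec (dualMat Λ) k)) = g ξ
    rw [affE_apply, sub_neg_eq_add, sub_add_cancel, inv_smul_smul₀ (by positivity)]
  have hfun : (fun ξ => ((2 * Real.pi : ℝ) : ℂ) * c k (affE (latVec (dualMat Λ) k) ξ) * g ξ) =
      fun ξ => ((2 * Real.pi : ℝ) : ℂ) * (fun α => c k α * h α) (affE (latVec (dualMat Λ) k) ξ) := by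
    ext ξ
    simp only [hha]
    ring
  rw [hfun]
  refine ⟨((integrable_affE_iff _ _).2 (hint h)).const_mul _, ?_⟩
  rw [integral_const_mul, integral_affE _ fun α => c k α * h α]
  have h1 := hval h
  have h2 : 𝓕⁻ (kern Λ hΛ (coeffTest Λ hΛ k h)) =
      (((|(dualMat Λ).det| : ℝ) : ℂ) * ((|Λ.det| : ℝ) : ℂ)) • g := by
    ext ξ
    rw [fourierInv_kern_coeffTest, hha, smul_apply, smul_eq_mul, mul_assoc]
  have h3 : u (kern Λ hΛ (coeffTest Λ hΛ k h)) =
      (((|(dualMat Λ).det| : ℝ) : ℂ) * ((|Λ.det| : ℝ) : ℂ)) * 𝓕 u g := by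
    rw [← smul_eq_mul, ← map_smul, ← h2, TemperedDistribution.fourier_apply,
      FourierTransform.fourier_fourierInv_eq]
  have hpow : ((|Λ.det| ^ (-(1 / 2) : ℝ) : ℝ) : ℂ) ≠ 0 := by
    rw [Complex.ofReal_ne_zero]
    exact (Real.rpow_pos_of_pos (abs_pos.2 hΛ.ne_zero) _).ne'
  rw [Jt_apply, h3, ← mul_assoc, ← mul_assoc, blochC_mul_abs_det hΛ] at h1
  have hpi : ((Real.pi : ℝ) : ℂ) ≠ 0 := by simp [Real.pi_ne_zero]
  have h4 : ((2 * Real.pi : ℝ) : ℂ) * 𝓕 u g = ∫ α, c k α * h α := by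
    refine mul_left_cancel₀ (mul_ne_zero hpow hdet) ?_
    linear_combination h1
  rw [← h4, Complex.real_smul]
  push_cast
  field_simp

end

/-! ### The norm of `L²(W*; H^s_α(W))` of Bloch transforms -/

theorem rpow_le_mul_rpow {a b K : ℝ} (s : ℝ) (ha : 0 < a) (hb : 0 < b) (hK : 1 ≤ K)
    (h₁ : a ≤ K * b) (h₂ : b ≤ K * a) : a ^ s ≤ K ^ |s| * b ^ s := by
  have hK0 : 0 < K := by linarith
  rcases le_or_gt 0 s with hs | hs
  · rw [abs_of_nonneg hs, ← Real.mul_rpow hK0.le hb.le]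
    exact Real.rpow_le_rpow ha.le h₁ hs
  · rw [abs_of_neg hs]
    have h3 : K⁻¹ * b ≤ a := by rwa [inv_mul_le_iff₀ hK0]
    have h4 := Real.rpow_le_rpow_of_nonpos (by positivity) h3 hs.le
    rwa [Real.mul_rpow (by positivity) hb.le, Real.inv_rpow hK0.le, ← Real.rpow_neg hK0.le] at h4

section

variable {Λ : Matrix (Fin 2) (Fin 2) ℝ} (hΛ : IsUnit Λ.det)

theorem exists_norm_cell_le {A : Matrix (Fin 2) (Fin 2) ℝ} (hA : IsUnit A.det) :
    ∃ R : ℝ, ∀ α ∈ cell A, ‖α‖ ≤ R := by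
  refine ⟨‖(latEquiv A hA : (Fin 2 → ℝ) →L[ℝ] Plane)‖, ?_⟩
  rintro α ⟨z, hz, rfl⟩
  have h := (latEquiv A hA : (Fin 2 → ℝ) →L[ℝ] Plane).le_opNorm z
  have hz1 : ‖z‖ ≤ 1 := by
    refine (pi_norm_le_iff_of_nonneg zero_le_one).2 fun i => ?_
    rw [Real.norm_eq_abs, abs_le]
    constructor <;> linarith [(hz i).1, (hz i).2]
  refine h.trans ?_
  exact mul_le_of_le_one_right (norm_nonneg _) hz1

theorem norm_latVec_le {A : Matrix (Fin 2) (Fin 2) ℝ} (hA : IsUnit A.det) (j : Fin 2 → ℤ) :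
    ‖latVec A j‖ ≤ ‖(latEquiv A hA : (Fin 2 → ℝ) →L[ℝ] Plane)‖ * ‖j‖ := by
  have h := (latEquiv A hA : (Fin 2 → ℝ) →L[ℝ] Plane).le_opNorm fun i => (j i : ℝ)
  have e : ‖fun i => (j i : ℝ)‖ = ‖j‖ := by
    simp only [Pi.norm_def]
    congr 1
  rw [e] at h
  exact h

theorem latWeight_bounds (j : Fin 2 → ℤ) :
    1 + ‖j‖ ^ 2 ≤ latWeight j ∧ latWeight j ≤ 1 + 2 * ‖j‖ ^ 2 := by
  have h0 : ‖j 0‖ ≤ ‖j‖ := norm_le_pi_norm j 0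
  have h1 : ‖j 1‖ ≤ ‖j‖ := norm_le_pi_norm j 1
  have e0 : (j 0 : ℝ) ^ 2 = ‖j 0‖ ^ 2 := by rw [Int.norm_eq_abs, sq_abs]
  have e1 : (j 1 : ℝ) ^ 2 = ‖j 1‖ ^ 2 := by rw [Int.norm_eq_abs, sq_abs]
  have n0 := norm_nonneg (j 0)
  have n1 := norm_nonneg (j 1)
  rw [latWeight, e0, e1]
  constructor
  · have : ‖j‖ ≤ max ‖j 0‖ ‖j 1‖ := by
      refine (pi_norm_le_iff_of_nonneg (le_max_of_le_left n0)).2 fun i => ?_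
      fin_cases i
      · exact le_max_left _ _
      · exact le_max_right _ _
    have hn := norm_nonneg j
    rcases le_max_iff.1 this with h | h <;> nlinarith
  · nlinarith

theorem latWeight_pos (j : Fin 2 → ℤ) : 0 < latWeight j := by
  unfold latWeight
  positivity

/-- Here 2πξ = α + Λ*j with α in a bounded cell, and |Λ*j| is comparable to |j|. So the weights in ξ
and in j agree up to constants. -/
theorem exists_latWeight_comparable (hΛ : IsUnit Λ.det) : ∃ K : ℝ, 1 ≤ K ∧
    ∀ j, ∀ α ∈ cell (dualMat Λ),
      1 + ‖(affE (latVec (dualMat Λ) j)).symm α‖ ^ 2 ≤ K * latWeight j ∧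
      latWeight j ≤ K * (1 + ‖(affE (latVec (dualMat Λ) j)).symm α‖ ^ 2) := by
  have hB := isUnit_det_dualMat hΛ
  obtain ⟨R, hR⟩ := exists_norm_cell_le hB
  obtain ⟨C, hC, hj⟩ := exists_norm_le_latVec hB
  set M := ‖(latEquiv (dualMat Λ) hB : (Fin 2 → ℝ) →L[ℝ] Plane)‖
  have hM : 0 ≤ M := norm_nonneg _
  have hpi := Real.pi_gt_three
  refine ⟨(1 + 2 * R ^ 2 + 2 * M ^ 2) + (1 + 4 * C ^ 2 * R ^ 2 + 4 * C ^ 2 * (2 * Real.pi) ^ 2),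
    by nlinarith [sq_nonneg R, sq_nonneg M, sq_nonneg (C * R), sq_nonneg (C * (2 * Real.pi))],
    fun j α hα => ?_⟩
  set ξ := (affE (latVec (dualMat Λ) j)).symm α with hξ
  have hαξ : α = (2 * Real.pi) • ξ - latVec (dualMat Λ) j := by
    rw [← affE_apply, hξ, Homeomorph.apply_symm_apply]
  have hRα := hR α hα
  have hα0 := norm_nonneg α
  have hR0 : 0 ≤ R := hα0.trans hRα
  have hξ0 := norm_nonneg ξ
  have hj0 := norm_nonneg j
  obtain ⟨w1, w2⟩ := latWeight_bounds j
  have hv := norm_latVec_le hB j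
  have hv0 := norm_nonneg (latVec (dualMat Λ) j)
  have n1 : ‖(2 * Real.pi) • ξ‖ = 2 * Real.pi * ‖ξ‖ := by
    rw [norm_smul, Real.norm_of_nonneg (by positivity)]
  have b1 : ‖ξ‖ ≤ R + M * ‖j‖ := by
    have : 2 * Real.pi * ‖ξ‖ ≤ ‖α‖ + ‖latVec (dualMat Λ) j‖ := by
      rw [← n1]
      have := norm_add_le α (latVec (dualMat Λ) j)
      rwa [hαξ, sub_add_cancel, ← hαξ] at this
    nlinarith
  have b2 : ‖latVec (dualMat Λ) j‖ ≤ 2 * Real.pi * ‖ξ‖ + R := by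
    have := norm_sub_le ((2 * Real.pi) • ξ) α
    rw [n1] at this
    have e : (2 * Real.pi) • ξ - α = latVec (dualMat Λ) j := by rw [hαξ]; abel
    rw [e] at this
    linarith
  have b3 : ‖j‖ ≤ C * (2 * Real.pi * ‖ξ‖ + R) :=
    (hj j).trans (mul_le_mul_of_nonneg_left b2 hC.le)
  have s1 : ‖ξ‖ ^ 2 ≤ 2 * R ^ 2 + 2 * M ^ 2 * ‖j‖ ^ 2 := by
    have := pow_le_pow_left₀ hξ0 b1 2
    nlinarith [sq_nonneg (R - M * ‖j‖)]
  have s2 : ‖j‖ ^ 2 ≤ 2 * C ^ 2 * R ^ 2 + 2 * C ^ 2 * (2 * Real.pi) ^ 2 * ‖ξ‖ ^ 2 := by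
    have := pow_le_pow_left₀ hj0 b3 2
    nlinarith [sq_nonneg (C * R - C * (2 * Real.pi * ‖ξ‖))]
  have q1 : 0 ≤ R ^ 2 := sq_nonneg R
  have q2 : 0 ≤ M ^ 2 := sq_nonneg M
  have q3 : 0 ≤ C ^ 2 * R ^ 2 := by positivity
  have q4 : 0 ≤ C ^ 2 * (2 * Real.pi) ^ 2 := by positivity
  have q5 : 0 ≤ ‖ξ‖ ^ 2 := sq_nonneg _
  have q6 : 0 ≤ ‖j‖ ^ 2 := sq_nonneg _
  constructor
  · have hX : 0 ≤ 1 + 4 * C ^ 2 * R ^ 2 + 4 * C ^ 2 * (2 * Real.pi) ^ 2 := by nlinarith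
    calc 1 + ‖ξ‖ ^ 2 ≤ (1 + 2 * R ^ 2 + 2 * M ^ 2) * (1 + ‖j‖ ^ 2) := by
          nlinarith [mul_nonneg q1 q6]
      _ ≤ (1 + 2 * R ^ 2 + 2 * M ^ 2) * latWeight j := by gcongr
      _ ≤ _ := by
          rw [add_mul (1 + 2 * R ^ 2 + 2 * M ^ 2)]
          exact le_add_of_nonneg_right (mul_nonneg hX (latWeight_pos j).le)
  · have hX : 0 ≤ 1 + 2 * R ^ 2 + 2 * M ^ 2 := by nlinarith
    calc latWeight j ≤ 1 + 2 * ‖j‖ ^ 2 := w2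
      _ ≤ (1 + 4 * C ^ 2 * R ^ 2 + 4 * C ^ 2 * (2 * Real.pi) ^ 2) * (1 + ‖ξ‖ ^ 2) := by
          nlinarith [mul_nonneg q3 q5]
      _ ≤ _ := by
          rw [add_mul (1 + 2 * R ^ 2 + 2 * M ^ 2)]
          exact le_add_of_nonneg_left (mul_nonneg hX (by positivity))

theorem affE_zero_symm_add (α v : Plane) : (affE 0).symm (α + v) = (affE v).symm α := by
  rw [affE_symm_apply, affE_symm_apply, add_zero]

/-- Unfolding the frequency plane along the tiling by dual cells. The Jacobian (2π)⁻² of the scaling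
is the square of the factor in `blochCoeff`, so no constant remains. -/
theorem lintegral_eq_tsum_blochCoeff (hΛ : IsUnit Λ.det) (w : Plane → ℂ) (s : ℝ) :
    ∫⁻ ξ, ENNReal.ofReal ((1 + ‖ξ‖ ^ 2) ^ s) * ‖w ξ‖ₑ ^ 2 =
      ∑' j, ∫⁻ α in cell (dualMat Λ),
        ENNReal.ofReal ((1 + ‖(affE (latVec (dualMat Λ) j)).symm α‖ ^ 2) ^ s) *
          ‖blochCoeff Λ w j α‖ₑ ^ 2 := by
  have h := lintegral_affE 0 fun α => ENNReal.ofReal ((1 + ‖(affE 0).symm α‖ ^ 2) ^ s) *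
    ‖w ((affE 0).symm α)‖ₑ ^ 2
  simp only [Homeomorph.symm_apply_apply] at h
  rw [h, (isTiling_cell (isUnit_det_dualMat hΛ)).lintegral_eq_tsum, ← ENNReal.tsum_mul_left]
  refine tsum_congr fun j => ?_
  rw [← lintegral_const_mul' _ _ ENNReal.ofReal_ne_top]
  congr 1
  ext α
  have e : ‖(((2 * Real.pi)⁻¹ : ℝ) : ℂ)‖ₑ ^ 2 = ENNReal.ofReal ((2 * Real.pi) ^ 2)⁻¹ := by
    rw [← ofReal_norm, Complex.norm_real, Real.norm_of_nonneg (by positivity), ← inv_pow,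
      ENNReal.ofReal_pow (by positivity)]
  rw [affE_zero_symm_add, blochCoeff, enorm_mul, mul_pow ‖(((2 * Real.pi)⁻¹ : ℝ) : ℂ)‖ₑ, e,
    mul_left_comm]

theorem exists_coeffSq_comparable (hΛ : IsUnit Λ.det) (s : ℝ) : ∃ K : ℝ≥0,
    ∀ (w : Plane → ℂ) (c : (Fin 2 → ℤ) → Plane → ℂ), (∀ j, c j =ᵐ[volume] blochCoeff Λ w j) →
      coeffSq Λ s c ≤ K * ∫⁻ ξ, ENNReal.ofReal ((1 + ‖ξ‖ ^ 2) ^ s) * ‖w ξ‖ₑ ^ 2 ∧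
      ∫⁻ ξ, ENNReal.ofReal ((1 + ‖ξ‖ ^ 2) ^ s) * ‖w ξ‖ₑ ^ 2 ≤ K * coeffSq Λ s c := by
  obtain ⟨K, hK, h⟩ := exists_latWeight_comparable hΛ
  have hm := (isTiling_cell (isUnit_det_dualMat hΛ)).1
  refine ⟨Real.toNNReal (K ^ |s|), fun w c hc => ?_⟩
  have hKc : ((Real.toNNReal (K ^ |s|) : ℝ≥0) : ℝ≥0∞) = ENNReal.ofReal (K ^ |s|) := rfl
  have hce : ∀ j, ENNReal.ofReal (latWeight j ^ s) * ∫⁻ α in cell (dualMat Λ), ‖c j α‖ₑ ^ 2 =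
      ∫⁻ α in cell (dualMat Λ), ENNReal.ofReal (latWeight j ^ s) * ‖blochCoeff Λ w j α‖ₑ ^ 2 := by
    intro j
    rw [← lintegral_const_mul' _ _ ENNReal.ofReal_ne_top]
    refine lintegral_congr_ae (ae_restrict_of_ae ?_)
    filter_upwards [hc j] with α hα
    rw [hα]
  rw [lintegral_eq_tsum_blochCoeff hΛ, coeffSq, hKc, ← ENNReal.tsum_mul_left,
    ← ENNReal.tsum_mul_left]
  simp only [hce]
  simp only [← lintegral_const_mul' _ _ ENNReal.ofReal_ne_top]
  constructor
  · refine ENNReal.tsum_le_tsum fun j => setLIntegral_mono' hm fun α hα => ?_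
    rw [← mul_assoc, ← ENNReal.ofReal_mul (by positivity)]
    gcongr
    exact rpow_le_mul_rpow s (latWeight_pos j) (by positivity) hK (h j α hα).2 (h j α hα).1
  · refine ENNReal.tsum_le_tsum fun j => setLIntegral_mono' hm fun α hα => ?_
    rw [← mul_assoc, ← ENNReal.ofReal_mul (by positivity)]
    gcongr
    exact rpow_le_mul_rpow s (by positivity) (latWeight_pos j) hK (h j α hα).1 (h j α hα).2

/-- One direction inserts the explicit coefficients. For the other, any admissible family of
coefficients represents û through each of its members, so all of them are determined by the one with
index 0. -/
theorem exists_l2Sq_comparable (s : ℝ) : ∃ K : ℝ≥0, ∀ u : 𝓢'(Plane, ℂ),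
    l2Sq Λ s (Jt Λ hΛ u) ≤ K * wSobSq s 0 u ∧ wSobSq s 0 u ≤ K * l2Sq Λ s (Jt Λ hΛ u) := by
  obtain ⟨K, hK⟩ := exists_coeffSq_comparable hΛ s
  refine ⟨K + 1, fun u => ⟨?_, ?_⟩⟩
  · by_cases hu : wSobSq s 0 u < ⊤
    · rw [wSobSq_zero_eq] at hu ⊢
      obtain ⟨w, hw⟩ := exists_represents_of_L2sq_weightMul_lt_top hu
      rw [hw.L2sq_weightMul_eq] at hu ⊢
      refine (iInf₂_le (blochCoeff Λ w) ⟨isBlochPeriodic_Jt hΛ u,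
        hasFourierCoeff_Jt hΛ hw hu⟩).trans ((hK w _ fun j => Filter.EventuallyEq.rfl).1.trans ?_)
      gcongr
      exact le_self_add
    · rw [not_lt_top_iff.1 hu, ENNReal.mul_top (by positivity)]
      exact le_top
  · rw [l2Sq, ENNReal.mul_iInf_of_ne (by positivity) (by simp)]
    refine le_iInf fun c => ?_
    rw [ENNReal.mul_iInf_of_ne (by positivity) (by simp)]
    refine le_iInf fun hc => ?_
    have h0 := hc.2.represents hΛ 0
    set w := fun ξ => ((2 * Real.pi : ℝ) : ℂ) * c 0 (affE (latVec (dualMat Λ) 0) ξ) with hw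
    have hcj : ∀ j, c j =ᵐ[volume] blochCoeff Λ w j := by
      intro j
      have := ae_affE_symm (v := latVec (dualMat Λ) j) ((hc.2.represents hΛ j).ae_eq h0)
      filter_upwards [this] with α hα
      rw [Homeomorph.apply_symm_apply] at hα
      rw [blochCoeff, ← hα]
      have := Real.pi_ne_zero
      push_cast
      field_simp
    rw [wSobSq_zero_eq, h0.L2sq_weightMul_eq]
    refine (hK w c hcj).2.trans ?_
    gcongr
    exact le_self_add

end

/-! ### Domination of squared norms -/

/-- `N ≤ K M` for some constant `K`. -/
def Dominated {V : Type*} (N M : V → ℝ≥0∞) : Prop := ∃ K : ℝ≥0, ∀ v, N v ≤ K * M v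

theorem Dominated.trans {V : Type*} {N M L : V → ℝ≥0∞} (h : Dominated N M) (h' : Dominated M L) :
    Dominated N L := by
  obtain ⟨K, hK⟩ := h
  obtain ⟨K', hK'⟩ := h'
  refine ⟨K * K', fun v => (hK v).trans ?_⟩
  rw [ENNReal.coe_mul, mul_assoc]
  gcongr
  exact hK' v

theorem Dominated.comp {V W : Type*} {N M : V → ℝ≥0∞} (h : Dominated N M) (f : W → V) :
    Dominated (fun w => N (f w)) fun w => M (f w) := by
  obtain ⟨K, hK⟩ := h
  exact ⟨K, fun w => hK (f w)⟩

theorem Dominated.sum {V ι : Type*} {N : ι → V → ℝ≥0∞} {M : V → ℝ≥0∞} {S : Finset ι}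
    (h : ∀ i ∈ S, Dominated (N i) M) : Dominated (fun v => ∑ i ∈ S, N i v) M := by
  choose! K hK using h
  refine ⟨∑ i ∈ S, K i, fun v => ?_⟩
  rw [ENNReal.ofNNReal_finsetSum, Finset.sum_mul]
  exact Finset.sum_le_sum fun i hi => hK i hi v

/-! ### Integer weights -/

/-- The function `(-i x₀)^a (-i x₁)^b`. -/
def negIMono (a b : ℕ) (x : Plane) : ℂ := negIMul 0 x ^ a * negIMul 1 x ^ b

theorem isSymb_const (c : ℂ) : IsSymb 0 fun _ : Plane => c := by
  refine ⟨contDiff_const, fun i => ⟨‖c‖, norm_nonneg c, fun x => ?_⟩⟩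
  rcases Nat.eq_zero_or_pos i with rfl | hi
  · simp
  · rw [iteratedFDeriv_const_of_ne hi.ne']
    simp

theorem isSymb_negIMul (k : Fin 2) : IsSymb 1 (negIMul k) := by
  have h := isSymb_clm (-(Complex.I • Complex.ofRealCLM.comp
    (EuclideanSpace.proj k : Plane →L[ℝ] ℝ)))
  exact h

theorem IsSymb.pow {r : ℝ} {m : Plane → ℂ} (h : IsSymb r m) (n : ℕ) :
    IsSymb (n * r) fun x => m x ^ n := by
  induction n with
  | zero => simpa using isSymb_const 1
  | succ n ih =>
    have := ih.mul h
    simp only [pow_succ]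
    convert this using 1
    push_cast
    ring

theorem isSymb_negIMono (a b : ℕ) : IsSymb (a + b) (negIMono a b) := by
  have := ((isSymb_negIMul 0).pow a).mul ((isSymb_negIMul 1).pow b)
  rw [mul_one, mul_one] at this
  exact this

theorem hasTemperateGrowth_fun_mul {m m' : Plane → ℂ} (hm : m.HasTemperateGrowth)
    (hm' : m'.HasTemperateGrowth) : (fun x => m x * m' x).HasTemperateGrowth := hm.mul hm'

theorem hasTemperateGrowth_fun_add {m m' : Plane → ℂ} (hm : m.HasTemperateGrowth)
    (hm' : m'.HasTemperateGrowth) : (fun x => m x + m' x).HasTemperateGrowth := hm.add hm'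

theorem hasTemperateGrowth_fun_pow {m : Plane → ℂ} (hm : m.HasTemperateGrowth) (n : ℕ) :
    (fun x => m x ^ n).HasTemperateGrowth := hm.pow n

theorem smulLeft_smulLeft {m m' : Plane → ℂ} (hm : m.HasTemperateGrowth)
    (hm' : m'.HasTemperateGrowth) (u : 𝓢'(Plane, ℂ)) :
    smulLeftCLM ℂ m (smulLeftCLM ℂ m' u) = smulLeftCLM ℂ (fun x => m x * m' x) u := by
  ext φ
  change u (smulS m' (smulS m φ)) = u (smulS (fun x => m x * m' x) φ)
  congr 1
  ext x
  rw [smulS_apply hm', smulS_apply hm, smulS_apply (hasTemperateGrowth_fun_mul hm hm')]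
  ring

theorem smulLeft_pow {m : Plane → ℂ} (hm : m.HasTemperateGrowth) (n : ℕ) (u : 𝓢'(Plane, ℂ)) :
    (smulLeftCLM ℂ m ^ n) u = smulLeftCLM ℂ (fun x => m x ^ n) u := by
  induction n with
  | zero =>
    ext φ
    change u φ = u (smulS (fun x => m x ^ 0) φ)
    congr 1
    ext x
    simp only [pow_zero]
    rw [smulS_apply (Function.HasTemperateGrowth.const 1), one_mul]
  | succ n ih =>
    rw [pow_succ']
    change smulLeftCLM ℂ m ((smulLeftCLM ℂ m ^ n) u) = _
    rw [ih, smulLeft_smulLeft hm (hasTemperateGrowth_fun_pow hm n)]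
    simp only [pow_succ']

theorem smulLeft_pow_mul (a b : ℕ) (u : 𝓢'(Plane, ℂ)) :
    (smulLeftCLM ℂ (negIMul 0) ^ a * smulLeftCLM ℂ (negIMul 1) ^ b) u =
      smulLeftCLM ℂ (negIMono a b) u := by
  change (smulLeftCLM ℂ (negIMul 0) ^ a) ((smulLeftCLM ℂ (negIMul 1) ^ b) u) = _
  rw [smulLeft_pow (hasTemperateGrowth_negIMul 1), smulLeft_pow (hasTemperateGrowth_negIMul 0),
    smulLeft_smulLeft (hasTemperateGrowth_fun_pow (hasTemperateGrowth_negIMul 0) a)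
      (hasTemperateGrowth_fun_pow (hasTemperateGrowth_negIMul 1) b)]
  rfl

theorem wSobSq_eq_weightMul (s r : ℝ) (u : 𝓢'(Plane, ℂ)) :
    wSobSq s r u = wSobSq s 0 (weightMul r u) := by
  rw [wSobSq_eq, wSobSq_eq, weightMul_zero]

theorem weightMul_eq_smulLeft (r : ℝ) (u : 𝓢'(Plane, ℂ)) :
    weightMul r u = smulLeftCLM ℂ (jap r) u := rfl

/-- Multiplication by symbols of order `t` maps `H^s_r` to `H^s_{r-t}`. -/
theorem IsSymb.dominated {t : ℝ} {m : Plane → ℂ} (hm : IsSymb t m) (s r r' : ℝ) (h : r' + t ≤ r) :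
    Dominated (fun u => wSobSq s r' (smulLeftCLM ℂ m u)) (wSobSq s r) := by
  -- Conjugation by the weights leaves a symbol of order r' + t - r ≤ 0, which is a multiplier of
  -- the unweighted space.
  have h0 : IsSymb 0 fun x => (jap r' x * m x) * jap (-r) x :=
    (((isSymb_jap r').mul hm).mul (isSymb_jap (-r))).mono (by linarith)
  obtain ⟨C, hC⟩ := h0.exists_wSobSq_smulLeft_le s
  refine ⟨C, fun u => ?_⟩
  change wSobSq s r' (smulLeftCLM ℂ m u) ≤ _
  have h1 := hC (weightMul r u)
  rw [weightMul_eq_smulLeft, smulLeft_smulLeft h0.hasTemperateGrowth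
    (jap_hasTemperateGrowth r)] at h1
  rw [wSobSq_eq_weightMul s r', wSobSq_eq_weightMul s r, weightMul_eq_smulLeft,
    smulLeft_smulLeft (jap_hasTemperateGrowth r') hm.hasTemperateGrowth]
  have e : (fun x => jap r' x * m x * jap (-r) x * jap r x) = fun x => jap r' x * m x := by
    ext x
    rw [mul_assoc, ← Pi.mul_apply (jap (-r)), jap_mul_jap, neg_add_cancel]
    simp [jap]
  rwa [e] at h1

theorem wSobSq_add_le (s r : ℝ) (u v : 𝓢'(Plane, ℂ)) :
    wSobSq s r (u + v) ≤ 2 * (wSobSq s r u + wSobSq s r v) := (wSobSq_quadLike s r).add u v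

theorem smulLeft_add {m m' : Plane → ℂ} (hm : m.HasTemperateGrowth)
    (hm' : m'.HasTemperateGrowth) (u : 𝓢'(Plane, ℂ)) :
    smulLeftCLM ℂ (fun x => m x + m' x) u = smulLeftCLM ℂ m u + smulLeftCLM ℂ m' u := by
  ext φ
  change u (smulS (fun x => m x + m' x) φ) = u (smulS m φ) + u (smulS m' φ)
  rw [← map_add]
  congr 1
  ext x
  rw [add_apply, smulS_apply hm', smulS_apply hm, smulS_apply (hasTemperateGrowth_fun_add hm hm')]
  ring

/-- Induction from u = ⟨x⟩⁻² u + ∑_k x_k ⟨x⟩⁻² (x_k u). Multiplication by the symbols ⟨x⟩⁻² and x_k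
⟨x⟩⁻² raises the weight by at least one, and the hypothesis for l is applied to u and to both x_k u.
-/
theorem exists_wSobSq_nat_le (s : ℝ) (l : ℕ) : ∃ C : ℝ≥0, ∀ (u : 𝓢'(Plane, ℂ)) (B : ℝ≥0∞),
    (∀ a b : ℕ, a + b ≤ l → wSobSq s 0 (smulLeftCLM ℂ (negIMono a b) u) ≤ B) →
      wSobSq s l u ≤ C * B := by
  induction l with
  | zero =>
    refine ⟨1, fun u B h => ?_⟩
    have := h 0 0 le_rfl
    rw [ENNReal.coe_one, one_mul, Nat.cast_zero]
    convert this using 2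
    ext φ
    change u φ = u (smulS (negIMono 0 0) φ)
    congr 1
    ext x
    rw [smulS_apply (isSymb_negIMono 0 0).hasTemperateGrowth]
    simp [negIMono]
  | succ l ih =>
    obtain ⟨C, hC⟩ := ih
    have d2 : ∀ k, Dominated
        (fun u => wSobSq s (l + 1) (smulLeftCLM ℂ (fun x => -(negIMul k x) * jap (-2) x) u))
        (wSobSq s l) := fun k => by
      have h : IsSymb (-1) fun x => -(negIMul k x) * jap (-2) x := by
        have := (((isSymb_const (-1)).mul (isSymb_negIMul k)).mul (isSymb_jap (-2)))
        simp only [neg_mul, one_mul] at this ⊢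
        convert this using 1
        norm_num
      exact h.dominated s l (l + 1) (by linarith)
    obtain ⟨K₀, hK₀⟩ := (isSymb_jap (-2)).dominated s (l : ℝ) (l + 1) (by linarith)
    obtain ⟨K₁, hK₁⟩ := d2 0
    obtain ⟨K₂, hK₂⟩ := d2 1
    refine ⟨2 * (2 * (K₀ * C + K₁ * C) + K₂ * C), fun u B h => ?_⟩
    have hneg : ∀ k, (fun x => -(negIMul k x) * jap (-2) x).HasTemperateGrowth := fun k =>
      (hasTemperateGrowth_negIMul k).neg.mul (jap_hasTemperateGrowth (-2))
    have e : u = smulLeftCLM ℂ (jap (-2)) u +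
        smulLeftCLM ℂ (fun x => -(negIMul 0 x) * jap (-2) x) (smulLeftCLM ℂ (negIMul 0) u) +
        smulLeftCLM ℂ (fun x => -(negIMul 1 x) * jap (-2) x) (smulLeftCLM ℂ (negIMul 1) u) := by
      have h0 := hasTemperateGrowth_fun_mul (hneg 0) (hasTemperateGrowth_negIMul 0)
      have h1 := hasTemperateGrowth_fun_mul (hneg 1) (hasTemperateGrowth_negIMul 1)
      have h2 := hasTemperateGrowth_fun_add (jap_hasTemperateGrowth (-2)) h0
      rw [smulLeft_smulLeft (hneg 0) (hasTemperateGrowth_negIMul 0),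
        smulLeft_smulLeft (hneg 1) (hasTemperateGrowth_negIMul 1),
        ← smulLeft_add (jap_hasTemperateGrowth (-2)) h0, ← smulLeft_add h2 h1]
      ext φ
      change u φ = u (smulS _ φ)
      congr 1
      ext x
      rw [smulS_apply (hasTemperateGrowth_fun_add h2 h1)]
      have hj : jap (-2) x * (1 + (((x 0 : ℝ) : ℂ) ^ 2 + ((x 1 : ℝ) : ℂ) ^ 2)) = 1 := by
        have : (1 + (((x 0 : ℝ) : ℂ) ^ 2 + ((x 1 : ℝ) : ℂ) ^ 2)) = jap 2 x := by
          rw [jap, div_self two_ne_zero, Real.rpow_one, EuclideanSpace.norm_sq_eq, Fin.sum_univ_two]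
          simp
        rw [this, ← Pi.mul_apply (jap (-2)), jap_mul_jap]
        simp [jap]
      simp only [negIMul]
      linear_combination (-φ x) * hj + jap (-2) x * φ x *
        (((x 0 : ℝ) : ℂ) ^ 2 + ((x 1 : ℝ) : ℂ) ^ 2) * Complex.I_sq
    have hM : ∀ k : Fin 2, ∀ a b : ℕ, a + b ≤ l → wSobSq s 0 (smulLeftCLM ℂ (negIMono a b)
        (smulLeftCLM ℂ (negIMul k) u)) ≤ B := by
      intro k a b hab
      rw [smulLeft_smulLeft (isSymb_negIMono a b).hasTemperateGrowth (hasTemperateGrowth_negIMul k)]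
      fin_cases k
      · have := h (a + 1) b (by omega)
        have e : (fun x => negIMono a b x * negIMul 0 x) = negIMono (a + 1) b := by
          ext x
          simp only [negIMono]
          ring
        rwa [← e] at this
      · have := h a (b + 1) (by omega)
        have e : (fun x => negIMono a b x * negIMul 1 x) = negIMono a (b + 1) := by
          ext x
          simp only [negIMono]
          ring
        rwa [← e] at this
    have b0 := hC u B fun a b hab => h a b (by omega)
    have b1 := hC _ B (hM 0)
    have b2 := hC _ B (hM 1)
    rw [e]
    push_cast
    refine (wSobSq_add_le _ _ _ _).trans ?_
    calc _ ≤ 2 * (2 * (K₀ * (C * B) + K₁ * (C * B)) + K₂ * (C * B)) := by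
          gcongr
          · refine (wSobSq_add_le _ _ _ _).trans ?_
            gcongr
            · exact (hK₀ u).trans (by gcongr)
            · exact (hK₁ _).trans (by gcongr)
          · exact (hK₂ _).trans (by gcongr)
      _ = _ := by ring

section

variable {Λ : Matrix (Fin 2) (Fin 2) ℝ} (hΛ : IsUnit Λ.det)

theorem sobSq_Jt (l : ℕ) (s : ℝ) (u : 𝓢'(Plane, ℂ)) : sobSq Λ l s (Jt Λ hΛ u) =
    ∑ γ ∈ (Finset.range (l + 1) ×ˢ Finset.range (l + 1)).filter (fun γ => γ.1 + γ.2 ≤ l),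
      l2Sq Λ s (Jt Λ hΛ (smulLeftCLM ℂ (negIMono γ.1 γ.2) u)) := by
  unfold sobSq
  refine Finset.sum_congr rfl fun γ _ => ?_
  rw [alphaDeriv_pow_mul_Jt, smulLeft_pow_mul]

theorem dominated_sobSq_Jt (l : ℕ) (s : ℝ) :
    Dominated (fun u => sobSq Λ l s (Jt Λ hΛ u)) (wSobSq s l) := by
  obtain ⟨K, hK⟩ := exists_l2Sq_comparable hΛ s
  simp only [sobSq_Jt]
  refine Dominated.sum fun γ hγ => ?_
  have h1 : Dominated (fun u => l2Sq Λ s (Jt Λ hΛ u)) (wSobSq s 0) := ⟨K, fun u => (hK u).1⟩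
  refine (h1.comp (smulLeftCLM ℂ (negIMono γ.1 γ.2))).trans ?_
  refine (isSymb_negIMono γ.1 γ.2).dominated s l 0 ?_
  rw [zero_add]
  exact_mod_cast (Finset.mem_filter.1 hγ).2

theorem le_sum_filter_add_le {a b l : ℕ} (hab : a + b ≤ l) (g : ℕ × ℕ → ℝ≥0∞) :
    g (a, b) ≤ ∑ γ ∈ (Finset.range (l + 1) ×ˢ Finset.range (l + 1)).filter
      (fun γ => γ.1 + γ.2 ≤ l), g γ := by
  refine Finset.single_le_sum_of_canonicallyOrdered (f := g) ?_
  rw [Finset.mem_filter, Finset.mem_product, Finset.mem_range, Finset.mem_range]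
  refine ⟨⟨?_, ?_⟩, hab⟩ <;> simp only <;> omega

theorem l2Sq_Jt_smulLeft_le {a b l : ℕ} (hab : a + b ≤ l) (s : ℝ) (u : 𝓢'(Plane, ℂ)) :
    l2Sq Λ s (Jt Λ hΛ (smulLeftCLM ℂ (negIMono a b) u)) ≤ sobSq Λ l s (Jt Λ hΛ u) := by
  rw [sobSq_Jt]
  generalize hg : (fun γ : ℕ × ℕ =>
    l2Sq Λ s (Jt Λ hΛ (smulLeftCLM ℂ (negIMono γ.1 γ.2) u))) = g
  have e : l2Sq Λ s (Jt Λ hΛ (smulLeftCLM ℂ (negIMono a b) u)) = g (a, b) := by rw [← hg]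
  rw [e]
  exact le_sum_filter_add_le hab g

theorem dominated_wSobSq_nat (l : ℕ) (s : ℝ) :
    Dominated (wSobSq s l) (fun u => sobSq Λ l s (Jt Λ hΛ u)) := by
  obtain ⟨K, hK⟩ := exists_l2Sq_comparable hΛ s
  obtain ⟨C, hC⟩ := exists_wSobSq_nat_le s l
  refine ⟨C * K, fun u => ?_⟩
  have h := hC u (K * sobSq Λ l s (Jt Λ hΛ u)) fun a b hab =>
    (hK _).2.trans (mul_le_mul_right (l2Sq_Jt_smulLeft_le hΛ hab s u) _)
  rw [← mul_assoc, ← ENNReal.coe_mul] at h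
  exact h

theorem isBlochPeriodic_of_l2Sq_lt_top {s : ℝ} {ψ : 𝓢'(Plane × Plane, ℂ)} (h : l2Sq Λ s ψ < ⊤) :
    IsBlochPeriodic Λ ψ := by
  obtain ⟨c, hc⟩ := iInf_lt_iff.1 h
  obtain ⟨hc, -⟩ := iInf_lt_iff.1 hc
  exact hc.1

theorem isBlochPeriodic_of_sobSq_lt_top {l : ℕ} {s : ℝ} {ψ : 𝓢'(Plane × Plane, ℂ)}
    (h : sobSq Λ l s ψ < ⊤) : IsBlochPeriodic Λ ψ := by
  unfold sobSq at h
  rw [ENNReal.sum_lt_top] at h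
  have := h (0, 0) (by simp)
  exact isBlochPeriodic_of_l2Sq_lt_top this

end

/-! ### Comparison of interpolation norms -/

theorem interpSq_le_mul_of_kSq {V W : Type*} [AddCommGroup V] [AddCommGroup W]
    {N₀ N₁ : V → ℝ≥0∞} {M₀ M₁ : W → ℝ≥0∞} {K : ℝ≥0} {v : V} {w : W} (θ : ℝ)
    (h : ∀ t, 0 < t → kSq N₀ N₁ t v ≤ K * kSq M₀ M₁ t w) :
    interpSq θ N₀ N₁ v ≤ K * interpSq θ M₀ M₁ w := by
  unfold interpSq
  rw [← lintegral_const_mul' _ _ (by simp)]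
  refine setLIntegral_mono' measurableSet_Ioi fun t ht => ?_
  rw [mul_left_comm]
  gcongr
  exact h t ht

theorem exists_interpSq_map_le {V W : Type*} [AddCommGroup V] [AddCommGroup W]
    (L : V →+ W) {N₀ N₁ : W → ℝ≥0∞} {M₀ M₁ : V → ℝ≥0∞}
    (h₀ : Dominated (fun v => N₀ (L v)) M₀) (h₁ : Dominated (fun v => N₁ (L v)) M₁) (θ : ℝ) :
    Dominated (fun v => interpSq θ N₀ N₁ (L v)) (interpSq θ M₀ M₁) := by
  obtain ⟨K₀, h₀⟩ := h₀
  obtain ⟨K₁, h₁⟩ := h₁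
  -- The summand 1 keeps the constant nonzero, so that it can be moved inside the infimum.
  refine ⟨K₀ + K₁ + 1, fun v => interpSq_le_mul_of_kSq θ fun t _ => ?_⟩
  change _ ≤ _ * ⨅ w, _
  rw [ENNReal.mul_iInf_of_ne (by simp) (by simp)]
  refine le_iInf fun w => (iInf_le _ (L w)).trans ?_
  rw [← map_sub]
  calc N₀ (L w) + ENNReal.ofReal t ^ 2 * N₁ (L (v - w))
      ≤ K₀ * M₀ w + ENNReal.ofReal t ^ 2 * (K₁ * M₁ (v - w)) := by
        gcongr
        · exact h₀ w
        · exact h₁ _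
    _ ≤ ((K₀ + K₁ + 1 : ℝ≥0) : ℝ≥0∞) * M₀ w +
        ENNReal.ofReal t ^ 2 * (((K₀ + K₁ + 1 : ℝ≥0) : ℝ≥0∞) * M₁ (v - w)) := by
        gcongr
        · rw [add_assoc]; exact le_self_add
        · rw [add_comm K₀, add_assoc]; exact le_self_add
    _ = _ := by ring

/-- A competitor w matters only if its first norm is finite, and then it lifts along L. Surjectivity
is thus needed only onto elements of finite norm. -/
theorem exists_interpSq_le_map {V W : Type*} [AddCommGroup V] [AddCommGroup W]
    (L : V →+ W) {N₀ N₁ : W → ℝ≥0∞} {M₀ M₁ : V → ℝ≥0∞}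
    (hL : ∀ w, N₀ w < ⊤ → ∃ v, L v = w)
    (h₀ : Dominated M₀ (fun v => N₀ (L v))) (h₁ : Dominated M₁ (fun v => N₁ (L v))) (θ : ℝ) :
    Dominated (interpSq θ M₀ M₁) (fun v => interpSq θ N₀ N₁ (L v)) := by
  obtain ⟨K₀, h₀⟩ := h₀
  obtain ⟨K₁, h₁⟩ := h₁
  refine ⟨K₀ + K₁ + 1, fun v => interpSq_le_mul_of_kSq θ fun t _ => ?_⟩
  change _ ≤ _ * ⨅ w, _
  rw [ENNReal.mul_iInf_of_ne (by simp) (by simp)]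
  refine le_iInf fun w => ?_
  rcases eq_or_ne (N₀ w) ⊤ with hw | hw
  · rw [hw, top_add, ENNReal.mul_top (by simp)]
    exact le_top
  obtain ⟨w, rfl⟩ := hL w hw.lt_top
  refine (iInf_le _ w).trans ?_
  rw [← map_sub]
  calc M₀ w + ENNReal.ofReal t ^ 2 * M₁ (v - w)
      ≤ K₀ * N₀ (L w) + ENNReal.ofReal t ^ 2 * (K₁ * N₁ (L (v - w))) := by
        gcongr
        · exact h₀ w
        · exact h₁ _
    _ ≤ ((K₀ + K₁ + 1 : ℝ≥0) : ℝ≥0∞) * N₀ (L w) +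
        ENNReal.ofReal t ^ 2 * (((K₀ + K₁ + 1 : ℝ≥0) : ℝ≥0∞) * N₁ (L (v - w))) := by
        gcongr
        · rw [add_assoc]; exact le_self_add
        · rw [add_comm K₀, add_assoc]; exact le_self_add
    _ = _ := by ring

/-- Without any splitting into finite parts the K-functional is infinite for every t > 0, and so is
the integral. -/
theorem exists_kSq_lt_top_of_interpSq {V : Type*} [AddCommGroup V] {N₀ N₁ : V → ℝ≥0∞} {θ : ℝ}
    {v : V} (h : interpSq θ N₀ N₁ v < ⊤) :
    ∃ w, N₀ w < ⊤ ∧ N₁ (v - w) < ⊤ := by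
  by_contra! hc
  have hk : ∀ t, 0 < t → kSq N₀ N₁ t v = ⊤ := by
    intro t ht
    refine iInf_eq_top.2 fun w => ?_
    rcases eq_or_ne (N₀ w) ⊤ with hw | hw
    · rw [hw, top_add]
    · rw [top_le_iff.1 (hc w hw.lt_top), ENNReal.mul_top, add_top]
      simpa using ht
  refine h.ne (top_le_iff.1 ?_)
  calc ⊤ = ∫⁻ _ in Set.Ioi (0 : ℝ), ⊤ := by simp
    _ ≤ interpSq θ N₀ N₁ v := by
      refine setLIntegral_mono' measurableSet_Ioi fun t ht => ?_
      rw [hk t ht, ENNReal.mul_top]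
      simpa using Real.rpow_pos_of_pos ht _

/-! ### Interpolation of weighted `L²` spaces -/

theorem lintegral_Ioi_rpow {c a : ℝ} (hc : 0 < c) (ha : a < -1) :
    ∫⁻ t in Set.Ioi c, ENNReal.ofReal (t ^ a) = ENNReal.ofReal (-c ^ (a + 1) / (a + 1)) := by
  rw [← integral_Ioi_rpow_of_lt ha hc,
    ofReal_integral_eq_lintegral_ofReal (integrableOn_Ioi_rpow_of_lt ha hc)]
  refine (ae_restrict_iff' measurableSet_Ioi).2 (Filter.Eventually.of_forall fun t ht => ?_)
  exact Real.rpow_nonneg (hc.trans ht).le _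

theorem lintegral_Ioc_rpow {c a : ℝ} (hc : 0 < c) (ha : -1 < a) :
    ∫⁻ t in Set.Ioc 0 c, ENNReal.ofReal (t ^ a) = ENNReal.ofReal (c ^ (a + 1) / (a + 1)) := by
  have hi := (intervalIntegral.intervalIntegrable_rpow' (a := 0) (b := c) ha).1
  have e : ∫ t in Set.Ioc 0 c, t ^ a = c ^ (a + 1) / (a + 1) := by
    rw [← intervalIntegral.integral_of_le hc.le, integral_rpow (Or.inl ha),
      Real.zero_rpow (by linarith), sub_zero]
  rw [← e, ofReal_integral_eq_lintegral_ofReal hi]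
  refine (ae_restrict_iff' measurableSet_Ioc).2 (Filter.Eventually.of_forall fun t ht => ?_)
  exact Real.rpow_nonneg ht.1.le _

/-- The minimum is 1 beyond t = q^{-1/2}; that part of the integral is already q^θ/(2θ). -/
theorem le_lintegral_rpow_mul_min {θ q : ℝ} (h0 : 0 < θ) (hq : 0 < q) :
    ENNReal.ofReal (q ^ θ / (2 * θ)) ≤ ∫⁻ t in Set.Ioi (0 : ℝ),
      ENNReal.ofReal (t ^ (-2 * θ - 1)) * min 1 (ENNReal.ofReal (t ^ 2 * q)) := by
  have hc : 0 < q ^ (-(1 / 2) : ℝ) := Real.rpow_pos_of_pos hq _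
  have e : q ^ θ / (2 * θ) = -(q ^ (-(1 / 2) : ℝ)) ^ (-2 * θ - 1 + 1) / (-2 * θ - 1 + 1) := by
    rw [← Real.rpow_mul hq.le, show -(1 / 2) * (-2 * θ - 1 + 1) = θ by ring]
    rw [show -2 * θ - 1 + 1 = -(2 * θ) by ring, neg_div_neg_eq]
  rw [e, ← lintegral_Ioi_rpow hc (by linarith)]
  refine (setLIntegral_mono' measurableSet_Ioi fun t ht => ?_).trans
    (lintegral_mono_set (Set.Ioi_subset_Ioi hc.le))
  have h1 : 1 ≤ t ^ 2 * q := by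
    have := pow_le_pow_left₀ hc.le (Set.mem_Ioi.1 ht).le 2
    rw [← Real.rpow_natCast, ← Real.rpow_mul hq.le] at this
    norm_num [Real.rpow_neg_one] at this
    exact (inv_le_iff_one_le_mul₀ hq).1 this
  rw [min_eq_left (by rw [← ENNReal.ofReal_one]; exact ENNReal.ofReal_le_ofReal h1), mul_one]

theorem lintegral_rpow_mul_min_le {θ q : ℝ} (h0 : 0 < θ) (h1 : θ < 1) (hq : 0 < q) :
    ∫⁻ t in Set.Ioi (0 : ℝ),
      ENNReal.ofReal (t ^ (-2 * θ - 1)) * min 1 (ENNReal.ofReal (t ^ 2 * q)) ≤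
    ENNReal.ofReal (q ^ θ) * ENNReal.ofReal (1 / (2 - 2 * θ) + 1 / (2 * θ)) := by
  have hc : 0 < q ^ (-(1 / 2) : ℝ) := Real.rpow_pos_of_pos hq _
  have hq' := (Real.rpow_pos_of_pos hq θ).le
  rw [← Set.Ioc_union_Ioi_eq_Ioi hc.le]
  refine (lintegral_union_le _ _ _).trans ?_
  rw [← ENNReal.ofReal_mul hq', mul_add, ENNReal.ofReal_add
    (mul_nonneg hq' (one_div_nonneg.2 (by linarith)))
    (mul_nonneg hq' (one_div_nonneg.2 (by linarith)))]
  refine add_le_add ?_ ?_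
  · have e : q ^ θ * (1 / (2 - 2 * θ)) =
        (q ^ (-(1 / 2) : ℝ)) ^ (1 - 2 * θ + 1) / (1 - 2 * θ + 1) * q := by
      rw [← Real.rpow_mul hq.le, show (-(1 / 2) * (1 - 2 * θ + 1) : ℝ) = θ - 1 by ring,
        Real.rpow_sub_one hq.ne', show (1 - 2 * θ + 1 : ℝ) = 2 - 2 * θ by ring]
      have : 2 - 2 * θ ≠ 0 := by linarith
      field_simp
    rw [e, ENNReal.ofReal_mul (by
      refine div_nonneg (Real.rpow_nonneg hc.le _) (by linarith)), 
      ← lintegral_Ioc_rpow hc (by linarith), ← lintegral_mul_const' _ _ (by simp)]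
    refine setLIntegral_mono' measurableSet_Ioc fun t ht => ?_
    refine (mul_le_mul_right (min_le_right _ _) _).trans (le_of_eq ?_)
    rw [ENNReal.ofReal_mul (by positivity), ← mul_assoc, ← ENNReal.ofReal_mul (by
      exact Real.rpow_nonneg ht.1.le _), ← Real.rpow_natCast t 2, ← Real.rpow_add ht.1]
    congr 3
    push_cast
    ring
  · have e : q ^ θ * (1 / (2 * θ)) =
        -(q ^ (-(1 / 2) : ℝ)) ^ (-2 * θ - 1 + 1) / (-2 * θ - 1 + 1) := by
      rw [← Real.rpow_mul hq.le, show -(1 / 2) * (-2 * θ - 1 + 1) = θ by ring]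
      rw [show -2 * θ - 1 + 1 = -(2 * θ) by ring, neg_div_neg_eq]
      ring
    rw [e, ← lintegral_Ioi_rpow hc (by linarith)]
    refine lintegral_mono fun t => ?_
    refine (mul_le_mul_right (min_le_left _ _) _).trans_eq (mul_one _)

theorem Represents.congr {V : Type*} [NormedAddCommGroup V] [NormedSpace ℝ V] [MeasureSpace V]
    {f g : V → ℂ} {T : 𝓢'(V, ℂ)} (h : Represents f T) (hfg : f =ᵐ[volume] g) :
    Represents g T := by
  intro φ
  have e : (fun x => f x * φ x) =ᵐ[volume] fun x => g x * φ x := by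
    filter_upwards [hfg] with x hx
    rw [hx]
  exact ⟨(h φ).1.congr e, (h φ).2.trans (integral_congr_ae e)⟩

/-- Membership in some weighted L² space guarantees that the cut-off function still defines a
tempered distribution, hence an admissible competitor. -/
theorem Represents.exists_indicator {f : Plane → ℂ} {T : 𝓢'(Plane, ℂ)} {b : ℝ}
    (hf : Represents f T) (h : L2sq (FloquetBloch.weightMul b T) < ⊤) {A : Set Plane}
    (hA : MeasurableSet A) : ∃ T', Represents (A.indicator f) T' := by
  obtain ⟨g, hg⟩ := exists_eq_of_L2sq_lt_top h
  have hae := (hg ▸ hf.weightMul b).ae_eq (represents_coe g)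
  have hgA : MemLp (A.indicator g) 2 volume := (Lp.memLp g).indicator hA
  refine ⟨FloquetBloch.weightMul (-b) (hgA.toLp _ : 𝓢'(Plane, ℂ)),
    ((represents_coe (hgA.toLp _)).weightMul (-b)).congr ?_⟩
  filter_upwards [hae, hgA.coeFn_toLp] with x hx hx'
  rw [hx']
  by_cases hxA : x ∈ A
  · rw [Set.indicator_of_mem hxA, Set.indicator_of_mem hxA, ← hx, ← mul_assoc]
    have := congrFun (jap_mul_jap (-b) b) x
    rw [Pi.mul_apply, neg_add_cancel, jap_zero] at this
    rw [this, one_mul]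
  · rw [Set.indicator_of_notMem hxA, Set.indicator_of_notMem hxA, mul_zero]

theorem ofReal_rpow_add_one (a : ℝ) (x : Plane) : ENNReal.ofReal ((1 + ‖x‖ ^ 2) ^ (a + 1)) =
    ENNReal.ofReal ((1 + ‖x‖ ^ 2) ^ a) * ENNReal.ofReal (1 + ‖x‖ ^ 2) := by
  have : 0 < 1 + ‖x‖ ^ 2 := by positivity
  rw [Real.rpow_add_one this.ne', ENNReal.ofReal_mul (Real.rpow_nonneg this.le _)]

theorem continuous_one_add_norm_sq_rpow (a : ℝ) : Continuous fun x : Plane => (1 + ‖x‖ ^ 2) ^ a :=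
  Continuous.rpow_const (by fun_prop) fun x => Or.inl (by positivity)

theorem Represents.aemeasurable_weight {f : Plane → ℂ} {T : 𝓢'(Plane, ℂ)} (hf : Represents f T)
    (a : ℝ) : AEMeasurable fun x => ENNReal.ofReal ((1 + ‖x‖ ^ 2) ^ a) * ‖f x‖ₑ ^ 2 :=
  ((continuous_one_add_norm_sq_rpow a).measurable.ennreal_ofReal.aemeasurable).mul
    (hf.locallyIntegrable.aestronglyMeasurable.enorm.pow_const 2)

/-- For each x the cheaper space is chosen: f is put in the first one where t²(1+|x|²) ≥ 1 and in
the second one elsewhere. -/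
theorem Represents.kSq_le {f : Plane → ℂ} {T : 𝓢'(Plane, ℂ)} {b : ℝ} (hf : Represents f T)
    (h : L2sq (FloquetBloch.weightMul b T) < ⊤) (a : ℝ) {t : ℝ} (ht : 0 < t) :
    kSq (fun T => L2sq (FloquetBloch.weightMul a T))
      (fun T => L2sq (FloquetBloch.weightMul (a + 1) T)) t T ≤
    ∫⁻ x, ENNReal.ofReal ((1 + ‖x‖ ^ 2) ^ a) * ‖f x‖ₑ ^ 2 *
      min 1 (ENNReal.ofReal (t ^ 2 * (1 + ‖x‖ ^ 2))) := by
  have hA : MeasurableSet {x : Plane | 1 ≤ t ^ 2 * (1 + ‖x‖ ^ 2)} :=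
    measurableSet_le measurable_const (by fun_prop)
  obtain ⟨T', hT'⟩ := hf.exists_indicator h hA
  refine (iInf_le _ T').trans ?_
  simp only
  rw [hT'.L2sq_weightMul_eq, (hf.sub hT').L2sq_weightMul_eq,
    ← lintegral_const_mul' _ _ (by simp), ← lintegral_add_left' (hT'.aemeasurable_weight a)]
  refine lintegral_mono fun x => ?_
  rw [ofReal_rpow_add_one]
  by_cases hx : 1 ≤ t ^ 2 * (1 + ‖x‖ ^ 2)
  · have hx' : x ∈ {x : Plane | 1 ≤ t ^ 2 * (1 + ‖x‖ ^ 2)} := hx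
    rw [Set.indicator_of_mem hx', sub_self, min_eq_left]
    · simp
    · rw [← ENNReal.ofReal_one]
      exact ENNReal.ofReal_le_ofReal hx
  · have hx' : x ∉ {x : Plane | 1 ≤ t ^ 2 * (1 + ‖x‖ ^ 2)} := hx
    rw [Set.indicator_of_notMem hx', sub_zero, min_eq_right]
    · rw [ENNReal.ofReal_mul (by positivity), ENNReal.ofReal_pow ht.le]
      simp only [enorm_zero, ne_eq, OfNat.ofNat_ne_zero, not_false_eq_true, zero_pow, mul_zero,
        zero_add]
      apply le_of_eq
      ring
    · rw [← ENNReal.ofReal_one]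
      exact ENNReal.ofReal_le_ofReal (not_le.1 hx).le

theorem exists_represents_of_split {a : ℝ} {T w : 𝓢'(Plane, ℂ)}
    (h₀ : L2sq (weightMul a w) < ⊤) (h₁ : L2sq (weightMul (a + 1) (T - w)) < ⊤) :
    ∃ g h, Represents g w ∧ Represents h (T - w) ∧ Represents (fun x => g x + h x) T := by
  obtain ⟨g, hg⟩ := exists_represents_of_L2sq_weightMul_lt_top h₀
  obtain ⟨h, hh⟩ := exists_represents_of_L2sq_weightMul_lt_top h₁
  refine ⟨g, h, hg, hh, ?_⟩
  have := hg.add hh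
  rwa [add_sub_cancel] at this

/-- For any splitting f = g + h one has |f|² ≤ 2(|g|² + |h|²), and the minimum is bounded by 1 on
the first part and by t²(1+|x|²) on the second. -/
theorem Represents.le_kSq {f : Plane → ℂ} {T : 𝓢'(Plane, ℂ)} (hf : Represents f T)
    (a : ℝ) {t : ℝ} (ht : 0 < t) :
    ∫⁻ x, ENNReal.ofReal ((1 + ‖x‖ ^ 2) ^ a) * ‖f x‖ₑ ^ 2 *
      min 1 (ENNReal.ofReal (t ^ 2 * (1 + ‖x‖ ^ 2))) ≤
    2 * kSq (fun T => L2sq (FloquetBloch.weightMul a T))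
      (fun T => L2sq (FloquetBloch.weightMul (a + 1) T)) t T := by
  unfold kSq
  rw [ENNReal.mul_iInf_of_ne (by simp) (by simp)]
  refine le_iInf fun w => ?_
  beta_reduce
  rcases eq_or_ne (L2sq (FloquetBloch.weightMul a w)) ⊤ with h₀ | h₀
  · rw [h₀, top_add, ENNReal.mul_top (by simp)]; exact le_top
  rcases eq_or_ne (L2sq (FloquetBloch.weightMul (a + 1) (T - w))) ⊤ with h₁ | h₁
  · rw [h₁, ENNReal.mul_top (by simpa using ht), add_top, ENNReal.mul_top (by simp)]; exact le_top
  obtain ⟨g, h, hg, hh, hgh⟩ := exists_represents_of_split h₀.lt_top h₁.lt_top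
  rw [hg.L2sq_weightMul_eq, hh.L2sq_weightMul_eq,
    ← lintegral_const_mul' _ _ (by simp), ← lintegral_add_left' (hg.aemeasurable_weight a),
    ← lintegral_const_mul' _ _ (by simp)]
  refine lintegral_mono_ae ?_
  filter_upwards [hf.ae_eq hgh] with x hx
  rw [hx, ofReal_rpow_add_one, ENNReal.ofReal_mul (by positivity), ENNReal.ofReal_pow ht.le]
  have e := enorm_add_sq_le (g x) (h x)
  generalize ‖g x + h x‖ₑ ^ 2 = A at *
  generalize ‖g x‖ₑ ^ 2 = B at *
  generalize ‖h x‖ₑ ^ 2 = C at *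
  generalize ENNReal.ofReal ((1 + ‖x‖ ^ 2) ^ a) = D at *
  generalize ENNReal.ofReal (1 + ‖x‖ ^ 2) = E at *
  generalize ENNReal.ofReal t ^ 2 = F at *
  calc D * A * min 1 (F * E) ≤ D * (2 * (B + C)) * min 1 (F * E) := by gcongr
    _ = 2 * (D * B * min 1 (F * E) + D * C * min 1 (F * E)) := by ring
    _ ≤ 2 * (D * B * 1 + D * C * (F * E)) := by
      gcongr
      · exact min_le_left _ _
      · exact min_le_right _ _
    _ = _ := by ring

theorem Represents.lintegral_kernel_swap {f : Plane → ℂ} {T : 𝓢'(Plane, ℂ)} (hf : Represents f T)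
    (a θ : ℝ) : ∫⁻ t in Set.Ioi (0 : ℝ), ENNReal.ofReal (t ^ (-2 * θ - 1)) *
      ∫⁻ x, ENNReal.ofReal ((1 + ‖x‖ ^ 2) ^ a) * ‖f x‖ₑ ^ 2 *
        min 1 (ENNReal.ofReal (t ^ 2 * (1 + ‖x‖ ^ 2))) =
    ∫⁻ x, ENNReal.ofReal ((1 + ‖x‖ ^ 2) ^ a) * ‖f x‖ₑ ^ 2 *
      ∫⁻ t in Set.Ioi (0 : ℝ), ENNReal.ofReal (t ^ (-2 * θ - 1)) *
        min 1 (ENNReal.ofReal (t ^ 2 * (1 + ‖x‖ ^ 2))) := by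
  have e1 : ∀ t : ℝ, ENNReal.ofReal (t ^ (-2 * θ - 1)) *
      ∫⁻ x, ENNReal.ofReal ((1 + ‖x‖ ^ 2) ^ a) * ‖f x‖ₑ ^ 2 *
        min 1 (ENNReal.ofReal (t ^ 2 * (1 + ‖x‖ ^ 2))) =
      ∫⁻ x, ENNReal.ofReal ((1 + ‖x‖ ^ 2) ^ a) * ‖f x‖ₑ ^ 2 *
        (ENNReal.ofReal (t ^ (-2 * θ - 1)) *
        min 1 (ENNReal.ofReal (t ^ 2 * (1 + ‖x‖ ^ 2)))) := by
    intro t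
    rw [← lintegral_const_mul' _ _ (by simp)]
    congr 1
    ext x
    ring
  simp only [e1]
  rw [lintegral_lintegral_swap]
  · congr 1
    ext x
    rw [lintegral_const_mul]
    fun_prop
  · have h2 : Measurable fun p : ℝ × Plane => ENNReal.ofReal (p.1 ^ (-2 * θ - 1)) *
        min 1 (ENNReal.ofReal (p.1 ^ 2 * (1 + ‖p.2‖ ^ 2))) := by fun_prop
    exact ((hf.aemeasurable_weight a).comp_snd).mul h2.aemeasurable

theorem dominated_interpSq_weight (a : ℝ) {θ : ℝ} (h0 : 0 < θ) (h1 : θ < 1) :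
    Dominated (interpSq θ (fun T => L2sq (weightMul a T)) fun T => L2sq (weightMul (a + 1) T))
      (fun T => L2sq (weightMul (a + θ) T)) := by
  refine ⟨(1 / (2 - 2 * θ) + 1 / (2 * θ)).toNNReal + 1, fun T => ?_⟩
  change _ ≤ _ * L2sq (weightMul (a + θ) T)
  rcases eq_or_ne (L2sq (weightMul (a + θ) T)) ⊤ with h | h
  · rw [h, ENNReal.mul_top (by simp)]; exact le_top
  obtain ⟨f, hf⟩ := exists_represents_of_L2sq_weightMul_lt_top h.lt_top
  calc _ ≤ ∫⁻ t in Set.Ioi (0 : ℝ), ENNReal.ofReal (t ^ (-2 * θ - 1)) *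
        ∫⁻ x, ENNReal.ofReal ((1 + ‖x‖ ^ 2) ^ a) * ‖f x‖ₑ ^ 2 *
        min 1 (ENNReal.ofReal (t ^ 2 * (1 + ‖x‖ ^ 2))) := by
        refine setLIntegral_mono' measurableSet_Ioi fun t ht => ?_
        gcongr
        exact hf.kSq_le h.lt_top a ht
    _ ≤ ENNReal.ofReal (1 / (2 - 2 * θ) + 1 / (2 * θ)) * L2sq (weightMul (a + θ) T) := by
        rw [hf.lintegral_kernel_swap, hf.L2sq_weightMul_eq, ← lintegral_const_mul' _ _ (by simp)]
        refine lintegral_mono fun x => ?_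
        refine (mul_le_mul_right (lintegral_rpow_mul_min_le h0 h1 (by positivity)) _).trans_eq ?_
        rw [Real.rpow_add (by positivity), ENNReal.ofReal_mul (by positivity)]
        ring
    _ ≤ _ := by
        gcongr
        exact ENNReal.coe_le_coe.2 le_self_add

theorem dominated_weight_interpSq (a : ℝ) {θ : ℝ} (h0 : 0 < θ) :
    Dominated (fun T => L2sq (weightMul (a + θ) T))
      (interpSq θ (fun T => L2sq (weightMul a T)) fun T => L2sq (weightMul (a + 1) T)) := by
  refine ⟨(2 * (2 * θ)).toNNReal, fun T => ?_⟩
  rcases eq_or_ne (interpSq θ (fun T => L2sq (weightMul a T))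
    (fun T => L2sq (weightMul (a + 1) T)) T) ⊤ with h | h
  · rw [h, ENNReal.mul_top (by simpa using h0)]; exact le_top
  obtain ⟨w, hw₀, hw₁⟩ := exists_kSq_lt_top_of_interpSq h.lt_top
  obtain ⟨g, h', -, -, hf⟩ := exists_represents_of_split hw₀ hw₁
  generalize (fun x => g x + h' x) = f at hf
  have key : L2sq (weightMul (a + θ) T) * ENNReal.ofReal (1 / (2 * θ)) ≤
      2 * interpSq θ (fun T => L2sq (weightMul a T)) (fun T => L2sq (weightMul (a + 1) T)) T := by
    calc _ ≤ ∫⁻ t in Set.Ioi (0 : ℝ), ENNReal.ofReal (t ^ (-2 * θ - 1)) *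
          ∫⁻ x, ENNReal.ofReal ((1 + ‖x‖ ^ 2) ^ a) * ‖f x‖ₑ ^ 2 *
          min 1 (ENNReal.ofReal (t ^ 2 * (1 + ‖x‖ ^ 2))) := by
          rw [hf.lintegral_kernel_swap, hf.L2sq_weightMul_eq, ← lintegral_mul_const' _ _ (by simp)]
          refine lintegral_mono fun x => ?_
          refine le_trans (le_of_eq ?_)
            (mul_le_mul_right (le_lintegral_rpow_mul_min h0 (by positivity)) _)
          rw [Real.rpow_add (by positivity), ENNReal.ofReal_mul (by positivity),
            div_eq_mul_one_div ((1 + ‖x‖ ^ 2) ^ θ), ENNReal.ofReal_mul (p := (1 + ‖x‖ ^ 2) ^ θ) (by positivity)]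
          ring
      _ ≤ _ := by
          unfold interpSq
          rw [← lintegral_const_mul' _ _ (by simp)]
          refine setLIntegral_mono' measurableSet_Ioi fun t ht => ?_
          rw [mul_left_comm]
          gcongr
          exact hf.le_kSq a ht
  have e : ENNReal.ofReal (1 / (2 * θ)) * ENNReal.ofReal (2 * θ) = 1 := by
    rw [← ENNReal.ofReal_mul (by positivity), one_div_mul_cancel (by positivity),
      ENNReal.ofReal_one]
  calc L2sq (weightMul (a + θ) T) =
        L2sq (weightMul (a + θ) T) * ENNReal.ofReal (1 / (2 * θ)) * ENNReal.ofReal (2 * θ) := by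
        rw [mul_assoc, e, mul_one]
    _ ≤ 2 * interpSq θ (fun T => L2sq (weightMul a T)) (fun T => L2sq (weightMul (a + 1) T)) T *
        ENNReal.ofReal (2 * θ) := by gcongr
    _ = _ := by
        change _ = ENNReal.ofReal _ * _
        rw [ENNReal.ofReal_mul (p := 2) (q := 2 * θ) (by norm_num), ENNReal.ofReal_ofNat]
        ring

/-! ### The norms of nonnegative order -/

theorem besselPotential_neg_besselPotential (s : ℝ) (u : 𝓢'(Plane, ℂ)) :
    besselPotential Plane ℂ s (besselPotential Plane ℂ (-s) u) = u := by
  rw [besselPotential_besselPotential_apply]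
  simp [besselPotential_zero]

/-- The Bessel potential is a bijection on tempered distributions. Since potentials and weights can
be interchanged, it carries the couple to weighted L² spaces with comparable norms, where the
interpolation norm is known. -/
theorem dominated_interpSq_wSobSq (l : ℕ) (s : ℝ) {θ : ℝ} (h0 : 0 < θ) (h1 : θ < 1) :
    Dominated (interpSq θ (wSobSq s l) (wSobSq s (l + 1 : ℕ))) (wSobSq s (l + θ)) := by
  have hb := exists_interpSq_le_map (besselPotential Plane ℂ s : _ →L[ℂ] _).toLinearMap.toAddMonoidHom
    (N₀ := fun T => L2sq (weightMul l T)) (N₁ := fun T => L2sq (weightMul (l + 1) T))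
    (M₀ := wSobSq s l) (M₁ := wSobSq s (l + 1 : ℕ))
    (fun w _ => ⟨_, besselPotential_neg_besselPotential s w⟩)
    (exists_wSobSq_le_sobWSq s l)
    (by push_cast; exact exists_wSobSq_le_sobWSq s (l + 1)) θ
  refine hb.trans (((dominated_interpSq_weight l h0 h1).comp (besselPotential Plane ℂ s)).trans ?_)
  exact exists_sobWSq_le_wSobSq s (l + θ)

theorem dominated_wSobSq_interpSq (l : ℕ) (s : ℝ) {θ : ℝ} (h0 : 0 < θ) :
    Dominated (wSobSq s (l + θ)) (interpSq θ (wSobSq s l) (wSobSq s (l + 1 : ℕ))) := by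
  have hb := exists_interpSq_map_le (besselPotential Plane ℂ s : _ →L[ℂ] _).toLinearMap.toAddMonoidHom
    (N₀ := fun T => L2sq (weightMul l T)) (N₁ := fun T => L2sq (weightMul (l + 1) T))
    (M₀ := wSobSq s l) (M₁ := wSobSq s (l + 1 : ℕ))
    (exists_sobWSq_le_wSobSq s l)
    (by push_cast; exact exists_sobWSq_le_wSobSq s (l + 1)) θ
  have h2 : Dominated (wSobSq s (l + θ)) (sobWSq s (l + θ)) := exists_wSobSq_le_sobWSq s (l + θ)
  exact h2.trans (((dominated_weight_interpSq l h0).comp (besselPotential Plane ℂ s)).trans hb)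

theorem isBlochPeriodic_of_posSq_lt_top {Λ : Matrix (Fin 2) (Fin 2) ℝ} {r s : ℝ}
    {ψ : 𝓢'(Plane × Plane, ℂ)} (h : posSq Λ r s ψ < ⊤) : IsBlochPeriodic Λ ψ := by
  unfold posSq at h
  split_ifs at h with hr
  · exact isBlochPeriodic_of_sobSq_lt_top h
  · obtain ⟨w, h₀, h₁⟩ := exists_kSq_lt_top_of_interpSq h
    have := (isBlochPeriodic_of_sobSq_lt_top h₀).add (isBlochPeriodic_of_sobSq_lt_top h₁)
    rwa [add_sub_cancel] at this

section

variable {Λ : Matrix (Fin 2) (Fin 2) ℝ} (hΛ : IsUnit Λ.det)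

theorem sub_natFloor_mem_Ioo {r : ℝ} (hr : 0 ≤ r) (h : r ≠ ⌊r⌋₊) :
    0 < r - ⌊r⌋₊ ∧ r - ⌊r⌋₊ < 1 := by
  have h1 := Nat.floor_le hr
  have h2 := Nat.lt_floor_add_one r
  exact ⟨sub_pos.2 (lt_of_le_of_ne h1 h.symm), by linarith⟩

theorem dominated_posSq_Jt (s : ℝ) {r : ℝ} (hr : 0 ≤ r) :
    Dominated (fun u => posSq Λ r s (Jt Λ hΛ u)) (wSobSq s r) := by
  unfold posSq
  split_ifs with h
  · rw [show wSobSq s r = wSobSq s ⌊r⌋₊ from congrArg (wSobSq s) h]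
    exact dominated_sobSq_Jt hΛ _ s
  · obtain ⟨h0, h1⟩ := sub_natFloor_mem_Ioo hr h
    have h2 := dominated_interpSq_wSobSq ⌊r⌋₊ s h0 h1
    rw [add_sub_cancel] at h2
    exact (exists_interpSq_map_le (Jt Λ hΛ).toLinearMap.toAddMonoidHom
      (dominated_sobSq_Jt hΛ _ s) (dominated_sobSq_Jt hΛ _ s) _).trans h2

theorem dominated_wSobSq_posSq (s : ℝ) {r : ℝ} (hr : 0 ≤ r) :
    Dominated (wSobSq s r) (fun u => posSq Λ r s (Jt Λ hΛ u)) := by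
  unfold posSq
  split_ifs with h
  · rw [show wSobSq s r = wSobSq s ⌊r⌋₊ from congrArg (wSobSq s) h]
    exact dominated_wSobSq_nat hΛ _ s
  · obtain ⟨h0, h1⟩ := sub_natFloor_mem_Ioo hr h
    have h2 := dominated_wSobSq_interpSq ⌊r⌋₊ s h0
    rw [add_sub_cancel] at h2
    exact h2.trans (exists_interpSq_le_map (Jt Λ hΛ).toLinearMap.toAddMonoidHom
      (fun w hw => ⟨_, Jt_Jinv hΛ (isBlochPeriodic_of_sobSq_lt_top hw)⟩)
      (dominated_wSobSq_nat hΛ _ s) (dominated_wSobSq_nat hΛ _ s) _)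

end

/-! ### Bloch transforms of test functions, cell partitions -/

theorem dist_injective {φ χ : 𝓢(Plane, ℂ)} (h : dist φ = dist χ) : φ = χ := by
  have h1 := (represents_dist φ).ae_eq (h ▸ represents_dist χ)
  ext x
  exact congrFun ((Continuous.ae_eq_iff_eq volume φ.continuous χ.continuous).1 h1) x

section

variable {Λ : Matrix (Fin 2) (Fin 2) ℝ}

/-- A cell partition of product form. -/
def cellPart (hΛ : IsUnit Λ.det) (p : Plane × Plane) : ℂ :=
  latPart (dualMat Λ) (isUnit_det_dualMat hΛ) p.1 * latPart Λ hΛ p.2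

theorem isCellPartition_cellPart (hΛ : IsUnit Λ.det) : IsCellPartition Λ (cellPart hΛ) := by
  refine ⟨?_, ?_, fun α x => ?_⟩
  · exact ((contDiff_latPart _).comp contDiff_fst).mul ((contDiff_latPart _).comp contDiff_snd)
  · have h1 := hasCompactSupport_latPart (isUnit_det_dualMat hΛ)
    have h2 := hasCompactSupport_latPart hΛ
    refine HasCompactSupport.intro (h1.isCompact.prod h2.isCompact) fun p hp => ?_
    rw [Set.mem_prod, not_and_or] at hp
    unfold cellPart
    rcases hp with hp | hp
    · rw [image_eq_zero_of_notMem_tsupport hp, zero_mul]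
    · rw [image_eq_zero_of_notMem_tsupport hp, mul_zero]
  · have h1 := hasSum_latPart (isUnit_det_dualMat hΛ) α
    have h2 := hasSum_latPart hΛ x
    have h3 := tsum_mul_tsum_of_summable_norm h1.summable.norm h2.summable.norm
    rw [h1.tsum_eq, h2.tsum_eq, mul_one] at h3
    exact h3.symm

theorem contDiff_blochFun (hΛ : IsUnit Λ.det) {φ : Plane → ℂ} (hφ : ContDiff ℝ ∞ φ)
    (hc : HasCompactSupport φ) : ContDiff ℝ ∞ (blochFun Λ φ) := by
  obtain ⟨R, hR⟩ := hc.isCompact.isBounded.exists_norm_le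
  refine contDiff_iff_contDiffAt.2 fun p => ?_
  have hfin := finite_norm_latVec_le hΛ (R + ‖p.2‖ + 1)
  have hev : blochFun Λ φ =ᶠ[nhds p] fun q => ((Real.sqrt |Λ.det| / (2 * Real.pi) : ℝ) : ℂ) *
      ∑ j ∈ hfin.toFinset, φ (q.2 + latVec Λ j) * phase (-q.1) (latVec Λ j) := by
    have hn : ∀ᶠ q : Plane × Plane in nhds p, ‖q.2‖ < ‖p.2‖ + 1 :=
      (continuous_snd.norm.tendsto p).eventually (gt_mem_nhds (lt_add_one _))
    filter_upwards [hn] with q hq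
    unfold blochFun
    congr 1
    refine tsum_eq_sum fun j hj => ?_
    rw [Set.Finite.mem_toFinset, Set.mem_ofPred_eq, not_le] at hj
    have hm : q.2 + latVec Λ j ∉ tsupport φ := fun hm => ?_
    · rw [image_eq_zero_of_notMem_tsupport hm, zero_mul]
    have h1 := hR _ hm
    have h2 := norm_sub_le (q.2 + latVec Λ j) q.2
    rw [add_sub_cancel_left] at h2
    linarith
  refine ContDiffAt.congr_of_eventuallyEq (ContDiff.contDiffAt ?_) hev
  refine contDiff_const.mul (ContDiff.sum fun j _ => ?_)
  refine (hφ.comp (contDiff_snd.add contDiff_const)).mul ?_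
  exact (contDiff_phase.comp (contDiff_fst.neg.prodMk contDiff_const) :
    ContDiff ℝ ∞ fun q : Plane × Plane => phase (-q.1) (latVec Λ j))

theorem isBlochTest_blochFun (hΛ : IsUnit Λ.det) {φ : Plane → ℂ} (hφ : ContDiff ℝ ∞ φ)
    (hc : HasCompactSupport φ) : IsBlochTest Λ (blochFun Λ φ) := by
  refine ⟨contDiff_blochFun hΛ hφ hc, fun l α x => ?_, fun j α x => ?_⟩
  · unfold blochFun
    congr 1
    refine tsum_congr fun j => ?_
    simp only
    rw [neg_add, phase_add_left, ← latVec_neg, phase_dual hΛ, mul_one]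
  · unfold blochFun
    rw [mul_left_comm, ← tsum_mul_left (a := phase α (latVec Λ j))]
    congr 1
    refine Eq.trans ?_ ((Equiv.addRight j).tsum_eq _)
    refine tsum_congr fun i => ?_
    simp only [Equiv.coe_addRight]
    rw [latVec_add, phase_add_right, add_assoc, add_comm (latVec Λ j)]
    linear_combination (-φ (x + (latVec Λ i + latVec Λ j)) * phase (-α) (latVec Λ i)) *
      phase_mul_phase_neg α (latVec Λ j)

theorem exists_schwartz_cellPart_mul_conj (hΛ : IsUnit Λ.det) {f : Plane × Plane → ℂ}
    (hf : ContDiff ℝ ∞ f) : ∃ Φ : 𝓢(Plane × Plane, ℂ),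
      ∀ p, Φ p = cellPart hΛ p * (starRingEnd ℂ) (f p) := by
  obtain ⟨h1, h2, -⟩ := isCellPartition_cellPart hΛ
  have h3 : ContDiff ℝ ∞ fun p => (starRingEnd ℂ) (f p) := Complex.conjCLE.contDiff.comp hf
  have h4 : HasCompactSupport (fun p => cellPart hΛ p * (starRingEnd ℂ) (f p)) := h2.mul_right
  exact ⟨h4.toSchwartzMap (h1.mul h3), fun p => rfl⟩

/-! ### The norms of negative order -/

theorem isBlochPeriodic_of_dualSq_lt_top {N : 𝓢'(Plane × Plane, ℂ) → ℝ≥0∞}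
    {ψ : 𝓢'(Plane × Plane, ℂ)} (h : dualSq Λ N ψ < ⊤) : IsBlochPeriodic Λ ψ := by
  obtain ⟨h, -⟩ := iInf_lt_iff.1 h
  exact h

theorem enorm_apply_conjS_sq_le {s r : ℝ} {u : 𝓢'(Plane, ℂ)} (hu : u ∈ WSob s r)
    (χ : 𝓢(Plane, ℂ)) :
    ‖u (conjS χ)‖ₑ ^ 2 ≤ wSobSq s r u * wSobSq (-s) (-r) (dist χ) := by
  have h := enorm_planePairing_sq_le s r ⟨u, hu⟩ ⟨dist χ, dist_mem_WSob _ _ χ⟩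
  rwa [planePairing_dist s r _ _ χ rfl] at h

/-- Each competitor in the dual norm is the transform of some Schwartz χ, and the value at it is u
at the conjugate of χ. The duality of the weighted spaces on the plane bounds this. -/
theorem dominated_dualSq_Jt (hΛ : IsUnit Λ.det) (s r : ℝ) {N : 𝓢'(Plane × Plane, ℂ) → ℝ≥0∞}
    (hN : Dominated (wSobSq (-s) (-r)) fun u => N (Jt Λ hΛ u)) :
    Dominated (fun u => dualSq Λ N (Jt Λ hΛ u)) (wSobSq s r) := by
  obtain ⟨K, hK⟩ := hN
  refine ⟨K + 1, fun u => ?_⟩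
  rcases eq_or_ne (wSobSq s r u) ⊤ with hu | hu
  · rw [hu, ENNReal.mul_top (by simp)]; exact le_top
  refine (iInf_le _ (isBlochPeriodic_Jt hΛ u)).trans ?_
  refine iSup_le fun f => iSup_le fun F => iSup_le fun ρ => iSup_le fun Φ => iSup_le fun h => ?_
  obtain ⟨hf, hF, hρ, hΦ⟩ := h
  rw [eq_Jt_dist_of_represents hΛ hf hρ hΦ hF, Jt_apply_eq_conjS]
  generalize blochC Λ • conjS (kern Λ hΛ Φ) = χ
  refine ENNReal.div_le_of_le_mul ?_
  refine (enorm_apply_conjS_sq_le (mem_WSob_iff.2 hu.lt_top) χ).trans ?_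
  calc wSobSq s r u * wSobSq (-s) (-r) (dist χ)
      ≤ wSobSq s r u * (K * N (Jt Λ hΛ (dist χ))) := by gcongr; exact hK _
    _ = (K : ℝ≥0∞) * wSobSq s r u * N (Jt Λ hΛ (dist χ)) := by ring
    _ ≤ _ := by gcongr; exact le_self_add

/-- The transform of a compactly supported φ is an admissible competitor, and injectivity of `Jt`
identifies φ with the preimage produced by the cell partition. -/
theorem enorm_apply_conjS_sq_le_dualSq (hΛ : IsUnit Λ.det) {N : 𝓢'(Plane × Plane, ℂ) → ℝ≥0∞}
    {u : 𝓢'(Plane, ℂ)} (hu : dualSq Λ N (Jt Λ hΛ u) ≠ ⊤) {φ : 𝓢(Plane, ℂ)}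
    (hφ : HasCompactSupport φ) (hN : N (Jt Λ hΛ (dist φ)) ≠ ⊤) :
    ‖u (conjS φ)‖ₑ ^ 2 ≤ dualSq Λ N (Jt Λ hΛ u) * N (Jt Λ hΛ (dist φ)) := by
  have hf := isBlochTest_blochFun hΛ (φ.smooth ⊤) hφ
  have hF := represents_blochFun hΛ φ
  have hρ := isCellPartition_cellPart hΛ
  obtain ⟨Φ, hΦ⟩ := exists_schwartz_cellPart_mul_conj hΛ hf.1
  have e : φ = blochC Λ • conjS (kern Λ hΛ Φ) := by
    have := congrArg (Jinv Λ hΛ) (eq_Jt_dist_of_represents hΛ hf hρ hΦ hF)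
    rw [Jinv_Jt, Jinv_Jt] at this
    exact dist_injective this
  have e2 : Jt Λ hΛ u Φ = u (conjS φ) := by rw [Jt_apply_eq_conjS, ← e]
  rw [← ENNReal.div_le_iff_le_mul (Or.inr hu) (Or.inl hN), ← e2]
  refine le_iInf fun _ => ?_
  exact le_iSup_of_le _ (le_iSup_of_le _ (le_iSup_of_le _ (le_iSup_of_le Φ
    (le_iSup_of_le ⟨hf, hF, hρ, hΦ⟩ le_rfl))))

theorem norm_apply_le_of_hasCompactSupport {s r : ℝ} {u : 𝓢'(Plane, ℂ)} {C : ℝ}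
    (h : ∀ φ : 𝓢(Plane, ℂ), HasCompactSupport φ → ‖u φ‖ ≤ C * nrm (bes s (wt r φ)))
    (φ : 𝓢(Plane, ℂ)) : ‖u φ‖ ≤ C * nrm (bes s (wt r φ)) := by
  obtain ⟨g, hg, hl⟩ := exists_tendsto_hasCompactSupport φ
  have hc : Continuous fun φ => nrm (bes s (wt r φ)) := by
    change Continuous fun φ => ‖SchwartzMap.toLpCLM ℂ ℂ 2 volume (bes s (wt r φ))‖
    fun_prop
  have h1 := ((u.continuous.norm).tendsto φ).comp hl
  have hc' : Continuous fun φ => C * nrm (bes s (wt r φ)) := continuous_const.mul hc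
  have h2 := (hc'.tendsto φ).comp hl
  exact le_of_tendsto_of_tendsto' h1 h2 fun n => h (g n) (hg n)

/-- The norm of u is the best constant in an estimate over test functions; compactly supported ones
suffice by density, and for those the dual norm gives the estimate. -/
theorem dominated_wSobSq_dualSq (hΛ : IsUnit Λ.det) (s r : ℝ) {N : 𝓢'(Plane × Plane, ℂ) → ℝ≥0∞}
    (hN : Dominated (fun u => N (Jt Λ hΛ u)) (wSobSq (-s) (-r))) :
    Dominated (wSobSq s r) (fun u => dualSq Λ N (Jt Λ hΛ u)) := by
  obtain ⟨K, hK⟩ := hN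
  refine ⟨K + 1, fun u => ?_⟩
  beta_reduce
  rcases eq_or_ne (dualSq Λ N (Jt Λ hΛ u)) ⊤ with hu | hu
  · rw [hu, ENNReal.mul_top (by simp)]; exact le_top
  obtain ⟨C, hC⟩ := exists_nnreal_sq_ge
    (ENNReal.mul_lt_top ENNReal.coe_lt_top hu.lt_top : ((K + 1 : ℝ≥0) : ℝ≥0∞) * _ < ⊤)
  rw [hC, wSobSq_le_iff]
  refine norm_apply_le_of_hasCompactSupport fun φ hφ => ?_
  have hφ' : HasCompactSupport (conjS φ) := hφ.comp_left (map_zero (starRingEnd ℂ))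
  have hb := hK (dist (conjS φ))
  have h1 := enorm_apply_conjS_sq_le_dualSq hΛ hu hφ' (hb.trans_lt (ENNReal.mul_lt_top
    ENNReal.coe_lt_top (mem_WSob_iff.1 (dist_mem_WSob _ _ _)))).ne
  rw [conjS_conjS] at h1
  have h2 : ‖u φ‖ₑ ^ 2 ≤ ((C : ℝ≥0∞) * ENNReal.ofReal (nrm (bes (-s) (wt (-r) φ)))) ^ 2 := by
    refine h1.trans ?_
    rw [mul_pow, ← hC]
    calc _ ≤ dualSq Λ N (Jt Λ hΛ u) * (K * wSobSq (-s) (-r) (dist (conjS φ))) := by gcongr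
      _ ≤ dualSq Λ N (Jt Λ hΛ u) *
          (((K + 1 : ℝ≥0) : ℝ≥0∞) * wSobSq (-s) (-r) (dist (conjS φ))) := by
          gcongr
          exact le_self_add
      _ = _ := by
          rw [wSobSq_dist, ← conjS_wt, ← conjS_bes, nrm_conjS]
          ring
  have h3 := (ENNReal.pow_le_pow_left_iff two_ne_zero).1 h2
  rw [← ofReal_norm, ← ENNReal.ofReal_coe_nnreal, ← ENNReal.ofReal_mul NNReal.zero_le_coe] at h3
  exact (ENNReal.ofReal_le_ofReal_iff (mul_nonneg C.2 (nrm_nonneg _))).1 h3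

/-! ### All orders -/

theorem isBlochPeriodic_of_blochSq_lt_top {r s : ℝ} {ψ : 𝓢'(Plane × Plane, ℂ)}
    (h : blochSq Λ r s ψ < ⊤) : IsBlochPeriodic Λ ψ := by
  unfold blochSq at h
  split_ifs at h
  · exact isBlochPeriodic_of_posSq_lt_top h
  · exact isBlochPeriodic_of_dualSq_lt_top h

theorem dominated_blochSq_Jt (hΛ : IsUnit Λ.det) (s r : ℝ) :
    Dominated (fun u => blochSq Λ r s (Jt Λ hΛ u)) (wSobSq s r) := by
  unfold blochSq
  split_ifs with h
  · exact dominated_posSq_Jt hΛ s h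
  · exact dominated_dualSq_Jt hΛ s r (dominated_wSobSq_posSq hΛ (-s) (by linarith))

theorem dominated_wSobSq_blochSq (hΛ : IsUnit Λ.det) (s r : ℝ) :
    Dominated (wSobSq s r) (fun u => blochSq Λ r s (Jt Λ hΛ u)) := by
  unfold blochSq
  split_ifs with h
  · exact dominated_wSobSq_posSq hΛ s h
  · exact dominated_wSobSq_dualSq hΛ s r (dominated_posSq_Jt hΛ (-s) (by linarith))

end

/-! ### Uniqueness of bounded extensions -/

theorem eq_zero_of_forall_exists_lt {x : ℝ≥0∞} {C : ℝ≥0}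
    (h : ∀ ε : ℝ≥0∞, 0 < ε → ∃ y < ε, x ≤ C * y) : x = 0 := by
  by_contra hx
  have hC : ((C + 1 : ℝ≥0) : ℝ≥0∞) ≠ 0 := by simp
  obtain ⟨y, hy, hxy⟩ := h (x / (C + 1 : ℝ≥0)) (ENNReal.div_pos hx ENNReal.coe_ne_top)
  rw [ENNReal.lt_div_iff_mul_lt (Or.inl hC) (Or.inl ENNReal.coe_ne_top)] at hy
  refine absurd (hxy.trans ?_) (not_le.2 hy)
  rw [mul_comm]
  gcongr
  exact le_self_add

/-- Approximation one variable at a time; the finite norm of the fixed argument enters the constant.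
-/
theorem sesqForm_eq_zero {X Y : Type*} [AddCommGroup X] [Module ℂ X] [AddCommGroup Y] [Module ℂ Y]
    (d : X →ₗ[ℂ] Y →ₗ⋆[ℂ] ℂ) {N : X → ℝ≥0∞} {M : Y → ℝ≥0∞} (hN : ∀ u, N u < ⊤)
    (hM : ∀ v, M v < ⊤) {C : ℝ≥0} (hb : ∀ u v, ‖d u v‖ₑ ^ 2 ≤ C * N u * M v)
    {S : Set X} {S' : Set Y} (hS : ∀ u ε, 0 < ε → ∃ x ∈ S, N (u - x) < ε)
    (hS' : ∀ v ε, 0 < ε → ∃ y ∈ S', M (v - y) < ε) (h : ∀ x ∈ S, ∀ y ∈ S', d x y = 0) : d = 0 := by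
  have h1 : ∀ u, ∀ y ∈ S', d u y = 0 := by
    intro u y hy
    have : ‖d u y‖ₑ ^ 2 = 0 := by
      refine eq_zero_of_forall_exists_lt (C := C * (M y).toNNReal) fun ε hε => ?_
      obtain ⟨x, hx, hlt⟩ := hS u ε hε
      refine ⟨_, hlt, ?_⟩
      have e : d u y = d (u - x) y := by
        rw [map_sub, LinearMap.sub_apply, h x hx y hy, sub_zero]
      rw [e, ENNReal.coe_mul, ENNReal.coe_toNNReal (hM y).ne]
      refine (hb _ _).trans (le_of_eq (by ring))
    simpa using this
  ext u v
  have : ‖d u v‖ₑ ^ 2 = 0 := by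
    refine eq_zero_of_forall_exists_lt (C := C * (N u).toNNReal) fun ε hε => ?_
    obtain ⟨y, hy, hlt⟩ := hS' v ε hε
    refine ⟨_, hlt, ?_⟩
    have e : d u v = d u (v - y) := by
      rw [map_sub, h1 u y hy, sub_zero]
    rw [e, ENNReal.coe_mul, ENNReal.coe_toNNReal (hN u).ne]
    exact hb _ _
  simpa using this

theorem sesqForm_eq {X Y : Type*} [AddCommGroup X] [Module ℂ X] [AddCommGroup Y] [Module ℂ Y]
    {b b' : X →ₗ[ℂ] Y →ₗ⋆[ℂ] ℂ} {N : X → ℝ≥0∞} {M : Y → ℝ≥0∞} (hN : ∀ u, N u < ⊤)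
    (hM : ∀ v, M v < ⊤) (hb : ∃ C : ℝ≥0, ∀ u v, ‖b u v‖ₑ ^ 2 ≤ C * N u * M v)
    (hb' : ∃ C : ℝ≥0, ∀ u v, ‖b' u v‖ₑ ^ 2 ≤ C * N u * M v)
    {S : Set X} {S' : Set Y} (hS : ∀ u ε, 0 < ε → ∃ x ∈ S, N (u - x) < ε)
    (hS' : ∀ v ε, 0 < ε → ∃ y ∈ S', M (v - y) < ε)
    (h : ∀ x ∈ S, ∀ y ∈ S', b x y = b' x y) : b = b' := by
  obtain ⟨C, hC⟩ := hb
  obtain ⟨C', hC'⟩ := hb'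
  rw [← sub_eq_zero]
  refine sesqForm_eq_zero _ hN hM (C := 2 * (C + C')) (fun u v => ?_) hS hS' fun x hx y hy => ?_
  · rw [LinearMap.sub_apply, LinearMap.sub_apply, sub_eq_add_neg]
    refine (enorm_add_sq_le _ _).trans ?_
    rw [enorm_neg]
    push_cast
    calc _ ≤ 2 * (C * N u * M v + C' * N u * M v) := by
          gcongr
          · exact hC u v
          · exact hC' u v
      _ = _ := by ring
  · rw [LinearMap.sub_apply, LinearMap.sub_apply, h x hx y hy, sub_self]

/-! ### The pairing on the plane -/

/-- The test functions as elements of a weighted Sobolev space. -/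
def testSet (s r : ℝ) : Set (WSob s r) :=
  {u | ∃ φ : 𝓢(Plane, ℂ), HasCompactSupport φ ∧ (u : 𝓢'(Plane, ℂ)) = dist φ}

theorem exists_testSet_lt {s r : ℝ} (u : WSob s r) (ε : ℝ≥0∞) (hε : 0 < ε) :
    ∃ x ∈ testSet s r, wSobSq s r ((u - x : WSob s r) : 𝓢'(Plane, ℂ)) < ε := by
  obtain ⟨φ, hφ, h⟩ := exists_wSobSq_sub_dist_lt u.2 hε
  exact ⟨⟨dist φ, dist_mem_WSob s r φ⟩, ⟨φ, hφ, rfl⟩, h⟩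

theorem wSobSq_lt_top {s r : ℝ} (u : WSob s r) : wSobSq s r u < ⊤ := mem_WSob_iff.1 u.2

theorem IsPlanePairing.unique {s r : ℝ} {b b' : WSob s r →ₗ[ℂ] WSob (-s) (-r) →ₗ⋆[ℂ] ℂ}
    (h : IsPlanePairing s r b) (h' : IsPlanePairing s r b') : b = b' := by
  refine sesqForm_eq wSobSq_lt_top wSobSq_lt_top h.bounded h'.bounded exists_testSet_lt
    exists_testSet_lt ?_
  rintro x ⟨φ, hφ, hx⟩ y ⟨χ, hχ, hy⟩
  have hx' : Represents φ (x : 𝓢'(Plane, ℂ)) := hx ▸ represents_dist φ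
  have hy' : Represents χ (y : 𝓢'(Plane, ℂ)) := hy ▸ represents_dist χ
  rw [h.extends_test φ χ x y (φ.smooth ⊤) hφ (χ.smooth ⊤) hχ hx' hy',
    h'.extends_test φ χ x y (φ.smooth ⊤) hφ (χ.smooth ⊤) hχ hx' hy']

theorem exists_toL2_eq (s r : ℝ) (g : Lp ℂ 2 (volume : Measure Plane)) :
    ∃ u : WSob s r, toL2 s r u = g := by
  have e : besselPotential Plane ℂ s (weightMul r (weightMul (-r)
      (besselPotential Plane ℂ (-s) (g : 𝓢'(Plane, ℂ))))) = g := by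
    rw [weightMul_weightMul, neg_add_cancel, weightMul_zero, besselPotential_neg_besselPotential]
  exact ⟨⟨_, g, e⟩, toL2_eq_of e⟩

/-- Every L² function comes from some u, so u can be chosen with the same L² function as v, and the
pairing is then the squared norm. -/
theorem eq_zero_of_planePairing_eq_zero {s r : ℝ} {v : WSob (-s) (-r)}
    (h : ∀ u, planePairing s r u v = 0) : v = 0 := by
  obtain ⟨u, hu⟩ := exists_toL2_eq s r (toL2 (-s) (-r) v)
  have h1 := h u
  rw [planePairing_apply, hu, inner_self_eq_zero] at h1
  have h2 := wSobSq_eq_toL2 (-s) (-r) v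
  rw [h1, enorm_zero, zero_pow two_ne_zero] at h2
  exact Subtype.ext (eq_zero_of_wSobSq_eq_zero h2)

section

variable {Λ : Matrix (Fin 2) (Fin 2) ℝ} (hΛ : IsUnit Λ.det)

/-! ### The Bloch transform as an isomorphism -/

theorem Jt_mem_BlochSob {s r : ℝ} {u : 𝓢'(Plane, ℂ)} (hu : u ∈ WSob s r) :
    Jt Λ hΛ u ∈ BlochSob Λ r s := by
  obtain ⟨K, hK⟩ := dominated_blochSq_Jt hΛ s r
  exact (hK u).trans_lt (ENNReal.mul_lt_top ENNReal.coe_lt_top (mem_WSob_iff.1 hu))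

theorem Jt_Jinv_of_mem {s r : ℝ} {ψ : 𝓢'(Plane × Plane, ℂ)} (hψ : ψ ∈ BlochSob Λ r s) :
    Jt Λ hΛ (Jinv Λ hΛ ψ) = ψ :=
  Jt_Jinv hΛ (isBlochPeriodic_of_blochSq_lt_top hψ)

theorem Jinv_mem_WSob {s r : ℝ} {ψ : 𝓢'(Plane × Plane, ℂ)} (hψ : ψ ∈ BlochSob Λ r s) :
    Jinv Λ hΛ ψ ∈ WSob s r := by
  obtain ⟨K, hK⟩ := dominated_wSobSq_blochSq hΛ s r
  have h := hK (Jinv Λ hΛ ψ)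
  beta_reduce at h
  rw [Jt_Jinv_of_mem hΛ hψ] at h
  exact mem_WSob_iff.2 (h.trans_lt (ENNReal.mul_lt_top ENNReal.coe_lt_top hψ))

/-- The Bloch transform between weighted Sobolev spaces. -/
def blochEquiv (s r : ℝ) : WSob s r ≃ₗ[ℂ] BlochSob Λ r s where
  toFun u := ⟨Jt Λ hΛ u, Jt_mem_BlochSob hΛ u.2⟩
  map_add' _ _ := Subtype.ext (map_add (Jt Λ hΛ) _ _)
  map_smul' c _ := Subtype.ext (map_smul (Jt Λ hΛ) c _)
  invFun ψ := ⟨Jinv Λ hΛ ψ, Jinv_mem_WSob hΛ ψ.2⟩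
  left_inv _ := Subtype.ext (Jinv_Jt hΛ _)
  right_inv ψ := Subtype.ext (Jt_Jinv_of_mem hΛ ψ.2)

theorem coe_blochEquiv (s r : ℝ) (u : WSob s r) :
    (blochEquiv hΛ s r u : 𝓢'(Plane × Plane, ℂ)) = Jt Λ hΛ u := rfl

theorem coe_blochEquiv_symm (s r : ℝ) (ψ : BlochSob Λ r s) :
    ((blochEquiv hΛ s r).symm ψ : 𝓢'(Plane, ℂ)) = Jinv Λ hΛ ψ := rfl

theorem Represents.eq_dist_toSchwartzMap {φ : Plane → ℂ} {u : 𝓢'(Plane, ℂ)} (h : Represents φ u)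
    (hc : HasCompactSupport φ) (hφ : ContDiff ℝ ∞ φ) : u = dist (hc.toSchwartzMap hφ) :=
  Represents.eq_dist (φ := hc.toSchwartzMap hφ) h

theorem isBlochTransform_blochEquiv (s r : ℝ) : IsBlochTransform Λ s r (blochEquiv hΛ s r) where
  bounded := by
    obtain ⟨K, hK⟩ := dominated_blochSq_Jt hΛ s r
    exact ⟨K, fun u => hK u⟩
  bounded_symm := by
    obtain ⟨K, hK⟩ := dominated_wSobSq_blochSq hΛ s r
    refine ⟨K, fun ψ => ?_⟩
    have h := hK (Jinv Λ hΛ ψ)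
    beta_reduce at h
    rwa [Jt_Jinv_of_mem hΛ ψ.2] at h
  extends_test := by
    intro φ u hφ hc hu
    rw [coe_blochEquiv, hu.eq_dist_toSchwartzMap hc hφ]
    exact represents_blochFun hΛ (hc.toSchwartzMap hφ)

theorem eq_zero_of_blochSq_eq_zero (hΛ : IsUnit Λ.det) {s r : ℝ} {ψ : BlochSob Λ r s}
    (h : blochSq Λ r s ψ = 0) : ψ = 0 := by
  obtain ⟨K, hK⟩ := (isBlochTransform_blochEquiv hΛ s r).bounded_symm
  have h1 := hK ψ
  rw [h, mul_zero, nonpos_iff_eq_zero] at h1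
  have h2 : (blochEquiv hΛ s r).symm ψ = 0 := Subtype.ext (eq_zero_of_wSobSq_eq_zero h1)
  simpa using h2

/-- The difference of two Bloch transforms is bounded and vanishes on the dense set of test
functions. -/
theorem IsBlochTransform.eq_blochEquiv {s r : ℝ} {J : WSob s r ≃ₗ[ℂ] BlochSob Λ r s}
    (h : IsBlochTransform Λ s r J) : J = blochEquiv hΛ s r := by
  have h' := isBlochTransform_blochEquiv hΛ s r
  obtain ⟨C, hC⟩ := h.bounded
  obtain ⟨C', hC'⟩ := h'.bounded
  have hq := blochSq_quadLike Λ r s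
  have hd : ∀ u, blochSq Λ r s (J u - blochEquiv hΛ s r u : BlochSob Λ r s) ≤
      ((2 * (C + C') : ℝ≥0) : ℝ≥0∞) * wSobSq s r u := by
    intro u
    have e : ((J u - blochEquiv hΛ s r u : BlochSob Λ r s) : 𝓢'(Plane × Plane, ℂ)) =
        (J u : 𝓢'(Plane × Plane, ℂ)) + (-1 : ℂ) • (blochEquiv hΛ s r u : 𝓢'(Plane × Plane, ℂ)) := by
      rw [Submodule.coe_sub]
      module
    have e2 := hq.smul (-1 : ℂ) (blochEquiv hΛ s r u) (by simp)
    rw [enorm_neg, enorm_one, one_pow, one_mul] at e2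
    rw [e]
    refine (hq.add _ _).trans ?_
    push_cast
    calc _ ≤ 2 * (C * wSobSq s r u + C' * wSobSq s r u) := by
          gcongr
          · exact hC u
          · exact e2.trans (hC' u)
      _ = _ := by ring
  ext1 u
  rw [← sub_eq_zero]
  refine eq_zero_of_blochSq_eq_zero hΛ
    (eq_zero_of_forall_exists_lt (C := 2 * (C + C')) fun ε hε => ?_)
  obtain ⟨x, ⟨φ, hφ, hx⟩, hlt⟩ := exists_testSet_lt u ε hε
  refine ⟨_, hlt, ?_⟩
  have hx' : Represents φ (x : 𝓢'(Plane, ℂ)) := hx ▸ represents_dist φ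
  have e : J x = blochEquiv hΛ s r x := Subtype.ext
    ((h.extends_test φ x (φ.smooth ⊤) hφ hx').eq_of (h'.extends_test φ x (φ.smooth ⊤) hφ hx'))
  have e2 := hd (u - x)
  rwa [map_sub, map_sub, e, sub_sub_sub_cancel_right] at e2

/-! ### The pairing on the cell -/

/-- The pairing of the spaces of quasiperiodic distributions. -/
def cellPairing (s r : ℝ) : BlochSob Λ r s →ₗ[ℂ] BlochSob Λ (-r) (-s) →ₗ⋆[ℂ] ℂ :=
  LinearMap.mk₂'ₛₗ (RingHom.id ℂ) (starRingEnd ℂ)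
    (fun ψ ψ' => planePairing s r ((blochEquiv hΛ s r).symm ψ)
      ((blochEquiv hΛ (-s) (-r)).symm ψ'))
    (fun a b c => by rw [map_add, map_add, LinearMap.add_apply])
    (fun k a b => by rw [map_smul, map_smul, LinearMap.smul_apply]; rfl)
    (fun a b c => by rw [map_add, map_add])
    (fun k a b => by rw [map_smul, LinearMap.map_smulₛₗ])

theorem cellPairing_apply (s r : ℝ) (ψ : BlochSob Λ r s) (ψ' : BlochSob Λ (-r) (-s)) :
    cellPairing hΛ s r ψ ψ' = planePairing s r ((blochEquiv hΛ s r).symm ψ)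
      ((blochEquiv hΛ (-s) (-r)).symm ψ') := rfl

theorem exists_isCompact_cell_subset {A : Matrix (Fin 2) (Fin 2) ℝ} (hA : IsUnit A.det) :
    ∃ K, IsCompact K ∧ cell A ⊆ K := by
  refine ⟨latEquiv A hA '' Metric.closedBall 0 1,
    (isCompact_closedBall 0 1).image (latEquiv A hA).continuous, ?_⟩
  rintro x ⟨z, hz, rfl⟩
  refine ⟨z, ?_, rfl⟩
  rw [mem_closedBall_zero_iff, pi_norm_le_iff_of_nonneg zero_le_one]
  intro i
  rw [Real.norm_eq_abs, abs_le]
  constructor <;> linarith [(hz i).1, (hz i).2]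

theorem IsBlochTest.mul_conj_periodic {f g : Plane × Plane → ℂ}
    (hf : IsBlochTest Λ f) (hg : IsBlochTest Λ g) (l j : Fin 2 → ℤ) (p : Plane × Plane) :
    f (p + (latVec (dualMat Λ) l, latVec Λ j)) *
      (starRingEnd ℂ) (g (p + (latVec (dualMat Λ) l, latVec Λ j))) =
    f p * (starRingEnd ℂ) (g p) := by
  obtain ⟨α, x⟩ := p
  rw [Prod.mk_add_mk, hf.2.2, hg.2.2, hf.2.1, hg.2.1, map_mul, conj_phase]
  linear_combination (f (α, x) * (starRingEnd ℂ) (g (α, x))) *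
    phase_mul_phase_neg (α + latVec (dualMat Λ) l) (latVec Λ j)

theorem integral_cellPart_mul {f g : Plane × Plane → ℂ}
    (hf : IsBlochTest Λ f) (hg : IsBlochTest Λ g)
    (hi : Integrable fun p => cellPart hΛ p * (f p * (starRingEnd ℂ) (g p))) :
    ∫ p, cellPart hΛ p * (f p * (starRingEnd ℂ) (g p)) =
      ∫ α in cell (dualMat Λ), ∫ x in cell Λ, f (α, x) * (starRingEnd ℂ) (g (α, x)) := by
  have ht := (isTiling_cell (isUnit_det_dualMat hΛ)).prod (isTiling_cell hΛ)
  rw [ht.integral_mul_eq hi (fun i p => hf.mul_conj_periodic hg i.1 i.2 p)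
    (fun p => (isCellPartition_cellPart hΛ).2.2 p.1 p.2), Measure.volume_eq_prod]
  refine setIntegral_prod _ ?_
  obtain ⟨K, hK, hs⟩ := exists_isCompact_cell_subset (isUnit_det_dualMat hΛ)
  obtain ⟨K', hK', hs'⟩ := exists_isCompact_cell_subset hΛ
  have hc : Continuous fun p => f p * (starRingEnd ℂ) (g p) :=
    hf.1.continuous.mul (Complex.continuous_conj.comp hg.1.continuous)
  exact (hc.continuousOn.integrableOn_compact (hK.prod hK')).mono_set (Set.prod_mono hs hs')

/-- Bounds are inherited from the plane through the inverse transforms. On smooth functions the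
value is the integral of f conj(g) against a cell partition, and unfolding converts this to the
integral over the cells. -/
theorem isCellPairing_cellPairing (s r : ℝ) : IsCellPairing Λ s r (cellPairing hΛ s r) where
  bounded := by
    obtain ⟨K, hK⟩ := (isBlochTransform_blochEquiv hΛ s r).bounded_symm
    obtain ⟨K', hK'⟩ := (isBlochTransform_blochEquiv hΛ (-s) (-r)).bounded_symm
    refine ⟨K * K', fun u v => (enorm_planePairing_sq_le s r _ _).trans ?_⟩
    refine (mul_le_mul' (hK u) (hK' v)).trans (le_of_eq ?_)
    push_cast
    ring
  extends_test := by
    intro f g u v hf hg hu hv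
    obtain ⟨Φ, hΦ⟩ := exists_schwartz_cellPart_mul_conj hΛ hg.1
    have e := eq_Jt_dist_of_represents hΛ hg (isCellPartition_cellPart hΛ) hΦ hv
    have e1 := congrArg (Jinv Λ hΛ) e
    rw [Jinv_Jt] at e1
    rw [cellPairing_apply, planePairing_dist s r _ _ _ e1, ← Jt_apply_eq_conjS,
      coe_blochEquiv_symm, Jt_Jinv_of_mem hΛ u.2, (hu Φ).2]
    have hcongr : (fun p => f p * Φ p) =
        fun p => cellPart hΛ p * (f p * (starRingEnd ℂ) (g p)) := by
      ext p
      rw [hΦ]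
      ring
    have hi := (hu Φ).1
    rw [hcongr] at hi ⊢
    exact integral_cellPart_mul hΛ hf hg hi

theorem exists_blochEquiv_testSet_lt {s r : ℝ} (u : BlochSob Λ r s) (ε : ℝ≥0∞) (hε : 0 < ε) :
    ∃ x ∈ blochEquiv hΛ s r '' testSet s r,
      blochSq Λ r s ((u - x : BlochSob Λ r s) : 𝓢'(Plane × Plane, ℂ)) < ε := by
  obtain ⟨C, hC⟩ := (isBlochTransform_blochEquiv hΛ s r).bounded
  have hC0 : ((C + 1 : ℝ≥0) : ℝ≥0∞) ≠ 0 := by simp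
  obtain ⟨x, hx, hlt⟩ := exists_testSet_lt ((blochEquiv hΛ s r).symm u) (ε / (C + 1 : ℝ≥0))
    (ENNReal.div_pos hε.ne' ENNReal.coe_ne_top)
  refine ⟨_, ⟨x, hx, rfl⟩, ?_⟩
  have h := hC ((blochEquiv hΛ s r).symm u - x)
  rw [map_sub, LinearEquiv.apply_symm_apply] at h
  rw [ENNReal.lt_div_iff_mul_lt (Or.inl hC0) (Or.inl ENNReal.coe_ne_top)] at hlt
  refine h.trans_lt (lt_of_le_of_lt ?_ hlt)
  rw [mul_comm]
  gcongr
  exact le_self_add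

/-- Bloch transforms of compactly supported functions are smooth Bloch functions and dense, being
the image of a dense set under an isomorphism; the forms agree on them. -/
theorem IsCellPairing.unique (hΛ : IsUnit Λ.det) {s r : ℝ}
    {B B' : BlochSob Λ r s →ₗ[ℂ] BlochSob Λ (-r) (-s) →ₗ⋆[ℂ] ℂ}
    (h : IsCellPairing Λ s r B) (h' : IsCellPairing Λ s r B') : B = B' := by
  refine sesqForm_eq (fun u => u.2) (fun v => v.2) h.bounded h'.bounded
    (exists_blochEquiv_testSet_lt hΛ) (exists_blochEquiv_testSet_lt hΛ) ?_
  rintro _ ⟨x, ⟨φ, hφ, hx⟩, rfl⟩ _ ⟨y, ⟨χ, hχ, hy⟩, rfl⟩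
  have hf := isBlochTest_blochFun hΛ (φ.smooth ⊤) hφ
  have hg := isBlochTest_blochFun hΛ (χ.smooth ⊤) hχ
  have hx' := represents_blochFun hΛ φ
  have hy' := represents_blochFun hΛ χ
  rw [← hx] at hx'
  rw [← hy] at hy'
  rw [h.extends_test _ _ _ _ hf hg hx' hy', h'.extends_test _ _ _ _ hf hg hx' hy']

/-! ### The adjoint of the Bloch transform -/

/-- The pairing on the cell is the transported pairing on the plane, so the inverse satisfies the
adjoint identity by definition. Nondegeneracy forces any other solution to coincide with it, without
assuming it linear or bounded. -/
theorem isAdjoint_cellPairing_iff (s r : ℝ) (A : BlochSob Λ (-r) (-s) → WSob (-s) (-r)) :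
    IsAdjoint (fun ψ₁ ψ₂ => cellPairing hΛ s r ψ₁ ψ₂) (fun φ₁ φ₂ => planePairing s r φ₁ φ₂)
      (blochEquiv hΛ s r) A ↔ A = (blochEquiv hΛ (-s) (-r)).symm := by
  constructor
  · intro h
    funext ψ
    rw [← sub_eq_zero]
    refine eq_zero_of_planePairing_eq_zero fun u => ?_
    have := h u ψ
    simp only [cellPairing_apply, LinearEquiv.symm_apply_apply] at this
    rw [map_sub, ← this, sub_self]
  · rintro rfl φ ψ
    simp only [cellPairing_apply, LinearEquiv.symm_apply_apply]

end

end FloquetBloch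

end

theorem mainTheorem10 (Λ : Matrix (Fin 2) (Fin 2) ℝ) (hΛ : IsUnit Λ.det) (s r : ℝ) :
    (∃! J : FloquetBloch.WSob s r ≃ₗ[ℂ] FloquetBloch.BlochSob Λ r s,
      FloquetBloch.IsBlochTransform Λ s r J) ∧
    (∃! b : FloquetBloch.WSob s r →ₗ[ℂ] FloquetBloch.WSob (-s) (-r) →ₗ⋆[ℂ] ℂ,
      FloquetBloch.IsPlanePairing s r b) ∧
    (∃! B : FloquetBloch.BlochSob Λ r s →ₗ[ℂ] FloquetBloch.BlochSob Λ (-r) (-s) →ₗ⋆[ℂ] ℂ,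
      FloquetBloch.IsCellPairing Λ s r B) ∧
    ∀ (J : FloquetBloch.WSob s r ≃ₗ[ℂ] FloquetBloch.BlochSob Λ r s)
      (J' : FloquetBloch.WSob (-s) (-r) ≃ₗ[ℂ] FloquetBloch.BlochSob Λ (-r) (-s))
      (b : FloquetBloch.WSob s r →ₗ[ℂ] FloquetBloch.WSob (-s) (-r) →ₗ⋆[ℂ] ℂ)
      (B : FloquetBloch.BlochSob Λ r s →ₗ[ℂ] FloquetBloch.BlochSob Λ (-r) (-s) →ₗ⋆[ℂ] ℂ),
      FloquetBloch.IsBlochTransform Λ s r J →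
      FloquetBloch.IsBlochTransform Λ (-s) (-r) J' →
      FloquetBloch.IsPlanePairing s r b →
      FloquetBloch.IsCellPairing Λ s r B →
      ∀ A : FloquetBloch.BlochSob Λ (-r) (-s) → FloquetBloch.WSob (-s) (-r),
        FloquetBloch.IsAdjoint (fun ψ₁ ψ₂ => B ψ₁ ψ₂) (fun φ₁ φ₂ => b φ₁ φ₂) J A ↔
          A = J'.symm := by
  refine ⟨⟨FloquetBloch.blochEquiv hΛ s r, FloquetBloch.isBlochTransform_blochEquiv hΛ s r,
      fun J hJ => hJ.eq_blochEquiv hΛ⟩,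
    ⟨FloquetBloch.planePairing s r, FloquetBloch.isPlanePairing_planePairing s r,
      fun b hb => hb.unique (FloquetBloch.isPlanePairing_planePairing s r)⟩,
    ⟨FloquetBloch.cellPairing hΛ s r, FloquetBloch.isCellPairing_cellPairing hΛ s r,
      fun B hB => hB.unique hΛ (FloquetBloch.isCellPairing_cellPairing hΛ s r)⟩, ?_⟩
  intro J J' b B hJ hJ' hb hB A
  -- By uniqueness the given maps and forms are the constructed ones, for which the claim is known.
  rw [hJ.eq_blochEquiv hΛ, hJ'.eq_blochEquiv hΛ,
    hb.unique (FloquetBloch.isPlanePairing_planePairing s r),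
    hB.unique hΛ (FloquetBloch.isCellPairing_cellPairing hΛ s r)]
  exact FloquetBloch.isAdjoint_cellPairing_iff hΛ s r A
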